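/- Let $X$ be a compact connected Riemann surface with canonical bundle $K$. **Conventions.** An $SL(k,\mathbb C)$-Higgs bundle is a Higgs bundle $(E,\Phi)$ of rank $k$ ($E$ a holomorphic vector bundle, $\Phi\in H^0(X,\mathrm{End}\,E\otimes K)$) with a holomorphic trivialization $\omega$ of the determinant, i.e. a nowhere vanishing holomorphic volume form on $E$, and with $\mathrm{tr}\,\Phi=0$. An $SO(k,\mathbb C)$-Higgs bundle is a Higgs bundle $(E,\Phi)$ of rank $k$ with a holomorphic non-degenerate symmetric bilinear form $Q$, a holomorphic trivialization $\delta$ of the determinant of $E$ whose square is the discriminant of $Q$, and $Q(u,\Phi v)=-Q(\Phi u,v)$. For a complex matrix group $G$, a principal $G$-Higgs bundle $(P,\Phi)$ is a holomorphic principal $G$-bundle $P$ with a holomorphic section $\Phi$ of $\mathrm{ad}(P)\otimes K$. The standard representation turns a principal $SL(k,\mathbb C)$- or $SO(k,\mathbb C)$-Higgs bundle into an $SL(k,\mathbb C)$- or $SO(k,\mathbb C)$-Higgs bundle in the former sense. A holomorphic homomorphism $\Psi:G\to G'$ sends $(P,\Phi)$ to the principal $G'$-Higgs bundle $(P\times_\Psi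 G',d\Psi(\Phi))$. For $G$ connected semisimple, $(P,\Phi)$ is semistable if for each semisimple $s\in\mathfrak g$ with real eigenvalues under $\mathrm{ad}$, each character $\chi$ of the parabolic subgroup $P_s$ with differential $Y\mapsto\mathrm{tr}(sY)$ and each holomorphic reduction $R$ of $P$ to $P_s$ such that $\Phi$ takes values in $\mathfrak p_s$ on $R$ (where $\mathfrak p_s=\mathrm{Lie}(P_s)$ is the sum of the eigenspaces of $\mathrm{ad}\,s$ with eigenvalue $\ge 0$), one has $\deg(R\times_\chi\mathbb C)\le 0$; it is polystable if moreover, whenever this degree is $0$, $R$ contains a holomorphic reduction to the centralizer $L_s$ of $s$ on which $\Phi$ takes values in $\mathrm{Lie}(L_s)$. $\mathcal M_G$ is the set of isomorphism classes of polystable principal $G$-Higgs bundles on $X$. Let $\mathcal I_2:SL(2,\mathbb C)\times SL(2,\mathbb C)\to SO(4,\mathbb C)$ be the action on $\mathbb C^2\otimes\mathbb C^2$ with the product of the two area forms, and $\mathcal I_3:SL(4,\mathbb C)\to SO(6,\mathbb C)$ the action on $\Lambda^2\mathbb C^4$ with the form given by the wedge product, both written in (fixed) orthonormal bases. **Proposition.**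 1. $\mathcal I_2$ and $\mathcal I_3$ are isogenies (surjective with finite kernel). 2. Let $(E_1,\Phi_1,\omega_1)$ and $(E_2,\Phi_2,\omega_2)$ be $SL(2,\mathbb C)$-Higgs bundles. There is a principal $SL(2,\mathbb C)\times SL(2,\mathbb C)$-Higgs bundle whose extensions along the two projections have associated $SL(2,\mathbb C)$-Higgs bundles isomorphic to them. The Higgs bundle $(E_1\otimes E_2,\ \Phi_1\otimes 1+1\otimes\Phi_2)$ has the structure of an $SO(4,\mathbb C)$-Higgs bundle with form $Q(a\otimes b,c\otimes d)=\omega_1(a,c)\,\omega_2(b,d)$ such that, for every such principal bundle, the $SO(4,\mathbb C)$-Higgs bundle associated to its extension along $\mathcal I_2$ is isomorphic to it. 3. Let $(E,\Phi,\omega)$ be an $SL(4,\mathbb C)$-Higgs bundle. There is a principal $SL(4,\mathbb C)$-Higgs bundle whose associated $SL(4,\mathbb C)$-Higgs bundle is isomorphic to it. The Higgs bundle $(\Lambda^2E,\ \Phi\otimes1+1\otimes\Phi)$ has the structure of an $SO(6,\mathbb C)$-Higgs bundle with form $Q(a\wedge b,c\wedge d)=\omega(a,b,c,d)$ such that, for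 every such principal bundle, the $SO(6,\mathbb C)$-Higgs bundle associated to its extension along $\mathcal I_3$ is isomorphic to it. 4. $\mathcal I_2$ and $\mathcal I_3$ induce maps $\mathcal M_{SL(2,\mathbb C)}\times\mathcal M_{SL(2,\mathbb C)}\to\mathcal M_{SO(4,\mathbb C)}$ and $\mathcal M_{SL(4,\mathbb C)}\to\mathcal M_{SO(6,\mathbb C)}$: if both components of a principal $SL(2,\mathbb C)\times SL(2,\mathbb C)$-Higgs bundle are polystable, then so is its extension along $\mathcal I_2$, whose class depends only on the classes of the two components; if a principal $SL(4,\mathbb C)$-Higgs bundle is polystable, then so is its extension along $\mathcal I_3$, whose class depends only on the class of the given bundle. -/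

import Mathlib

open scoped Manifold ContDiff TensorProduct Matrix

universe u v

namespace HiggsBundles

noncomputable section

/-! ### Holomorphic functions and holomorphic one-forms on a Riemann surface -/

section Surface

variable {X : Type u} [TopologicalSpace X] [ChartedSpace ℂ X]

/-- `f` is a holomorphic function on the set `U` (always used with `U` open). -/
def IsHolOn (f : X → ℂ) (U : Set X) : Prop := MDifferentiableOn 𝓘(ℂ) 𝓘(ℂ) f U

/-- The holomorphic tangent space of the Riemann surface `X` at `x`. -/
abbrev Tan (x : X) : Type := TangentSpace 𝓘(ℂ) x

instance (x : X) : T2Space (Tan x) := inferInstanceAs (T2Space ℂ)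

instance (x : X) : FiniteDimensional ℂ (Tan x) := inferInstanceAs (FiniteDimensional ℂ ℂ)

theorem IsHolOn.mono {f : X → ℂ} {U V : Set X} (h : IsHolOn f U) (e : V ⊆ U) : IsHolOn f V :=
  MDifferentiableOn.mono h e

theorem IsHolOn.congr {f g : X → ℂ} {U : Set X} (h : IsHolOn f U) (e : ∀ x ∈ U, g x = f x) :
    IsHolOn g U := MDifferentiableOn.congr h e

theorem IsHolOn.mul {f g : X → ℂ} {U : Set X} (hf : IsHolOn f U) (hg : IsHolOn g U) :
    IsHolOn (fun x => f x * g x) U := MDifferentiableOn.mul hf hg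

theorem IsHolOn.sub {f g : X → ℂ} {U : Set X} (hf : IsHolOn f U) (hg : IsHolOn g U) :
    IsHolOn (fun x => f x - g x) U := MDifferentiableOn.sub hf hg

theorem isHolOn_const (c : ℂ) (U : Set X) : IsHolOn (fun _ => c) U := mdifferentiableOn_const

variable [IsManifold 𝓘(ℂ) ω X]

/-- `α` is a holomorphic section of the canonical bundle `K = T^*X` over `U`. -/
def IsHolFormOn (α : ∀ x : X, Tan x →ₗ[ℂ] ℂ) (U : Set X) : Prop :=
  MDifferentiableOn 𝓘(ℂ) (𝓘(ℂ).prod 𝓘(ℂ, ℂ →L[ℂ] ℂ))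
    (fun x => Bundle.TotalSpace.mk' (ℂ →L[ℂ] ℂ)
      (E := fun x : X => TangentSpace 𝓘(ℂ) x →L[ℂ] Bundle.Trivial X ℂ x) x
      (LinearMap.toContinuousLinearMap (α x))) U

theorem IsHolFormOn.congr {α β : ∀ x : X, Tan x →ₗ[ℂ] ℂ} {U : Set X} (h : IsHolFormOn α U)
    (e : ∀ x ∈ U, β x = α x) : IsHolFormOn β U := by
  refine MDifferentiableOn.congr h fun x hx => ?_
  rw [e x hx]

theorem IsHolFormOn.mono {α : ∀ x : X, Tan x →ₗ[ℂ] ℂ} {U V : Set X} (h : IsHolFormOn α U)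
    (e : V ⊆ U) : IsHolFormOn α V := MDifferentiableOn.mono h e

theorem IsHolFormOn.smul {α : ∀ x : X, Tan x →ₗ[ℂ] ℂ} {f : X → ℂ} {U : Set X}
    (hf : IsHolOn f U) (h : IsHolFormOn α U) : IsHolFormOn (fun x => f x • α x) U := by
  have := MDifferentiableOn.smul_section
    (E := fun x : X => TangentSpace 𝓘(ℂ) x →L[ℂ] Bundle.Trivial X ℂ x)
    (s := fun x => LinearMap.toContinuousLinearMap (α x)) hf h
  refine MDifferentiableOn.congr this fun x _ => ?_
  rw [map_smul]
  rfl

theorem IsHolFormOn.sum {J : Type*} (s : Finset J) {α : J → ∀ x : X, Tan x →ₗ[ℂ] ℂ} {U : Set X}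
    (h : ∀ j ∈ s, IsHolFormOn (α j) U) : IsHolFormOn (fun x => ∑ j ∈ s, α j x) U := by
  have := MDifferentiableOn.sum_section
    (E := fun x : X => TangentSpace 𝓘(ℂ) x →L[ℂ] Bundle.Trivial X ℂ x)
    (t := fun j x => LinearMap.toContinuousLinearMap (α j x)) (s := s) (u := U) h
  refine MDifferentiableOn.congr this fun x _ => ?_
  rw [map_sum]

theorem IsHolFormOn.add {α β : ∀ x : X, Tan x →ₗ[ℂ] ℂ} {U : Set X} (h : IsHolFormOn α U)
    (h' : IsHolFormOn β U) : IsHolFormOn (fun x => α x + β x) U := by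
  have := IsHolFormOn.sum (Finset.univ : Finset Bool) (α := fun j => if j then α else β) (U := U)
    (fun j _ => by cases j <;> simpa)
  exact this.congr fun x _ => by simp

end Surface

/-! ### Higgs bundles in terms of vector bundles -/

section Vector

variable (X : Type u) [TopologicalSpace X] [ChartedSpace ℂ X]

/-- A holomorphic vector bundle of rank `k` on `X`, given by its fibres and by holomorphic local
frames: for every point `p` of `X` a frame over an open neighbourhood `dom p` of `p` (the values of
`frame p` outside of `dom p` carry no information), any two of which differ by a holomorphic
matrix function. -/
structure HolVectorBundle (k : ℕ) where
  fiber : X → Type v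
  [addCommGroup : ∀ x, AddCommGroup (fiber x)]
  [module : ∀ x, Module ℂ (fiber x)]
  dom : X → Set X
  isOpen_dom : ∀ p, IsOpen (dom p)
  mem_dom : ∀ p, p ∈ dom p
  frame : X → ∀ x, Module.Basis (Fin k) ℂ (fiber x)
  hol_frame : ∀ p q a b,
    IsHolOn (fun x => (frame p x).toMatrix (frame q x) a b) (dom p ∩ dom q)

attribute [instance] HolVectorBundle.addCommGroup HolVectorBundle.module

variable [IsManifold 𝓘(ℂ) ω X]

/-- A Higgs bundle `(E, Φ)` of rank `k`: a holomorphic vector bundle `E` with a holomorphic section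
`Φ` of `End E ⊗ K`. An element of `End (E_x) ⊗ K_x` is a linear map from `T_x X` to `End (E_x)`. -/
structure HiggsBundle (k : ℕ) extends HolVectorBundle.{u, v} X k where
  higgs : ∀ x, Tan x →ₗ[ℂ] Module.End ℂ (fiber x)
  hol_higgs : ∀ p a b, IsHolFormOn
    (fun x => Matrix.entryLinearMap ℂ ℂ a b ∘ₗ
      (LinearMap.toMatrix (frame p x) (frame p x)).toLinearMap ∘ₗ higgs x) (dom p)

variable {X}

/-- Isomorphisms of Higgs bundles. -/
structure HiggsBundle.Iso {k : ℕ} (H H' : HiggsBundle.{u, v} X k) where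
  equiv : ∀ x, H.fiber x ≃ₗ[ℂ] H'.fiber x
  hol : ∀ p q a b, IsHolOn
    (fun x => LinearMap.toMatrix (H.frame p x) (H'.frame q x) (equiv x).toLinearMap a b)
    (H.dom p ∩ H'.dom q)
  map_higgs : ∀ x t w, equiv x (H.higgs x t w) = H'.higgs x t (equiv x w)

/-- The structure that makes a Higgs bundle `(E, Φ)` of rank `k` an `SL(k, ℂ)`-Higgs bundle: a
holomorphic trivialization `vol` of the determinant of `E`, and `Φ` is traceless. -/
structure SLStructure {k : ℕ} (H : HiggsBundle.{u, v} X k) where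
  vol : ∀ x, H.fiber x [⋀^Fin k]→ₗ[ℂ] ℂ
  vol_ne_zero : ∀ x, vol x ≠ 0
  hol_vol : ∀ p, IsHolOn (fun x => vol x (H.frame p x)) (H.dom p)
  trace_higgs : ∀ x t, LinearMap.trace ℂ (H.fiber x) (H.higgs x t) = 0

/-- Two `SL(k, ℂ)`-Higgs bundles are isomorphic. -/
def SLStructure.Isomorphic {k : ℕ} {H H' : HiggsBundle.{u, v} X k} (S : SLStructure H)
    (S' : SLStructure H') : Prop :=
  ∃ φ : H.Iso H', ∀ x w, S'.vol x (fun i => φ.equiv x (w i)) = S.vol x w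

/-- The structure that makes a Higgs bundle `(E, Φ)` of rank `k` an `SO(k, ℂ)`-Higgs bundle: a
holomorphic non-degenerate symmetric bilinear form `form` on `E`, a holomorphic trivialization `vol`
of the determinant of `E` whose square is the discriminant of `form`, and `Φ` is skew. -/
structure SOStructure {k : ℕ} (H : HiggsBundle.{u, v} X k) where
  form : ∀ x, LinearMap.BilinForm ℂ (H.fiber x)
  form_symm : ∀ x, (form x).IsSymm
  form_nondegenerate : ∀ x, (form x).Nondegenerate
  hol_form : ∀ p a b, IsHolOn (fun x => form x (H.frame p x a) (H.frame p x b)) (H.dom p)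
  vol : ∀ x, H.fiber x [⋀^Fin k]→ₗ[ℂ] ℂ
  hol_vol : ∀ p, IsHolOn (fun x => vol x (H.frame p x)) (H.dom p)
  vol_sq : ∀ x w, vol x w ^ 2 = (Matrix.of fun i j => form x (w i) (w j)).det
  form_higgs : ∀ x t w w', form x w (H.higgs x t w') = -form x (H.higgs x t w) w'

/-- Two `SO(k, ℂ)`-Higgs bundles are isomorphic. -/
def SOStructure.Isomorphic {k : ℕ} {H H' : HiggsBundle.{u, v} X k} (S : SOStructure H)
    (S' : SOStructure H') : Prop :=
  ∃ φ : H.Iso H', (∀ x w w', S'.form x (φ.equiv x w) (φ.equiv x w') = S.form x w w') ∧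
    ∀ x w, S'.vol x (fun i => φ.equiv x (w i)) = S.vol x w

end Vector

/-! ### Tensor products and exterior squares -/

section Tensor

variable {X : Type u} [TopologicalSpace X] [ChartedSpace ℂ X]

/-- The tensor product of two holomorphic vector bundles. -/
def HolVectorBundle.tensor {k l : ℕ} (E : HolVectorBundle.{u, v} X k)
    (F : HolVectorBundle.{u, v} X l) : HolVectorBundle.{u, v} X (k * l) where
  fiber x := E.fiber x ⊗[ℂ] F.fiber x
  dom p := E.dom p ∩ F.dom p
  isOpen_dom p := (E.isOpen_dom p).inter (F.isOpen_dom p)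
  mem_dom p := ⟨E.mem_dom p, F.mem_dom p⟩
  frame p x := ((E.frame p x).tensorProduct (F.frame p x)).reindex finProdFinEquiv
  hol_frame p q a b := by
    have h := ((E.hol_frame p q (finProdFinEquiv.symm a).1 (finProdFinEquiv.symm b).1).mono
      (V := (E.dom p ∩ F.dom p) ∩ (E.dom q ∩ F.dom q)) (fun x hx => ⟨hx.1.1, hx.2.1⟩)).mul
      ((F.hol_frame p q (finProdFinEquiv.symm a).2 (finProdFinEquiv.symm b).2).mono
      (fun x hx => ⟨hx.1.2, hx.2.2⟩))
    refine h.congr fun x _ => ?_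
    simp only [Module.Basis.toMatrix_apply, Module.Basis.reindex_apply,
      Module.Basis.tensorProduct_apply', Module.Basis.repr_reindex_apply]
    exact (Module.Basis.tensorProduct_repr_tmul_apply (E.frame p x) (F.frame p x) _ _ _ _).trans
      (mul_comm _ _)

/-- The wedge product `u ∧ w`. -/
def wedge₂ {V : Type v} [AddCommGroup V] [Module ℂ V] (u w : V) : ⋀[ℂ]^2 V :=
  exteriorPower.ιMulti ℂ 2 ![u, w]

theorem coe_wedge₂ {V : Type v} [AddCommGroup V] [Module ℂ V] (u w : V) :
    (wedge₂ u w : ExteriorAlgebra ℂ V) = ExteriorAlgebra.ι ℂ u * ExteriorAlgebra.ι ℂ w := by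
  simp [wedge₂, ExteriorAlgebra.ιMulti_apply]

/-- The endomorphism `φ ⊗ 1 + 1 ⊗ φ` of the exterior square, as an alternating map: it sends
`(w₀, w₁)` to `φ w₀ ∧ w₁ + w₀ ∧ φ w₁`. -/
def wedgeAlternating {V : Type v} [AddCommGroup V] [Module ℂ V] (φ : Module.End ℂ V) :
    V [⋀^Fin 2]→ₗ[ℂ] ⋀[ℂ]^2 V where
  toFun w := wedge₂ (φ (w 0)) (w 1) + wedge₂ (w 0) (φ (w 1))
  map_update_add' {inst} w i a b := by
    rw [Subsingleton.elim inst (instDecidableEqFin 2)]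
    apply Subtype.ext
    fin_cases i <;> simp [coe_wedge₂, add_mul, mul_add] <;> abel
  map_update_smul' {inst} w i c a := by
    rw [Subsingleton.elim inst (instDecidableEqFin 2)]
    apply Subtype.ext
    fin_cases i <;> simp [coe_wedge₂]
  map_eq_zero_of_eq' w i j h hij := by
    have h01 : w 0 = w 1 := by
      fin_cases i <;> fin_cases j <;> simp_all
    apply Subtype.ext
    simp [coe_wedge₂, h01]

/-- The endomorphism `φ ⊗ 1 + 1 ⊗ φ` of the exterior square. -/
def wedgeEnd (V : Type v) [AddCommGroup V] [Module ℂ V] :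
    Module.End ℂ V →ₗ[ℂ] Module.End ℂ (⋀[ℂ]^2 V) where
  toFun φ := exteriorPower.alternatingMapLinearEquiv (wedgeAlternating φ)
  map_add' φ ψ := by
    rw [← map_add]
    congr 1
    ext w : 1
    apply Subtype.ext
    simp [wedgeAlternating, coe_wedge₂, add_mul, mul_add]
    abel
  map_smul' c φ := by
    rw [RingHom.id_apply, ← map_smul]
    congr 1
    ext w : 1
    apply Subtype.ext
    simp [wedgeAlternating, coe_wedge₂]

theorem wedgeEnd_wedge₂ {V : Type v} [AddCommGroup V] [Module ℂ V] (φ : Module.End ℂ V) (u w : V) :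
    wedgeEnd V φ (wedge₂ u w) = wedge₂ (φ u) w + wedge₂ u (φ w) := by
  simp [wedgeEnd, wedgeAlternating, wedge₂]

/-- The two-element subsets of `Fin k`, numbered; they label the frames `e_i ∧ e_j`. -/
def pairsEquiv (k : ℕ) : Set.powersetCard (Fin k) 2 ≃ Fin (k.choose 2) :=
  Fintype.equivFinOfCardEq (by rw [← Nat.card_eq_fintype_card, Set.powersetCard.card]; simp)

/-- The increasing enumeration of the `a`-th two-element subset of `Fin k`. -/
def pairEmb {k : ℕ} (a : Fin (k.choose 2)) : Fin 2 ↪o Fin k :=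
  Set.powersetCard.ofFinEmbEquiv.symm ((pairsEquiv k).symm a)

/-- The exterior square of a holomorphic vector bundle. -/
def HolVectorBundle.wedge {k : ℕ} (E : HolVectorBundle.{u, v} X k) :
    HolVectorBundle.{u, v} X (k.choose 2) where
  fiber x := ⋀[ℂ]^2 (E.fiber x)
  dom := E.dom
  isOpen_dom := E.isOpen_dom
  mem_dom := E.mem_dom
  frame p x := ((E.frame p x).exteriorPower 2).reindex (pairsEquiv k)
  hol_frame p q a b := by
    let f := pairEmb a
    let g := pairEmb b
    have h := ((E.hol_frame p q (f 0) (g 0)).mul (E.hol_frame p q (f 1) (g 1))).sub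
      ((E.hol_frame p q (f 1) (g 0)).mul (E.hol_frame p q (f 0) (g 1)))
    refine h.congr fun x _ => ?_
    simp [Module.Basis.toMatrix_apply, exteriorPower.basis_repr_apply,
      exteriorPower.ιMulti_family, exteriorPower.ιMultiDual_apply_ιMulti, Matrix.det_fin_two, f, g, pairEmb]

theorem toMatrix_tensor {V W : Type v} [AddCommGroup V] [Module ℂ V] [AddCommGroup W] [Module ℂ W]
    {k l : ℕ} (e : Module.Basis (Fin k) ℂ V) (f : Module.Basis (Fin l) ℂ W) (φ : Module.End ℂ V)
    (ψ : Module.End ℂ W) (a₁ b₁ : Fin k) (a₂ b₂ : Fin l) :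
    LinearMap.toMatrix ((e.tensorProduct f).reindex finProdFinEquiv)
      ((e.tensorProduct f).reindex finProdFinEquiv) (φ.rTensor W + ψ.lTensor V)
      (finProdFinEquiv (a₁, a₂)) (finProdFinEquiv (b₁, b₂)) =
    (if a₂ = b₂ then 1 else 0) * LinearMap.toMatrix e e φ a₁ b₁ +
      (if a₁ = b₁ then 1 else 0) * LinearMap.toMatrix f f ψ a₂ b₂ := by
  simp only [LinearMap.toMatrix_apply, Module.Basis.reindex_apply, Equiv.symm_apply_apply,
    Module.Basis.tensorProduct_apply, LinearMap.add_apply, LinearMap.rTensor_tmul,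
    LinearMap.lTensor_tmul, map_add, Finsupp.add_apply, Module.Basis.repr_reindex_apply,
    Module.Basis.tensorProduct_repr_tmul_apply, Module.Basis.repr_self, Finsupp.single_apply,
    smul_eq_mul, @eq_comm _ b₁ a₁, @eq_comm _ b₂ a₂]
  ring

theorem toMatrix_wedge {V : Type v} [AddCommGroup V] [Module ℂ V] {k : ℕ}
    (e : Module.Basis (Fin k) ℂ V) (φ : Module.End ℂ V) (a b : Fin (k.choose 2)) :
    LinearMap.toMatrix ((e.exteriorPower 2).reindex (pairsEquiv k))
      ((e.exteriorPower 2).reindex (pairsEquiv k)) (wedgeEnd V φ) a b =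
    (if pairEmb a 1 = pairEmb b 1 then 1 else 0) *
        LinearMap.toMatrix e e φ (pairEmb a 0) (pairEmb b 0) +
      (if pairEmb a 0 = pairEmb b 1 then -1 else 0) *
        LinearMap.toMatrix e e φ (pairEmb a 1) (pairEmb b 0) +
      ((if pairEmb a 0 = pairEmb b 0 then 1 else 0) *
        LinearMap.toMatrix e e φ (pairEmb a 1) (pairEmb b 1) +
      (if pairEmb a 1 = pairEmb b 0 then -1 else 0) *
        LinearMap.toMatrix e e φ (pairEmb a 0) (pairEmb b 1)) := by
  have h : (e.exteriorPower 2).reindex (pairsEquiv k) b =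
      wedge₂ (e (pairEmb b 0)) (e (pairEmb b 1)) := by
    simp only [Module.Basis.reindex_apply, exteriorPower.basis_apply,
      exteriorPower.ιMulti_family, wedge₂]
    congr 1
    ext i
    fin_cases i <;> rfl
  have r : ∀ u w, ((e.exteriorPower 2).reindex (pairsEquiv k)).repr (wedge₂ u w) a =
      e.repr u (pairEmb a 0) * e.repr w (pairEmb a 1) -
      e.repr u (pairEmb a 1) * e.repr w (pairEmb a 0) := by
    intro u w
    simp [wedge₂, exteriorPower.basis_repr_apply, exteriorPower.ιMultiDual_apply_ιMulti,
      Matrix.det_fin_two, pairEmb]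
  simp only [LinearMap.toMatrix_apply, h, wedgeEnd_wedge₂, map_add, Finsupp.add_apply, r,
    Module.Basis.repr_self, Finsupp.single_apply, @eq_comm _ (pairEmb b _) (pairEmb a _)]
  split_ifs <;> ring

variable [IsManifold 𝓘(ℂ) ω X]

/-- The Higgs bundle `(E₁ ⊗ E₂, Φ₁ ⊗ 1 + 1 ⊗ Φ₂)`. -/
def HiggsBundle.tensor {k l : ℕ} (E : HiggsBundle.{u, v} X k) (F : HiggsBundle.{u, v} X l) :
    HiggsBundle.{u, v} X (k * l) where
  toHolVectorBundle := E.toHolVectorBundle.tensor F.toHolVectorBundle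
  higgs x := LinearMap.rTensorHom (F.fiber x) ∘ₗ E.higgs x +
    LinearMap.lTensorHom (E.fiber x) ∘ₗ F.higgs x
  hol_higgs p a b := by
    obtain ⟨⟨a₁, a₂⟩, rfl⟩ := finProdFinEquiv.surjective a
    obtain ⟨⟨b₁, b₂⟩, rfl⟩ := finProdFinEquiv.surjective b
    have h := (((E.hol_higgs p a₁ b₁).mono (V := E.dom p ∩ F.dom p) Set.inter_subset_left).smul
      (isHolOn_const (if a₂ = b₂ then 1 else 0) _)).add
      (((F.hol_higgs p a₂ b₂).mono (V := E.dom p ∩ F.dom p) Set.inter_subset_right).smul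
      (isHolOn_const (if a₁ = b₁ then 1 else 0) _))
    refine h.congr fun x _ => ?_
    exact LinearMap.ext fun t => toMatrix_tensor (E.frame p x) (F.frame p x) _ _ a₁ b₁ a₂ b₂

/-- The Higgs bundle `(Λ²E, Φ ⊗ 1 + 1 ⊗ Φ)`. -/
def HiggsBundle.wedge {k : ℕ} (E : HiggsBundle.{u, v} X k) :
    HiggsBundle.{u, v} X (k.choose 2) where
  toHolVectorBundle := E.toHolVectorBundle.wedge
  higgs x := wedgeEnd (E.fiber x) ∘ₗ E.higgs x
  hol_higgs p a b := by
    let f := pairEmb a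
    let g := pairEmb b
    have h := (((E.hol_higgs p (f 0) (g 0)).smul
        (isHolOn_const (if f 1 = g 1 then 1 else 0) _)).add ((E.hol_higgs p (f 1) (g 0)).smul
        (isHolOn_const (if f 0 = g 1 then -1 else 0) _))).add
      (((E.hol_higgs p (f 1) (g 1)).smul
        (isHolOn_const (if f 0 = g 0 then 1 else 0) _)).add ((E.hol_higgs p (f 0) (g 1)).smul
        (isHolOn_const (if f 1 = g 0 then -1 else 0) _)))
    refine h.congr fun x _ => ?_
    exact LinearMap.ext fun t => toMatrix_wedge (E.frame p x) _ a b

end Tensor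

/-! ### Complex matrix groups and their homomorphisms -/

section Groups

/-- A closed subgroup `G` of `GL(N, ℂ)`, where `N` is the number of elements of `n`; `mat` is the
inclusion. -/
class MatrixGroup (G : Type) [Group G] (n : outParam Type) [Fintype n] [DecidableEq n] where
  mat : G →* Matrix n n ℂ
  mat_injective : Function.Injective mat
  isClosed_range : IsClosed (Set.range mat)

open MatrixGroup (mat)

variable {n m : Type} [Fintype n] [DecidableEq n] [Fintype m] [DecidableEq m]

/-- The Lie algebra of a complex matrix group. -/
def lieAlg (G : Type) [Group G] [MatrixGroup G n] : Set (Matrix n n ℂ) :=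
  {A | ∀ t : ℂ, NormedSpace.exp (t • A) ∈ Set.range (mat (G := G))}

/-- Holomorphic homomorphisms of complex matrix groups: in the neighbourhood of each point they are
the restriction of a holomorphic map between spaces of matrices. -/
structure HolHom (G G' : Type) [Group G] [Group G'] [MatrixGroup G n] [MatrixGroup G' m]
    where
  hom : G →* G'
  hol : ∀ g : G, ∃ (V : Set (n → n → ℂ)) (F : (n → n → ℂ) → (m → m → ℂ)),
    IsOpen V ∧ mat g ∈ V ∧ DifferentiableOn ℂ F V ∧
      ∀ h : G, mat h ∈ V → F (mat h) = mat (hom h)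

variable {G G' : Type} [Group G] [Group G'] [MatrixGroup G n] [MatrixGroup G' m]

/-- The element `exp (tA)` of `G`, for `A` in the Lie algebra of `G`. -/
def expG (G : Type) [Group G] [MatrixGroup G n] (A : Matrix n n ℂ) (t : ℂ) : G :=
  Function.invFun (mat (G := G)) (NormedSpace.exp (t • A))

/-- The derivative at the identity of a holomorphic homomorphism, evaluated at an element `A` of the
Lie algebra of `G`. -/
def HolHom.d (Ψ : HolHom G G') (A : Matrix n n ℂ) : Matrix m m ℂ :=
  Matrix.of fun i j => deriv (fun t : ℂ => mat (Ψ.hom (expG G A t)) i j) 0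

/-- An isogeny is a surjective homomorphism with finite kernel. -/
def HolHom.IsIsogeny (Ψ : HolHom G G') : Prop :=
  Function.Surjective Ψ.hom ∧ (Ψ.hom.ker : Set G).Finite

theorem mat_expG {A : Matrix n n ℂ} (hA : A ∈ lieAlg G) (t : ℂ) :
    mat (expG G A t) = NormedSpace.exp (t • A) := Function.invFun_eq (hA t)

theorem mat_mul_mat_inv (g : G) : mat g * mat g⁻¹ = 1 := by rw [← map_mul]; simp

theorem mat_inv_mul_mat (g : G) : mat g⁻¹ * mat g = 1 := by rw [← map_mul]; simp

theorem exp_conj (g : G) (A : Matrix n n ℂ) :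
    NormedSpace.exp (mat g⁻¹ * A * mat g) = mat g⁻¹ * NormedSpace.exp A * mat g :=
  Matrix.exp_units_conj ⟨mat g⁻¹, mat g, mat_inv_mul_mat g, mat_mul_mat_inv g⟩ A

theorem conj_mem_lieAlg (g : G) {A : Matrix n n ℂ} (hA : A ∈ lieAlg G) :
    mat g⁻¹ * A * mat g ∈ lieAlg G := by
  intro t
  obtain ⟨h, hh⟩ := hA t
  refine ⟨g⁻¹ * h * g, ?_⟩
  rw [← smul_mul_assoc, ← mul_smul_comm, exp_conj, map_mul, map_mul, hh]

theorem hasDerivAt_exp_entry (A : Matrix n n ℂ) (i j : n) :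
    HasDerivAt (fun t : ℂ => NormedSpace.exp (t • A) i j) (A i j) 0 := by
  let _ := Matrix.linftyOpNormedRing (n := n) (α := ℂ)
  let _ := Matrix.linftyOpNormedAlgebra (R := ℂ) (n := n) (α := ℂ)
  have h := hasDerivAt_exp_smul_const (𝕂 := ℂ) A 0
  rw [zero_smul, NormedSpace.exp_zero, one_mul] at h
  let γ : ℂ → n → n → ℂ := fun t => (NormedSpace.exp (t • A) : Matrix n n ℂ)
  have h' : HasDerivAt γ A 0 := h
  exact hasDerivAt_pi.1 (hasDerivAt_pi.1 h' i) j

/-- A differentiable one-parameter subgroup is an exponential. -/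
theorem exp_of_hasDerivAt_aux {𝔸 : Type} [NormedRing 𝔸] [NormedAlgebra ℂ 𝔸] [CompleteSpace 𝔸]
    {γ : ℂ → 𝔸} {B : 𝔸} (h0 : γ 0 = 1) (hadd : ∀ s t, γ (s + t) = γ s * γ t)
    (hd : HasDerivAt γ B 0) (t : ℂ) : NormedSpace.exp (t • B) = γ t := by
  have hγ : ∀ t, HasDerivAt γ (γ t * B) t := by
    intro t
    have h1 : HasDerivAt (fun s => γ (s - t)) B t := by
      have := HasDerivAt.scomp (𝕜' := ℂ) t (h := fun s => s - t) (g₁ := γ) (by simpa using hd)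
        ((hasDerivAt_id t).sub_const t)
      simpa [Function.comp_def] using this
    have h2 := h1.const_mul (γ t)
    refine h2.congr_of_eventuallyEq (Filter.Eventually.of_forall fun s => ?_)
    simp [← hadd]
  have hE : ∀ t, HasDerivAt (fun s : ℂ => γ s * NormedSpace.exp (s • (-B))) 0 t := by
    intro t
    have := (hγ t).mul (hasDerivAt_exp_smul_const' (𝕂 := ℂ) (-B) t)
    have e : γ t * B * NormedSpace.exp (t • -B) + γ t * (-B * NormedSpace.exp (t • -B)) = 0 := by
      rw [neg_mul, mul_neg, mul_assoc, add_neg_cancel]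
    rw [e] at this
    exact this
  have hc := is_const_of_deriv_eq_zero (fun t => (hE t).differentiableAt) (fun t => (hE t).deriv) t 0
  simp only [h0, zero_smul, NormedSpace.exp_zero, mul_one] at hc
  let _ := NormedAlgebra.restrictScalars ℚ ℂ 𝔸
  have e : NormedSpace.exp (t • (-B)) * NormedSpace.exp (t • B) = 1 := by
    rw [smul_neg, ← NormedSpace.exp_add_of_commute (Commute.neg_left (Commute.refl _))]
    simp
  calc NormedSpace.exp (t • B) = (γ t * NormedSpace.exp (t • (-B))) * NormedSpace.exp (t • B) := by
        rw [hc, one_mul]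
    _ = γ t := by rw [mul_assoc, e, mul_one]

theorem exp_of_hasDerivAt {γ : ℂ → Matrix m m ℂ} {B : Matrix m m ℂ} (h0 : γ 0 = 1)
    (hadd : ∀ s t, γ (s + t) = γ s * γ t) (hd : ∀ i j, HasDerivAt (fun t => γ t i j) (B i j) 0)
    (t : ℂ) : NormedSpace.exp (t • B) = γ t := by
  let _ := Matrix.linftyOpNormedRing (n := m) (α := ℂ)
  let _ := Matrix.linftyOpNormedAlgebra (R := ℂ) (n := m) (α := ℂ)
  have h : HasDerivAt (F := m → m → ℂ) γ B 0 :=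
    hasDerivAt_pi.2 fun i => hasDerivAt_pi.2 fun j => hd i j
  exact exp_of_hasDerivAt_aux h0 hadd h t

theorem HolHom.exists_linear (Ψ : HolHom G G') :
    ∃ D : Matrix n n ℂ →ₗ[ℂ] Matrix m m ℂ, ∀ A ∈ lieAlg G, ∀ i j,
      HasDerivAt (fun t : ℂ => mat (Ψ.hom (expG G A t)) i j) (D A i j) 0 := by
  obtain ⟨V, F, hV, h1, hF, hFΨ⟩ := Ψ.hol 1
  refine ⟨(fderiv ℂ F (mat (1 : G))).toLinearMap, fun A hA i j => ?_⟩
  let γ : ℂ → n → n → ℂ := fun t => mat (expG G A t)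
  have hγ : HasDerivAt γ A 0 := by
    refine hasDerivAt_pi.2 fun i => hasDerivAt_pi.2 fun j => ?_
    have := hasDerivAt_exp_entry A i j
    refine this.congr_of_eventuallyEq (Filter.Eventually.of_forall fun t => ?_)
    simp only [γ, mat_expG hA]
  have hγ0 : γ 0 = mat (1 : G) := by
    simp only [γ, mat_expG hA, zero_smul, NormedSpace.exp_zero, map_one]
    rfl
  have hD : HasFDerivAt F (fderiv ℂ F (mat (1 : G))) (γ 0) := by
    rw [hγ0]
    exact (hF.differentiableAt (hV.mem_nhds h1)).hasFDerivAt
  have h2 := hD.comp_hasDerivAt (0 : ℂ) hγ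
  have h3 := hasDerivAt_pi.1 (hasDerivAt_pi.1 h2 i) j
  refine h3.congr_of_eventuallyEq ?_
  have : ∀ᶠ t in nhds (0 : ℂ), γ t ∈ V :=
    hγ.continuousAt (by rw [hγ0]; exact hV.mem_nhds h1)
  filter_upwards [this] with t ht
  exact (congrFun (congrFun (hFΨ _ ht) i) j).symm

theorem HolHom.hasDerivAt (Ψ : HolHom G G') {A : Matrix n n ℂ} (hA : A ∈ lieAlg G) (i j : m) :
    HasDerivAt (fun t : ℂ => mat (Ψ.hom (expG G A t)) i j) (Ψ.d A i j) 0 := by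
  obtain ⟨D, hD⟩ := Ψ.exists_linear
  exact (hD A hA i j).differentiableAt.hasDerivAt

theorem expG_add {A : Matrix n n ℂ} (hA : A ∈ lieAlg G) (s t : ℂ) :
    expG G A (s + t) = expG G A s * expG G A t := by
  apply MatrixGroup.mat_injective
  rw [map_mul, mat_expG hA, mat_expG hA, mat_expG hA, add_smul, Matrix.exp_add_of_commute]
  exact ((Commute.refl A).smul_left s).smul_right t

theorem expG_zero {A : Matrix n n ℂ} (hA : A ∈ lieAlg G) : expG G A 0 = 1 := by
  apply MatrixGroup.mat_injective
  rw [mat_expG hA]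
  simp

theorem HolHom.exp_d (Ψ : HolHom G G') {A : Matrix n n ℂ} (hA : A ∈ lieAlg G) (t : ℂ) :
    NormedSpace.exp (t • Ψ.d A) = mat (Ψ.hom (expG G A t)) := by
  refine exp_of_hasDerivAt (γ := fun t => mat (Ψ.hom (expG G A t))) ?_ (fun s t => ?_)
    (Ψ.hasDerivAt hA) t
  · rw [expG_zero hA]
    simp
  · rw [expG_add hA, ← map_mul, ← map_mul]

theorem HolHom.d_mem (Ψ : HolHom G G') {A : Matrix n n ℂ} (hA : A ∈ lieAlg G) :
    Ψ.d A ∈ lieAlg G' := fun t => ⟨_, (Ψ.exp_d hA t).symm⟩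

theorem HolHom.d_conj (Ψ : HolHom G G') (g : G) {A : Matrix n n ℂ} (hA : A ∈ lieAlg G) :
    Ψ.d (mat g⁻¹ * A * mat g) = mat (Ψ.hom g)⁻¹ * Ψ.d A * mat (Ψ.hom g) := by
  have e : ∀ t, mat (Ψ.hom (expG G (mat g⁻¹ * A * mat g) t)) =
      mat (Ψ.hom g)⁻¹ * mat (Ψ.hom (expG G A t)) * mat (Ψ.hom g) := by
    intro t
    have : expG G (mat g⁻¹ * A * mat g) t = g⁻¹ * expG G A t * g := by
      apply MatrixGroup.mat_injective
      rw [mat_expG (conj_mem_lieAlg g hA), map_mul, map_mul, mat_expG hA, ← exp_conj,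
        mul_smul_comm, smul_mul_assoc]
    rw [this, ← map_mul, ← map_mul]
    simp
  ext i j
  refine HasDerivAt.unique (Ψ.hasDerivAt (conj_mem_lieAlg g hA) i j) ?_
  simp only [e, Matrix.mul_apply]
  exact HasDerivAt.fun_sum fun k _ => HasDerivAt.mul_const
    (HasDerivAt.fun_sum fun l _ => (Ψ.hasDerivAt hA l k).const_mul _) _

/-- On the Lie algebra, the derivative of a homomorphism is linear. -/
theorem HolHom.exists_linear_d (Ψ : HolHom G G') :
    ∃ D : Matrix n n ℂ →ₗ[ℂ] Matrix m m ℂ, ∀ A ∈ lieAlg G, Ψ.d A = D A := by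
  obtain ⟨D, hD⟩ := Ψ.exists_linear
  refine ⟨D, fun A hA => ?_⟩
  ext i j
  exact (Ψ.hasDerivAt hA i j).unique (hD A hA i j)

theorem HolHom.isHolOn_comp {X : Type u} [TopologicalSpace X] [ChartedSpace ℂ X] (Ψ : HolHom G G')
    {g : X → G} {U : Set X} (hg : ∀ i j, IsHolOn (fun x => mat (g x) i j) U) (i j : m) :
    IsHolOn (fun x => mat (Ψ.hom (g x)) i j) U := by
  intro x hx
  obtain ⟨V, F, hV, h1, hF, hFΨ⟩ := Ψ.hol (g x)
  let γ : X → n → n → ℂ := fun y => mat (g y)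
  have hγ : MDifferentiableWithinAt 𝓘(ℂ) 𝓘(ℂ, n → n → ℂ) γ U x := by
    have h := fun i j => mdifferentiableWithinAt_iff.1 (hg i j x hx)
    refine mdifferentiableWithinAt_iff.2 ⟨?_, ?_⟩
    · exact continuousWithinAt_pi.2 fun i => continuousWithinAt_pi.2 fun j => (h i j).1
    · exact differentiableWithinAt_pi.2 fun i => differentiableWithinAt_pi.2 fun j => (h i j).2
  have hFm : MDifferentiableAt 𝓘(ℂ, n → n → ℂ) 𝓘(ℂ, m → m → ℂ) F (γ x) :=
    (hF.differentiableAt (hV.mem_nhds h1)).mdifferentiableAt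
  have h2 := hFm.comp_mdifferentiableWithinAt x hγ
  have h3 : MDifferentiableAt 𝓘(ℂ, m → m → ℂ) 𝓘(ℂ) (fun M : m → m → ℂ => M i j) (F (γ x)) :=
    DifferentiableAt.mdifferentiableAt (by fun_prop)
  have h4 := h3.comp_mdifferentiableWithinAt x h2
  refine h4.congr_of_eventuallyEq ?_ ?_
  · have : ∀ᶠ y in nhdsWithin x U, γ y ∈ V := hγ.continuousWithinAt (hV.mem_nhds h1)
    filter_upwards [this] with y hy
    exact (congrFun (congrFun (hFΨ _ hy) i) j).symm
  · exact (congrFun (congrFun (hFΨ _ h1) i) j).symm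

end Groups

/-! ### Principal Higgs bundles -/

section Principal

open MatrixGroup (mat)

variable {n m : Type} [Fintype n] [DecidableEq n] [Fintype m] [DecidableEq m]
variable (G : Type) [Group G] [MatrixGroup G n] {G' : Type} [Group G'] [MatrixGroup G' m]
variable (X : Type u) [TopologicalSpace X] [ChartedSpace ℂ X]

/-- A holomorphic principal `G`-bundle on `X`, given by its fibres, each of them with a simply
transitive right action of `G`, and by holomorphic local sections: for every point `p` of `X` a
section over an open neighbourhood `dom p` of `p` (the values of `sec p` outside of `dom p` carry no
information), any two of which differ by a holomorphic `G`-valued function. For two points `a`, `b`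
of a fibre, `diff a b` is the element `g` of `G` with `a g = b`. -/
structure PrincipalBundle where
  fiber : X → Type v
  act : ∀ {x}, fiber x → G → fiber x
  act_one : ∀ {x} (a : fiber x), act a 1 = a
  act_mul : ∀ {x} (a : fiber x) (g h : G), act a (g * h) = act (act a g) h
  diff : ∀ {x}, fiber x → fiber x → G
  act_diff : ∀ {x} (a b : fiber x), act a (diff a b) = b
  diff_act : ∀ {x} (a : fiber x) (g : G), diff a (act a g) = g
  dom : X → Set X
  isOpen_dom : ∀ p, IsOpen (dom p)
  mem_dom : ∀ p, p ∈ dom p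
  sec : X → ∀ x, fiber x
  hol_sec : ∀ p q i j,
    IsHolOn (fun x => mat (diff (sec p x) (sec q x)) i j) (dom p ∩ dom q)

variable {G X}

namespace PrincipalBundle

variable (P : PrincipalBundle.{u, v} G X)

/-- `σ` is a holomorphic section of `P` over `U`. -/
def IsHolSection (σ : ∀ x, P.fiber x) (U : Set X) : Prop :=
  ∀ p i j, IsHolOn (fun x => mat (P.diff (P.sec p x) (σ x)) i j) (P.dom p ∩ U)

theorem diff_mul_diff {x : X} (a b c : P.fiber x) : P.diff a b * P.diff b c = P.diff a c := by
  rw [← P.diff_act a (P.diff a b * P.diff b c), P.act_mul, P.act_diff, P.act_diff]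

theorem diff_self {x : X} (a : P.fiber x) : P.diff a a = 1 := by
  have h := P.diff_act a 1
  rwa [P.act_one] at h

theorem diff_act_left {x : X} (a b : P.fiber x) (g : G) :
    P.diff (P.act a g) b = g⁻¹ * P.diff a b := by
  rw [← P.diff_mul_diff (P.act a g) a b]
  congr 1
  have h := P.diff_mul_diff (P.act a g) a (P.act a g)
  rwa [P.diff_self, P.diff_act, mul_eq_one_iff_eq_inv] at h

end PrincipalBundle

/-! #### Extension of the structure group of a principal bundle -/

namespace PrincipalBundle

variable (P : PrincipalBundle.{u, v} G X) (Ψ : HolHom G G')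

/-- The fibre at `x` of the extension `P ×_Ψ G'` of the structure group. The class of
`(a, h)` in `P_x × G'` modulo `(a g, h) ∼ (a, Ψ (g) h)` is viewed as the function `f : P_x → G'`
with `f (a g) = Ψ(g)⁻¹ f (a)` whose value at `a` is `h`. -/
@[ext]
structure ExtFiber (x : X) : Type v where
  val : P.fiber x → G'
  val_act : ∀ a g, val (P.act a g) = (Ψ.hom g)⁻¹ * val a

variable {P Ψ} in
theorem ExtFiber.val_eq {x : X} (f : P.ExtFiber Ψ x) (a b : P.fiber x) :
    f.val a = Ψ.hom (P.diff a b) * f.val b := by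
  have h := f.val_act a (P.diff a b)
  rw [P.act_diff] at h
  simp [h]

/-- The point `[a, 1]` of the extension `P ×_Ψ G'`. -/
def toExt {x : X} (a : P.fiber x) : P.ExtFiber Ψ x where
  val b := Ψ.hom (P.diff b a)
  val_act b g := by simp [P.diff_act_left]

/-- The extension `P ×_Ψ G'` of the structure group along `Ψ : G → G'`. -/
def extend : PrincipalBundle.{u, v} G' X where
  fiber := P.ExtFiber Ψ
  act f h := ⟨fun a => f.val a * h, fun a g => by simp [f.val_act, mul_assoc]⟩
  act_one f := by simp
  act_mul f g h := by simp [mul_assoc]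
  diff {x} f f' := (f.val (P.sec x x))⁻¹ * f'.val (P.sec x x)
  act_diff {x} f f' := by
    apply ExtFiber.ext
    funext a
    simp [f.val_eq a (P.sec x x), f'.val_eq a (P.sec x x), mul_assoc]
  diff_act f g := by simp
  dom := P.dom
  isOpen_dom := P.isOpen_dom
  mem_dom := P.mem_dom
  sec p x := P.toExt Ψ (P.sec p x)
  hol_sec p q i j := by
    refine (Ψ.isHolOn_comp (P.hol_sec p q) i j).congr fun x _ => ?_
    rw [← P.diff_mul_diff (P.sec p x) (P.sec x x) (P.sec q x)]
    have h : P.diff (P.sec p x) (P.sec x x) = (P.diff (P.sec x x) (P.sec p x))⁻¹ := by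
      rw [← mul_eq_one_iff_eq_inv, P.diff_mul_diff, P.diff_self]
    simp [toExt, h]

end PrincipalBundle

variable (G X) [IsManifold 𝓘(ℂ) ω X]

/-- A `G`-Higgs bundle `(P, Φ)`: a holomorphic principal `G`-bundle `P` with a holomorphic section
`Φ` of `ad P ⊗ K`. Since `ad P` is associated to the adjoint representation of `G` on its Lie
algebra, such a section is the same as a function on `P` with values in one-forms with coefficients
in the Lie algebra that satisfies `Φ (a g) = g⁻¹ Φ (a) g`. -/
structure PrincipalHiggs extends PrincipalBundle.{u, v} G X where
  higgs : ∀ {x}, fiber x → Tan x →ₗ[ℂ] Matrix n n ℂ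
  higgs_mem : ∀ {x} (a : fiber x) (t : Tan x), higgs a t ∈ lieAlg G
  higgs_act : ∀ {x} (a : fiber x) (g : G) (t : Tan x),
    higgs (act a g) t = mat g⁻¹ * higgs a t * mat g
  hol_higgs : ∀ p i j,
    IsHolFormOn (fun x => Matrix.entryLinearMap ℂ ℂ i j ∘ₗ higgs (sec p x)) (dom p)

variable {G X}

/-- Isomorphisms of `G`-Higgs bundles. -/
structure PrincipalHiggs.Iso (P P' : PrincipalHiggs.{u, v} G X) where
  map : ∀ {x}, P.fiber x → P'.fiber x
  map_act : ∀ {x} (a : P.fiber x) (g : G), map (P.act a g) = P'.act (map a) g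
  hol : ∀ p, P'.IsHolSection (fun x => map (P.sec p x)) (P.dom p)
  map_higgs : ∀ {x} (a : P.fiber x), P'.higgs (map a) = P.higgs a

/-! #### Extension of the structure group of a Higgs bundle -/

/-- The Higgs field `dΨ (Φ)`. -/
def PrincipalHiggs.extHiggs (P : PrincipalHiggs.{u, v} G X) (Ψ : HolHom G G') {x : X}
    (f : P.ExtFiber Ψ x) : Tan x →ₗ[ℂ] Matrix m m ℂ where
  toFun t := mat (f.val (P.sec x x))⁻¹ * Ψ.d (P.higgs (P.sec x x) t) * mat (f.val (P.sec x x))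
  map_add' s t := by
    obtain ⟨D, hD⟩ := Ψ.exists_linear_d
    rw [hD _ (P.higgs_mem _ _), hD _ (P.higgs_mem _ _), hD _ (P.higgs_mem _ _)]
    simp [mul_add, add_mul]
  map_smul' c t := by
    obtain ⟨D, hD⟩ := Ψ.exists_linear_d
    rw [hD _ (P.higgs_mem _ _), hD _ (P.higgs_mem _ _)]
    simp

theorem PrincipalHiggs.extHiggs_toExt (P : PrincipalHiggs.{u, v} G X) (Ψ : HolHom G G') {x : X}
    (a : P.fiber x) (t : Tan x) : P.extHiggs Ψ (P.toExt Ψ a) t = Ψ.d (P.higgs a t) := by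
  have h := P.higgs_act (P.sec x x) (P.diff (P.sec x x) a) t
  rw [P.act_diff] at h
  rw [h, Ψ.d_conj _ (P.higgs_mem _ _)]
  rfl

/-- The `G'`-Higgs bundle `(P ×_Ψ G', dΨ (Φ))` induced from the `G`-Higgs bundle `(P, Φ)`: the
value of `dΨ (Φ)` at `[a, h] = [a, 1] h` is `h⁻¹ dΨ (Φ (a)) h`. -/
def PrincipalHiggs.extend (P : PrincipalHiggs.{u, v} G X) (Ψ : HolHom G G') :
    PrincipalHiggs.{u, v} G' X where
  toPrincipalBundle := P.toPrincipalBundle.extend Ψ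
  higgs {x} f := P.extHiggs Ψ f
  higgs_mem {x} f t := conj_mem_lieAlg _ (Ψ.d_mem (P.higgs_mem _ _))
  higgs_act {x} f g t := by
    change mat (f.val (P.sec x x) * g)⁻¹ * _ * mat (f.val (P.sec x x) * g) =
      mat g⁻¹ * (mat (f.val (P.sec x x))⁻¹ * _ * mat (f.val (P.sec x x))) * mat g
    simp only [mul_inv_rev, map_mul, mul_assoc]
  hol_higgs p i j := by
    obtain ⟨D, hD⟩ := Ψ.exists_linear_d
    have h : IsHolFormOn (fun x => ∑ a, ∑ b, (D (Matrix.single a b 1) i j) •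
        (Matrix.entryLinearMap ℂ ℂ a b ∘ₗ P.higgs (P.sec p x))) (P.dom p) :=
      IsHolFormOn.sum _ fun a _ => IsHolFormOn.sum _ fun b _ =>
        (P.hol_higgs p a b).smul (isHolOn_const _ _)
    refine h.congr fun x _ => LinearMap.ext fun t => ?_
    change P.extHiggs Ψ (P.toExt Ψ (P.sec p x)) t i j = _
    rw [P.extHiggs_toExt, hD _ (P.higgs_mem _ _)]
    conv_lhs => rw [Matrix.matrix_eq_sum_single (P.higgs (P.sec p x) t)]
    simp only [map_sum, Matrix.sum_apply, LinearMap.sum_apply]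
    refine Finset.sum_congr rfl fun a _ => Finset.sum_congr rfl fun b _ => ?_
    have : Matrix.single a b (P.higgs (P.sec p x) t a b) =
        (P.higgs (P.sec p x) t a b) • Matrix.single a b (1 : ℂ) := by simp
    rw [this, map_smul]
    exact mul_comm _ _

end Principal

/-! ### The special linear and special orthogonal groups -/

section Classical

open MatrixGroup (mat)

/-- The group `SL(k, ℂ)`. -/
abbrev SLGroup (k : ℕ) : Type := Matrix.SpecialLinearGroup (Fin k) ℂ

/-- The group `SO(k, ℂ)` of complex matrices `A` with `Aᵀ A = 1` and `det A = 1`. -/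
abbrev SOGroup (k : ℕ) : Type := Matrix.specialOrthogonalGroup (Fin k) ℂ

theorem mem_SO_iff {k : ℕ} {A : Matrix (Fin k) (Fin k) ℂ} :
    A ∈ Matrix.specialOrthogonalGroup (Fin k) ℂ ↔ Aᵀ * A = 1 ∧ A.det = 1 := by
  rw [Matrix.mem_specialOrthogonalGroup_iff, Matrix.mem_orthogonalGroup_iff']

instance (k : ℕ) : MatrixGroup (SLGroup k) (Fin k) where
  mat := ⟨⟨fun A => A.1, rfl⟩, fun _ _ => rfl⟩
  mat_injective _ _ h := Subtype.ext h
  isClosed_range := by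
    have : Set.range (fun A : SLGroup k => A.1) = {A | A.det = 1} := Subtype.range_coe
    exact this ▸ isClosed_eq (by fun_prop) continuous_const

instance (k : ℕ) : MatrixGroup (SOGroup k) (Fin k) where
  mat := (Matrix.specialOrthogonalGroup (Fin k) ℂ).subtype
  mat_injective _ _ h := Subtype.ext h
  isClosed_range := by
    have : Set.range (fun A : SOGroup k => A.1) = {A | Aᵀ * A = 1} ∩ {A | A.det = 1} := by
      ext A
      simp [mem_SO_iff]
    exact this ▸ (isClosed_eq (by fun_prop) continuous_const).inter
      (isClosed_eq (by fun_prop) continuous_const)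

/-- A product of two special linear groups consists of block diagonal matrices. -/
instance (k l : ℕ) : MatrixGroup (SLGroup k × SLGroup l) (Fin k ⊕ Fin l) where
  mat := ⟨⟨fun A => Matrix.fromBlocks A.1.1 0 0 A.2.1, Matrix.fromBlocks_one⟩, fun A B => by
    simp [Matrix.fromBlocks_multiply]⟩
  mat_injective A B h := by
    have h' := Matrix.fromBlocks_inj.1 h
    exact Prod.ext (Subtype.ext h'.1) (Subtype.ext h'.2.2.2)
  isClosed_range := by
    have : Set.range (fun A : SLGroup k × SLGroup l => Matrix.fromBlocks A.1.1 0 0 A.2.1) =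
        {M | M.toBlocks₁₂ = 0} ∩ {M | M.toBlocks₂₁ = 0} ∩
          ({M | M.toBlocks₁₁.det = 1} ∩ {M | M.toBlocks₂₂.det = 1}) := by
      ext M
      constructor
      · rintro ⟨A, rfl⟩
        simp
      · rintro ⟨⟨h1, h2⟩, h3, h4⟩
        refine ⟨(⟨_, h3⟩, ⟨_, h4⟩), ?_⟩
        conv_rhs => rw [← Matrix.fromBlocks_toBlocks M, h1, h2]
    exact this ▸ ((isClosed_eq (by unfold Matrix.toBlocks₁₂; fun_prop) continuous_const).inter
      (isClosed_eq (by unfold Matrix.toBlocks₂₁; fun_prop) continuous_const)).inter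
      ((isClosed_eq (by unfold Matrix.toBlocks₁₁; fun_prop) continuous_const).inter
      (isClosed_eq (by unfold Matrix.toBlocks₂₂; fun_prop) continuous_const))

theorem trace_of_mem_lieAlg {k : ℕ} {A : Matrix (Fin k) (Fin k) ℂ} (hA : A ∈ lieAlg (SLGroup k)) :
    A.trace = 0 := by
  let F : (Fin k → Fin k → ℂ) → ℂ := fun M => Matrix.det (Matrix.of M)
  have hF : Differentiable ℂ F := by
    have : F = fun M => ∑ σ : Equiv.Perm (Fin k), ((Equiv.Perm.sign σ : ℤ) : ℂ) * ∏ i, M (σ i) i := by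
      funext M
      simp [F, Matrix.det_apply']
    rw [this]
    fun_prop
  let γ : ℂ → Fin k → Fin k → ℂ := fun t => (NormedSpace.exp (t • A) : Matrix (Fin k) (Fin k) ℂ)
  let δ : ℂ → Fin k → Fin k → ℂ := fun t => (1 + t • A : Matrix (Fin k) (Fin k) ℂ)
  have hγ : HasDerivAt γ A 0 :=
    hasDerivAt_pi.2 fun i => hasDerivAt_pi.2 fun j => hasDerivAt_exp_entry A i j
  have hδ : HasDerivAt δ A 0 := by
    refine hasDerivAt_pi.2 fun i => hasDerivAt_pi.2 fun j => ?_
    have := ((hasDerivAt_id (0 : ℂ)).mul_const (A i j)).const_add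
      ((1 : Matrix (Fin k) (Fin k) ℂ) i j)
    simpa [δ] using this
  have e : γ 0 = δ 0 := by
    simp only [γ, δ, zero_smul, NormedSpace.exp_zero, add_zero]
    rfl
  have h1 := (hF (γ 0)).hasFDerivAt.comp_hasDerivAt (0 : ℂ) hγ
  have h2 := (hF (δ 0)).hasFDerivAt.comp_hasDerivAt (0 : ℂ) hδ
  rw [← e] at h2
  have h3 : F ∘ γ = fun _ => 1 := by
    funext t
    obtain ⟨g, hg⟩ := hA t
    change Matrix.det (NormedSpace.exp (t • A)) = 1
    rw [← hg]
    exact g.2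
  rw [h3] at h1
  have h5 := h1.unique (hasDerivAt_const _ _)
  rw [h5] at h2
  have h6 : HasDerivAt (F ∘ δ) A.trace 0 := by
    have h7 := (Matrix.det (1 + (Polynomial.X : Polynomial ℂ) • A.map Polynomial.C)).hasDerivAt
      (0 : ℂ)
    rw [← Polynomial.coeff_zero_eq_eval_zero, Polynomial.coeff_zero_eq_eval_zero,
      Matrix.derivative_det_one_add_X_smul] at h7
    refine h7.congr_of_eventuallyEq (Filter.Eventually.of_forall fun t => ?_)
    change Matrix.det (1 + t • A) = Polynomial.evalRingHom t (Matrix.det _)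
    rw [RingHom.map_det]
    congr 1
    ext i j
    simp [Matrix.one_apply, apply_ite (Polynomial.eval t)]
    exact mul_comm _ _
  exact h6.unique h2

theorem transpose_of_mem_lieAlg {k : ℕ} {A : Matrix (Fin k) (Fin k) ℂ}
    (hA : A ∈ lieAlg (SOGroup k)) : Aᵀ = -A := by
  have h : ∀ t : ℂ, NormedSpace.exp (t • Aᵀ) = NormedSpace.exp (t • -A) := by
    intro t
    obtain ⟨g, hg⟩ := hA t
    have h1 : (NormedSpace.exp (t • A))ᵀ * NormedSpace.exp (t • A) = 1 := by
      rw [← hg]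
      exact (mem_SO_iff.1 g.2).1
    have h2 : NormedSpace.exp (t • A) * NormedSpace.exp (t • -A) = 1 := by
      rw [smul_neg, Matrix.exp_neg, Matrix.mul_nonsing_inv]
      exact (Matrix.isUnit_iff_isUnit_det _).1 (Matrix.isUnit_exp _)
    rw [← Matrix.transpose_smul, Matrix.exp_transpose]
    exact left_inv_eq_right_inv h1 h2
  ext i j
  have h1 := hasDerivAt_exp_entry Aᵀ i j
  simp only [h] at h1
  exact h1.unique (hasDerivAt_exp_entry (-A) i j)

end Classical

/-! ### The vector bundle associated to a principal Higgs bundle -/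

section Associated

open MatrixGroup (mat)

variable {k : ℕ} {G : Type} [Group G] [MatrixGroup G (Fin k)]
variable {X : Type u} [TopologicalSpace X] [ChartedSpace ℂ X]

/-- The fibre at `x` of the vector bundle `P ×_G ℂᵏ` associated to the standard representation of
`G ⊆ GL(k, ℂ)`. The class of `(a, w)` in `P_x × ℂᵏ` modulo `(a g, w) ∼ (a, g w)` is viewed as the
function `f : P_x → ℂᵏ` with `f (a g) = g⁻¹ f (a)` whose value at `a` is `w`. -/
def PrincipalBundle.assocFiber (P : PrincipalBundle.{u, v} G X) (x : X) :
    Submodule ℂ (P.fiber x → Fin k → ℂ) where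
  carrier := {f | ∀ a g, f (P.act a g) = mat g⁻¹ *ᵥ f a}
  add_mem' hf hf' a g := by simp [hf a g, hf' a g, Matrix.mulVec_add]
  zero_mem' a g := by simp
  smul_mem' c f hf a g := by simp [hf a g, Matrix.mulVec_smul]

theorem PrincipalBundle.assocFiber_eq (P : PrincipalBundle.{u, v} G X) {x : X}
    (f : P.assocFiber x) (a b : P.fiber x) : f.1 a = mat (P.diff a b) *ᵥ f.1 b := by
  have h := f.2 a (P.diff a b)
  rw [P.act_diff] at h
  rw [h, Matrix.mulVec_mulVec, mat_mul_mat_inv, Matrix.one_mulVec]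

/-- The frame of `P ×_G ℂᵏ` at `x` given by a point `a` of `P_x`. -/
def PrincipalBundle.assocEquiv (P : PrincipalBundle.{u, v} G X) {x : X} (a : P.fiber x) :
    P.assocFiber x ≃ₗ[ℂ] (Fin k → ℂ) where
  toFun f := f.1 a
  map_add' f f' := rfl
  map_smul' c f := rfl
  invFun w := ⟨fun b => mat (P.diff b a) *ᵥ w, fun b g => by
    simp [P.diff_act_left, Matrix.mulVec_mulVec]⟩
  left_inv f := by
    apply Subtype.ext
    funext b
    exact (P.assocFiber_eq f b a).symm
  right_inv w := by simp [P.diff_self]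

theorem PrincipalBundle.toMatrix_frame (P : PrincipalBundle.{u, v} G X) (p q x : X) (i j : Fin k) :
    (Module.Basis.ofEquivFun (P.assocEquiv (P.sec p x))).toMatrix
      (Module.Basis.ofEquivFun (P.assocEquiv (P.sec q x))) i j =
      mat (P.diff (P.sec p x) (P.sec q x)) i j := by
  simp [Module.Basis.toMatrix_apply, PrincipalBundle.assocEquiv]

/-- The holomorphic vector bundle associated to the standard representation. -/
def PrincipalBundle.assoc (P : PrincipalBundle.{u, v} G X) : HolVectorBundle.{u, v} X k where
  fiber x := P.assocFiber x
  dom := P.dom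
  isOpen_dom := P.isOpen_dom
  mem_dom := P.mem_dom
  frame p x := Module.Basis.ofEquivFun (P.assocEquiv (P.sec p x))
  hol_frame p q i j := by
    exact (P.hol_sec p q i j).congr fun x _ => P.toMatrix_frame p q x i j

variable [IsManifold 𝓘(ℂ) ω X]

/-- The action of the Higgs field on the associated vector bundle. -/
def PrincipalHiggs.assocHiggs (P : PrincipalHiggs.{u, v} G X) (x : X) :
    Tan x →ₗ[ℂ] Module.End ℂ (P.assocFiber x) where
  toFun t :=
    { toFun := fun f => ⟨fun a => P.higgs a t *ᵥ f.1 a, fun a g => by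
        have h := f.2 a g
        simp only [P.higgs_act, h, Matrix.mulVec_mulVec, mul_assoc, mat_mul_mat_inv, mul_one]⟩
      map_add' := fun f f' => by
        apply Subtype.ext
        funext a
        exact Matrix.mulVec_add (P.higgs a t) (f.1 a) (f'.1 a)
      map_smul' := fun c f => by
        apply Subtype.ext
        funext a
        exact Matrix.mulVec_smul (P.higgs a t) c (f.1 a) }
  map_add' s t := by
    refine LinearMap.ext fun f => Subtype.ext (funext fun a => ?_)
    change P.higgs a (s + t) *ᵥ f.1 a = P.higgs a s *ᵥ f.1 a + P.higgs a t *ᵥ f.1 a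
    rw [map_add, Matrix.add_mulVec]
  map_smul' c t := by
    refine LinearMap.ext fun f => Subtype.ext (funext fun a => ?_)
    change P.higgs a (c • t) *ᵥ f.1 a = c • (P.higgs a t *ᵥ f.1 a)
    rw [map_smul, Matrix.smul_mulVec]

theorem PrincipalHiggs.toMatrix_assocHiggs (P : PrincipalHiggs.{u, v} G X) {x : X} (a : P.fiber x)
    (t : Tan x) (i j : Fin k) :
    LinearMap.toMatrix (Module.Basis.ofEquivFun (P.assocEquiv a))
      (Module.Basis.ofEquivFun (P.assocEquiv a)) (P.assocHiggs x t) i j = P.higgs a t i j := by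
  simp [LinearMap.toMatrix_apply, PrincipalBundle.assocEquiv, PrincipalHiggs.assocHiggs,
    P.diff_self, Matrix.mulVec, dotProduct, Matrix.one_apply]

/-- The Higgs bundle `(P ×_G ℂᵏ, Φ)` associated to the `G`-Higgs bundle `(P, Φ)`, for
`G ⊆ GL(k, ℂ)`. -/
def PrincipalHiggs.assoc (P : PrincipalHiggs.{u, v} G X) : HiggsBundle.{u, v} X k where
  toHolVectorBundle := P.toPrincipalBundle.assoc
  higgs := P.assocHiggs
  hol_higgs p i j := by
    refine (P.hol_higgs p i j).congr fun x _ => LinearMap.ext fun t => ?_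
    change LinearMap.toMatrix (Module.Basis.ofEquivFun (P.assocEquiv (P.sec p x)))
      (Module.Basis.ofEquivFun (P.assocEquiv (P.sec p x))) (P.assocHiggs x t) i j =
      P.higgs (P.sec p x) t i j
    exact P.toMatrix_assocHiggs _ t i j

end Associated

section AssociatedStructures

open MatrixGroup (mat)

variable {k : ℕ} {X : Type u} [TopologicalSpace X] [ChartedSpace ℂ X]

theorem PrincipalBundle.det_frame {G : Type} [Group G] [MatrixGroup G (Fin k)]
    (P : PrincipalBundle.{u, v} G X) (hG : ∀ g : G, (mat g).det = 1) (p q x : X) :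
    (P.assoc.frame p x).det (P.assoc.frame q x) = 1 := by
  rw [Module.Basis.det_apply, ← hG (P.diff (P.sec p x) (P.sec q x))]
  congr 1
  ext i j
  exact P.toMatrix_frame p q x i j

/-- The bilinear form on the fibre of the associated bundle for which the frame given by the point
`a` of `P_x` is orthonormal. -/
def PrincipalBundle.assocForm {G : Type} [Group G] [MatrixGroup G (Fin k)]
    (P : PrincipalBundle.{u, v} G X) {x : X} (a : P.fiber x) :
    LinearMap.BilinForm ℂ (P.assocFiber x) :=
  (dotProductBilin ℂ ℂ).compl₁₂ (P.assocEquiv a).toLinearMap (P.assocEquiv a).toLinearMap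

theorem PrincipalBundle.assocForm_apply {G : Type} [Group G] [MatrixGroup G (Fin k)]
    (P : PrincipalBundle.{u, v} G X) {x : X} (a : P.fiber x) (f f' : P.assocFiber x) :
    P.assocForm a f f' = f.1 a ⬝ᵥ f'.1 a := rfl

theorem PrincipalBundle.assocForm_frame {G : Type} [Group G] [MatrixGroup G (Fin k)]
    (P : PrincipalBundle.{u, v} G X) {x : X} (a : P.fiber x) (i j : Fin k) :
    P.assocForm a (Module.Basis.ofEquivFun (P.assocEquiv a) i)
      (Module.Basis.ofEquivFun (P.assocEquiv a) j) = if i = j then 1 else 0 := by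
  have h : ∀ i, (Module.Basis.ofEquivFun (P.assocEquiv a) i).1 a = Pi.single i 1 := fun i => by
    rw [Module.Basis.coe_ofEquivFun]
    exact (P.assocEquiv a).apply_symm_apply _
  rw [assocForm_apply, h, h]
  by_cases e : i = j
  · simp [e]
  · simp [e]

theorem PrincipalBundle.assocForm_nondegenerate {G : Type} [Group G] [MatrixGroup G (Fin k)]
    (P : PrincipalBundle.{u, v} G X) {x : X} (a : P.fiber x) : (P.assocForm a).Nondegenerate := by
  refine ⟨fun f hf => (P.assocEquiv a).injective ?_, fun f hf => (P.assocEquiv a).injective ?_⟩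
  · rw [map_zero]
    refine dotProduct_eq_zero _ fun w => ?_
    have h := hf ((P.assocEquiv a).symm w)
    rw [assocForm_apply] at h
    exact (congrArg _ ((P.assocEquiv a).apply_symm_apply w)).symm.trans h
  · rw [map_zero]
    refine dotProduct_eq_zero _ fun w => ?_
    have h := hf ((P.assocEquiv a).symm w)
    rw [assocForm_apply, dotProduct_comm] at h
    exact (congrArg _ ((P.assocEquiv a).apply_symm_apply w)).symm.trans h

theorem PrincipalBundle.assocForm_eq (P : PrincipalBundle.{u, v} (SOGroup k) X) {x : X}
    (a b : P.fiber x) : P.assocForm a = P.assocForm b := by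
  refine LinearMap.ext fun f => LinearMap.ext fun f' => ?_
  change f.1 a ⬝ᵥ f'.1 a = f.1 b ⬝ᵥ f'.1 b
  rw [P.assocFiber_eq f a b, P.assocFiber_eq f' a b, Matrix.dotProduct_mulVec,
    Matrix.vecMul_mulVec]
  have h : (mat (P.diff a b))ᵀ * mat (P.diff a b) = 1 := (mem_SO_iff.1 (P.diff a b).2).1
  rw [h, Matrix.vecMul_one]

variable [IsManifold 𝓘(ℂ) ω X]

/-- The vector bundle associated to an `SL(k, ℂ)`-Higgs bundle, with the trivialization of its
determinant that takes the value one on the frames in `P`. -/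
def PrincipalHiggs.assocSL (P : PrincipalHiggs.{u, v} (SLGroup k) X) : SLStructure P.assoc where
  vol x := (P.assoc.frame x x).det
  vol_ne_zero x h := by
    have := (P.assoc.frame x x).det_self
    rw [h] at this
    exact zero_ne_one this
  hol_vol p := (isHolOn_const 1 _).congr fun x _ => P.det_frame (fun g => g.2) x p x
  trace_higgs x t := by
    change LinearMap.trace ℂ (P.assocFiber x) (P.assocHiggs x t) = 0
    rw [LinearMap.trace_eq_matrix_trace ℂ (Module.Basis.ofEquivFun (P.assocEquiv (P.sec x x))),
      ← trace_of_mem_lieAlg (P.higgs_mem (P.sec x x) t)]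
    congr 1
    ext i j
    exact P.toMatrix_assocHiggs _ t i j

/-- The vector bundle associated to an `SO(k, ℂ)`-Higgs bundle, with the orthogonal structure for
which the frames in `P` are orthonormal and the trivialization of its determinant that takes the
value one on the frames in `P`. -/
def PrincipalHiggs.assocSO (P : PrincipalHiggs.{u, v} (SOGroup k) X) : SOStructure P.assoc where
  form x := P.assocForm (P.sec x x)
  form_symm x := ⟨fun f f' => dotProduct_comm (f.1 (P.sec x x)) (f'.1 (P.sec x x))⟩
  form_nondegenerate x := P.assocForm_nondegenerate (P.sec x x)
  hol_form p a b := by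
    refine (isHolOn_const (if a = b then 1 else 0) _).congr fun x _ => ?_
    rw [P.assocForm_eq _ (P.sec p x)]
    exact P.assocForm_frame (P.sec p x) a b
  vol x := (P.assoc.frame x x).det
  hol_vol p := (isHolOn_const 1 _).congr fun x _ =>
    P.det_frame (fun g => (mem_SO_iff.1 g.2).2) x p x
  vol_sq x w := by
    rw [Module.Basis.det_apply, sq]
    nth_rewrite 1 [← Matrix.det_transpose]
    rw [← Matrix.det_mul]
    rfl
  form_higgs x t f f' := by
    change f.1 (P.sec x x) ⬝ᵥ (P.higgs (P.sec x x) t *ᵥ f'.1 (P.sec x x)) =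
      -((P.higgs (P.sec x x) t *ᵥ f.1 (P.sec x x)) ⬝ᵥ f'.1 (P.sec x x))
    rw [Matrix.dotProduct_mulVec, ← Matrix.mulVec_transpose,
      transpose_of_mem_lieAlg (P.higgs_mem _ _), Matrix.neg_mulVec, neg_dotProduct]

end AssociatedStructures

/-! ### The isogenies -/

section Isogenies

open MatrixGroup (mat)

/-- Let the columns of `C` be an orthogonal basis of `ℂᵏ`, with common square length two, for the
symmetric bilinear form with Gram matrix `J`. If `K` is a matrix of determinant one that preserves
this form, then its matrix `C⁻¹ K C = ½ Cᵀ J K C` in this basis is special orthogonal. -/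
theorem conj_mem_SO {k : ℕ} {C J K : Matrix (Fin k) (Fin k) ℂ}
    (hC : ((1 / 2 : ℂ) • (Cᵀ * J)) * C = 1) (hJ : Jᵀ = J) (hK : Kᵀ * J * K = J) (hd : K.det = 1) :
    ((1 / 2 : ℂ) • (Cᵀ * J)) * K * C ∈ Matrix.specialOrthogonalGroup (Fin k) ℂ := by
  have hC' : C * ((1 / 2 : ℂ) • (Cᵀ * J)) = 1 := mul_eq_one_comm.1 hC
  rw [mem_SO_iff]
  constructor
  · calc (((1 / 2 : ℂ) • (Cᵀ * J)) * K * C)ᵀ * (((1 / 2 : ℂ) • (Cᵀ * J)) * K * C)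
        = (1 / 2 : ℂ) • (Cᵀ * (Kᵀ * (Jᵀ * (C * ((1 / 2 : ℂ) • (Cᵀ * J))) * (K * C)))) := by
          simp only [Matrix.transpose_mul, Matrix.transpose_smul, Matrix.transpose_transpose,
            mul_assoc, smul_mul_assoc, mul_smul_comm]
      _ = ((1 / 2 : ℂ) • (Cᵀ * (Kᵀ * J * K))) * C := by
          rw [hC', mul_one, hJ]
          simp only [mul_assoc, smul_mul_assoc]
      _ = 1 := by rw [hK, hC]
  · rw [Matrix.det_mul, Matrix.det_mul, hd, mul_one, ← Matrix.det_mul, hC, Matrix.det_one]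

/-- The matrix of `A ⊗ B` in the basis `e₁ ⊗ e₁, e₁ ⊗ e₂, e₂ ⊗ e₁, e₂ ⊗ e₂` of `ℂ² ⊗ ℂ²`. -/
def tensorMatrix (A B : Matrix (Fin 2) (Fin 2) ℂ) : Matrix (Fin 4) (Fin 4) ℂ :=
  Matrix.reindex (m := Fin 2 × Fin 2) (n := Fin 2 × Fin 2) finProdFinEquiv finProdFinEquiv
    (Matrix.kroneckerMap (· * ·) A B)

/-- The Gram matrix of the symmetric form on `ℂ² ⊗ ℂ²` that is the product of the two area forms. -/
def tensorGram : Matrix (Fin 4) (Fin 4) ℂ :=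
  !![0, 0, 0, 1; 0, 0, -1, 0; 0, -1, 0, 0; 1, 0, 0, 0]

/-- The columns are an orthogonal basis of `ℂ² ⊗ ℂ²`. -/
def tensorBasis : Matrix (Fin 4) (Fin 4) ℂ :=
  !![1, Complex.I, 0, 0; 0, 0, 1, Complex.I; 0, 0, -1, Complex.I; 1, -Complex.I, 0, 0]

theorem tensorBasis_spec :
    ((1 / 2 : ℂ) • (tensorBasisᵀ * tensorGram)) * tensorBasis = 1 := by
  ext i j
  fin_cases i <;> fin_cases j <;>
    simp [tensorBasis, tensorGram, Matrix.mul_apply, Fin.sum_univ_four] <;> ring_nf <;> simp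

theorem tensorGram_transpose : tensorGramᵀ = tensorGram := by
  ext i j
  fin_cases i <;> fin_cases j <;> rfl

theorem tensorMatrix_mul (A B A' B' : Matrix (Fin 2) (Fin 2) ℂ) :
    tensorMatrix (A * A') (B * B') = tensorMatrix A B * tensorMatrix A' B' := by
  rw [tensorMatrix, Matrix.mul_kronecker_mul]
  exact (Matrix.submatrix_mul_equiv (Matrix.kroneckerMap (· * ·) A B)
    (Matrix.kroneckerMap (· * ·) A' B') (finProdFinEquiv (m := 2) (n := 2)).symm
    (finProdFinEquiv (m := 2) (n := 2)).symm (finProdFinEquiv (m := 2) (n := 2)).symm).symm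

theorem tensorMatrix_one : tensorMatrix 1 1 = 1 := by
  rw [tensorMatrix, Matrix.one_kronecker_one]
  exact Matrix.submatrix_one_equiv _

theorem det_tensorMatrix (A B : SLGroup 2) : (tensorMatrix A.1 B.1).det = 1 := by
  have h := Matrix.det_reindex_self (m := Fin 2 × Fin 2) (n := Fin 4) finProdFinEquiv
    (Matrix.kroneckerMap (· * ·) A.1 B.1)
  rw [Matrix.det_kronecker, A.2, B.2] at h
  exact h.trans (by simp)

theorem tensorMatrix_gram (A B : SLGroup 2) :
    (tensorMatrix A.1 B.1)ᵀ * tensorGram * tensorMatrix A.1 B.1 = tensorGram := by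
  have hA := A.2
  have hB := B.2
  rw [Matrix.det_fin_two] at hA hB
  have e : (A.1 0 0 * A.1 1 1 - A.1 0 1 * A.1 1 0) * (B.1 0 0 * B.1 1 1 - B.1 0 1 * B.1 1 0) = 1 := by
    rw [hA, hB, one_mul]
  ext i j
  fin_cases i <;> fin_cases j <;>
    simp [tensorMatrix, tensorGram, Matrix.mul_apply, Fin.sum_univ_four, finProdFinEquiv,
      Fin.divNat, Fin.modNat] <;> first | ring1 | linear_combination e | linear_combination -e

/-- The isogeny `SL(2, ℂ) × SL(2, ℂ) → SO(4, ℂ)`: the action on `ℂ² ⊗ ℂ²` with the symmetric form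
that is the product of the two area forms, written in an orthonormal basis. -/
def isogeny₂ : HolHom (SLGroup 2 × SLGroup 2) (SOGroup 4) where
  hom :=
    { toFun := fun A => ⟨((1 / 2 : ℂ) • (tensorBasisᵀ * tensorGram)) * tensorMatrix A.1.1 A.2.1 *
        tensorBasis, conj_mem_SO tensorBasis_spec tensorGram_transpose
          (tensorMatrix_gram A.1 A.2) (det_tensorMatrix A.1 A.2)⟩
      map_one' := by
        apply Subtype.ext
        change ((1 / 2 : ℂ) • (tensorBasisᵀ * tensorGram)) * tensorMatrix 1 1 * tensorBasis = 1
        rw [tensorMatrix_one, mul_one, tensorBasis_spec]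
      map_mul' := fun A B => by
        apply Subtype.ext
        have h : tensorBasis * ((1 / 2 : ℂ) • (tensorBasisᵀ * tensorGram)) = 1 :=
          mul_eq_one_comm.1 tensorBasis_spec
        change ((1 / 2 : ℂ) • (tensorBasisᵀ * tensorGram)) *
          tensorMatrix (A.1.1 * B.1.1) (A.2.1 * B.2.1) * tensorBasis =
          (((1 / 2 : ℂ) • (tensorBasisᵀ * tensorGram)) * tensorMatrix A.1.1 A.2.1 * tensorBasis) *
          (((1 / 2 : ℂ) • (tensorBasisᵀ * tensorGram)) * tensorMatrix B.1.1 B.2.1 * tensorBasis)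
        rw [tensorMatrix_mul]
        generalize ((1 / 2 : ℂ) • (tensorBasisᵀ * tensorGram)) = D at h ⊢
        simp only [mul_assoc]
        rw [← mul_assoc tensorBasis D, h, one_mul] }
  hol g := by
    refine ⟨Set.univ, fun M => ((1 / 2 : ℂ) • (tensorBasisᵀ * tensorGram)) *
      tensorMatrix (Matrix.toBlocks₁₁ M) (Matrix.toBlocks₂₂ M) * tensorBasis, isOpen_univ,
      Set.mem_univ _, ?_, fun h _ => rfl⟩
    refine Differentiable.differentiableOn ?_
    refine differentiable_pi.2 fun i => differentiable_pi.2 fun j => ?_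
    simp only [Matrix.mul_apply, tensorMatrix, Matrix.reindex_apply, Matrix.submatrix_apply,
      Matrix.kroneckerMap_apply, Matrix.toBlocks₁₁, Matrix.toBlocks₂₂, Matrix.of_apply]
    fun_prop

/-- The projection of `SL(2, ℂ) × SL(2, ℂ)` to the first factor. -/
def proj₁ : HolHom (SLGroup 2 × SLGroup 2) (SLGroup 2) where
  hom := MonoidHom.fst _ _
  hol g := by
    refine ⟨Set.univ, fun M => Matrix.toBlocks₁₁ M, isOpen_univ, Set.mem_univ _, ?_, fun h _ => rfl⟩
    refine Differentiable.differentiableOn ?_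
    refine differentiable_pi.2 fun i => differentiable_pi.2 fun j => ?_
    simp only [Matrix.toBlocks₁₁, Matrix.of_apply]
    fun_prop

/-- The projection of `SL(2, ℂ) × SL(2, ℂ)` to the second factor. -/
def proj₂ : HolHom (SLGroup 2 × SLGroup 2) (SLGroup 2) where
  hom := MonoidHom.snd _ _
  hol g := by
    refine ⟨Set.univ, fun M => Matrix.toBlocks₂₂ M, isOpen_univ, Set.mem_univ _, ?_, fun h _ => rfl⟩
    refine Differentiable.differentiableOn ?_
    refine differentiable_pi.2 fun i => differentiable_pi.2 fun j => ?_
    simp only [Matrix.toBlocks₂₂, Matrix.of_apply]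
    fun_prop

/-- The pairs of indices that label the basis `e_i ∧ e_j` of `Λ²ℂ⁴`. -/
def wedgeIndex : Fin 6 → Fin 4 × Fin 4 := ![(0, 1), (0, 2), (0, 3), (1, 2), (1, 3), (2, 3)]

/-- The matrix of `Λ²A` in the basis `e_i ∧ e_j`, `i < j`, of `Λ²ℂ⁴`: its entries are the two by two
minors of `A`. -/
def wedgeMatrix (A : Matrix (Fin 4) (Fin 4) ℂ) : Matrix (Fin 6) (Fin 6) ℂ :=
  Matrix.of fun a b =>
    A (wedgeIndex a).1 (wedgeIndex b).1 * A (wedgeIndex a).2 (wedgeIndex b).2 -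
      A (wedgeIndex a).1 (wedgeIndex b).2 * A (wedgeIndex a).2 (wedgeIndex b).1

/-- The Gram matrix of the symmetric form on `Λ²ℂ⁴` given by the wedge product. -/
def wedgeGram : Matrix (Fin 6) (Fin 6) ℂ :=
  !![0, 0, 0, 0, 0, 1; 0, 0, 0, 0, -1, 0; 0, 0, 0, 1, 0, 0;
    0, 0, 1, 0, 0, 0; 0, -1, 0, 0, 0, 0; 1, 0, 0, 0, 0, 0]

/-- The columns are an orthogonal basis of `Λ²ℂ⁴`. -/
def wedgeBasis : Matrix (Fin 6) (Fin 6) ℂ :=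
  !![1, Complex.I, 0, 0, 0, 0; 0, 0, 1, Complex.I, 0, 0; 0, 0, 0, 0, 1, Complex.I;
    0, 0, 0, 0, 1, -Complex.I; 0, 0, -1, Complex.I, 0, 0; 1, -Complex.I, 0, 0, 0, 0]

theorem wedgeBasis_spec :
    ((1 / 2 : ℂ) • (wedgeBasisᵀ * wedgeGram)) * wedgeBasis = 1 := by
  ext i j
  fin_cases i <;> fin_cases j <;>
    simp [wedgeBasis, wedgeGram, Matrix.mul_apply, Fin.sum_univ_six] <;> ring_nf <;> simp

theorem wedgeGram_transpose : wedgeGramᵀ = wedgeGram := by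
  ext i j
  fin_cases i <;> fin_cases j <;> rfl

theorem wedgeMatrix_mul (A B : Matrix (Fin 4) (Fin 4) ℂ) :
    wedgeMatrix (A * B) = wedgeMatrix A * wedgeMatrix B := by
  ext a b
  generalize hp : wedgeIndex a = p
  generalize hq : wedgeIndex b = q
  simp only [wedgeMatrix, Matrix.mul_apply, Matrix.of_apply, hp, hq]
  simp only [Fin.sum_univ_succ, wedgeIndex, Fin.sum_univ_zero]
  simp
  ring

theorem wedgeMatrix_one : wedgeMatrix 1 = 1 := by
  ext a b
  fin_cases a <;> fin_cases b <;> simp [wedgeMatrix, wedgeIndex, Matrix.one_apply]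

set_option maxHeartbeats 2000000 in
theorem wedgeMatrix_gram (A : Matrix (Fin 4) (Fin 4) ℂ) :
    (wedgeMatrix A)ᵀ * wedgeGram * wedgeMatrix A = A.det • wedgeGram := by
  rw [Matrix.det_succ_row_zero]
  simp only [Fin.sum_univ_four, Matrix.det_fin_three, Matrix.submatrix_apply]
  ext i j
  fin_cases i <;> fin_cases j <;>
    simp [wedgeMatrix, wedgeGram, wedgeIndex, Matrix.mul_apply, Fin.sum_univ_six,
      Fin.succAbove] <;> ring

theorem det_wedgeMatrix (A : SLGroup 4) : (wedgeMatrix A.1).det = 1 := by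
  suffices h : ∀ M : Matrix (Fin 4) (Fin 4) ℂ, (wedgeMatrix M).det = M.det ^ 3 by
    rw [h, A.2, one_pow]
  intro M
  induction M using Matrix.diagonal_transvection_induction with
  | hdiag D _ =>
    have h : wedgeMatrix (Matrix.diagonal D) =
        Matrix.diagonal fun a => D (wedgeIndex a).1 * D (wedgeIndex a).2 := by
      ext a b
      fin_cases a <;> fin_cases b <;> simp [wedgeMatrix, wedgeIndex]
    rw [h, Matrix.det_diagonal, Matrix.det_diagonal]
    simp [Fin.prod_univ_succ, wedgeIndex]
    ring
  | htransvec t =>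
    have h := congrArg Matrix.det (wedgeMatrix_gram (Matrix.transvection t.i t.j (t.c / 2)))
    have hJ : wedgeGram.det ≠ 0 := by
      intro e
      have := congrArg Matrix.det wedgeBasis_spec
      rw [Matrix.det_mul, Matrix.det_smul, Matrix.det_mul, e] at this
      simp at this
    rw [Matrix.det_transvection_of_ne _ _ t.hij, one_smul, Matrix.det_mul, Matrix.det_mul,
      Matrix.det_transpose] at h
    have e : t.toMatrix = Matrix.transvection t.i t.j (t.c / 2) *
        Matrix.transvection t.i t.j (t.c / 2) := by
      rw [Matrix.transvection_mul_transvection_same _ _ t.hij, add_halves]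
      rfl
    rw [Matrix.TransvectionStruct.det, one_pow, e, wedgeMatrix_mul, Matrix.det_mul]
    exact mul_right_cancel₀ hJ (by rw [one_mul]; linear_combination h)
  | hmul A B hA hB => rw [wedgeMatrix_mul, Matrix.det_mul, hA, hB, Matrix.det_mul, mul_pow]

/-- The isogeny `SL(4, ℂ) → SO(6, ℂ)`: the action on `Λ²ℂ⁴` with the symmetric form given by the
wedge product, written in an orthonormal basis. -/
def isogeny₃ : HolHom (SLGroup 4) (SOGroup 6) where
  hom :=
    { toFun := fun A => ⟨((1 / 2 : ℂ) • (wedgeBasisᵀ * wedgeGram)) * wedgeMatrix A.1 * wedgeBasis,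
        conj_mem_SO wedgeBasis_spec wedgeGram_transpose
          (by rw [wedgeMatrix_gram, A.2, one_smul]) (det_wedgeMatrix A)⟩
      map_one' := by
        apply Subtype.ext
        change ((1 / 2 : ℂ) • (wedgeBasisᵀ * wedgeGram)) * wedgeMatrix 1 * wedgeBasis = 1
        rw [wedgeMatrix_one, mul_one, wedgeBasis_spec]
      map_mul' := fun A B => by
        apply Subtype.ext
        have h : wedgeBasis * ((1 / 2 : ℂ) • (wedgeBasisᵀ * wedgeGram)) = 1 :=
          mul_eq_one_comm.1 wedgeBasis_spec
        change ((1 / 2 : ℂ) • (wedgeBasisᵀ * wedgeGram)) * wedgeMatrix (A.1 * B.1) * wedgeBasis =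
          (((1 / 2 : ℂ) • (wedgeBasisᵀ * wedgeGram)) * wedgeMatrix A.1 * wedgeBasis) *
          (((1 / 2 : ℂ) • (wedgeBasisᵀ * wedgeGram)) * wedgeMatrix B.1 * wedgeBasis)
        rw [wedgeMatrix_mul]
        generalize ((1 / 2 : ℂ) • (wedgeBasisᵀ * wedgeGram)) = D at h ⊢
        simp only [mul_assoc]
        rw [← mul_assoc wedgeBasis D, h, one_mul] }
  hol g := by
    refine ⟨Set.univ, fun M => ((1 / 2 : ℂ) • (wedgeBasisᵀ * wedgeGram)) * wedgeMatrix M *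
      wedgeBasis, isOpen_univ, Set.mem_univ _, ?_, fun h _ => rfl⟩
    refine Differentiable.differentiableOn ?_
    refine differentiable_pi.2 fun i => differentiable_pi.2 fun j => ?_
    simp only [Matrix.mul_apply, wedgeMatrix, Matrix.of_apply]
    fun_prop

end Isogenies

/-! ### Stability of principal Higgs bundles and moduli -/

section Stability

open MatrixGroup (mat)

variable {n : Type} [Fintype n] [DecidableEq n]

section Parabolic

variable (G : Type) [Group G] [MatrixGroup G n]

/-- The element `s` of the Lie algebra `𝔤` of `G` is semisimple with real eigenvalues: `𝔤` is spanned
by eigenvectors of `ad s` with real eigenvalues. -/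
def IsRealSemisimple (s : Matrix n n ℂ) : Prop :=
  s ∈ lieAlg G ∧ lieAlg G ⊆
    Submodule.span ℂ {Y | Y ∈ lieAlg G ∧ ∃ r : ℝ, s * Y - Y * s = (r : ℂ) • Y}

/-- The parabolic subalgebra `𝔭_s`: the sum of the eigenspaces of `ad s` with eigenvalue at least
zero. -/
def parabolicAlg (s : Matrix n n ℂ) : Submodule ℂ (Matrix n n ℂ) :=
  Submodule.span ℂ {Y | Y ∈ lieAlg G ∧ ∃ r : ℝ, 0 ≤ r ∧ s * Y - Y * s = (r : ℂ) • Y}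

/-- The parabolic subgroup `P_s`: the normalizer of `𝔭_s`. -/
def parabolicGroup (s : Matrix n n ℂ) : Subgroup G where
  carrier := {g | ∀ Y, Y ∈ parabolicAlg G s ↔ mat g * Y * mat g⁻¹ ∈ parabolicAlg G s}
  one_mem' Y := by simp
  mul_mem' {g h} hg hh Y := by
    rw [hh Y, hg, mul_inv_rev, map_mul, map_mul]
    simp only [mul_assoc]
  inv_mem' {g} hg Y := by
    rw [hg (mat g⁻¹ * Y * mat g⁻¹⁻¹), inv_inv]
    have h : mat g * (mat g⁻¹ * Y * mat g) * mat g⁻¹ = Y := by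
      rw [← mul_assoc, ← mul_assoc, mat_mul_mat_inv, one_mul, mul_assoc, mat_mul_mat_inv, mul_one]
    rw [h]

/-- The Levi subgroup `L_s` of `P_s`: the centralizer of `s`. -/
def leviGroup (s : Matrix n n ℂ) : Subgroup G where
  carrier := {g | mat g * s = s * mat g}
  one_mem' := by simp
  mul_mem' {g h} hg hh := by
    change mat (g * h) * s = s * mat (g * h)
    rw [map_mul, mul_assoc, show mat h * s = s * mat h from hh, ← mul_assoc,
      show mat g * s = s * mat g from hg, mul_assoc]
  inv_mem' {g} hg := by
    change mat g⁻¹ * s = s * mat g⁻¹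
    have h : mat g⁻¹ * (mat g * s) * mat g⁻¹ = mat g⁻¹ * (s * mat g) * mat g⁻¹ := by
      rw [show mat g * s = s * mat g from hg]
    rw [← mul_assoc, mat_inv_mul_mat, one_mul, ← mul_assoc, mul_assoc (mat g⁻¹ * s),
      mat_mul_mat_inv, mul_one] at h
    exact h.symm

variable {G}

/-- `χ` is the character of `P_s` whose differential is `Y ↦ tr (s Y)`. -/
def IsDualCharacter (s : Matrix n n ℂ) (χ : parabolicGroup G s →* ℂˣ) : Prop :=
  ∀ (g : parabolicGroup G s), ∀ Y ∈ parabolicAlg G s, mat (g : G) = NormedSpace.exp Y →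
    (χ g : ℂ) = Complex.exp (s * Y).trace

end Parabolic

variable {G : Type} [Group G] [MatrixGroup G n]
variable {X : Type u} [TopologicalSpace X] [ChartedSpace ℂ X]

/-- A holomorphic reduction of the structure group of `P` to the subgroup `H` of `G`: locally, the
set of the points `σ h`, `h` in `H`, for a holomorphic section `σ` of `P`. -/
structure Reduction (P : PrincipalBundle.{u, v} G X) (H : Subgroup G) where
  carrier : ∀ x, Set (P.fiber x)
  exists_section : ∀ x, ∃ (U : Set X) (σ : ∀ y, P.fiber y), IsOpen U ∧ x ∈ U ∧
    P.IsHolSection σ U ∧ ∀ y ∈ U, ∀ a, a ∈ carrier y ↔ P.diff (σ y) a ∈ H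

namespace Reduction

variable {P : PrincipalBundle.{u, v} G X} {H : Subgroup G} (R : Reduction P H)

/-- `σ` is a holomorphic section of the reduction `R` over the open set `U`. -/
def IsSection (σ : ∀ x, P.fiber x) (U : Set X) : Prop :=
  IsOpen U ∧ P.IsHolSection σ U ∧ ∀ x ∈ U, σ x ∈ R.carrier x

/-- A smooth Hermitian metric on the line bundle `R ×_χ ℂ`. Here `h a` is the square of the length
of `[a, 1]`, for `a` in `R`. -/
structure Metric (χ : H →* ℂˣ) where
  h : ∀ {x}, P.fiber x → ℝ
  h_pos : ∀ {x}, ∀ a ∈ R.carrier x, 0 < h a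
  h_act : ∀ {x}, ∀ a ∈ R.carrier x, ∀ g : H, h (P.act a g) = ‖(χ g : ℂ)‖ ^ 2 * h a
  smooth : ∀ σ U, R.IsSection σ U → ∀ p, ContDiffOn ℝ ∞
    (fun z => h (σ ((chartAt ℂ p).symm z)))
    ((chartAt ℂ p).target ∩ (chartAt ℂ p).symm ⁻¹' U)

/-- The line bundle `R ×_χ ℂ` has degree `d`: it has a Hermitian metric `h` such that the integral
over `X` of the first Chern form `(i / 2π) ∂̄∂ log h` is `d`. In the chart at `p`, this form is
`κ p dx dy` with `κ p = -(1 / 4π) Δ log h (σ)` for each holomorphic section `σ` of `R`, and the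
integral is computed by means of a partition of unity `ρ`. -/
def HasDegree (χ : H →* ℂˣ) (d : ℝ) : Prop :=
  ∃ (μ : R.Metric χ) (κ : X → ℂ → ℝ) (A : Finset X) (ρ : X → X → ℝ),
    (∀ p σ U, R.IsSection σ U → ∀ z ∈ (chartAt ℂ p).target ∩ (chartAt ℂ p).symm ⁻¹' U,
      κ p z = -(1 / (4 * Real.pi)) *
        Laplacian.laplacian (fun w => Real.log (μ.h (σ ((chartAt ℂ p).symm w)))) z) ∧
    (∀ p ∈ A, Continuous (ρ p) ∧ tsupport (ρ p) ⊆ (chartAt ℂ p).source) ∧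
    (∀ x, ∑ p ∈ A, ρ p x = 1) ∧
    ∑ p ∈ A, ∫ z in (chartAt ℂ p).target, ρ p ((chartAt ℂ p).symm z) * κ p z = d

end Reduction

variable [IsManifold 𝓘(ℂ) ω X]

namespace PrincipalHiggs

/-- `R` is a reduction of the `G`-Higgs bundle `P` to `P_s`: the Higgs field takes values in `𝔭_s`
on `R`. -/
def IsHiggsReduction (P : PrincipalHiggs.{u, v} G X) {s : Matrix n n ℂ}
    (R : Reduction P.toPrincipalBundle (parabolicGroup G s)) : Prop :=
  ∀ x, ∀ a ∈ R.carrier x, ∀ t, P.higgs a t ∈ parabolicAlg G s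

/-- Semistability of a `G`-Higgs bundle, for a connected semisimple group `G`: for each reduction `R`
to a parabolic subgroup `P_s` that is compatible with the Higgs field, the degree of the line bundle
associated to `R` and to the dominant character of `P_s` dual to `s` is at most zero. -/
def Semistable (P : PrincipalHiggs.{u, v} G X) : Prop :=
  ∀ (s : Matrix n n ℂ) (χ : parabolicGroup G s →* ℂˣ)
    (R : Reduction P.toPrincipalBundle (parabolicGroup G s)) (d : ℝ),
    IsRealSemisimple G s → IsDualCharacter s χ → P.IsHiggsReduction R → R.HasDegree χ d → d ≤ 0

/-- Polystability of a `G`-Higgs bundle, for a connected semisimple group `G`: it is semistable, and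
whenever the degree in the definition of semistability is zero, `R` contains a reduction `R'` to the
Levi subgroup `L_s` such that the Higgs field takes values in the Lie algebra of `L_s` on `R'`. -/
def Polystable (P : PrincipalHiggs.{u, v} G X) : Prop :=
  P.Semistable ∧ ∀ (s : Matrix n n ℂ) (χ : parabolicGroup G s →* ℂˣ)
    (R : Reduction P.toPrincipalBundle (parabolicGroup G s)),
    IsRealSemisimple G s → IsDualCharacter s χ → P.IsHiggsReduction R → R.HasDegree χ 0 →
    ∃ R' : Reduction P.toPrincipalBundle (leviGroup G s),
      (∀ x, R'.carrier x ⊆ R.carrier x) ∧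
        ∀ x, ∀ a ∈ R'.carrier x, ∀ t, P.higgs a t * s = s * P.higgs a t

end PrincipalHiggs

variable (G X) in
/-- The set of points of the moduli space `M_G`: isomorphism classes of polystable `G`-Higgs
bundles. -/
def Moduli : Type (max u (v + 1)) :=
  Quot fun P P' : {P : PrincipalHiggs.{u, v} G X // P.Polystable} => Nonempty (P.1.Iso P'.1)

/-- The point of the moduli space given by a polystable `G`-Higgs bundle. -/
def Moduli.mk (P : PrincipalHiggs.{u, v} G X) (h : P.Polystable) : Moduli.{u, v} G X :=
  Quot.mk _ ⟨P, h⟩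

end Stability

end

end HiggsBundles

open HiggsBundles

namespace HiggsBundles
noncomputable section

/-! ### Holomorphic functions of matrix entries on a Riemann surface. -/

section Holomorphy

variable {X : Type u} [TopologicalSpace X] [ChartedSpace ℂ X]

/-! Isogenies. Both homomorphisms have the form K ↦ D K C, where the columns of C are orthogonal of
square length two for a form with Gram matrix J, and D = ½ Cᵀ J = C⁻¹. Surjectivity therefore means
that every isometry of J of determinant one is a tensor product, respectively an exterior square.
The first and the last column of such an isometry are isotropic, hence decomposable, so some group
element has the same two columns, and one may assume that the isometry fixes two isotropic basis
vectors with product one. On ℂ² ⊗ ℂ² an element of SO(2) remains, and this torus is hit by pairs of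
diagonal matrices. On Λ²ℂ⁴ an isometry of a copy of ℂ² ⊗ ℂ² remains, and the first case applies
(`exists_tensorMatrix`, `exists_wedgeMatrix`). The kernels are read off from the matrix entries.

Associated bundles. A `Framing` lets the points of a principal bundle act as linear coordinates on
the fibres of a Higgs bundle H, compatibly with the group and the Higgs fields. It identifies H with
the bundle associated to the extension (`Framing.iso`), and every such identification comes from a
framing (`Framing.ofIso`). Unimodular coordinates form a principal bundle `SLStructure.frameBundle`,
which gives existence. Framings of the factors induce framings of E₁ ⊗ E₂ and of Λ²E in orthonormal
coordinates, and these define the orthogonal structures. All unimodular coordinates yield the same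
form and volume, so the structure fits every principal bundle with the prescribed components.

Polystability. For a local isomorphism Ψ (`HolHom.IsLocalIso`) that multiplies the trace form by c,
let E invert dΨ. The element of the source that corresponds to s is c E(s): its parabolic subgroup
is the full preimage of P_s, and tr(c E(s) Y) = tr(s dΨ(Y)), so dual characters pull back to dual
characters. Reductions of the extension pull back with the same metric and hence the same degree,
while Levi reductions are pushed forward; polystability passes to the extension
(`HolHom.IsLocalIso.polystable`). The local lifts this requires come from a holomorphic logarithm
that is skew on orthogonal matrices.

Products. Parabolic and Levi subgroups of SL(2) × SL(2) are products, and so are reductions to them.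
The main point is additivity of the degree (`Reduction.HasDegree.prod`): any metric on the line
bundle of the first component divides the given one, and the quotient is a metric for the second
component, with the difference as curvature. Existence of curvatures needs log |χ| to be harmonic
along holomorphic maps. As χ is only an abstract homomorphism, this is deduced from its values on
exponentials: |χ(g)| is a power of the absolute value of an eigenvalue of g
(`IsDualCharacter.isLogHarmonic`). Finally each SL(2) × SL(2)-bundle is the product of its two
extensions. -/

theorem IsHolOn.comp_matrix {n m : Type} [Fintype n] [Fintype m] {g : X → n → m → ℂ} {U : Set X}
    (hg : ∀ i j, IsHolOn (fun x => g x i j) U) {F : (n → m → ℂ) → ℂ}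
    (hF : ∀ x ∈ U, DifferentiableAt ℂ F (g x)) : IsHolOn (fun x => F (g x)) U := by
  intro x hx
  have hγ : MDifferentiableWithinAt 𝓘(ℂ) 𝓘(ℂ, n → m → ℂ) g U x := by
    have h := fun i j => mdifferentiableWithinAt_iff.1 (hg i j x hx)
    refine mdifferentiableWithinAt_iff.2 ⟨?_, ?_⟩
    · exact continuousWithinAt_pi.2 fun i => continuousWithinAt_pi.2 fun j => (h i j).1
    · exact differentiableWithinAt_pi.2 fun i => differentiableWithinAt_pi.2 fun j => (h i j).2
  exact (hF x hx).mdifferentiableAt.comp_mdifferentiableWithinAt x hγ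

theorem IsHolOn.inv {f : X → ℂ} {U : Set X} (hf : IsHolOn f U) (h0 : ∀ x ∈ U, f x ≠ 0) :
    IsHolOn (fun x => (f x)⁻¹) U := by
  intro x hx
  have h : DifferentiableAt ℂ (fun z : ℂ => z⁻¹) (f x) := differentiableAt_inv (h0 x hx)
  exact h.mdifferentiableAt.comp_mdifferentiableWithinAt x (hf x hx)

theorem IsHolOn.sum {J : Type*} (s : Finset J) {f : J → X → ℂ} {U : Set X}
    (h : ∀ j ∈ s, IsHolOn (f j) U) : IsHolOn (fun x => ∑ j ∈ s, f j x) U := by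
  classical
  induction s using Finset.induction_on with
  | empty => simpa using isHolOn_const 0 U
  | insert a s ha ih =>
    simp only [Finset.sum_insert ha]
    exact MDifferentiableOn.add (h a (Finset.mem_insert_self a s))
      (ih fun j hj => h j (Finset.mem_insert_of_mem hj))

/-- Holomorphy is a local property. -/
theorem isHolOn_of_locally {f : X → ℂ} {U : Set X}
    (h : ∀ x ∈ U, ∃ V : Set X, IsOpen V ∧ x ∈ V ∧ IsHolOn f (U ∩ V)) : IsHolOn f U := by
  intro x hx
  obtain ⟨V, hV, hxV, hf⟩ := h x hx
  exact (hf x ⟨hx, hxV⟩).mono_of_mem_nhdsWithin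
    (Filter.inter_mem self_mem_nhdsWithin (mem_nhdsWithin_of_mem_nhds (hV.mem_nhds hxV)))

theorem isHolOn_matrix_mul {n m l : Type} [Fintype m] {g : X → Matrix n m ℂ} {h : X → Matrix m l ℂ} {U : Set X}
    (hg : ∀ i j, IsHolOn (fun x => g x i j) U) (hh : ∀ i j, IsHolOn (fun x => h x i j) U) (i : n)
    (j : l) : IsHolOn (fun x => (g x * h x) i j) U :=
  (IsHolOn.sum Finset.univ fun k _ => (hg i k).mul (hh k j)).congr fun x _ => by
    rw [Matrix.mul_apply]

variable {n : Type} [Fintype n] [DecidableEq n]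

theorem differentiable_det : Differentiable ℂ (fun M : n → n → ℂ => Matrix.det (Matrix.of M)) := by
  have : (fun M : n → n → ℂ => Matrix.det (Matrix.of M)) =
      fun M => ∑ σ : Equiv.Perm n, ((Equiv.Perm.sign σ : ℤ) : ℂ) * ∏ i, M (σ i) i := by
    funext M
    simp [Matrix.det_apply']
  rw [this]
  fun_prop

/-- Cramer's rule: the determinant and the entries of the adjugate are polynomials in the entries of
`g x`. -/
theorem isHolOn_matrix_inv {g : X → Matrix n n ℂ} {U : Set X}
    (hg : ∀ i j, IsHolOn (fun x => g x i j) U) (h0 : ∀ x ∈ U, (g x).det ≠ 0) (i j : n) :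
    IsHolOn (fun x => (g x)⁻¹ i j) U := by
  have hd : IsHolOn (fun x => (g x).det) U :=
    IsHolOn.comp_matrix (F := fun M => Matrix.det (Matrix.of M)) hg
      fun x _ => differentiable_det _
  have ha : IsHolOn (fun x => (g x).adjugate i j) U := by
    refine IsHolOn.comp_matrix (F := fun M => (Matrix.of M).adjugate i j) hg fun x _ => ?_
    simp only [Matrix.adjugate_apply]
    let φ : (n → n → ℂ) → n → n → ℂ := fun M => (Matrix.of M).updateRow j (Pi.single i 1)
    have h2 : Differentiable ℂ φ := by
      refine differentiable_pi.2 fun a => differentiable_pi.2 fun b => ?_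
      by_cases h : a = j
      · subst h
        simp [φ]
      · simp only [φ, Matrix.updateRow_ne h, Matrix.of_apply]
        fun_prop
    exact (differentiable_det.comp h2) (g x)
  refine ((hd.inv h0).mul ha).congr fun x _ => ?_
  rw [Matrix.inv_def, Matrix.smul_apply, Ring.inverse_eq_inv', smul_eq_mul]

/-- Transports holomorphy to chart coordinates, where the Laplacians in the definition of the degree
are taken. -/
theorem IsHolOn.differentiableOn_chart [IsManifold 𝓘(ℂ) ω X] {f : X → ℂ} {U : Set X}
    (hf : IsHolOn f U) (p : X) :
    DifferentiableOn ℂ (fun z => f ((chartAt ℂ p).symm z))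
      ((chartAt ℂ p).target ∩ (chartAt ℂ p).symm ⁻¹' U) := by
  have h1 : MDifferentiableOn 𝓘(ℂ) 𝓘(ℂ) (chartAt ℂ p).symm (chartAt ℂ p).target :=
    mdifferentiableOn_atlas_symm (I := 𝓘(ℂ)) (chart_mem_atlas ℂ p)
  have h2 := MDifferentiableOn.comp (s := (chartAt ℂ p).target ∩ (chartAt ℂ p).symm ⁻¹' U) hf
    (h1.mono Set.inter_subset_left) fun z hz => hz.2
  exact mdifferentiableOn_iff_differentiableOn.1 h2

theorem isOpen_chart_preimage {U : Set X} (hU : IsOpen U) (p : X) :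
    IsOpen ((chartAt ℂ p).target ∩ (chartAt ℂ p).symm ⁻¹' U) :=
  (chartAt ℂ p).isOpen_inter_preimage_symm hU

end Holomorphy

/-! ### Holomorphic maps to matrix groups and holomorphic sections of principal bundles. -/

section GroupValued

open HiggsBundles.MatrixGroup (mat)

variable {X : Type u} [TopologicalSpace X] [ChartedSpace ℂ X]
variable {n m : Type} [Fintype n] [DecidableEq n] [Fintype m] [DecidableEq m]
variable {G : Type} [Group G] [MatrixGroup G n] {G' : Type} [Group G'] [MatrixGroup G' m]

/-- The function `g` with values in a matrix group is holomorphic on `U`. -/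
def IsHolMap (g : X → G) (U : Set X) : Prop := ∀ i j, IsHolOn (fun x => mat (g x) i j) U

theorem IsHolMap.mono {g : X → G} {U V : Set X} (h : IsHolMap g U) (e : V ⊆ U) : IsHolMap g V :=
  fun i j => (h i j).mono e

theorem IsHolMap.congr {g g' : X → G} {U : Set X} (h : IsHolMap g U) (e : ∀ x ∈ U, g' x = g x) :
    IsHolMap g' U := fun i j => (h i j).congr fun x hx => by rw [e x hx]

theorem IsHolMap.mul {g h : X → G} {U : Set X} (hg : IsHolMap g U) (hh : IsHolMap h U) :
    IsHolMap (fun x => g x * h x) U := fun i j =>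
  (isHolOn_matrix_mul hg hh i j).congr fun x _ => by rw [map_mul]

theorem isHolMap_const (g : G) (U : Set X) : IsHolMap (fun _ => g) U :=
  fun i j => isHolOn_const (mat g i j) U

theorem mat_inv (g : G) : mat g⁻¹ = (mat g)⁻¹ :=
  (Matrix.inv_eq_right_inv (mat_mul_mat_inv g)).symm

theorem det_mat_ne_zero (g : G) : (mat g).det ≠ 0 := by
  have h := congrArg Matrix.det (mat_mul_mat_inv g)
  rw [Matrix.det_mul, Matrix.det_one] at h
  exact left_ne_zero_of_mul_eq_one h

theorem IsHolMap.inv {g : X → G} {U : Set X} (hg : IsHolMap g U) :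
    IsHolMap (fun x => (g x)⁻¹) U := fun i j =>
  (isHolOn_matrix_inv hg (fun x _ => det_mat_ne_zero (g x)) i j).congr fun x _ => by rw [mat_inv]

theorem IsHolMap.map {g : X → G} {U : Set X} (hg : IsHolMap g U) (Ψ : HolHom G G') :
    IsHolMap (fun x => Ψ.hom (g x)) U := Ψ.isHolOn_comp hg

theorem isHolMap_of_locally {g : X → G} {U : Set X}
    (h : ∀ x ∈ U, ∃ V : Set X, IsOpen V ∧ x ∈ V ∧ IsHolMap g (U ∩ V)) : IsHolMap g U :=
  fun i j => isHolOn_of_locally fun x hx =>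
    let ⟨V, hV, hxV, hg⟩ := h x hx
    ⟨V, hV, hxV, hg i j⟩

namespace PrincipalBundle

variable (P : PrincipalBundle.{u, v} G X)

theorem diff_act_right {x : X} (a b : P.fiber x) (g : G) :
    P.diff a (P.act b g) = P.diff a b * g := by
  rw [← P.diff_mul_diff a b, P.diff_act]

theorem diff_inv {x : X} (a b : P.fiber x) : (P.diff a b)⁻¹ = P.diff b a := by
  rw [inv_eq_iff_mul_eq_one, P.diff_mul_diff, P.diff_self]

variable {P}

theorem IsHolSection.mono {σ : ∀ x, P.fiber x} {U V : Set X} (h : P.IsHolSection σ U)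
    (e : V ⊆ U) : P.IsHolSection σ V :=
  fun p i j => (h p i j).mono (Set.inter_subset_inter_right _ e)

theorem isHolSection_iff {σ : ∀ x, P.fiber x} {U : Set X} :
    P.IsHolSection σ U ↔ ∀ p, IsHolMap (fun x => P.diff (P.sec p x) (σ x)) (P.dom p ∩ U) := Iff.rfl

variable (P) in
theorem isHolSection_sec (p : X) : P.IsHolSection (P.sec p) (P.dom p) := fun q => P.hol_sec q p

/-- `IsHolSection` compares a section only with the given local sections. Near `x`, `P.sec x` serves
as an intermediary: the difference factors as the one from `σ` to `P.sec x` times the one from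
`P.sec x` to `τ`. -/
theorem IsHolSection.isHolMap_diff {σ τ : ∀ x, P.fiber x} {U V : Set X}
    (hσ : P.IsHolSection σ U) (hτ : P.IsHolSection τ V) :
    IsHolMap (fun x => P.diff (σ x) (τ x)) (U ∩ V) := by
  refine isHolMap_of_locally fun x hx => ⟨P.dom x, P.isOpen_dom x, P.mem_dom x, ?_⟩
  have h1 := (IsHolMap.mono (isHolSection_iff.1 hσ x) (V := U ∩ V ∩ P.dom x)
    fun y hy => ⟨hy.2, hy.1.1⟩).inv
  have h2 := IsHolMap.mono (isHolSection_iff.1 hτ x) (V := U ∩ V ∩ P.dom x)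
    fun y hy => ⟨hy.2, hy.1.2⟩
  refine (h1.mul h2).congr fun y _ => ?_
  rw [P.diff_inv, P.diff_mul_diff]

theorem IsHolSection.act {σ : ∀ x, P.fiber x} {U : Set X} (hσ : P.IsHolSection σ U) {g : X → G}
    (hg : IsHolMap g U) : P.IsHolSection (fun x => P.act (σ x) (g x)) U := by
  intro p
  refine (IsHolMap.mul (isHolSection_iff.1 hσ p) (hg.mono Set.inter_subset_right)).congr
    fun x _ => ?_
  rw [P.diff_act_right]

theorem IsHolSection.of_diff {σ τ : ∀ x, P.fiber x} {U : Set X} (hσ : P.IsHolSection σ U)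
    (h : IsHolMap (fun x => P.diff (σ x) (τ x)) U) : P.IsHolSection τ U := by
  have h2 := hσ.act h
  simpa only [P.act_diff] using h2

/-- To be a holomorphic section is a local property. -/
theorem isHolSection_of_locally {σ : ∀ x, P.fiber x} {U : Set X}
    (h : ∀ x ∈ U, ∃ V : Set X, IsOpen V ∧ x ∈ V ∧ P.IsHolSection σ (U ∩ V)) :
    P.IsHolSection σ U := by
  intro p
  refine isHolMap_of_locally fun x hx => ?_
  obtain ⟨V, hV, hxV, hσ⟩ := h x hx.2
  exact ⟨V, hV, hxV, fun i j => (hσ p i j).mono fun y hy => ⟨hy.1.1, hy.1.2, hy.2⟩⟩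

end PrincipalBundle

end GroupValued

/-! ### Lie algebras of the classical groups -/

section LieAlgebras

open HiggsBundles.MatrixGroup (mat)

variable {n m : Type} [Fintype n] [DecidableEq n] [Fintype m] [DecidableEq m]

/-- The determinant of `exp (t A)` is a differentiable one-parameter subgroup of ℂˣ, so it is the
exponential of t times its derivative at 0, which is the trace. -/
theorem det_exp_smul (A : Matrix n n ℂ) (t : ℂ) :
    (NormedSpace.exp (t • A)).det = Complex.exp (t * A.trace) := by
  let F : (n → n → ℂ) → ℂ := fun M => Matrix.det (Matrix.of M)
  have hF : Differentiable ℂ F := differentiable_det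
  let γ : ℂ → n → n → ℂ := fun t => (NormedSpace.exp (t • A) : Matrix n n ℂ)
  -- The curve `1 + t A` has the same value and velocity at 0 as `exp (t A)`, and along it the
  -- derivative of the determinant is a statement about polynomials.
  let δ : ℂ → n → n → ℂ := fun t => (1 + t • A : Matrix n n ℂ)
  have hγ : HasDerivAt γ A 0 :=
    hasDerivAt_pi.2 fun i => hasDerivAt_pi.2 fun j => hasDerivAt_exp_entry A i j
  have hδ : HasDerivAt δ A 0 := by
    refine hasDerivAt_pi.2 fun i => hasDerivAt_pi.2 fun j => ?_
    have := ((hasDerivAt_id (0 : ℂ)).mul_const (A i j)).const_add ((1 : Matrix n n ℂ) i j)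
    simpa [δ] using this
  have e : γ 0 = δ 0 := by
    simp only [γ, δ, zero_smul, NormedSpace.exp_zero, add_zero]
    rfl
  have h1 := (hF (γ 0)).hasFDerivAt.comp_hasDerivAt (0 : ℂ) hγ
  have h2 := (hF (δ 0)).hasFDerivAt.comp_hasDerivAt (0 : ℂ) hδ
  rw [← e] at h2
  have h6 : HasDerivAt (F ∘ δ) A.trace 0 := by
    have h7 := (Matrix.det (1 + (Polynomial.X : Polynomial ℂ) • A.map Polynomial.C)).hasDerivAt
      (0 : ℂ)
    rw [← Polynomial.coeff_zero_eq_eval_zero, Polynomial.coeff_zero_eq_eval_zero,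
      Matrix.derivative_det_one_add_X_smul] at h7
    refine h7.congr_of_eventuallyEq (Filter.Eventually.of_forall fun t => ?_)
    change Matrix.det (1 + t • A) = Polynomial.evalRingHom t (Matrix.det _)
    rw [RingHom.map_det]
    congr 1
    ext i j
    simp [Matrix.one_apply, apply_ite (Polynomial.eval t)]
    exact mul_comm _ _
  rw [h2.unique h6] at h1
  have h3 := exp_of_hasDerivAt_aux (γ := F ∘ γ) (by
    change Matrix.det (NormedSpace.exp ((0 : ℂ) • A)) = 1
    simp) (fun s t => by
      change Matrix.det (NormedSpace.exp ((s + t) • A)) =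
        Matrix.det (NormedSpace.exp (s • A)) * Matrix.det (NormedSpace.exp (t • A))
      rw [add_smul, Matrix.exp_add_of_commute _ _
        (((Commute.refl A).smul_left s).smul_right t), Matrix.det_mul]) h1 t
  rw [smul_eq_mul, ← Complex.exp_eq_exp_ℂ] at h3
  exact h3.symm

theorem mem_lieAlg_SL {k : ℕ} {A : Matrix (Fin k) (Fin k) ℂ} :
    A ∈ lieAlg (SLGroup k) ↔ A.trace = 0 := by
  refine ⟨trace_of_mem_lieAlg, fun h t => ⟨⟨NormedSpace.exp (t • A), ?_⟩, rfl⟩⟩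
  rw [det_exp_smul, h, mul_zero, Complex.exp_zero]

/-- The block diagonal curve is a one-parameter subgroup with the required velocity, and such a
subgroup is unique. -/
theorem exp_fromBlocks (A : Matrix n n ℂ) (B : Matrix m m ℂ) :
    NormedSpace.exp (Matrix.fromBlocks A 0 0 B) =
      Matrix.fromBlocks (NormedSpace.exp A) 0 0 (NormedSpace.exp B) := by
  have h := exp_of_hasDerivAt (B := Matrix.fromBlocks A 0 0 B) (γ := fun t =>
    Matrix.fromBlocks (NormedSpace.exp (t • A)) 0 0 (NormedSpace.exp (t • B))) (by simp)
    (fun s t => by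
      rw [Matrix.fromBlocks_multiply, add_smul, add_smul,
        Matrix.exp_add_of_commute _ _ (((Commute.refl A).smul_left s).smul_right t),
        Matrix.exp_add_of_commute _ _ (((Commute.refl B).smul_left s).smul_right t)]
      simp)
    (fun i j => by
      rcases i with i | i <;> rcases j with j | j
      · exact hasDerivAt_exp_entry A i j
      · exact hasDerivAt_const _ _
      · exact hasDerivAt_const _ _
      · exact hasDerivAt_exp_entry B i j) 1
  simpa using h

/-- The off-diagonal blocks of `exp (t A)` vanish for all t, hence so do their derivatives at 0. The
exponential of a block diagonal matrix then reduces the claim to the two factors. -/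
theorem mem_lieAlg_prod {k l : ℕ} {A : Matrix (Fin k ⊕ Fin l) (Fin k ⊕ Fin l) ℂ} :
    A ∈ lieAlg (SLGroup k × SLGroup l) ↔
      ∃ A₁ A₂, A₁.trace = 0 ∧ A₂.trace = 0 ∧ A = Matrix.fromBlocks A₁ 0 0 A₂ := by
  constructor
  · intro h
    have h12 : A.toBlocks₁₂ = 0 := by
      ext i j
      have h1 := hasDerivAt_exp_entry A (Sum.inl i) (Sum.inr j)
      refine h1.unique ((hasDerivAt_const (0 : ℂ) (0 : ℂ)).congr_of_eventuallyEq
        (Filter.Eventually.of_forall fun t => ?_))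
      obtain ⟨g, hg⟩ := h t
      exact (congrFun (congrFun hg (Sum.inl i)) (Sum.inr j)).symm
    have h21 : A.toBlocks₂₁ = 0 := by
      ext i j
      have h1 := hasDerivAt_exp_entry A (Sum.inr i) (Sum.inl j)
      refine h1.unique ((hasDerivAt_const (0 : ℂ) (0 : ℂ)).congr_of_eventuallyEq
        (Filter.Eventually.of_forall fun t => ?_))
      obtain ⟨g, hg⟩ := h t
      exact (congrFun (congrFun hg (Sum.inr i)) (Sum.inl j)).symm
    have e : A = Matrix.fromBlocks A.toBlocks₁₁ 0 0 A.toBlocks₂₂ := by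
      conv_lhs => rw [← Matrix.fromBlocks_toBlocks A, h12, h21]
    have h3 : ∀ t : ℂ, ∃ g : SLGroup k × SLGroup l, Matrix.fromBlocks g.1.1 0 0 g.2.1 =
        Matrix.fromBlocks (NormedSpace.exp (t • A.toBlocks₁₁)) 0 0
          (NormedSpace.exp (t • A.toBlocks₂₂)) := by
      intro t
      obtain ⟨g, hg⟩ := h t
      refine ⟨g, Eq.trans hg ?_⟩
      rw [← exp_fromBlocks]
      conv_lhs => rw [e, Matrix.fromBlocks_smul]
      simp
    refine ⟨_, _, trace_of_mem_lieAlg fun t => ?_, trace_of_mem_lieAlg fun t => ?_, e⟩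
    · obtain ⟨g, hg⟩ := h3 t
      exact ⟨g.1, (Matrix.fromBlocks_inj.1 hg).1⟩
    · obtain ⟨g, hg⟩ := h3 t
      exact ⟨g.2, (Matrix.fromBlocks_inj.1 hg).2.2.2⟩
  · rintro ⟨A₁, A₂, h1, h2, rfl⟩ t
    obtain ⟨g₁, hg₁⟩ := mem_lieAlg_SL.2 h1 t
    obtain ⟨g₂, hg₂⟩ := mem_lieAlg_SL.2 h2 t
    refine ⟨(g₁, g₂), ?_⟩
    rw [Matrix.fromBlocks_smul, smul_zero, smul_zero, exp_fromBlocks, ← hg₁, ← hg₂]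
    rfl

variable {G G' : Type} [Group G] [Group G'] [MatrixGroup G n] [MatrixGroup G' m]

/-- The derivative of a homomorphism that is the restriction of a differentiable map `F`. -/
theorem HolHom.d_eq_of_curve (Ψ : HolHom G G') {A : Matrix n n ℂ} (hA : A ∈ lieAlg G)
    {F : Matrix n n ℂ → Matrix m m ℂ} (hF : ∀ g, mat (Ψ.hom g) = F (mat g)) {B : Matrix m m ℂ}
    (hB : ∀ i j, HasDerivAt (fun t : ℂ => F (NormedSpace.exp (t • A)) i j) (B i j) 0) :
    Ψ.d A = B := by
  ext i j
  refine (Ψ.hasDerivAt hA i j).unique ?_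
  simpa only [hF, mat_expG hA] using hB i j

theorem proj₁_d {A : Matrix (Fin 2 ⊕ Fin 2) (Fin 2 ⊕ Fin 2) ℂ}
    (hA : A ∈ lieAlg (SLGroup 2 × SLGroup 2)) : proj₁.d A = A.toBlocks₁₁ :=
  proj₁.d_eq_of_curve hA (F := Matrix.toBlocks₁₁) (fun _ => rfl) fun _ _ =>
    hasDerivAt_exp_entry A _ _

theorem proj₂_d {A : Matrix (Fin 2 ⊕ Fin 2) (Fin 2 ⊕ Fin 2) ℂ}
    (hA : A ∈ lieAlg (SLGroup 2 × SLGroup 2)) : proj₂.d A = A.toBlocks₂₂ :=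
  proj₂.d_eq_of_curve hA (F := Matrix.toBlocks₂₂) (fun _ => rfl) fun _ _ =>
    hasDerivAt_exp_entry A _ _

variable (G) in
/-- The identity homomorphism. -/
def HolHom.refl : HolHom G G where
  hom := MonoidHom.id G
  hol _ := ⟨Set.univ, id, isOpen_univ, Set.mem_univ _, differentiableOn_id, fun _ _ => rfl⟩

theorem HolHom.refl_d {A : Matrix n n ℂ} (hA : A ∈ lieAlg G) : (HolHom.refl G).d A = A :=
  (HolHom.refl G).d_eq_of_curve hA (F := id) (fun _ => rfl) fun _ _ => hasDerivAt_exp_entry A _ _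

end LieAlgebras

/-! ### Homomorphisms of principal Higgs bundles -/

section Homs

open HiggsBundles.MatrixGroup (mat)

variable {n m : Type} [Fintype n] [DecidableEq n] [Fintype m] [DecidableEq m]
variable {G : Type} [Group G] [MatrixGroup G n] {G' : Type} [Group G'] [MatrixGroup G' m]
variable {X : Type u} [TopologicalSpace X] [ChartedSpace ℂ X] [IsManifold 𝓘(ℂ) ω X]

/-- Homomorphisms of principal Higgs bundles that cover a homomorphism of structure groups. -/
structure HiggsHom (Ψ : HolHom G G') (P : PrincipalHiggs.{u, v} G X)
    (P' : PrincipalHiggs.{u, v} G' X) where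
  map : ∀ {x}, P.fiber x → P'.fiber x
  map_act : ∀ {x} (a : P.fiber x) (g : G), map (P.act a g) = P'.act (map a) (Ψ.hom g)
  hol : ∀ p, P'.IsHolSection (fun x => map (P.sec p x)) (P.dom p)
  map_higgs : ∀ {x} (a : P.fiber x) (t : Tan x), P'.higgs (map a) t = Ψ.d (P.higgs a t)

namespace HiggsHom

variable {Ψ : HolHom G G'} {P : PrincipalHiggs.{u, v} G X} {P' : PrincipalHiggs.{u, v} G' X}

theorem diff_map (F : HiggsHom Ψ P P') {x : X} (a b : P.fiber x) :
    P'.diff (F.map a) (F.map b) = Ψ.hom (P.diff a b) := by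
  conv_lhs => rw [← P.act_diff a b, F.map_act, P'.diff_act]

/-- Holomorphy of `F` is required only on the chosen local sections. Any other section differs from
them by a holomorphic map to `G`, and `Ψ` preserves such maps. -/
theorem isHolSection (F : HiggsHom Ψ P P') {σ : ∀ x, P.fiber x} {U : Set X}
    (hσ : P.IsHolSection σ U) : P'.IsHolSection (fun x => F.map (σ x)) U := by
  refine PrincipalBundle.isHolSection_of_locally fun x hx =>
    ⟨P.dom x, P.isOpen_dom x, P.mem_dom x, ?_⟩
  refine ((F.hol x).mono Set.inter_subset_right).of_diff ?_
  refine (((P.isHolSection_sec x).isHolMap_diff hσ).map Ψ).mono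
    (V := U ∩ P.dom x) (fun y hy => ⟨hy.2, hy.1⟩) |>.congr fun y _ => ?_
  rw [F.diff_map]

variable (Ψ P) in
/-- The canonical homomorphism to the extension of the structure group. -/
def toExtend : HiggsHom Ψ P (P.extend Ψ) where
  map a := P.toExt Ψ a
  map_act {x} a g := by
    apply PrincipalBundle.ExtFiber.ext
    funext b
    change Ψ.hom (P.diff b (P.act a g)) = Ψ.hom (P.diff b a) * Ψ.hom g
    rw [P.diff_act_right, map_mul]
  hol p := (P.extend Ψ).isHolSection_sec p
  map_higgs a t := P.extHiggs_toExt Ψ a t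

end HiggsHom

namespace PrincipalHiggs.Iso

variable {P P' : PrincipalHiggs.{u, v} G X}

/-- An isomorphism as a homomorphism over the identity. -/
def toHiggsHom (φ : P.Iso P') : HiggsHom (HolHom.refl G) P P' where
  map := φ.map
  map_act := φ.map_act
  hol := φ.hol
  map_higgs a t := by rw [φ.map_higgs, HolHom.refl_d (P.higgs_mem a t)]

theorem diff_map (φ : P.Iso P') {x : X} (a b : P.fiber x) :
    P'.diff (φ.map a) (φ.map b) = P.diff a b := φ.toHiggsHom.diff_map a b

theorem map_symm_aux (φ : P.Iso P') {x : X} (b : P'.fiber x) :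
    φ.map (P.act (P.sec x x) (P'.diff (φ.map (P.sec x x)) b)) = b := by
  rw [φ.map_act, P'.act_diff]

/-- The inverse of an isomorphism. -/
def symm (φ : P.Iso P') : P'.Iso P where
  map {x} b := P.act (P.sec x x) (P'.diff (φ.map (P.sec x x)) b)
  map_act {x} b g := by rw [P'.diff_act_right, P.act_mul]
  hol p := by
    refine PrincipalBundle.isHolSection_of_locally fun x hx =>
      ⟨P.dom x, P.isOpen_dom x, P.mem_dom x, ?_⟩
    refine ((P.isHolSection_sec x).mono Set.inter_subset_right).of_diff ?_
    refine ((φ.hol x).isHolMap_diff (P'.isHolSection_sec p)).mono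
      (V := P'.dom p ∩ P.dom x) (fun y hy => ⟨hy.2, hy.1⟩) |>.congr fun y _ => ?_
    rw [← φ.diff_map, φ.map_symm_aux]
  map_higgs {x} b := by rw [← φ.map_higgs, φ.map_symm_aux]

end PrincipalHiggs.Iso

namespace HiggsHom

variable {Ψ : HolHom G G'} {P Q : PrincipalHiggs.{u, v} G X} {P' Q' : PrincipalHiggs.{u, v} G' X}

/-- The composition of an isomorphism and a homomorphism. -/
def isoComp (φ : P.Iso Q) (F : HiggsHom Ψ Q P') : HiggsHom Ψ P P' where
  map a := F.map (φ.map a)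
  map_act a g := by rw [φ.map_act, F.map_act]
  hol p := F.isHolSection (φ.hol p)
  map_higgs a t := by rw [F.map_higgs, φ.map_higgs]

/-- The composition of a homomorphism and an isomorphism. -/
def compIso (F : HiggsHom Ψ P P') (φ : P'.Iso Q') : HiggsHom Ψ P Q' where
  map a := φ.map (F.map a)
  map_act a g := by rw [F.map_act, φ.map_act]
  hol p := φ.toHiggsHom.isHolSection (F.hol p)
  map_higgs a t := by rw [φ.map_higgs, F.map_higgs]

/-- The target of a homomorphism over `Ψ` is the extension of the structure group of its source. -/
def extendIso (F : HiggsHom Ψ P P') : (P.extend Ψ).Iso P' where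
  map {x} f := P'.act (F.map (P.sec x x)) (f.val (P.sec x x))
  map_act {x} f g := P'.act_mul _ _ _
  hol p := by
    refine (F.hol p).of_diff ((isHolMap_const 1 _).congr fun x _ => ?_)
    change P'.diff _ (P'.act _ (Ψ.hom (P.diff (P.sec x x) (P.sec p x)))) = 1
    rw [← F.map_act, P.act_diff, P'.diff_self]
  map_higgs {x} f := by
    refine LinearMap.ext fun t => ?_
    rw [P'.higgs_act, F.map_higgs]
    rfl

end HiggsHom

/-- Isomorphic Higgs bundles have isomorphic extensions of the structure group. -/
def PrincipalHiggs.Iso.extend {P Q : PrincipalHiggs.{u, v} G X} (φ : P.Iso Q) (Ψ : HolHom G G') :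
    (P.extend Ψ).Iso (Q.extend Ψ) :=
  ((HiggsHom.toExtend Ψ Q).isoComp φ).extendIso

end Homs

/-! ### Products -/

section Products

open HiggsBundles.MatrixGroup (mat)

variable {X : Type u} [TopologicalSpace X] [ChartedSpace ℂ X]

theorem isHolMap_prod {g : X → SLGroup 2 × SLGroup 2} {U : Set X}
    (h1 : IsHolMap (fun x => (g x).1) U) (h2 : IsHolMap (fun x => (g x).2) U) : IsHolMap g U := by
  rintro (i | i) (j | j)
  · exact h1 i j
  · exact isHolOn_const 0 U
  · exact isHolOn_const 0 U
  · exact h2 i j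

variable [IsManifold 𝓘(ℂ) ω X]

theorem isHolFormOn_zero (U : Set X) : IsHolFormOn (X := X) (fun _ => 0) U :=
  (IsHolFormOn.sum (∅ : Finset ℕ) (α := fun _ _ => 0) (by simp)).congr fun x _ => by simp

/-- The product of two `SL(2, ℂ)`-Higgs bundles. -/
def PrincipalHiggs.prod (P₁ P₂ : PrincipalHiggs.{u, v} (SLGroup 2) X) :
    PrincipalHiggs.{u, v} (SLGroup 2 × SLGroup 2) X where
  fiber x := P₁.fiber x × P₂.fiber x
  act a g := (P₁.act a.1 g.1, P₂.act a.2 g.2)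
  act_one a := by simp [P₁.act_one, P₂.act_one]
  act_mul a g h := by simp [P₁.act_mul, P₂.act_mul]
  diff a b := (P₁.diff a.1 b.1, P₂.diff a.2 b.2)
  act_diff a b := by simp [P₁.act_diff, P₂.act_diff]
  diff_act a g := by simp [P₁.diff_act, P₂.diff_act]
  dom p := P₁.dom p ∩ P₂.dom p
  isOpen_dom p := (P₁.isOpen_dom p).inter (P₂.isOpen_dom p)
  mem_dom p := ⟨P₁.mem_dom p, P₂.mem_dom p⟩
  sec p x := (P₁.sec p x, P₂.sec p x)
  hol_sec p q := isHolMap_prod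
    (IsHolMap.mono (P₁.hol_sec p q) fun x hx => ⟨hx.1.1, hx.2.1⟩)
    (IsHolMap.mono (P₂.hol_sec p q) fun x hx => ⟨hx.1.2, hx.2.2⟩)
  higgs {x} a :=
    { toFun := fun t => Matrix.fromBlocks (P₁.higgs a.1 t) 0 0 (P₂.higgs a.2 t)
      map_add' := fun s t => by simp [Matrix.fromBlocks_add]
      map_smul' := fun c t => by simp [Matrix.fromBlocks_smul] }
  higgs_mem a t := mem_lieAlg_prod.2 ⟨_, _, trace_of_mem_lieAlg (P₁.higgs_mem a.1 t),
    trace_of_mem_lieAlg (P₂.higgs_mem a.2 t), rfl⟩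
  higgs_act a g t := by
    change Matrix.fromBlocks _ 0 0 _ = Matrix.fromBlocks (mat g.1⁻¹) 0 0 (mat g.2⁻¹) *
      Matrix.fromBlocks _ 0 0 _ * Matrix.fromBlocks (mat g.1) 0 0 (mat g.2)
    simp [Matrix.fromBlocks_multiply, P₁.higgs_act, P₂.higgs_act]
  hol_higgs p := by
    rintro (i | i) (j | j)
    · exact (P₁.hol_higgs p i j).mono Set.inter_subset_left
    · exact isHolFormOn_zero _
    · exact isHolFormOn_zero _
    · exact (P₂.hol_higgs p i j).mono Set.inter_subset_right

namespace HiggsHom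

variable (P₁ P₂ : PrincipalHiggs.{u, v} (SLGroup 2) X)

/-- The first projection of a product. -/
def fst : HiggsHom proj₁ (P₁.prod P₂) P₁ where
  map a := a.1
  map_act a g := rfl
  hol p := (P₁.isHolSection_sec p).mono Set.inter_subset_left
  map_higgs a t := by
    rw [proj₁_d ((P₁.prod P₂).higgs_mem a t)]
    rfl

/-- The second projection of a product. -/
def snd : HiggsHom proj₂ (P₁.prod P₂) P₂ where
  map a := a.2
  map_act a g := rfl
  hol p := (P₂.isHolSection_sec p).mono Set.inter_subset_right
  map_higgs a t := by
    rw [proj₂_d ((P₁.prod P₂).higgs_mem a t)]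
    rfl

variable {P₁ P₂}

/-- The product is determined by its two projections. -/
def isoProd {Q : PrincipalHiggs.{u, v} (SLGroup 2 × SLGroup 2) X} (F₁ : HiggsHom proj₁ Q P₁)
    (F₂ : HiggsHom proj₂ Q P₂) : Q.Iso (P₁.prod P₂) where
  map a := (F₁.map a, F₂.map a)
  map_act a g := Prod.ext (F₁.map_act a g) (F₂.map_act a g)
  hol p q := isHolMap_prod
    (IsHolMap.mono (F₁.hol p q) fun x hx => ⟨hx.1.1, hx.2⟩)
    (IsHolMap.mono (F₂.hol p q) fun x hx => ⟨hx.1.2, hx.2⟩)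
  map_higgs {x} a := by
    refine LinearMap.ext fun t => ?_
    change Matrix.fromBlocks (P₁.higgs (F₁.map a) t) 0 0 (P₂.higgs (F₂.map a) t) = Q.higgs a t
    rw [F₁.map_higgs, F₂.map_higgs, proj₁_d (Q.higgs_mem a t), proj₂_d (Q.higgs_mem a t)]
    -- Values of the Higgs field are block diagonal, so the two projections determine them.
    obtain ⟨A₁, A₂, -, -, h⟩ := mem_lieAlg_prod.1 (Q.higgs_mem a t)
    rw [h]
    simp

end HiggsHom

end Products

/-! ### Reductions of the structure group -/

section Reductions

open HiggsBundles.MatrixGroup (mat)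

variable {n m : Type} [Fintype n] [DecidableEq n] [Fintype m] [DecidableEq m]
variable {G : Type} [Group G] [MatrixGroup G n] {G' : Type} [Group G'] [MatrixGroup G' m]
variable {X : Type u} [TopologicalSpace X] [ChartedSpace ℂ X]

namespace Reduction

variable {P : PrincipalBundle.{u, v} G X} {H : Subgroup G} (R : Reduction P H)

/-- Each fibre of a reduction is a single `H`-orbit, so any of its points can serve as base point.
-/
theorem mem_iff_of_mem {x : X} {a : P.fiber x} (ha : a ∈ R.carrier x) (b : P.fiber x) :
    b ∈ R.carrier x ↔ P.diff a b ∈ H := by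
  obtain ⟨U, σ, -, hx, -, h⟩ := R.exists_section x
  have h1 := (h x hx a).1 ha
  rw [h x hx b, ← P.diff_mul_diff (σ x) a b]
  exact H.mul_mem_cancel_left h1

theorem exists_isSection (x : X) : ∃ (U : Set X) (σ : ∀ y, P.fiber y), x ∈ U ∧ R.IsSection σ U := by
  obtain ⟨U, σ, hU, hx, hσ, h⟩ := R.exists_section x
  refine ⟨U, σ, hx, hU, hσ, fun y hy => ?_⟩
  rw [h y hy, P.diff_self]
  exact H.one_mem

end Reduction

theorem IsHolMap.continuousOn {g : X → G} {U : Set X} (hg : IsHolMap g U) :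
    ContinuousOn (fun x => (mat (g x) : n → n → ℂ)) U :=
  continuousOn_pi.2 fun i => continuousOn_pi.2 fun j => (hg i j).continuousOn

variable [IsManifold 𝓘(ℂ) ω X]

/-- The image of a reduction of the structure group. -/
def Reduction.map {Ψ : HolHom G G'} {P : PrincipalHiggs.{u, v} G X}
    {P' : PrincipalHiggs.{u, v} G' X} (F : HiggsHom Ψ P P') {H : Subgroup G} {H' : Subgroup G'}
    (hH : ∀ g ∈ H, Ψ.hom g ∈ H') (R : Reduction P.toPrincipalBundle H) :
    Reduction P'.toPrincipalBundle H' where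
  -- The image of the reduction is stable only under `Ψ(H)`, so its saturation under `H'` is taken.
  carrier x := {b | ∃ a ∈ R.carrier x, P'.diff (F.map a) b ∈ H'}
  exists_section x := by
    obtain ⟨U, σ, hx, hU, hσ, hσR⟩ := R.exists_isSection x
    refine ⟨U, fun y => F.map (σ y), hU, hx, F.isHolSection hσ, fun y hy b => ⟨?_, fun h =>
      ⟨σ y, hσR y hy, h⟩⟩⟩
    rintro ⟨a, ha, hb⟩
    rw [← P'.diff_mul_diff _ (F.map a), F.diff_map]
    exact H'.mul_mem (hH _ ((R.mem_iff_of_mem (hσR y hy) a).1 ha)) hb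

theorem Reduction.map_mem_map {Ψ : HolHom G G'} {P : PrincipalHiggs.{u, v} G X}
    {P' : PrincipalHiggs.{u, v} G' X} (F : HiggsHom Ψ P P') {H : Subgroup G} {H' : Subgroup G'}
    (hH : ∀ g ∈ H, Ψ.hom g ∈ H') (R : Reduction P.toPrincipalBundle H) {x : X} {a : P.fiber x}
    (ha : a ∈ R.carrier x) : F.map a ∈ (R.map F hH).carrier x :=
  ⟨a, ha, by rw [P'.diff_self]; exact H'.one_mem⟩

end Reductions

/-! ### Local isomorphisms of matrix groups -/

section LocalIso

open HiggsBundles.MatrixGroup (mat)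

variable {n m : Type} [Fintype n] [DecidableEq n] [Fintype m] [DecidableEq m]
variable {G : Type} [Group G] [MatrixGroup G n] {G' : Type} [Group G'] [MatrixGroup G' m]

theorem hasDerivAt_exp_conj_aux {𝔸 : Type} [NormedRing 𝔸] [NormedAlgebra ℂ 𝔸] [CompleteSpace 𝔸]
    (A B : 𝔸) : HasDerivAt
      (fun t : ℂ => NormedSpace.exp (t • -B) * A * NormedSpace.exp (t • B)) (A * B - B * A) 0 := by
  have h := ((hasDerivAt_exp_smul_const (𝕂 := ℂ) (-B) 0).mul_const A).mul
    (hasDerivAt_exp_smul_const (𝕂 := ℂ) B 0)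
  refine h.congr_deriv ?_
  simp only [zero_smul, NormedSpace.exp_zero, one_mul, mul_one, neg_mul]
  abel

theorem hasDerivAt_exp_conj (A B : Matrix n n ℂ) (i j : n) :
    HasDerivAt (fun t : ℂ => (NormedSpace.exp (t • -B) * A * NormedSpace.exp (t • B)) i j)
      ((A * B - B * A) i j) 0 := by
  let _ := Matrix.linftyOpNormedRing (n := n) (α := ℂ)
  let _ := Matrix.linftyOpNormedAlgebra (R := ℂ) (n := n) (α := ℂ)
  let γ : ℂ → n → n → ℂ :=
    fun t => (NormedSpace.exp (t • -B) * A * NormedSpace.exp (t • B) : Matrix n n ℂ)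
  have h' : HasDerivAt γ (A * B - B * A) 0 := hasDerivAt_exp_conj_aux A B
  exact hasDerivAt_pi.1 (hasDerivAt_pi.1 h' i) j

theorem mat_expG_inv {A : Matrix n n ℂ} (hA : A ∈ lieAlg G) (t : ℂ) :
    mat (expG G A t)⁻¹ = NormedSpace.exp (t • -A) := by
  rw [mat_inv, mat_expG hA, smul_neg, Matrix.exp_neg]

/-- The derivative of a homomorphism is compatible with commutators. -/
theorem HolHom.d_lie (Ψ : HolHom G G') {A B : Matrix n n ℂ} (hA : A ∈ lieAlg G)
    (hB : B ∈ lieAlg G) (hAB : A * B - B * A ∈ lieAlg G) :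
    Ψ.d (A * B - B * A) = Ψ.d A * Ψ.d B - Ψ.d B * Ψ.d A := by
  obtain ⟨D, hD⟩ := Ψ.exists_linear_d
  ext i j
  have h1 := hasDerivAt_exp_conj (Ψ.d A) (Ψ.d B) i j
  refine HasDerivAt.unique (f := fun t : ℂ =>
    (NormedSpace.exp (t • -Ψ.d B) * Ψ.d A * NormedSpace.exp (t • Ψ.d B)) i j) ?_ h1
  -- Conjugation by `exp (t B)` is intertwined with conjugation by its image. Writing the derivative
  -- as the linear map `D` makes the right-hand side differentiable in t; comparing velocities at 0
  -- gives the commutators.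
  have e : ∀ t : ℂ, NormedSpace.exp (t • -Ψ.d B) * Ψ.d A * NormedSpace.exp (t • Ψ.d B) =
      D (NormedSpace.exp (t • -B) * A * NormedSpace.exp (t • B)) := by
    intro t
    have h2 := Ψ.d_conj (expG G B t) hA
    rw [hD _ (conj_mem_lieAlg _ hA), mat_expG_inv hB, mat_expG hB, ← Ψ.exp_d hB] at h2
    rw [h2, ← mat_expG_inv (Ψ.d_mem hB)]
    congr 4
    apply MatrixGroup.mat_injective
    rw [mat_expG (Ψ.d_mem hB), Ψ.exp_d hB]
  simp only [e]
  rw [hD _ hAB]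
  let L : (n → n → ℂ) →L[ℂ] (m → m → ℂ) := LinearMap.toContinuousLinearMap
    (E := n → n → ℂ) (F' := m → m → ℂ) D
  let γ : ℂ → n → n → ℂ :=
    fun t => (NormedSpace.exp (t • -B) * A * NormedSpace.exp (t • B) : Matrix n n ℂ)
  have hγ : HasDerivAt γ (A * B - B * A) 0 :=
    hasDerivAt_pi.2 fun a => hasDerivAt_pi.2 fun b => hasDerivAt_exp_conj A B a b
  have h3 := L.hasFDerivAt.comp_hasDerivAt (0 : ℂ) hγ
  exact hasDerivAt_pi.1 (hasDerivAt_pi.1 h3 i) j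

/-- `Ψ` is a surjective local isomorphism of matrix groups: `E` inverts its derivative, which
multiplies the trace form by the positive number `c`, and `Ψ` has a holomorphic local section. -/
structure HolHom.IsLocalIso (Ψ : HolHom G G') (c : ℝ) (E : Matrix m m ℂ →ₗ[ℂ] Matrix n n ℂ) :
    Prop where
  pos : 0 < c
  surjective : Function.Surjective Ψ.hom
  add_mem : ∀ A ∈ lieAlg G, ∀ B ∈ lieAlg G, A + B ∈ lieAlg G
  lie_mem : ∀ A ∈ lieAlg G, ∀ B ∈ lieAlg G, A * B - B * A ∈ lieAlg G
  map_mem : ∀ B ∈ lieAlg G', E B ∈ lieAlg G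
  d_map : ∀ B ∈ lieAlg G', Ψ.d (E B) = B
  map_d : ∀ A ∈ lieAlg G, E (Ψ.d A) = A
  trace_d : ∀ A ∈ lieAlg G, ∀ B ∈ lieAlg G, (Ψ.d A * Ψ.d B).trace = c * (A * B).trace
  exists_section : ∃ (V : Set (m → m → ℂ)) (F : (m → m → ℂ) → n → n → ℂ), IsOpen V ∧
    (mat (1 : G') : m → m → ℂ) ∈ V ∧ DifferentiableOn ℂ F V ∧
    ∀ h : G', (mat h : m → m → ℂ) ∈ V → ∃ g : G, Ψ.hom g = h ∧ mat g = F (mat h)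

theorem smul_mem_lieAlg {A : Matrix n n ℂ} (hA : A ∈ lieAlg G) (c : ℂ) : c • A ∈ lieAlg G :=
  fun t => by
    rw [smul_smul]
    exact hA (t * c)

theorem HolHom.d_smul (Ψ : HolHom G G') {A : Matrix n n ℂ} (hA : A ∈ lieAlg G) (c : ℂ) :
    Ψ.d (c • A) = c • Ψ.d A := by
  obtain ⟨D, hD⟩ := Ψ.exists_linear_d
  rw [hD _ (smul_mem_lieAlg hA c), hD _ hA, map_smul]

theorem conj_mem_lieAlg' (g : G) {A : Matrix n n ℂ} (hA : A ∈ lieAlg G) :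
    mat g * A * mat g⁻¹ ∈ lieAlg G := by
  have h := conj_mem_lieAlg g⁻¹ hA
  rwa [inv_inv] at h

theorem HolHom.d_conj' (Ψ : HolHom G G') (g : G) {A : Matrix n n ℂ} (hA : A ∈ lieAlg G) :
    Ψ.d (mat g * A * mat g⁻¹) = mat (Ψ.hom g) * Ψ.d A * mat (Ψ.hom g)⁻¹ := by
  have h := Ψ.d_conj g⁻¹ hA
  rwa [inv_inv, map_inv Ψ.hom, inv_inv] at h

/-- `lieAlg G` is only a set, so its stability under addition has to be supplied to pass from the
generators to their span. -/
theorem parabolicAlg_subset (hadd : ∀ A ∈ lieAlg G, ∀ B ∈ lieAlg G, A + B ∈ lieAlg G)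
    {s Y : Matrix n n ℂ} (hY : Y ∈ parabolicAlg G s) : Y ∈ lieAlg G := by
  refine Submodule.span_induction (p := fun Y _ => Y ∈ lieAlg G) (fun Y h => h.1) (fun t => ?_)
    (fun A B _ _ hA hB => hadd A hA B hB) (fun c A _ hA => smul_mem_lieAlg hA c) hY
  exact ⟨1, by simp⟩

/-- Splits the defining equivalence into stability under `g` and under its inverse, the form in
which membership is checked on generators. -/
theorem mem_parabolicGroup_iff {s : Matrix n n ℂ} {g : G} :
    g ∈ parabolicGroup G s ↔ (∀ Y ∈ parabolicAlg G s, mat g * Y * mat g⁻¹ ∈ parabolicAlg G s) ∧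
      ∀ Y ∈ parabolicAlg G s, mat g⁻¹ * Y * mat g ∈ parabolicAlg G s := by
  have e : ∀ Y, mat g * (mat g⁻¹ * Y * mat g) * mat g⁻¹ = Y := fun Y => by
    rw [← mul_assoc, ← mul_assoc, mat_mul_mat_inv, one_mul, mul_assoc, mat_mul_mat_inv, mul_one]
  have e' : ∀ Y, mat g⁻¹ * (mat g * Y * mat g⁻¹) * mat g = Y := fun Y => by
    rw [← mul_assoc, ← mul_assoc, mat_inv_mul_mat, one_mul, mul_assoc, mat_inv_mul_mat, mul_one]
  constructor
  · intro h
    refine ⟨fun Y hY => (h Y).1 hY, fun Y hY => (h _).2 ?_⟩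
    rwa [e]
  · rintro ⟨h1, h2⟩ Y
    refine ⟨h1 Y, fun h => ?_⟩
    have := h2 _ h
    rwa [e'] at this

/-- An element that commutes with s preserves each eigenspace of ad s, in particular the sum of
those with nonnegative eigenvalue. -/
theorem leviGroup_le_parabolicGroup (s : Matrix n n ℂ) : leviGroup G s ≤ parabolicGroup G s := by
  have key : ∀ g ∈ leviGroup G s, ∀ Y ∈ parabolicAlg G s,
      mat g * Y * mat g⁻¹ ∈ parabolicAlg G s := by
    intro g hg Y hY
    have hg' : mat g * s = s * mat g := hg
    have hi : mat g⁻¹ * s = s * mat g⁻¹ := (leviGroup G s).inv_mem hg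
    have h : parabolicAlg G s ≤ (parabolicAlg G s).comap
        (LinearMap.mulLeft ℂ (mat g) ∘ₗ LinearMap.mulRight ℂ (mat g⁻¹)) := by
      refine Submodule.span_le.2 ?_
      rintro Z ⟨hZ, r, hr, e⟩
      refine Submodule.subset_span ⟨?_, r, hr, ?_⟩
      · have := conj_mem_lieAlg' g hZ
        rwa [mul_assoc] at this
      · change s * (mat g * (Z * mat g⁻¹)) - mat g * (Z * mat g⁻¹) * s =
          (r : ℂ) • (mat g * (Z * mat g⁻¹))
        rw [← mul_assoc s, ← hg', mul_assoc (mat g) (Z * _) s, mul_assoc Z, hi, mul_assoc,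
          ← mul_sub, ← mul_assoc s, ← mul_assoc Z, ← sub_mul, e, smul_mul_assoc, mul_smul_comm]
    have := h hY
    change mat g * (Y * mat g⁻¹) ∈ parabolicAlg G s at this
    rwa [mul_assoc]
  intro g hg
  refine mem_parabolicGroup_iff.2 ⟨key g hg, fun Y hY => ?_⟩
  have := key g⁻¹ ((leviGroup G s).inv_mem hg) Y hY
  rwa [inv_inv] at this

namespace HolHom.IsLocalIso

variable {Ψ : HolHom G G'} {c : ℝ} {E : Matrix m m ℂ →ₗ[ℂ] Matrix n n ℂ}

theorem map_lie (h : Ψ.IsLocalIso c E) {A B : Matrix m m ℂ} (hA : A ∈ lieAlg G')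
    (hB : B ∈ lieAlg G') : E (A * B - B * A) = E A * E B - E B * E A := by
  have hA' := h.map_mem A hA
  have hB' := h.map_mem B hB
  rw [← h.map_d _ (h.lie_mem _ hA' _ hB'), Ψ.d_lie hA' hB' (h.lie_mem _ hA' _ hB'),
    h.d_map A hA, h.d_map B hB]

/-- The element `c • E s`, not `E s`, corresponds to s, because it is the one that matches the trace
forms. Eigenvalues are multiplied by c > 0, so their signs, and with them the parabolic subalgebra,
are preserved. -/
theorem eigen_map (h : Ψ.IsLocalIso c E) {s Y : Matrix m m ℂ} (hs : s ∈ lieAlg G')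
    (hY : Y ∈ lieAlg G') {r : ℝ} (e : s * Y - Y * s = (r : ℂ) • Y) :
    ((c : ℂ) • E s) * E Y - E Y * ((c : ℂ) • E s) = ((c * r : ℝ) : ℂ) • E Y := by
  have := h.map_lie hs hY
  rw [e, map_smul] at this
  rw [smul_mul_assoc, mul_smul_comm, ← smul_sub, ← this, smul_smul, Complex.ofReal_mul]

theorem eigen_d (h : Ψ.IsLocalIso c E) {s : Matrix m m ℂ} {Y : Matrix n n ℂ}
    (hs : s ∈ lieAlg G') (hY : Y ∈ lieAlg G) {r : ℝ}
    (e : ((c : ℂ) • E s) * Y - Y * ((c : ℂ) • E s) = (r : ℂ) • Y) :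
    s * Ψ.d Y - Ψ.d Y * s = ((r / c : ℝ) : ℂ) • Ψ.d Y := by
  have hc : (c : ℂ) ≠ 0 := by exact_mod_cast h.pos.ne'
  rw [smul_mul_assoc, mul_smul_comm, ← smul_sub] at e
  have h1 := congrArg Ψ.d e
  have h2 := h.lie_mem _ (h.map_mem s hs) _ hY
  rw [Ψ.d_smul h2, Ψ.d_lie (h.map_mem s hs) hY h2, h.d_map s hs, Ψ.d_smul hY] at h1
  rw [Complex.ofReal_div, div_eq_inv_mul, mul_smul, ← h1, smul_smul, inv_mul_cancel₀ hc, one_smul]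

theorem isRealSemisimple (h : Ψ.IsLocalIso c E) {s : Matrix m m ℂ} (hs : IsRealSemisimple G' s) :
    IsRealSemisimple G ((c : ℂ) • E s) := by
  refine ⟨smul_mem_lieAlg (h.map_mem s hs.1) _, fun A hA => ?_⟩
  have h1 := hs.2 (Ψ.d_mem hA)
  have h2 : E (Ψ.d A) ∈ Submodule.map E (Submodule.span ℂ {Y | Y ∈ lieAlg G' ∧
      ∃ r : ℝ, s * Y - Y * s = (r : ℂ) • Y}) := Submodule.mem_map_of_mem h1
  rw [h.map_d A hA, Submodule.map_span] at h2
  refine Submodule.span_mono ?_ h2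
  rintro _ ⟨Y, ⟨hY, r, e⟩, rfl⟩
  exact ⟨h.map_mem Y hY, _, h.eigen_map hs.1 hY e⟩

theorem map_mem_parabolicAlg (h : Ψ.IsLocalIso c E) {s Y : Matrix m m ℂ} (hs : s ∈ lieAlg G')
    (hY : Y ∈ parabolicAlg G' s) : E Y ∈ parabolicAlg G ((c : ℂ) • E s) := by
  have h2 := Submodule.mem_map_of_mem (f := E) hY
  rw [parabolicAlg, Submodule.map_span] at h2
  refine Submodule.span_mono ?_ h2
  rintro _ ⟨Y, ⟨hY, r, hr, e⟩, rfl⟩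
  exact ⟨h.map_mem Y hY, _, mul_nonneg h.pos.le hr, h.eigen_map hs hY e⟩

theorem d_mem_parabolicAlg (h : Ψ.IsLocalIso c E) {s : Matrix m m ℂ} {Y : Matrix n n ℂ}
    (hs : s ∈ lieAlg G') (hY : Y ∈ parabolicAlg G ((c : ℂ) • E s)) :
    Ψ.d Y ∈ parabolicAlg G' s := by
  obtain ⟨D, hD⟩ := Ψ.exists_linear_d
  rw [hD _ (parabolicAlg_subset h.add_mem hY)]
  have h2 := Submodule.mem_map_of_mem (f := D) hY
  rw [parabolicAlg, Submodule.map_span] at h2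
  refine Submodule.span_mono ?_ h2
  rintro _ ⟨Y, ⟨hY, r, hr, e⟩, rfl⟩
  rw [← hD Y hY]
  exact ⟨Ψ.d_mem hY, _, div_nonneg hr h.pos.le, h.eigen_d hs hY e⟩

theorem add_mem_target (h : Ψ.IsLocalIso c E) (A : Matrix m m ℂ) (hA : A ∈ lieAlg G')
    (B : Matrix m m ℂ) (hB : B ∈ lieAlg G') : A + B ∈ lieAlg G' := by
  obtain ⟨D, hD⟩ := Ψ.exists_linear_d
  have h1 := h.add_mem _ (h.map_mem A hA) _ (h.map_mem B hB)
  have h2 := Ψ.d_mem h1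
  rwa [hD _ h1, map_add, ← hD _ (h.map_mem A hA), ← hD _ (h.map_mem B hB), h.d_map A hA,
    h.d_map B hB] at h2

theorem mem_parabolicAlg_iff (h : Ψ.IsLocalIso c E) {s : Matrix m m ℂ} {Y : Matrix n n ℂ}
    (hs : s ∈ lieAlg G') (hY : Y ∈ lieAlg G) :
    Y ∈ parabolicAlg G ((c : ℂ) • E s) ↔ Ψ.d Y ∈ parabolicAlg G' s := by
  refine ⟨h.d_mem_parabolicAlg hs, fun h1 => ?_⟩
  have := h.map_mem_parabolicAlg hs h1
  rwa [h.map_d Y hY] at this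

/-- dΨ identifies the two parabolic subalgebras and intertwines the adjoint actions of `g` and `Ψ
g`, so the parabolic subgroup upstairs is the full preimage. The equivalence is what allows
reductions to be pulled back. -/
theorem mem_parabolicGroup_iff (h : Ψ.IsLocalIso c E) {s : Matrix m m ℂ} (hs : s ∈ lieAlg G')
    (g : G) : g ∈ parabolicGroup G ((c : ℂ) • E s) ↔ Ψ.hom g ∈ parabolicGroup G' s := by
  have key : ∀ g : G, (∀ Y ∈ parabolicAlg G ((c : ℂ) • E s),
      mat g * Y * mat g⁻¹ ∈ parabolicAlg G ((c : ℂ) • E s)) ↔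
      ∀ Y ∈ parabolicAlg G' s, mat (Ψ.hom g) * Y * mat (Ψ.hom g)⁻¹ ∈ parabolicAlg G' s := by
    intro g
    constructor
    · intro hg Y hY
      have hY' := parabolicAlg_subset h.add_mem_target hY
      have h1 := h.d_mem_parabolicAlg hs (hg _ (h.map_mem_parabolicAlg hs hY))
      rwa [Ψ.d_conj' g (h.map_mem Y hY'), h.d_map Y hY'] at h1
    · intro hg Y hY
      have hY' := parabolicAlg_subset h.add_mem hY
      rw [h.mem_parabolicAlg_iff hs (conj_mem_lieAlg' g hY'), Ψ.d_conj' g hY']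
      exact hg _ (h.d_mem_parabolicAlg hs hY)
  have k1 := key g
  have k2 := key g⁻¹
  rw [inv_inv, map_inv Ψ.hom, inv_inv] at k2
  rw [HiggsBundles.mem_parabolicGroup_iff, HiggsBundles.mem_parabolicGroup_iff, k1, k2]

/-- Only this inclusion is used, since Levi reductions are pushed forward and never pulled back. -/
theorem map_mem_leviGroup (h : Ψ.IsLocalIso c E) {s : Matrix m m ℂ} (hs : s ∈ lieAlg G')
    {g : G} (hg : g ∈ leviGroup G ((c : ℂ) • E s)) : Ψ.hom g ∈ leviGroup G' s := by
  have hc : (c : ℂ) ≠ 0 := by exact_mod_cast h.pos.ne'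
  have h1 : mat g * ((c : ℂ) • E s) = ((c : ℂ) • E s) * mat g := hg
  rw [smul_mul_assoc, mul_smul_comm] at h1
  have h2 : mat g * E s * mat g⁻¹ = E s := by
    rw [smul_right_injective _ hc h1, mul_assoc, mat_mul_mat_inv, mul_one]
  have h3 := Ψ.d_conj' g (h.map_mem s hs)
  rw [h2, h.d_map s hs] at h3
  change mat (Ψ.hom g) * s = s * mat (Ψ.hom g)
  conv_rhs => rw [h3]
  rw [mul_assoc, mat_inv_mul_mat, mul_one]

variable {X : Type u} [TopologicalSpace X] [ChartedSpace ℂ X]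

/-- Holomorphic functions can be lifted locally. -/
theorem exists_lift (h : Ψ.IsLocalIso c E) {g' : X → G'} {U : Set X} (hU : IsOpen U)
    (hg' : IsHolMap g' U) {x : X} (hx : x ∈ U) : ∃ (W : Set X) (g : X → G), IsOpen W ∧ x ∈ W ∧
      W ⊆ U ∧ IsHolMap g W ∧ ∀ y ∈ W, Ψ.hom (g y) = g' y := by
  classical
  obtain ⟨V, F, hV, h1, hF, hsec⟩ := h.exists_section
  -- The local section of `Ψ` exists only near 1. Therefore `g'` is translated to have the value 1
  -- at `x`, lifted there, and translated back by a preimage `k` of `g' x`.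
  obtain ⟨k, hk⟩ := h.surjective (g' x)
  have hh : IsHolMap (fun y => (g' x)⁻¹ * g' y) U := (isHolMap_const _ U).mul hg'
  let W := U ∩ (fun y => (mat ((g' x)⁻¹ * g' y) : m → m → ℂ)) ⁻¹' V
  have hW : IsOpen W := hh.continuousOn.isOpen_inter_preimage hU hV
  choose! l hl using hsec
  have hl' : IsHolMap (fun y => l ((g' x)⁻¹ * g' y)) W := by
    intro i j
    refine IsHolOn.congr (f := fun y => F (mat ((g' x)⁻¹ * g' y)) i j) ?_ fun y hy => ?_
    · refine IsHolOn.comp_matrix (F := fun M => F M i j)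
        (fun a b => (hh a b).mono Set.inter_subset_left) fun y hy => ?_
      have h3 := hF.differentiableAt (hV.mem_nhds hy.2)
      exact differentiableAt_pi.1 (differentiableAt_pi.1 h3 i) j
    · rw [(hl _ hy.2).2]
  refine ⟨W, fun y => k * l ((g' x)⁻¹ * g' y), hW, ⟨hx, ?_⟩, Set.inter_subset_left,
    (isHolMap_const k W).mul hl', fun y hy => ?_⟩
  · change (mat ((g' x)⁻¹ * g' x) : m → m → ℂ) ∈ V
    rwa [inv_mul_cancel]
  · rw [map_mul, hk, (hl _ hy.2).1, mul_inv_cancel_left]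

end HolHom.IsLocalIso

end LocalIso

/-! ### Polystability and local isomorphisms of the structure group -/

section Transfer

open HiggsBundles.MatrixGroup (mat)

variable {n m : Type} [Fintype n] [DecidableEq n] [Fintype m] [DecidableEq m]
variable {G : Type} [Group G] [MatrixGroup G n] {G' : Type} [Group G'] [MatrixGroup G' m]
variable {X : Type u} [TopologicalSpace X] [ChartedSpace ℂ X] [IsManifold 𝓘(ℂ) ω X]
variable {Ψ : HolHom G G'} {c : ℝ} {E : Matrix m m ℂ →ₗ[ℂ] Matrix n n ℂ}
variable {P : PrincipalHiggs.{u, v} G X} {P' : PrincipalHiggs.{u, v} G' X}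

/-- The inverse image of a reduction along a local isomorphism. -/
def Reduction.comap (h : Ψ.IsLocalIso c E) (F : HiggsHom Ψ P P') {H : Subgroup G}
    {H' : Subgroup G'} (hH : ∀ g, g ∈ H ↔ Ψ.hom g ∈ H')
    (R : Reduction P'.toPrincipalBundle H') : Reduction P.toPrincipalBundle H where
  carrier x := {a | F.map a ∈ R.carrier x}
  exists_section x := by
    obtain ⟨U, σ, hx, hU, hσ, hσR⟩ := R.exists_isSection x
    -- A section of `R` need not come from `P`. Its difference from the image of `P.sec x` is lifted
    -- to `G`, and moving `P.sec x` by the lift gives a preimage of `σ`.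
    obtain ⟨W, g, hW, hxW, hWU, hg, e⟩ := h.exists_lift ((P.isOpen_dom x).inter hU)
      ((F.hol x).isHolMap_diff hσ) ⟨P.mem_dom x, hx⟩
    refine ⟨W, fun y => P.act (P.sec x y) (g y), hW, hxW,
      ((P.isHolSection_sec x).mono fun y hy => (hWU hy).1).act hg, fun y hy a => ?_⟩
    change F.map a ∈ R.carrier y ↔ _
    have e1 : F.map (P.act (P.sec x y) (g y)) = σ y := by rw [F.map_act, e y hy, P'.act_diff]
    rw [R.mem_iff_of_mem (hσR y (hWU hy).2), ← e1, F.diff_map, hH]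

theorem HolHom.IsLocalIso.isSection_map (h : Ψ.IsLocalIso c E) (F : HiggsHom Ψ P P')
    {H : Subgroup G} {H' : Subgroup G'} (hH : ∀ g, g ∈ H ↔ Ψ.hom g ∈ H')
    {R : Reduction P'.toPrincipalBundle H'} {σ : ∀ x, P.fiber x} {U : Set X}
    (hσ : (R.comap h F hH).IsSection σ U) : R.IsSection (fun x => F.map (σ x)) U :=
  ⟨hσ.1, F.isHolSection hσ.2.1, hσ.2.2⟩

/-- The inverse image of a metric along a local isomorphism. -/
def Reduction.Metric.comap (h : Ψ.IsLocalIso c E) (F : HiggsHom Ψ P P')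
    {H : Subgroup G} {H' : Subgroup G'} (hH : ∀ g, g ∈ H ↔ Ψ.hom g ∈ H')
    {R : Reduction P'.toPrincipalBundle H'} {χ' : H' →* ℂˣ} {χ : H →* ℂˣ}
    (hχ : ∀ g : H, χ g = χ' ⟨Ψ.hom g, (hH g).1 g.2⟩) (μ : R.Metric χ') :
    (R.comap h F hH).Metric χ where
  h a := μ.h (F.map a)
  h_pos a ha := μ.h_pos (F.map a) ha
  h_act a ha g := by
    rw [F.map_act, hχ]
    exact μ.h_act (F.map a) ha ⟨Ψ.hom g, (hH g).1 g.2⟩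
  smooth σ U hσ := μ.smooth (fun x => F.map (σ x)) U (h.isSection_map F hH hσ)

/-- Sections of the pulled back reduction map to sections of `R`, and the pulled back metric has the
same local expressions along them. The same densities `κ` and the same partition of unity therefore
compute both degrees. -/
theorem Reduction.HasDegree.comap (h : Ψ.IsLocalIso c E) (F : HiggsHom Ψ P P')
    {H : Subgroup G} {H' : Subgroup G'} (hH : ∀ g, g ∈ H ↔ Ψ.hom g ∈ H')
    {R : Reduction P'.toPrincipalBundle H'} {χ' : H' →* ℂˣ} {χ : H →* ℂˣ}
    (hχ : ∀ g : H, χ g = χ' ⟨Ψ.hom g, (hH g).1 g.2⟩) {d : ℝ} (hd : R.HasDegree χ' d) :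
    (R.comap h F hH).HasDegree χ d := by
  obtain ⟨μ, κ, A, ρ, h1, h2⟩ := hd
  refine ⟨μ.comap h F hH hχ, κ, A, ρ, ?_, h2⟩
  intro p σ U hσ
  exact h1 p (fun x => F.map (σ x)) U (h.isSection_map F hH hσ)

/-- The composite of the character with `Ψ` is dual to `c • E s` because tr(c E(s) Y) = tr(s dΨ(Y)).
This identity dictates the factor c. -/
theorem HolHom.IsLocalIso.exists_dualCharacter (h : Ψ.IsLocalIso c E) {s : Matrix m m ℂ}
    (hs : s ∈ lieAlg G') {χ' : parabolicGroup G' s →* ℂˣ} (hχ' : IsDualCharacter s χ') :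
    ∃ χ : parabolicGroup G ((c : ℂ) • E s) →* ℂˣ, IsDualCharacter ((c : ℂ) • E s) χ ∧
      ∀ g, χ g = χ' ⟨Ψ.hom g, (h.mem_parabolicGroup_iff hs g).1 g.2⟩ := by
  refine ⟨χ'.comp ((Ψ.hom.comp (Subgroup.subtype _)).codRestrict _
    fun g => (h.mem_parabolicGroup_iff hs g).1 g.2), fun g Y hY e => ?_, fun g => rfl⟩
  have hYG := parabolicAlg_subset h.add_mem hY
  have h1 : mat (Ψ.hom g) = NormedSpace.exp (Ψ.d Y) := by
    have h2 := Ψ.exp_d hYG 1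
    rw [one_smul] at h2
    rw [h2]
    congr 2
    apply MatrixGroup.mat_injective
    rw [e, mat_expG hYG, one_smul]
  have h3 := hχ' ⟨Ψ.hom g, (h.mem_parabolicGroup_iff hs g).1 g.2⟩ _
    (h.d_mem_parabolicAlg hs hY) h1
  refine h3.trans ?_
  rw [smul_mul_assoc, Matrix.trace_smul, smul_eq_mul, ← h.trace_d _ (h.map_mem s hs) _ hYG,
    h.d_map s hs]

/-- A reduction of `P'` that tests stability pulls back to one of `P` with the same degree, which
gives the inequality. In degree zero, the Levi reduction of `P` is pushed forward to `P'`. -/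
theorem HolHom.IsLocalIso.polystable (h : Ψ.IsLocalIso c E) (F : HiggsHom Ψ P P')
    (hP : P.Polystable) : P'.Polystable := by
  have key : ∀ (s : Matrix m m ℂ) (hs : s ∈ lieAlg G')
      (R : Reduction P'.toPrincipalBundle (parabolicGroup G' s)), P'.IsHiggsReduction R →
      P.IsHiggsReduction (R.comap h F (h.mem_parabolicGroup_iff hs)) := by
    intro s hs R hR x a ha t
    rw [h.mem_parabolicAlg_iff hs (P.higgs_mem a t), ← F.map_higgs]
    exact hR x _ ha t
  constructor
  · intro s χ R d hs hχ hR hd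
    obtain ⟨χ₁, hχ₁, e⟩ := h.exists_dualCharacter hs.1 hχ
    exact hP.1 _ χ₁ _ d (h.isRealSemisimple hs) hχ₁ (key s hs.1 R hR) (hd.comap h F _ e)
  · intro s χ R hs hχ hR hd
    obtain ⟨χ₁, hχ₁, e⟩ := h.exists_dualCharacter hs.1 hχ
    obtain ⟨R₀, hR₀, hc⟩ := hP.2 _ χ₁ _ (h.isRealSemisimple hs) hχ₁ (key s hs.1 R hR)
      (hd.comap h F _ e)
    refine ⟨R₀.map F fun g hg => h.map_mem_leviGroup hs.1 hg, fun x b hb => ?_,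
      fun x b hb t => ?_⟩
    · obtain ⟨a, ha, hab⟩ := hb
      have h1 : F.map a ∈ R.carrier x := hR₀ x ha
      rw [R.mem_iff_of_mem h1]
      exact leviGroup_le_parabolicGroup s hab
    · obtain ⟨a, ha, hab⟩ := hb
      have h1 := hc x a ha t
      have hne : (c : ℂ) ≠ 0 := by exact_mod_cast h.pos.ne'
      rw [smul_mul_assoc, mul_smul_comm] at h1
      have h2 := smul_right_injective _ hne h1
      -- dΨ takes commutators to commutators, so commuting with `E s` upstairs becomes commuting
      -- with s at the point `F.map a`.
      have h3 := Ψ.d_lie (P.higgs_mem a t) (h.map_mem s hs.1)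
        (h.lie_mem _ (P.higgs_mem a t) _ (h.map_mem s hs.1))
      have h0 : Ψ.d 0 = 0 := by
        have := Ψ.d_smul (P.higgs_mem a t) 0
        rwa [zero_smul, zero_smul] at this
      rw [h2, sub_self, h0, h.d_map s hs.1, ← F.map_higgs] at h3
      have h4 : P'.higgs (F.map a) t * s = s * P'.higgs (F.map a) t := (sub_eq_zero.1 h3.symm)
      have hl : mat (P'.diff (F.map a) b) * s = s * mat (P'.diff (F.map a) b) := hab
      have hl' : mat (P'.diff (F.map a) b)⁻¹ * s = s * mat (P'.diff (F.map a) b)⁻¹ :=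
        (leviGroup G' s).inv_mem hab
      -- `b` is `F.map a` moved by an element of the Levi group. Conjugation by that element fixes
      -- s, so the commutation relation carries over to `b`.
      rw [← P'.act_diff (F.map a) b, P'.higgs_act, mul_assoc, hl, mul_assoc, ← mul_assoc _ s, h4,
        mul_assoc, ← mul_assoc _ s, hl']
      simp only [mul_assoc]

theorem lieAlg_SL_add_mem {k : ℕ} (A : Matrix (Fin k) (Fin k) ℂ) (hA : A ∈ lieAlg (SLGroup k))
    (B : Matrix (Fin k) (Fin k) ℂ) (hB : B ∈ lieAlg (SLGroup k)) : A + B ∈ lieAlg (SLGroup k) := by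
  rw [mem_lieAlg_SL] at *
  rw [Matrix.trace_add, hA, hB, add_zero]

theorem lieAlg_SL_lie_mem {k : ℕ} (A : Matrix (Fin k) (Fin k) ℂ) (_ : A ∈ lieAlg (SLGroup k))
    (B : Matrix (Fin k) (Fin k) ℂ) (_ : B ∈ lieAlg (SLGroup k)) :
    A * B - B * A ∈ lieAlg (SLGroup k) := by
  rw [mem_lieAlg_SL, Matrix.trace_sub, Matrix.trace_mul_comm, sub_self]

end Transfer

/-! ### The two homomorphisms are isogenies -/

section Isogeny

/-- If the columns of `C` are orthogonal of square length two for the form `J`, then the inverse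
conjugation by `C` takes orthogonal matrices to isometries of `J`. -/
theorem conj_isometry {k : ℕ} {C J g : Matrix (Fin k) (Fin k) ℂ}
    (hC : ((1 / 2 : ℂ) • (Cᵀ * J)) * C = 1) (hg : gᵀ * g = 1) :
    (C * g * ((1 / 2 : ℂ) • (Cᵀ * J)))ᵀ * J * (C * g * ((1 / 2 : ℂ) • (Cᵀ * J))) = J := by
  have hC' : C * ((1 / 2 : ℂ) • (Cᵀ * J)) = 1 := mul_eq_one_comm.1 hC
  set D := (1 / 2 : ℂ) • (Cᵀ * J) with hD
  have h2 : Cᵀ * J = (2 : ℂ) • D := by rw [hD, smul_smul]; norm_num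
  -- As `D` is the inverse of `C`, the relation Cᵀ J = 2 D can be solved for J; the form is twice
  -- the pullback of the dot product along `D`.
  have hJ : J = (2 : ℂ) • (Dᵀ * D) := by
    have : Dᵀ * Cᵀ = 1 := by rw [← Matrix.transpose_mul, hC', Matrix.transpose_one]
    calc J = Dᵀ * Cᵀ * J := by rw [this, one_mul]
      _ = (2 : ℂ) • (Dᵀ * D) := by rw [mul_assoc, h2, mul_smul_comm]
  calc (C * g * D)ᵀ * J * (C * g * D)
      = Dᵀ * (gᵀ * ((Cᵀ * J) * C * (g * D))) := by
        simp only [Matrix.transpose_mul, mul_assoc]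
    _ = (2 : ℂ) • (Dᵀ * (gᵀ * g * D)) := by
        rw [h2, smul_mul_assoc, hC]
        simp only [smul_mul_assoc, mul_smul_comm, one_mul, mul_assoc]
    _ = J := by rw [hg, one_mul, ← hJ]

theorem conj_conj {k : ℕ} {C D g : Matrix (Fin k) (Fin k) ℂ} (h : D * C = 1) :
    D * (C * g * D) * C = g := by
  rw [← mul_assoc, ← mul_assoc, h, one_mul, mul_assoc, h, mul_one]

theorem eq_of_conj_eq_one {k : ℕ} {C D K : Matrix (Fin k) (Fin k) ℂ} (h : D * C = 1)
    (e : D * K * C = 1) : K = 1 := by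
  have h' : C * D = 1 := mul_eq_one_comm.1 h
  calc K = C * (D * K * C) * D := (conj_conj h').symm
    _ = 1 := by rw [e, mul_one, h']

/-! ### Surjectivity and kernel of the homomorphism to SO(4, ℂ). -/

theorem tensorMatrix_apply (A B : Matrix (Fin 2) (Fin 2) ℂ) :
    tensorMatrix A B =
      !![A 0 0 * B 0 0, A 0 0 * B 0 1, A 0 1 * B 0 0, A 0 1 * B 0 1;
        A 0 0 * B 1 0, A 0 0 * B 1 1, A 0 1 * B 1 0, A 0 1 * B 1 1;
        A 1 0 * B 0 0, A 1 0 * B 0 1, A 1 1 * B 0 0, A 1 1 * B 0 1;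
        A 1 0 * B 1 0, A 1 0 * B 1 1, A 1 1 * B 1 0, A 1 1 * B 1 1] := by
  ext i j
  fin_cases i <;> fin_cases j <;> rfl

/-- Isotropic vectors of `ℂ² ⊗ ℂ²` are decomposable. -/
theorem exists_tensor_of_isotropic {w₀ w₁ w₂ w₃ : ℂ} (h : w₀ * w₃ = w₁ * w₂) :
    ∃ a₀ a₁ c₀ c₁ : ℂ, w₀ = a₀ * c₀ ∧ w₁ = a₀ * c₁ ∧ w₂ = a₁ * c₀ ∧ w₃ = a₁ * c₁ := by
  -- The hypothesis says that the matrix with rows (w₀, w₁) and (w₂, w₃) is singular. The vector c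
  -- is its first row, or the second if the first one vanishes, and a records the multiples.
  by_cases h0 : w₀ = 0
  · by_cases h1 : w₁ = 0
    · exact ⟨0, 1, w₂, w₃, by simp [h0], by simp [h1], by simp, by simp⟩
    · have h2 : w₂ = 0 := by
        rw [h0, zero_mul] at h
        exact (mul_eq_zero.1 h.symm).resolve_left h1
      exact ⟨1, w₃ / w₁, 0, w₁, by simp [h0], by simp, by simp [h2], by field_simp⟩
  · refine ⟨1, w₂ / w₀, w₀, w₁, by simp, by simp, by field_simp, ?_⟩
    field_simp
    linear_combination h

theorem gram_bilin {k : ℕ} {J K : Matrix (Fin k) (Fin k) ℂ} (h : Kᵀ * J * K = J) (a b : Fin k) :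
    ∑ j, ∑ i, K i a * J i j * K j b = J a b := by
  have := congrFun (congrFun h a) b
  simpa only [Matrix.mul_apply, Matrix.transpose_apply, Finset.sum_mul] using this

theorem tensorGram_bilin {K : Matrix (Fin 4) (Fin 4) ℂ} (h : Kᵀ * tensorGram * K = tensorGram)
    (a b : Fin 4) : K 0 a * K 3 b - K 1 a * K 2 b - K 2 a * K 1 b + K 3 a * K 0 b =
      tensorGram a b := by
  rw [← gram_bilin h a b]
  simp only [Fin.sum_univ_four]
  simp [tensorGram]
  ring

theorem isometry_inv_mul {k : ℕ} {J K L : Matrix (Fin k) (Fin k) ℂ} (hK : Kᵀ * J * K = J)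
    (hL : Lᵀ * J * L = J) : (L * K)ᵀ * J * (L * K) = J := by
  calc (L * K)ᵀ * J * (L * K) = Kᵀ * (Lᵀ * J * L) * K := by
        simp only [Matrix.transpose_mul, mul_assoc]
    _ = J := by rw [hL, hK]

theorem tensorMatrix_coe_mul (A B A' B' : SLGroup 2) :
    tensorMatrix (A * A').1 (B * B').1 = tensorMatrix A.1 B.1 * tensorMatrix A'.1 B'.1 :=
  tensorMatrix_mul A.1 B.1 A'.1 B'.1

/-- An isometry of `ℂ² ⊗ ℂ²` of determinant one that fixes `e₁ ⊗ e₁` and `e₂ ⊗ e₂`. -/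
theorem exists_tensorMatrix_of_fixed {K : Matrix (Fin 4) (Fin 4) ℂ}
    (hK : Kᵀ * tensorGram * K = tensorGram) (hd : K.det = 1) (h0 : ∀ i, K i 0 = if i = 0 then 1 else 0)
    (h3 : ∀ i, K i 3 = if i = 3 then 1 else 0) : ∃ A B : SLGroup 2, K = tensorMatrix A.1 B.1 := by
  have b := tensorGram_bilin hK
  have e01 := b 0 1
  have e02 := b 0 2
  have e31 := b 3 1
  have e32 := b 3 2
  have e11 := b 1 1
  have e22 := b 2 2
  have e12 := b 1 2
  simp [h0, h3, tensorGram] at e01 e02 e31 e32 e11 e22 e12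
  -- The two middle columns are orthogonal to the fixed isotropic vectors, so they lie in the span
  -- of e₁ ⊗ e₂ and e₂ ⊗ e₁.
  have eK : K = !![1, 0, 0, 0; 0, K 1 1, K 1 2, 0; 0, K 2 1, K 2 2, 0; 0, 0, 0, 1] := by
    ext i j
    fin_cases i <;> fin_cases j <;> simp [h0, h3, e01, e02, e31, e32]
  rw [eK] at hd
  simp [Matrix.det_succ_row_zero, Fin.sum_univ_succ, Fin.succAbove] at hd
  simp only [e31, e32, e01, e02, mul_zero, zero_sub, add_zero] at e11 e22 e12
  -- For the middle block, the determinant gives the difference and the isometry condition the sum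
  -- of K₁₁K₂₂ and K₁₂K₂₁; both are 1. This excludes the component of O(2) that swaps the two
  -- isotropic lines.
  have p : K 1 1 * K 2 2 = 1 := by linear_combination (hd - e12) / 2
  have hne := left_ne_zero_of_mul_eq_one p
  have hne' := right_ne_zero_of_mul_eq_one p
  have q1 : K 2 1 = 0 := by
    have : K 1 1 * K 2 1 = 0 := by linear_combination -e11 / 2
    exact (mul_eq_zero.1 this).resolve_left hne
  have q2 : K 1 2 = 0 := by
    have : K 1 2 * K 2 2 = 0 := by linear_combination -e22 / 2
    exact (mul_eq_zero.1 this).resolve_right hne'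
  -- With K₁₁ = t², the pair diag(t, t⁻¹), diag(t⁻¹, t) fixes e₁ ⊗ e₁ and e₂ ⊗ e₂, and scales e₁ ⊗
  -- e₂ by t² and e₂ ⊗ e₁ by t⁻².
  obtain ⟨t, ht⟩ := IsAlgClosed.exists_eq_mul_self (K 1 1)
  have ht0 : t ≠ 0 := by
    rintro rfl
    exact hne (by simpa using ht)
  refine ⟨⟨!![t, 0; 0, t⁻¹], by simp [ht0]⟩, ⟨!![t⁻¹, 0; 0, t], by simp [ht0]⟩, ?_⟩
  have e22' : K 2 2 = t⁻¹ * t⁻¹ := by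
    field_simp
    linear_combination p - K 2 2 * ht
  rw [tensorMatrix_apply, eK]
  ext i j
  fin_cases i <;> fin_cases j <;> simp [q1, q2, ht0, ht, e22']

/-- The isometries of `ℂ² ⊗ ℂ²` of determinant one are tensor products. -/
theorem exists_tensorMatrix {K : Matrix (Fin 4) (Fin 4) ℂ}
    (hK : Kᵀ * tensorGram * K = tensorGram) (hd : K.det = 1) :
    ∃ A B : SLGroup 2, K = tensorMatrix A.1 B.1 := by
  have b := tensorGram_bilin hK
  have b00 := b 0 0
  have b33 := b 3 3
  have b03 := b 0 3
  simp only [tensorGram, Matrix.of_apply, Matrix.cons_val] at b00 b33 b03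
  -- Columns 0 and 3 are the images of the isotropic vectors e₁ ⊗ e₁ and e₂ ⊗ e₂; they become a ⊗ c
  -- and p ⊗ q.
  obtain ⟨a₀, a₁, c₀, c₁, k0, k1, k2, k3⟩ := exists_tensor_of_isotropic
    (w₀ := K 0 0) (w₁ := K 1 0) (w₂ := K 2 0) (w₃ := K 3 0) (by linear_combination b00 / 2)
  obtain ⟨p₀, p₁, q₀, q₁, l0, l1, l2, l3⟩ := exists_tensor_of_isotropic
    (w₀ := K 0 3) (w₁ := K 1 3) (w₂ := K 2 3) (w₃ := K 3 3) (by linear_combination b33 / 2)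
  -- α and β are the areas of (a, p) and of (c, q), and the pairing of the two columns says αβ = 1.
  -- Replacing a by βa and c by αc leaves a ⊗ c unchanged and makes both areas equal to 1.
  set α := a₀ * p₁ - a₁ * p₀ with hα
  set β := c₀ * q₁ - c₁ * q₀ with hβ
  have hαβ : α * β = 1 := by
    rw [k0, k1, k2, k3, l0, l1, l2, l3] at b03
    rw [hα, hβ]
    linear_combination b03
  let A : SLGroup 2 := ⟨!![β * a₀, p₀; β * a₁, p₁], by
    rw [Matrix.det_fin_two_of]
    linear_combination hαβ⟩
  let B : SLGroup 2 := ⟨!![α * c₀, q₀; α * c₁, q₁], by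
    rw [Matrix.det_fin_two_of]
    linear_combination hαβ⟩
  have hc : tensorMatrix A⁻¹.1 B⁻¹.1 * tensorMatrix A.1 B.1 = 1 := by
    rw [← tensorMatrix_coe_mul, inv_mul_cancel, inv_mul_cancel]
    exact tensorMatrix_one
  have hc' : tensorMatrix A.1 B.1 * tensorMatrix A⁻¹.1 B⁻¹.1 = 1 := mul_eq_one_comm.1 hc
  have col0 : ∀ i, K i 0 = tensorMatrix A.1 B.1 i 0 := by
    intro i
    rw [tensorMatrix_apply]
    fin_cases i <;> simp [A, B, k0, k1, k2, k3]
    · linear_combination -a₀ * c₀ * hαβ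
    · linear_combination -a₀ * c₁ * hαβ
    · linear_combination -a₁ * c₀ * hαβ
    · linear_combination -a₁ * c₁ * hαβ
  have col3 : ∀ i, K i 3 = tensorMatrix A.1 B.1 i 3 := by
    intro i
    rw [tensorMatrix_apply]
    fin_cases i <;> simp [A, B, l0, l1, l2, l3]
  -- A ⊗ B agrees with K on e₁ ⊗ e₁ and e₂ ⊗ e₂, so (A ⊗ B)⁻¹ K fixes both vectors.
  obtain ⟨A', B', h'⟩ := exists_tensorMatrix_of_fixed
    (K := tensorMatrix A⁻¹.1 B⁻¹.1 * K)
    (isometry_inv_mul hK (tensorMatrix_gram A⁻¹ B⁻¹))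
    (by rw [Matrix.det_mul, det_tensorMatrix, hd, one_mul])
    (fun i => by
      rw [Matrix.mul_apply]
      simp only [col0]
      rw [← Matrix.mul_apply, hc, Matrix.one_apply])
    (fun i => by
      rw [Matrix.mul_apply]
      simp only [col3]
      rw [← Matrix.mul_apply, hc, Matrix.one_apply])
  refine ⟨A * A', B * B', ?_⟩
  rw [tensorMatrix_coe_mul, ← h', ← mul_assoc, hc', one_mul]

theorem isogeny₂_surjective : Function.Surjective isogeny₂.hom := by
  intro g
  obtain ⟨h1, h2⟩ := mem_SO_iff.1 g.2
  obtain ⟨A, B, h⟩ := exists_tensorMatrix (conj_isometry tensorBasis_spec h1) (by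
    rw [Matrix.det_mul, Matrix.det_mul, h2, mul_one, ← Matrix.det_mul,
      mul_eq_one_comm.1 tensorBasis_spec, Matrix.det_one])
  refine ⟨(A, B), Subtype.ext ?_⟩
  change ((1 / 2 : ℂ) • (tensorBasisᵀ * tensorGram)) * tensorMatrix A.1 B.1 * tensorBasis = g.1
  rw [← h, conj_conj tensorBasis_spec]

/-- A ⊗ B = 1 forces A and B to be scalar with product 1; having determinant one, they are both 1 or
both -1. -/
theorem isogeny₂_isIsogeny : isogeny₂.IsIsogeny := by
  refine ⟨isogeny₂_surjective, ?_⟩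
  refine Set.Finite.subset (s := {(1, 1), (-1, -1)}) (by simp) ?_
  rintro ⟨A, B⟩ hAB
  have h : isogeny₂.hom (A, B) = 1 := hAB
  have h1 : tensorMatrix A.1 B.1 = 1 := eq_of_conj_eq_one tensorBasis_spec (congrArg Subtype.val h)
  rw [tensorMatrix_apply] at h1
  have hA := A.2
  have hB := B.2
  rw [Matrix.det_fin_two] at hA hB
  have e := fun i j => congrFun (congrFun h1 i) j
  have e00 := e 0 0
  have e01 := e 0 1
  have e02 := e 0 2
  have e10 := e 1 0
  have e20 := e 2 0
  have e11 := e 1 1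
  have e22 := e 2 2
  simp at e00 e01 e02 e10 e20 e11 e22
  have a0 := left_ne_zero_of_mul_eq_one e00
  have b0 := right_ne_zero_of_mul_eq_one e00
  have hb01 := e01.resolve_left a0
  have ha01 := e02.resolve_right b0
  have hb10 := e10.resolve_left a0
  have ha10 := e20.resolve_right b0
  have ha11 : A.1 1 1 = A.1 0 0 := mul_right_cancel₀ b0 (e22.trans e00.symm)
  have hb11 : B.1 1 1 = B.1 0 0 := mul_left_cancel₀ a0 (e11.trans e00.symm)
  rw [ha01, ha11, zero_mul, sub_zero, mul_self_eq_one_iff] at hA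
  rcases hA with hA | hA
  · left
    rw [hA, one_mul] at e00
    refine Prod.ext (Subtype.ext ?_) (Subtype.ext ?_)
    · ext i j
      fin_cases i <;> fin_cases j <;> simp [ha01, ha10, ha11, hA]
    · ext i j
      fin_cases i <;> fin_cases j <;> simp [hb01, hb10, hb11, e00]
  · right
    have hB' : B.1 0 0 = -1 := by
      rw [hA] at e00
      linear_combination -e00
    refine Prod.ext (Subtype.ext ?_) (Subtype.ext ?_)
    · ext i j
      fin_cases i <;> fin_cases j <;> simp [ha01, ha10, ha11, hA]
    · ext i j
      fin_cases i <;> fin_cases j <;> simp [hb01, hb10, hb11, hB']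

/-! ### Surjectivity and kernel of the homomorphism to SO(6, ℂ). -/

/-- Isotropic vectors of `Λ²ℂ⁴` are decomposable. -/
theorem exists_wedge_of_isotropic {w₀ w₁ w₂ w₃ w₄ w₅ : ℂ}
    (h : w₀ * w₅ - w₁ * w₄ + w₂ * w₃ = 0) : ∃ a₀ a₁ a₂ a₃ b₀ b₁ b₂ b₃ : ℂ,
      w₀ = a₀ * b₁ - a₁ * b₀ ∧ w₁ = a₀ * b₂ - a₂ * b₀ ∧ w₂ = a₀ * b₃ - a₃ * b₀ ∧
      w₃ = a₁ * b₂ - a₂ * b₁ ∧ w₄ = a₁ * b₃ - a₃ * b₁ ∧ w₅ = a₂ * b₃ - a₃ * b₂ := by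
  -- The hypothesis is the Plücker relation. If the coordinate ω_ij is nonzero, ω is the wedge
  -- product of its contractions with the i-th and j-th coordinate forms, divided by ω_ij; the
  -- witnesses are these contractions for the first nonzero coordinate.
  by_cases h0 : w₀ = 0
  swap
  · refine ⟨0, 1, w₁ / w₀, w₂ / w₀, -w₀, 0, w₃, w₄, ?_, ?_, ?_, ?_, ?_, ?_⟩ <;> field_simp <;>
      first | ring1 | linear_combination h
  by_cases h1 : w₁ = 0
  swap
  · refine ⟨0, w₀ / w₁, 1, w₂ / w₁, -w₁, -w₃, 0, w₅, ?_, ?_, ?_, ?_, ?_, ?_⟩ <;> field_simp <;>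
      first | ring1 | linear_combination -h
  by_cases h2 : w₂ = 0
  swap
  · refine ⟨0, w₀ / w₂, w₁ / w₂, 1, -w₂, -w₄, -w₅, 0, ?_, ?_, ?_, ?_, ?_, ?_⟩ <;> field_simp <;>
      first | ring1 | linear_combination h
  subst h0 h1 h2
  by_cases h3 : w₃ = 0
  swap
  · refine ⟨0, 0, 1, w₄ / w₃, 0, -w₃, 0, w₅, ?_, ?_, ?_, ?_, ?_, ?_⟩ <;> field_simp <;> ring1
  by_cases h4 : w₄ = 0
  swap
  · subst h3
    refine ⟨0, 0, 0, 1, 0, -w₄, -w₅, 0, ?_, ?_, ?_, ?_, ?_, ?_⟩ <;> ring1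
  subst h3 h4
  refine ⟨0, 0, 1, 0, 0, 0, 0, w₅, ?_, ?_, ?_, ?_, ?_, ?_⟩ <;> ring1

theorem wedgeGram_bilin {K : Matrix (Fin 6) (Fin 6) ℂ} (h : Kᵀ * wedgeGram * K = wedgeGram)
    (a b : Fin 6) : K 0 a * K 5 b - K 1 a * K 4 b + K 2 a * K 3 b + K 3 a * K 2 b -
      K 4 a * K 1 b + K 5 a * K 0 b = wedgeGram a b := by
  rw [← gram_bilin h a b]
  simp only [Fin.sum_univ_six]
  simp [wedgeGram]
  ring

theorem wedgeMatrix_coe_mul (A B : SLGroup 4) :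
    wedgeMatrix (A * B).1 = wedgeMatrix A.1 * wedgeMatrix B.1 := wedgeMatrix_mul A.1 B.1

/-- The square matrix of size six with `M` in the middle. -/
def middleBlock (M : Matrix (Fin 4) (Fin 4) ℂ) : Matrix (Fin 6) (Fin 6) ℂ :=
  !![1, 0, 0, 0, 0, 0; 0, M 0 0, M 0 1, M 0 2, M 0 3, 0; 0, M 1 0, M 1 1, M 1 2, M 1 3, 0;
    0, M 2 0, M 2 1, M 2 2, M 2 3, 0; 0, M 3 0, M 3 1, M 3 2, M 3 3, 0; 0, 0, 0, 0, 0, 1]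

theorem det_middleBlock (M : Matrix (Fin 4) (Fin 4) ℂ) : (middleBlock M).det = M.det := by
  rw [Matrix.det_succ_column_zero, Finset.sum_eq_single 0]
  · rw [Matrix.det_succ_column _ 4, Finset.sum_eq_single 4]
    · have : ((middleBlock M).submatrix (Fin.succAbove 0) Fin.succ).submatrix
          (Fin.succAbove 4) (Fin.succAbove 4) = M := by
        ext i j
        fin_cases i <;> fin_cases j <;> rfl
      rw [this]
      simp [middleBlock]
      norm_num
    · intro i _ hi
      fin_cases i <;> simp [middleBlock] at hi ⊢
    · simp
  · intro i _ hi
    fin_cases i <;> simp [middleBlock] at hi ⊢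
  · simp

/-- Λ²(V ⊕ W) = Λ²V ⊕ (V ⊗ W) ⊕ Λ²W, which in the order of `wedgeIndex` are the first, the four
middle and the last basis vectors. On the outer summands the action is by det A = 1 and det B = 1.
-/
theorem wedgeMatrix_fromBlocks (A B : SLGroup 2) :
    wedgeMatrix !![A.1 0 0, A.1 0 1, 0, 0; A.1 1 0, A.1 1 1, 0, 0; 0, 0, B.1 0 0, B.1 0 1;
      0, 0, B.1 1 0, B.1 1 1] = middleBlock (tensorMatrix A.1 B.1) := by
  have hA := A.2
  have hB := B.2
  rw [Matrix.det_fin_two] at hA hB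
  rw [tensorMatrix_apply]
  ext i j
  fin_cases i <;> fin_cases j <;> simp [wedgeMatrix, wedgeIndex, middleBlock] <;> assumption

/-- Orthogonality to the two fixed vectors leaves a four by four block in the middle. It preserves
the form of ℂ² ⊗ ℂ² up to sign and has determinant one, so it is a tensor product, and hence comes
from a block diagonal matrix. -/
theorem exists_wedgeMatrix_of_fixed {K : Matrix (Fin 6) (Fin 6) ℂ}
    (hK : Kᵀ * wedgeGram * K = wedgeGram) (hd : K.det = 1) (h0 : ∀ i, K i 0 = if i = 0 then 1 else 0)
    (h5 : ∀ i, K i 5 = if i = 5 then 1 else 0) : ∃ A : SLGroup 4, K = wedgeMatrix A.1 := by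
  have b := wedgeGram_bilin hK
  have r5 : ∀ j : Fin 4, K 5 (j.succ.castSucc) = 0 := fun j => by
    have := b 0 (j.succ.castSucc)
    fin_cases j <;> simpa [h0, wedgeGram] using this
  have r0 : ∀ j : Fin 4, K 0 (j.succ.castSucc) = 0 := fun j => by
    have := b 5 (j.succ.castSucc)
    fin_cases j <;> simpa [h5, wedgeGram] using this
  let M : Matrix (Fin 4) (Fin 4) ℂ := Matrix.of fun i j => K (i.succ.castSucc) (j.succ.castSucc)
  have eK : K = middleBlock M := by
    ext i j
    have r50 := r5 0
    have r51 := r5 1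
    have r52 := r5 2
    have r53 := r5 3
    have r00 := r0 0
    have r01 := r0 1
    have r02 := r0 2
    have r03 := r0 3
    simp at r50 r51 r52 r53 r00 r01 r02 r03
    fin_cases i <;> fin_cases j <;> simp [middleBlock, h0, h5, M] <;> assumption
  have hM : Mᵀ * tensorGram * M = tensorGram := by
    ext i j
    have h := b (i.succ.castSucc) (j.succ.castSucc)
    rw [r0, r0, r5, r5] at h
    -- The four middle basis vectors carry the form of ℂ² ⊗ ℂ² with the opposite sign, which does
    -- not change the group of isometries.
    have e : wedgeGram (i.succ.castSucc) (j.succ.castSucc) = -tensorGram i j := by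
      fin_cases i <;> fin_cases j <;> simp [wedgeGram, tensorGram]
    rw [e] at h
    simp only [Matrix.mul_apply, Matrix.transpose_apply, Fin.sum_univ_four]
    simp [tensorGram, M] at h ⊢
    linear_combination -h
  obtain ⟨A, B, hAB⟩ := exists_tensorMatrix hM (by rw [← det_middleBlock, ← eK, hd])
  have hA := A.2
  have hB := B.2
  rw [Matrix.det_fin_two] at hA hB
  refine ⟨⟨!![A.1 0 0, A.1 0 1, 0, 0; A.1 1 0, A.1 1 1, 0, 0; 0, 0, B.1 0 0, B.1 0 1;
      0, 0, B.1 1 0, B.1 1 1], ?_⟩, ?_⟩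
  · simp [Matrix.det_succ_row_zero, Fin.sum_univ_succ, Fin.succAbove]
    linear_combination hA + (A.1 0 0 * A.1 1 1 - A.1 0 1 * A.1 1 0) * hB
  · rw [eK, hAB, wedgeMatrix_fromBlocks]

/-- The isometries of `Λ²ℂ⁴` of determinant one are exterior squares. -/
theorem exists_wedgeMatrix {K : Matrix (Fin 6) (Fin 6) ℂ}
    (hK : Kᵀ * wedgeGram * K = wedgeGram) (hd : K.det = 1) :
    ∃ A : SLGroup 4, K = wedgeMatrix A.1 := by
  have b := wedgeGram_bilin hK
  have b00 := b 0 0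
  have b55 := b 5 5
  have b05 := b 0 5
  simp only [wedgeGram, Matrix.of_apply, Matrix.cons_val] at b00 b55 b05
  obtain ⟨a₀, a₁, a₂, a₃, b₀, b₁, b₂, b₃, k0, k1, k2, k3, k4, k5⟩ := exists_wedge_of_isotropic
    (w₀ := K 0 0) (w₁ := K 1 0) (w₂ := K 2 0) (w₃ := K 3 0) (w₄ := K 4 0) (w₅ := K 5 0)
    (by linear_combination b00 / 2)
  obtain ⟨c₀, c₁, c₂, c₃, d₀, d₁, d₂, d₃, l0, l1, l2, l3, l4, l5⟩ := exists_wedge_of_isotropic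
    (w₀ := K 0 5) (w₁ := K 1 5) (w₂ := K 2 5) (w₃ := K 3 5) (w₄ := K 4 5) (w₅ := K 5 5)
    (by linear_combination b55 / 2)
  -- The columns of this matrix are a, b, c, d. Its determinant is the pairing of a ∧ b with c ∧ d,
  -- which is 1, so no rescaling is needed.
  let A : SLGroup 4 := ⟨!![a₀, b₀, c₀, d₀; a₁, b₁, c₁, d₁; a₂, b₂, c₂, d₂; a₃, b₃, c₃, d₃], by
    rw [k0, k1, k2, k3, k4, k5, l0, l1, l2, l3, l4, l5] at b05
    simp [Matrix.det_succ_row_zero, Fin.sum_univ_succ, Fin.succAbove]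
    linear_combination b05⟩
  have hc : wedgeMatrix A⁻¹.1 * wedgeMatrix A.1 = 1 := by
    rw [← wedgeMatrix_coe_mul, inv_mul_cancel]
    exact wedgeMatrix_one
  have hc' : wedgeMatrix A.1 * wedgeMatrix A⁻¹.1 = 1 := mul_eq_one_comm.1 hc
  have col0 : ∀ i, K i 0 = wedgeMatrix A.1 i 0 := by
    intro i
    fin_cases i <;> simp [A, wedgeMatrix, wedgeIndex, k0, k1, k2, k3, k4, k5] <;> ring
  have col5 : ∀ i, K i 5 = wedgeMatrix A.1 i 5 := by
    intro i
    fin_cases i <;> simp [A, wedgeMatrix, wedgeIndex, l0, l1, l2, l3, l4, l5] <;> ring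
  obtain ⟨A', h'⟩ := exists_wedgeMatrix_of_fixed (K := wedgeMatrix A⁻¹.1 * K)
    (isometry_inv_mul hK (by rw [wedgeMatrix_gram, A⁻¹.2, one_smul]))
    (by rw [Matrix.det_mul, det_wedgeMatrix, hd, one_mul])
    (fun i => by
      rw [Matrix.mul_apply]
      simp only [col0]
      rw [← Matrix.mul_apply, hc, Matrix.one_apply])
    (fun i => by
      rw [Matrix.mul_apply]
      simp only [col5]
      rw [← Matrix.mul_apply, hc, Matrix.one_apply])
  refine ⟨A * A', ?_⟩
  rw [wedgeMatrix_coe_mul, ← h', ← mul_assoc, hc', one_mul]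

theorem isogeny₃_surjective : Function.Surjective isogeny₃.hom := by
  intro g
  obtain ⟨h1, h2⟩ := mem_SO_iff.1 g.2
  obtain ⟨A, h⟩ := exists_wedgeMatrix (conj_isometry wedgeBasis_spec h1) (by
    rw [Matrix.det_mul, Matrix.det_mul, h2, mul_one, ← Matrix.det_mul,
      mul_eq_one_comm.1 wedgeBasis_spec, Matrix.det_one])
  refine ⟨A, Subtype.ext ?_⟩
  change ((1 / 2 : ℂ) • (wedgeBasisᵀ * wedgeGram)) * wedgeMatrix A.1 * wedgeBasis = g.1
  rw [← h, conj_conj wedgeBasis_spec]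

/-- Λ²A = 1 prescribes all two by two minors of A, and these force A to be a scalar matrix whose
scalar has square one. -/
theorem isogeny₃_isIsogeny : isogeny₃.IsIsogeny := by
  refine ⟨isogeny₃_surjective, ?_⟩
  refine Set.Finite.subset (s := Subtype.val ⁻¹' {1, -1})
    (Set.Finite.preimage Subtype.val_injective.injOn (by simp)) ?_
  intro A hA
  have h : isogeny₃.hom A = 1 := hA
  have h1 : wedgeMatrix A.1 = 1 := eq_of_conj_eq_one wedgeBasis_spec (congrArg Subtype.val h)
  have m : ∀ k l : Fin 6, A.1 (wedgeIndex k).1 (wedgeIndex l).1 *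
      A.1 (wedgeIndex k).2 (wedgeIndex l).2 - A.1 (wedgeIndex k).1 (wedgeIndex l).2 *
      A.1 (wedgeIndex k).2 (wedgeIndex l).1 = if k = l then 1 else 0 := fun k l => by
    rw [← Matrix.one_apply, ← h1]
    rfl
  have idx : ∀ a b : Fin 4, a ≠ b → ∃ k, wedgeIndex k = (a, b) ∨ wedgeIndex k = (b, a) := by decide
  have one : ∀ a b : Fin 4, a ≠ b → A.1 a a * A.1 b b - A.1 a b * A.1 b a = 1 := by
    intro a b hab
    obtain ⟨k, hk | hk⟩ := idx a b hab
    · simpa [hk] using m k k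
    · have := m k k
      simp only [hk, if_pos] at this
      linear_combination this
  have zero : ∀ a b c d : Fin 4, a ≠ b → c ≠ d → a ≠ c → a ≠ d →
      A.1 a c * A.1 b d - A.1 a d * A.1 b c = 0 := by
    intro a b c d hab hcd hac had
    obtain ⟨k, hk⟩ := idx a b hab
    obtain ⟨l, hl⟩ := idx c d hcd
    have hkl : k ≠ l := by
      rintro rfl
      rcases hk with hk | hk <;> rcases hl with hl | hl <;> rw [hk] at hl <;>
        simp_all
    have := m k l
    rw [if_neg hkl] at this
    rcases hk with hk | hk <;> rcases hl with hl | hl <;> simp only [hk, hl] at this <;>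
      first | linear_combination this | linear_combination -this
  have off : ∀ p i : Fin 4, p ≠ i → A.1 p i = 0 := by
    intro p i hpi
    obtain ⟨j, hjp, hji⟩ : ∃ j : Fin 4, j ≠ p ∧ j ≠ i := by
      revert p i
      decide
    -- The block with rows and columns i, j is invertible, while row p has vanishing minors with
    -- both of its rows in these columns. So the part of row p in the columns i, j is zero.
    linear_combination -A.1 p i * one i j hji.symm +
      A.1 i i * zero p j i j hjp.symm hji.symm hpi hjp.symm -
      A.1 j i * zero p i i j hpi hji.symm hpi hjp.symm
  have diag : ∀ a b : Fin 4, a ≠ b → A.1 a a * A.1 b b = 1 := by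
    intro a b hab
    have := one a b hab
    rwa [off a b hab, zero_mul, sub_zero] at this
  -- With diagonal entries aᵢ: a₀² = (a₀a₁)(a₀a₂)/(a₁a₂), and all three products are 1.
  have sq : A.1 0 0 * A.1 0 0 = 1 := by
    linear_combination -A.1 0 0 ^ 2 * diag 1 2 (by decide) + diag 0 1 (by decide) +
      A.1 0 0 * A.1 1 1 * diag 0 2 (by decide)
  have all : ∀ a, A.1 a a = A.1 0 0 := by
    intro a
    by_cases ha : a = 0
    · rw [ha]
    · linear_combination -A.1 a a * sq + A.1 0 0 * diag 0 a (Ne.symm ha)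
  have e : A.1 = Matrix.diagonal fun _ => A.1 0 0 := by
    ext i j
    by_cases hij : i = j
    · rw [hij, Matrix.diagonal_apply_eq, all]
    · rw [Matrix.diagonal_apply_ne _ hij, off i j hij]
  rcases mul_self_eq_one_iff.1 sq with h0 | h0
  · left
    rw [e, h0, Matrix.diagonal_one]
  · right
    change A.1 = -1
    rw [e, h0, ← Matrix.diagonal_one, ← Matrix.diagonal_neg]

end Isogeny

/-! ### The derivatives of the isogenies -/

section Derivatives

open HiggsBundles.MatrixGroup (mat)

/-! ### Holomorphic logarithms and local sections of homomorphisms to SO(k, ℂ). -/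

/-- A holomorphic logarithm near the identity. -/
theorem exists_log_aux {𝔸 : Type} [NormedRing 𝔸] [NormedAlgebra ℂ 𝔸] [CompleteSpace 𝔸]
    {τ : 𝔸 → 𝔸} (hτ : Continuous τ) (hτ0 : τ 0 = 0) :
    ∃ (V : Set 𝔸) (log : 𝔸 → 𝔸), IsOpen V ∧ 1 ∈ V ∧ DifferentiableOn ℂ log V ∧
      ∀ M ∈ V, NormedSpace.exp (log M) = M ∧
        (NormedSpace.exp (τ (log M)) = M → τ (log M) = log M) := by
  have hf : ContDiffAt ℂ 1 (NormedSpace.exp : 𝔸 → 𝔸) 0 :=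
    (NormedSpace.exp_analytic (𝕂 := ℂ) (0 : 𝔸)).contDiffAt
  have hf' : HasFDerivAt (NormedSpace.exp : 𝔸 → 𝔸)
      ((ContinuousLinearEquiv.refl ℂ 𝔸 : 𝔸 ≃L[ℂ] 𝔸) : 𝔸 →L[ℂ] 𝔸) 0 :=
    (hasFDerivAt_exp_zero (𝕂 := ℂ) (𝔸 := 𝔸))
  let e := hf.toOpenPartialHomeomorph _ hf' one_ne_zero
  have he0 : (0 : 𝔸) ∈ e.source := hf.mem_toOpenPartialHomeomorph_source hf' one_ne_zero
  have he : ∀ x, e x = NormedSpace.exp x := fun x => rfl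
  have h1 : (1 : 𝔸) ∈ e.target := by
    have := e.map_source he0
    rwa [he, NormedSpace.exp_zero] at this
  have hs1 : e.symm 1 = 0 := by
    have := e.left_inv he0
    rwa [he, NormedSpace.exp_zero] at this
  have hd : ContDiffAt ℂ 1 e.symm 1 := by
    have := hf.to_localInverse hf' one_ne_zero
    rwa [NormedSpace.exp_zero] at this
  obtain ⟨W, hW, hWo, h1W⟩ := eventually_nhds_iff.1 (hd.eventually (by simp))
  -- `V` is shrunk so that `τ (log M)` also lies where exp is injective; a second logarithm of this
  -- form then coincides with `log M`. The set `W` provides differentiability.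
  refine ⟨(e.target ∩ e.symm ⁻¹' (τ ⁻¹' e.source)) ∩ W, e.symm,
    (e.isOpen_inter_preimage_symm (e.open_source.preimage hτ)).inter hWo, ⟨⟨h1, ?_⟩, h1W⟩,
    fun M hM => ((hW M hM.2).differentiableAt one_ne_zero).differentiableWithinAt,
    fun M hM => ⟨e.right_inv hM.1.1, fun h => ?_⟩⟩
  · change τ (e.symm 1) ∈ e.source
    rwa [hs1, hτ0]
  · refine e.injOn hM.1.2 (e.map_target hM.1.1) ?_
    rw [he, h, e.right_inv hM.1.1]

/-- With `L`, also `-Lᵀ` is a logarithm of an orthogonal matrix. For τ(L) = -Lᵀ, uniqueness in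
`exists_log_aux` makes logarithms of orthogonal matrices skew. -/
theorem exp_neg_transpose {k : ℕ} {L M : Matrix (Fin k) (Fin k) ℂ} (h : NormedSpace.exp L = M)
    (hM : Mᵀ * M = 1) : NormedSpace.exp (-Lᵀ) = M := by
  rw [Matrix.exp_neg, Matrix.exp_transpose, h]
  exact Matrix.inv_eq_right_inv hM

theorem exists_log_skew (k : ℕ) : ∃ (V : Set (Fin k → Fin k → ℂ))
    (log : (Fin k → Fin k → ℂ) → Fin k → Fin k → ℂ), IsOpen V ∧
      (1 : Matrix (Fin k) (Fin k) ℂ) ∈ V ∧ DifferentiableOn ℂ log V ∧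
      ∀ M : Matrix (Fin k) (Fin k) ℂ, M ∈ V → NormedSpace.exp (Matrix.of (log M)) = M ∧
        (Mᵀ * M = 1 → (Matrix.of (log M))ᵀ = -Matrix.of (log M)) := by
  let _ := Matrix.linftyOpNormedRing (n := Fin k) (α := ℂ)
  let _ := Matrix.linftyOpNormedAlgebra (R := ℂ) (n := Fin k) (α := ℂ)
  obtain ⟨V, log, hV, h1, hd, h⟩ := exists_log_aux (𝔸 := Matrix (Fin k) (Fin k) ℂ)
    (τ := fun L => -Lᵀ) (by fun_prop) (by simp)
  refine ⟨V, log, hV, h1, hd, fun M hM => ⟨(h M hM).1, fun hMM => ?_⟩⟩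
  have := (h M hM).2 (exp_neg_transpose (h M hM).1 hMM)
  exact neg_eq_iff_eq_neg.1 this

theorem mem_lieAlg_SO {k : ℕ} {A : Matrix (Fin k) (Fin k) ℂ} :
    A ∈ lieAlg (SOGroup k) ↔ Aᵀ = -A := by
  refine ⟨transpose_of_mem_lieAlg, fun h t => ⟨⟨NormedSpace.exp (t • A), mem_SO_iff.2 ⟨?_, ?_⟩⟩, rfl⟩⟩
  · rw [← Matrix.exp_transpose, Matrix.transpose_smul, h, smul_neg, Matrix.exp_neg,
      Matrix.nonsing_inv_mul]
    exact (Matrix.isUnit_iff_isUnit_det _).1 (Matrix.isUnit_exp _)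
  · have : A.trace = 0 := by
      have h2 := Matrix.trace_transpose A
      rw [h, Matrix.trace_neg] at h2
      linear_combination -h2 / 2
    rw [det_exp_smul, this, mul_zero, Complex.exp_zero]

theorem differentiable_matrix_exp {n : Type} [Fintype n] [DecidableEq n] :
    Differentiable ℂ fun M : n → n → ℂ =>
      ((NormedSpace.exp (Matrix.of M) : Matrix n n ℂ) : n → n → ℂ) := by
  let _ := Matrix.linftyOpNormedRing (n := n) (α := ℂ)
  let _ := Matrix.linftyOpNormedAlgebra (R := ℂ) (n := n) (α := ℂ)
  let f : (n → n → ℂ) → n → n → ℂ := fun M => (NormedSpace.exp (Matrix.of M) : Matrix n n ℂ)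
  have h : Differentiable ℂ (NormedSpace.exp : Matrix n n ℂ → Matrix n n ℂ) :=
    fun M => (NormedSpace.exp_analytic (𝕂 := ℂ) M).differentiableAt
  have hf : Differentiable ℂ f := h
  exact hf

/-- A homomorphism to a special orthogonal group has a holomorphic local section if its derivative
has a right inverse. -/
theorem exists_section_of_SO {n : Type} [Fintype n] [DecidableEq n] {G : Type} [Group G]
    [MatrixGroup G n] {k : ℕ} {Ψ : HolHom G (SOGroup k)}
    {E : Matrix (Fin k) (Fin k) ℂ →ₗ[ℂ] Matrix n n ℂ}
    (hmem : ∀ B ∈ lieAlg (SOGroup k), E B ∈ lieAlg G)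
    (hd : ∀ B ∈ lieAlg (SOGroup k), Ψ.d (E B) = B) :
    ∃ (V : Set (Fin k → Fin k → ℂ)) (F : (Fin k → Fin k → ℂ) → n → n → ℂ), IsOpen V ∧
      (mat (1 : SOGroup k) : Fin k → Fin k → ℂ) ∈ V ∧ DifferentiableOn ℂ F V ∧
      ∀ h : SOGroup k, (mat h : Fin k → Fin k → ℂ) ∈ V → ∃ g : G, Ψ.hom g = h ∧
        mat g = F (mat h) := by
  obtain ⟨V, log, hV, h1, hlog, h⟩ := exists_log_skew k
  let L : (Fin k → Fin k → ℂ) →L[ℂ] (n → n → ℂ) := LinearMap.toContinuousLinearMap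
    (E := Fin k → Fin k → ℂ) (F' := n → n → ℂ) E
  -- The section is exp ∘ E ∘ log. It is defined for all matrices near 1, and takes values in `G` on
  -- special orthogonal ones because their logarithms are skew.
  refine ⟨V, fun M => (NormedSpace.exp (Matrix.of (L (log M))) : Matrix n n ℂ), hV, ?_, ?_, ?_⟩
  · rw [map_one]
    exact h1
  · exact (differentiable_matrix_exp.comp L.differentiable).comp_differentiableOn hlog
  · intro g hg
    obtain ⟨h2, h3⟩ := h (mat g) hg
    have h4 := mem_lieAlg_SO.2 (h3 (mem_SO_iff.1 g.2).1)
    refine ⟨expG G (E (Matrix.of (log (mat g)))) 1, ?_, ?_⟩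
    · apply MatrixGroup.mat_injective
      rw [← Ψ.exp_d (hmem _ h4), hd _ h4, one_smul, h2]
    · rw [mat_expG (hmem _ h4), one_smul]
      rfl

theorem hasDerivAt_conj_entry {k : ℕ} (C D : Matrix (Fin k) (Fin k) ℂ)
    {γ : ℂ → Matrix (Fin k) (Fin k) ℂ} {B : Matrix (Fin k) (Fin k) ℂ}
    (h : ∀ i j, HasDerivAt (fun t => γ t i j) (B i j) 0) (i j : Fin k) :
    HasDerivAt (fun t => (D * γ t * C) i j) ((D * B * C) i j) 0 := by
  simp only [Matrix.mul_apply]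
  exact HasDerivAt.fun_sum fun a _ => HasDerivAt.mul_const
    (HasDerivAt.fun_sum fun b _ => (h b a).const_mul _) _

theorem trace_conj_mul {k : ℕ} {C D : Matrix (Fin k) (Fin k) ℂ} (h : D * C = 1)
    (M N : Matrix (Fin k) (Fin k) ℂ) :
    ((D * M * C) * (D * N * C)).trace = (M * N).trace := by
  have h' : C * D = 1 := mul_eq_one_comm.1 h
  rw [Matrix.trace_mul_comm]
  calc ((D * N * C) * (D * M * C)).trace = (D * (N * (C * D) * M * C)).trace := by
        simp only [mul_assoc]
    _ = (N * (C * D) * M * (C * D)).trace := by rw [Matrix.trace_mul_comm]; simp only [mul_assoc]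
    _ = (M * N).trace := by rw [h', mul_one, mul_one, Matrix.trace_mul_comm]

/-- If `S` is skew, then `C S C⁻¹` is skew for the form `J`, where the columns of `C` are orthogonal
of square length two for `J`. -/
theorem conj_skew {k : ℕ} {C J S : Matrix (Fin k) (Fin k) ℂ}
    (hJ : Jᵀ = J) (hS : Sᵀ = -S) :
    (J * (C * S * ((1 / 2 : ℂ) • (Cᵀ * J))))ᵀ = -(J * (C * S * ((1 / 2 : ℂ) • (Cᵀ * J)))) := by
  simp only [Matrix.transpose_mul, Matrix.transpose_smul, Matrix.transpose_transpose, hJ, hS,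
    mul_assoc, mul_smul_comm, neg_mul, mul_neg, smul_neg]

/-! #### The first isogeny -/

/-- The infinitesimal action on `ℂ² ⊗ ℂ²`. -/
def tensorDer (A B : Matrix (Fin 2) (Fin 2) ℂ) : Matrix (Fin 4) (Fin 4) ℂ :=
  tensorMatrix A 1 + tensorMatrix 1 B

/-- The product rule at t = 0 for the entries of exp(tA) ⊗ exp(tB). -/
theorem isogeny₂_d {A B : Matrix (Fin 2) (Fin 2) ℂ} (hA : A.trace = 0) (hB : B.trace = 0) :
    isogeny₂.d (Matrix.fromBlocks A 0 0 B) =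
      ((1 / 2 : ℂ) • (tensorBasisᵀ * tensorGram)) * tensorDer A B * tensorBasis := by
  refine isogeny₂.d_eq_of_curve (mem_lieAlg_prod.2 ⟨A, B, hA, hB, rfl⟩) (F := fun M =>
    ((1 / 2 : ℂ) • (tensorBasisᵀ * tensorGram)) *
      tensorMatrix M.toBlocks₁₁ M.toBlocks₂₂ * tensorBasis) (fun _ => rfl) ?_
  refine hasDerivAt_conj_entry _ _ fun i j => ?_
  simp only [Matrix.fromBlocks_smul, smul_zero, exp_fromBlocks, Matrix.toBlocks_fromBlocks₁₁,
    Matrix.toBlocks_fromBlocks₂₂]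
  let e : Fin 2 × Fin 2 ≃ Fin 4 := finProdFinEquiv
  have h := (hasDerivAt_exp_entry A (e.symm i).1 (e.symm j).1).mul
    (hasDerivAt_exp_entry B (e.symm i).2 (e.symm j).2)
  simp only [zero_smul, NormedSpace.exp_zero] at h
  exact h

theorem trace_tensorMatrix (A B : Matrix (Fin 2) (Fin 2) ℂ) :
    (tensorMatrix A B).trace = A.trace * B.trace := by
  rw [tensorMatrix_apply]
  simp [Matrix.trace, Fin.sum_univ_succ]
  ring

/-- The source of the constant c = 2: tensoring with the identity of ℂ² doubles traces, and the
mixed terms vanish because A and A' are traceless. -/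
theorem trace_tensorDer_mul {A B A' B' : Matrix (Fin 2) (Fin 2) ℂ} (hA : A.trace = 0)
    (hA' : A'.trace = 0) :
    (tensorDer A B * tensorDer A' B').trace = 2 * ((A * A').trace + (B * B').trace) := by
  simp only [tensorDer, add_mul, mul_add, ← tensorMatrix_mul, Matrix.trace_add, trace_tensorMatrix,
    mul_one, one_mul, hA, hA', Matrix.trace_one, Fintype.card_fin]
  push_cast
  ring

/-- The partial traces of an endomorphism of `ℂ² ⊗ ℂ²`, divided by two. -/
def tensorInv : Matrix (Fin 4) (Fin 4) ℂ →ₗ[ℂ] Matrix (Fin 2 ⊕ Fin 2) (Fin 2 ⊕ Fin 2) ℂ where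
  toFun T := Matrix.fromBlocks
    ((1 / 2 : ℂ) • !![T 0 0 + T 1 1, T 0 2 + T 1 3; T 2 0 + T 3 1, T 2 2 + T 3 3]) 0 0
    ((1 / 2 : ℂ) • !![T 0 0 + T 2 2, T 0 1 + T 2 3; T 1 0 + T 3 2, T 1 1 + T 3 3])
  map_add' S T := by
    rw [Matrix.fromBlocks_add]
    congr 1
    · ext i j
      fin_cases i <;> fin_cases j <;> simp <;> ring
    · simp
    · simp
    · ext i j
      fin_cases i <;> fin_cases j <;> simp <;> ring
  map_smul' c T := by
    rw [Matrix.fromBlocks_smul]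
    congr 1
    · ext i j
      fin_cases i <;> fin_cases j <;> simp <;> ring
    · simp
    · simp
    · ext i j
      fin_cases i <;> fin_cases j <;> simp <;> ring

theorem tensorInv_tensorDer {A B : Matrix (Fin 2) (Fin 2) ℂ} (hA : A.trace = 0) (hB : B.trace = 0) :
    tensorInv (tensorDer A B) = Matrix.fromBlocks A 0 0 B := by
  rw [Matrix.trace_fin_two] at hA hB
  change Matrix.fromBlocks _ 0 0 _ = _
  rw [tensorDer, tensorMatrix_apply, tensorMatrix_apply]
  congr 1
  · ext i j
    fin_cases i <;> fin_cases j <;> simp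
    · linear_combination hB / 2
    · ring
    · ring
    · linear_combination hB / 2
  · ext i j
    fin_cases i <;> fin_cases j <;> simp
    · linear_combination hA / 2
    · ring
    · ring
    · linear_combination hA / 2

/-- Skewness of J T in explicit form: six free entries remain, as many as in sl(2) ⊕ sl(2), and
surjectivity of the derivative becomes an identity of matrices. -/
theorem tensorGram_skew {T : Matrix (Fin 4) (Fin 4) ℂ}
    (hT : (tensorGram * T)ᵀ = -(tensorGram * T)) :
    T = !![T 0 0, T 0 1, T 0 2, 0; T 1 0, T 1 1, 0, T 0 2; T 2 0, 0, -T 1 1, T 0 1;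
      0, T 2 0, T 1 0, -T 0 0] := by
  have e : ∀ i j, (tensorGram * T) j i = -(tensorGram * T) i j :=
    fun i j => congrFun (congrFun hT i) j
  simp only [Matrix.mul_apply, Fin.sum_univ_four] at e
  have e00 := e 0 0
  have e01 := e 0 1
  have e02 := e 0 2
  have e03 := e 0 3
  have e11 := e 1 1
  have e12 := e 1 2
  have e13 := e 1 3
  have e22 := e 2 2
  have e23 := e 2 3
  have e33 := e 3 3
  simp [tensorGram] at e00 e01 e02 e03 e11 e12 e13 e22 e23 e33
  ext i j
  fin_cases i <;> fin_cases j <;> simp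
  · linear_combination e33 / 2
  · linear_combination -e22 / 2
  · linear_combination -e23
  · linear_combination -e11 / 2
  · linear_combination -e12
  · linear_combination -e13
  · linear_combination e00 / 2
  · linear_combination -e01
  · linear_combination -e02
  · linear_combination e03

theorem tensorDer_tensorInv {T : Matrix (Fin 4) (Fin 4) ℂ}
    (hT : (tensorGram * T)ᵀ = -(tensorGram * T)) : ∃ A B, A.trace = 0 ∧ B.trace = 0 ∧
      tensorInv T = Matrix.fromBlocks A 0 0 B ∧ tensorDer A B = T := by
  have e := tensorGram_skew hT
  refine ⟨_, _, ?_, ?_, rfl, ?_⟩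
  · rw [e]
    simp [Matrix.trace_fin_two]
    ring
  · rw [e]
    simp [Matrix.trace_fin_two]
    ring
  · rw [tensorDer, tensorMatrix_apply, tensorMatrix_apply, e]
    ext i j
    fin_cases i <;> fin_cases j <;> simp <;> ring

/-- The inverse of the derivative of `isogeny₂`. -/
def isogeny₂Inv : Matrix (Fin 4) (Fin 4) ℂ →ₗ[ℂ] Matrix (Fin 2 ⊕ Fin 2) (Fin 2 ⊕ Fin 2) ℂ :=
  tensorInv ∘ₗ LinearMap.mulLeft ℂ tensorBasis ∘ₗ
    LinearMap.mulRight ℂ ((1 / 2 : ℂ) • (tensorBasisᵀ * tensorGram))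

theorem isogeny₂Inv_apply (S : Matrix (Fin 4) (Fin 4) ℂ) : isogeny₂Inv S =
    tensorInv (tensorBasis * S * ((1 / 2 : ℂ) • (tensorBasisᵀ * tensorGram))) := by
  rw [mul_assoc]
  rfl

theorem isogeny₂Inv_spec {S : Matrix (Fin 4) (Fin 4) ℂ} (hS : S ∈ lieAlg (SOGroup 4)) :
    isogeny₂Inv S ∈ lieAlg (SLGroup 2 × SLGroup 2) ∧ isogeny₂.d (isogeny₂Inv S) = S := by
  obtain ⟨A, B, hA, hB, e1, e2⟩ := tensorDer_tensorInv
    (conj_skew tensorGram_transpose (mem_lieAlg_SO.1 hS))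
  rw [isogeny₂Inv_apply, e1]
  refine ⟨mem_lieAlg_prod.2 ⟨A, B, hA, hB, rfl⟩, ?_⟩
  rw [isogeny₂_d hA hB, e2, conj_conj tensorBasis_spec]

theorem isogeny₂_isLocalIso : isogeny₂.IsLocalIso 2 isogeny₂Inv where
  pos := two_pos
  surjective := isogeny₂_surjective
  add_mem A hA B hB := by
    obtain ⟨A₁, A₂, h1, h2, rfl⟩ := mem_lieAlg_prod.1 hA
    obtain ⟨B₁, B₂, h3, h4, rfl⟩ := mem_lieAlg_prod.1 hB
    rw [Matrix.fromBlocks_add]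
    exact mem_lieAlg_prod.2 ⟨A₁ + B₁, A₂ + B₂, by rw [Matrix.trace_add, h1, h3, add_zero],
      by rw [Matrix.trace_add, h2, h4, add_zero], by simp⟩
  lie_mem A hA B hB := by
    obtain ⟨A₁, A₂, h1, h2, rfl⟩ := mem_lieAlg_prod.1 hA
    obtain ⟨B₁, B₂, h3, h4, rfl⟩ := mem_lieAlg_prod.1 hB
    refine mem_lieAlg_prod.2 ⟨A₁ * B₁ - B₁ * A₁, A₂ * B₂ - B₂ * A₂, ?_, ?_, ?_⟩
    · rw [Matrix.trace_sub, Matrix.trace_mul_comm, sub_self]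
    · rw [Matrix.trace_sub, Matrix.trace_mul_comm, sub_self]
    · simp [Matrix.fromBlocks_multiply, sub_eq_add_neg, Matrix.fromBlocks_neg,
        Matrix.fromBlocks_add]
  map_mem B hB := (isogeny₂Inv_spec hB).1
  d_map B hB := (isogeny₂Inv_spec hB).2
  map_d A hA := by
    obtain ⟨A₁, A₂, h1, h2, rfl⟩ := mem_lieAlg_prod.1 hA
    rw [isogeny₂_d h1 h2, isogeny₂Inv_apply, conj_conj (mul_eq_one_comm.1 tensorBasis_spec),
      tensorInv_tensorDer h1 h2]
  trace_d A hA B hB := by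
    obtain ⟨A₁, A₂, h1, h2, rfl⟩ := mem_lieAlg_prod.1 hA
    obtain ⟨B₁, B₂, h3, h4, rfl⟩ := mem_lieAlg_prod.1 hB
    rw [isogeny₂_d h1 h2, isogeny₂_d h3 h4, trace_conj_mul tensorBasis_spec,
      trace_tensorDer_mul h1 h3, Matrix.fromBlocks_multiply]
    simp [Matrix.trace, Fintype.sum_sum_type]
  exists_section := exists_section_of_SO (fun _ h => (isogeny₂Inv_spec h).1)
    fun _ h => (isogeny₂Inv_spec h).2

/-! #### The second isogeny -/

/-- The infinitesimal action on `Λ²ℂ⁴`. -/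
def wedgeDer (A : Matrix (Fin 4) (Fin 4) ℂ) : Matrix (Fin 6) (Fin 6) ℂ :=
  Matrix.of fun a b =>
    A (wedgeIndex a).1 (wedgeIndex b).1 *
        (1 : Matrix (Fin 4) (Fin 4) ℂ) (wedgeIndex a).2 (wedgeIndex b).2 +
      (1 : Matrix (Fin 4) (Fin 4) ℂ) (wedgeIndex a).1 (wedgeIndex b).1 *
        A (wedgeIndex a).2 (wedgeIndex b).2 -
      (A (wedgeIndex a).1 (wedgeIndex b).2 *
          (1 : Matrix (Fin 4) (Fin 4) ℂ) (wedgeIndex a).2 (wedgeIndex b).1 +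
        (1 : Matrix (Fin 4) (Fin 4) ℂ) (wedgeIndex a).1 (wedgeIndex b).2 *
          A (wedgeIndex a).2 (wedgeIndex b).1)

theorem isogeny₃_d {A : Matrix (Fin 4) (Fin 4) ℂ} (hA : A.trace = 0) :
    isogeny₃.d A = ((1 / 2 : ℂ) • (wedgeBasisᵀ * wedgeGram)) * wedgeDer A * wedgeBasis := by
  refine isogeny₃.d_eq_of_curve (mem_lieAlg_SL.2 hA) (F := fun M =>
    ((1 / 2 : ℂ) • (wedgeBasisᵀ * wedgeGram)) * wedgeMatrix M * wedgeBasis) (fun _ => rfl) ?_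
  refine hasDerivAt_conj_entry _ _ fun a b => ?_
  have h := ((hasDerivAt_exp_entry A (wedgeIndex a).1 (wedgeIndex b).1).mul
    (hasDerivAt_exp_entry A (wedgeIndex a).2 (wedgeIndex b).2)).sub
    ((hasDerivAt_exp_entry A (wedgeIndex a).1 (wedgeIndex b).2).mul
    (hasDerivAt_exp_entry A (wedgeIndex a).2 (wedgeIndex b).1))
  simp only [zero_smul, NormedSpace.exp_zero] at h
  exact h

theorem wedgeDer_apply (A : Matrix (Fin 4) (Fin 4) ℂ) : wedgeDer A =
    !![A 0 0 + A 1 1, A 1 2, A 1 3, -A 0 2, -A 0 3, 0;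
      A 2 1, A 0 0 + A 2 2, A 2 3, A 0 1, 0, -A 0 3;
      A 3 1, A 3 2, A 0 0 + A 3 3, 0, A 0 1, A 0 2;
      -A 2 0, A 1 0, 0, A 1 1 + A 2 2, A 2 3, -A 1 3;
      -A 3 0, 0, A 1 0, A 3 2, A 1 1 + A 3 3, A 1 2;
      0, -A 3 0, A 2 0, -A 3 1, A 2 1, A 2 2 + A 3 3] := by
  ext i j
  fin_cases i <;> fin_cases j <;> simp [wedgeDer, wedgeIndex, Matrix.one_apply]

/-- The second term vanishes on traceless matrices, so the constant is again c = 2. -/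
theorem trace_wedgeDer_mul (A B : Matrix (Fin 4) (Fin 4) ℂ) :
    (wedgeDer A * wedgeDer B).trace = 2 * (A * B).trace + A.trace * B.trace := by
  rw [wedgeDer_apply, wedgeDer_apply]
  simp only [Matrix.trace, Matrix.diag_apply, Matrix.mul_apply, Fin.sum_univ_four,
    Fin.sum_univ_six]
  simp
  ring

/-- A linear left inverse of `wedgeDer` on traceless matrices. -/
def wedgeInv : Matrix (Fin 6) (Fin 6) ℂ →ₗ[ℂ] Matrix (Fin 4) (Fin 4) ℂ where
  toFun T :=
    -- For a traceless matrix with diagonal entries aᵢ, the three sums aᵢ + aⱼ that contain a given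
    -- aᵢ add up to 2aᵢ, whence the halves on the diagonal.
    !![(T 0 0 + T 1 1 + T 2 2) / 2, T 1 3, T 2 5, -T 1 5;
      T 3 1, (T 0 0 + T 3 3 + T 4 4) / 2, T 4 5, -T 3 5;
      T 5 2, T 5 4, (T 1 1 + T 3 3 + T 5 5) / 2, T 1 2;
      -T 5 1, -T 5 3, T 2 1, (T 2 2 + T 4 4 + T 5 5) / 2]
  map_add' S T := by
    ext i j
    fin_cases i <;> fin_cases j <;> simp <;> ring
  map_smul' c T := by
    ext i j
    fin_cases i <;> fin_cases j <;> simp <;> ring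

theorem wedgeInv_apply (T : Matrix (Fin 6) (Fin 6) ℂ) : wedgeInv T =
    !![(T 0 0 + T 1 1 + T 2 2) / 2, T 1 3, T 2 5, -T 1 5;
      T 3 1, (T 0 0 + T 3 3 + T 4 4) / 2, T 4 5, -T 3 5;
      T 5 2, T 5 4, (T 1 1 + T 3 3 + T 5 5) / 2, T 1 2;
      -T 5 1, -T 5 3, T 2 1, (T 2 2 + T 4 4 + T 5 5) / 2] := rfl

theorem wedgeInv_wedgeDer {A : Matrix (Fin 4) (Fin 4) ℂ} (hA : A.trace = 0) :
    wedgeInv (wedgeDer A) = A := by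
  simp only [Matrix.trace, Matrix.diag_apply, Fin.sum_univ_four] at hA
  rw [wedgeInv_apply, wedgeDer_apply]
  ext i j
  fin_cases i <;> fin_cases j <;> simp <;> linear_combination hA / 2

/-- Explicit form of skewness with fifteen free entries, the dimension of sl(4), for the same
purpose as `tensorGram_skew`. -/
theorem wedgeGram_skew {T : Matrix (Fin 6) (Fin 6) ℂ} (hT : (wedgeGram * T)ᵀ = -(wedgeGram * T)) :
    T = !![T 0 0, T 0 1, T 0 2, T 0 3, T 0 4, 0; T 1 0, T 1 1, T 1 2, T 1 3, 0, T 0 4;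
      T 2 0, T 2 1, T 2 2, 0, T 1 3, -T 0 3; T 3 0, T 3 1, 0, -T 2 2, T 1 2, -T 0 2;
      T 4 0, 0, T 3 1, T 2 1, -T 1 1, T 0 1; 0, T 4 0, -T 3 0, -T 2 0, T 1 0, -T 0 0] := by
  have e : ∀ i j, (wedgeGram * T) j i = -(wedgeGram * T) i j :=
    fun i j => congrFun (congrFun hT i) j
  have g : ∀ j, (wedgeGram * T) 0 j = T 5 j ∧ (wedgeGram * T) 1 j = -T 4 j ∧
      (wedgeGram * T) 2 j = T 3 j ∧ (wedgeGram * T) 3 j = T 2 j ∧ (wedgeGram * T) 4 j = -T 1 j ∧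
      (wedgeGram * T) 5 j = T 0 j := fun j => by
    simp [Matrix.mul_apply, Fin.sum_univ_six, wedgeGram]
  -- Multiplication by J reverses the order of the rows of T and changes two signs, so each skewness
  -- relation involves just two entries of T.
  have r : ∀ i j, ![T 5 i, -T 4 i, T 3 i, T 2 i, -T 1 i, T 0 i] j =
      -![T 5 j, -T 4 j, T 3 j, T 2 j, -T 1 j, T 0 j] i := by
    intro i j
    have v : ∀ i j, (wedgeGram * T) j i = ![T 5 i, -T 4 i, T 3 i, T 2 i, -T 1 i, T 0 i] j := by
      intro i j
      obtain ⟨g0, g1, g2, g3, g4, g5⟩ := g i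
      fin_cases j <;> assumption
    rw [← v, ← v, e]
  ext i j
  fin_cases i <;> fin_cases j <;> simp
  · have h : T 0 5 = -T 0 5 := r 5 5
    linear_combination h / 2
  · have h : -T 1 4 = -(-T 1 4) := r 4 4
    linear_combination -h / 2
  · have h : -T 1 5 = -T 0 4 := r 5 4
    linear_combination -h
  · have h : T 2 3 = -T 2 3 := r 3 3
    linear_combination h / 2
  · have h : T 2 4 = -(-T 1 3) := r 4 3
    linear_combination h
  · have h : T 2 5 = -T 0 3 := r 5 3
    linear_combination h
  · have h : T 3 2 = -T 3 2 := r 2 2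
    linear_combination h / 2
  · have h : T 3 3 = -T 2 2 := r 3 2
    linear_combination h
  · have h : T 3 4 = -(-T 1 2) := r 4 2
    linear_combination h
  · have h : T 3 5 = -T 0 2 := r 5 2
    linear_combination h
  · have h : -T 4 1 = -(-T 4 1) := r 1 1
    linear_combination -h / 2
  · have h : -T 4 2 = -T 3 1 := r 2 1
    linear_combination -h
  · have h : -T 4 3 = -T 2 1 := r 3 1
    linear_combination -h
  · have h : -T 4 4 = -(-T 1 1) := r 4 1
    linear_combination -h
  · have h : -T 4 5 = -T 0 1 := r 5 1
    linear_combination -h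
  · have h : T 5 0 = -T 5 0 := r 0 0
    linear_combination h / 2
  · have h : T 5 1 = -(-T 4 0) := r 1 0
    linear_combination h
  · have h : T 5 2 = -T 3 0 := r 2 0
    linear_combination h
  · have h : T 5 3 = -T 2 0 := r 3 0
    linear_combination h
  · have h : T 5 4 = -(-T 1 0) := r 4 0
    linear_combination h
  · have h : T 5 5 = -T 0 0 := r 5 0
    linear_combination h

theorem wedgeDer_wedgeInv {T : Matrix (Fin 6) (Fin 6) ℂ}
    (hT : (wedgeGram * T)ᵀ = -(wedgeGram * T)) :
    (wedgeInv T).trace = 0 ∧ wedgeDer (wedgeInv T) = T := by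
  have e := wedgeGram_skew hT
  constructor
  · rw [wedgeInv_apply, e]
    simp [Matrix.trace, Fin.sum_univ_four]
    ring
  · rw [wedgeDer_apply, wedgeInv_apply, e]
    ext i j
    fin_cases i <;> fin_cases j <;> simp <;> ring

/-- The inverse of the derivative of `isogeny₃`. -/
def isogeny₃Inv : Matrix (Fin 6) (Fin 6) ℂ →ₗ[ℂ] Matrix (Fin 4) (Fin 4) ℂ :=
  wedgeInv ∘ₗ LinearMap.mulLeft ℂ wedgeBasis ∘ₗ
    LinearMap.mulRight ℂ ((1 / 2 : ℂ) • (wedgeBasisᵀ * wedgeGram))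

theorem isogeny₃Inv_apply (S : Matrix (Fin 6) (Fin 6) ℂ) : isogeny₃Inv S =
    wedgeInv (wedgeBasis * S * ((1 / 2 : ℂ) • (wedgeBasisᵀ * wedgeGram))) := by
  rw [mul_assoc]
  rfl

theorem isogeny₃Inv_spec {S : Matrix (Fin 6) (Fin 6) ℂ} (hS : S ∈ lieAlg (SOGroup 6)) :
    isogeny₃Inv S ∈ lieAlg (SLGroup 4) ∧ isogeny₃.d (isogeny₃Inv S) = S := by
  obtain ⟨h1, h2⟩ := wedgeDer_wedgeInv
    (conj_skew (C := wedgeBasis) wedgeGram_transpose (mem_lieAlg_SO.1 hS))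
  rw [isogeny₃Inv_apply]
  refine ⟨mem_lieAlg_SL.2 h1, ?_⟩
  rw [isogeny₃_d h1, h2, conj_conj wedgeBasis_spec]

theorem isogeny₃_isLocalIso : isogeny₃.IsLocalIso 2 isogeny₃Inv where
  pos := two_pos
  surjective := isogeny₃_surjective
  add_mem := lieAlg_SL_add_mem
  lie_mem := lieAlg_SL_lie_mem
  map_mem B hB := (isogeny₃Inv_spec hB).1
  d_map B hB := (isogeny₃Inv_spec hB).2
  map_d A hA := by
    rw [mem_lieAlg_SL] at hA
    rw [isogeny₃_d hA, isogeny₃Inv_apply, conj_conj (mul_eq_one_comm.1 wedgeBasis_spec),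
      wedgeInv_wedgeDer hA]
  trace_d A hA B hB := by
    rw [mem_lieAlg_SL] at hA hB
    rw [isogeny₃_d hA, isogeny₃_d hB, trace_conj_mul wedgeBasis_spec, trace_wedgeDer_mul, hA,
      zero_mul, add_zero]
    simp
  exists_section := exists_section_of_SO (fun _ h => (isogeny₃Inv_spec h).1)
    fun _ h => (isogeny₃Inv_spec h).2

end Derivatives

/-! ### Hermitian metrics on associated line bundles -/

section Metrics

open HiggsBundles.MatrixGroup (mat)

variable {n : Type} [Fintype n] [DecidableEq n] {G : Type} [Group G] [MatrixGroup G n]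

/-- The logarithm of the absolute value of the character `χ` is a multiple of the logarithm of the
absolute value of a holomorphic function. -/
def IsLogHarmonic {H : Subgroup G} (χ : H →* ℂˣ) : Prop :=
  ∃ (r : ℝ) (f : (n → n → ℂ) → ℂ), Differentiable ℂ f ∧
    ∀ g : H, f (mat (g : G)) ≠ 0 ∧ Real.log ‖(χ g : ℂ)‖ = r * Real.log ‖f (mat (g : G))‖

open Classical in
/-- The logarithm of the absolute value of a character, extended by zero. -/
def logChar {H : Subgroup G} (χ : H →* ℂˣ) (g : G) : ℝ :=
  if h : g ∈ H then Real.log ‖(χ ⟨g, h⟩ : ℂ)‖ else 0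

theorem logChar_coe {H : Subgroup G} (χ : H →* ℂˣ) (g : H) :
    logChar χ (g : G) = Real.log ‖(χ g : ℂ)‖ := dif_pos g.2

theorem logChar_mul {H : Subgroup G} (χ : H →* ℂˣ) {g h : G} (hg : g ∈ H) (hh : h ∈ H) :
    logChar χ (g * h) = logChar χ g + logChar χ h := by
  have e := logChar_coe χ (⟨g, hg⟩ * ⟨h, hh⟩)
  have eg := logChar_coe χ ⟨g, hg⟩
  have eh := logChar_coe χ ⟨h, hh⟩
  rw [map_mul, Units.val_mul, norm_mul,
    Real.log_mul (norm_ne_zero_iff.2 (Units.ne_zero _)) (norm_ne_zero_iff.2 (Units.ne_zero _))] at e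
  rw [← eg, ← eh] at e
  exact e

theorem exp_two_logChar {H : Subgroup G} (χ : H →* ℂˣ) (g : H) :
    Real.exp (2 * logChar χ (g : G)) = ‖(χ g : ℂ)‖ ^ 2 := by
  rw [logChar_coe, two_mul, Real.exp_add,
    Real.exp_log (norm_pos_iff.2 (Units.ne_zero _)), sq]

variable {X : Type u} [TopologicalSpace X] [ChartedSpace ℂ X]

/-- The real smooth structure underlying X, needed for smooth partitions of unity. -/
theorem isManifold_real [IsManifold 𝓘(ℂ) ω X] : IsManifold 𝓘(ℝ, ℂ) ∞ X := by
  refine isManifold_of_contDiffOn 𝓘(ℝ, ℂ) ∞ X fun e e' he he' => ?_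
  have h := (contDiffGroupoid ω 𝓘(ℂ)).compatible he he'
  rw [contDiffGroupoid, mem_groupoid_of_pregroupoid] at h
  have h1 : ContDiffOn ℂ ω (𝓘(ℂ) ∘ (e.symm ≫ₕ e') ∘ 𝓘(ℂ).symm) _ := h.1
  exact (h1.restrict_scalars ℝ).of_le le_top

theorem eventually_chart_symm_mem {U : Set X} (hU : IsOpen U) (p : X) {z : ℂ}
    (hz : z ∈ (chartAt ℂ p).target ∩ (chartAt ℂ p).symm ⁻¹' U) :
    ∀ᶠ w in nhds z, w ∈ (chartAt ℂ p).target ∩ (chartAt ℂ p).symm ⁻¹' U :=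
  (isOpen_chart_preimage hU p).mem_nhds hz

/-- Near z the function is r log |F| for a holomorphic F without zero at z, and such a function is
harmonic. -/
theorem IsLogHarmonic.harmonicAt [IsManifold 𝓘(ℂ) ω X] {H : Subgroup G} {χ : H →* ℂˣ} (hχ : IsLogHarmonic χ) {g : X → G}
    {U : Set X} (hU : IsOpen U) (hg : IsHolMap g U) (hH : ∀ x ∈ U, g x ∈ H) (p : X) {z : ℂ}
    (hz : z ∈ (chartAt ℂ p).target ∩ (chartAt ℂ p).symm ⁻¹' U) :
    InnerProductSpace.HarmonicAt (fun w => logChar χ (g ((chartAt ℂ p).symm w))) z := by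
  obtain ⟨r, f, hf, h⟩ := hχ
  have h1 : IsHolOn (fun x => f (mat (g x))) U := IsHolOn.comp_matrix hg fun x _ => hf _
  have h2 : AnalyticAt ℂ (fun w => f (mat (g ((chartAt ℂ p).symm w)))) z :=
    (h1.differentiableOn_chart p).analyticAt ((isOpen_chart_preimage hU p).mem_nhds hz)
  have h3 := (h2.harmonicAt_log_norm (h ⟨_, hH _ hz.2⟩).1).const_smul (c := r)
  refine (InnerProductSpace.harmonicAt_congr_nhds ?_).1 h3
  filter_upwards [eventually_chart_symm_mem hU p hz] with w hw
  exact (((logChar_coe χ ⟨_, hH _ hw.2⟩).trans (h ⟨_, hH _ hw.2⟩).2)).symm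

theorem IsLogHarmonic.contDiffAt [IsManifold 𝓘(ℂ) ω X] {H : Subgroup G} {χ : H →* ℂˣ} (hχ : IsLogHarmonic χ) {g : X → G}
    {U : Set X} (hU : IsOpen U) (hg : IsHolMap g U) (hH : ∀ x ∈ U, g x ∈ H) (p : X) {z : ℂ}
    (hz : z ∈ (chartAt ℂ p).target ∩ (chartAt ℂ p).symm ⁻¹' U) :
    ContDiffAt ℝ ∞ (fun w => logChar χ (g ((chartAt ℂ p).symm w))) z :=
  (HarmonicAt.analyticAt (hχ.harmonicAt hU hg hH p hz)).contDiffAt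

theorem contDiffAt_comp_chart_symm [IsManifold 𝓘(ℝ, ℂ) ∞ X] {f : X → ℝ}
    (hf : ContMDiff 𝓘(ℝ, ℂ) 𝓘(ℝ) ∞ f) (p : X) {z : ℂ} (hz : z ∈ (chartAt ℂ p).target) :
    ContDiffAt ℝ ∞ (fun w => f ((chartAt ℂ p).symm w)) z := by
  have h1 : ContMDiffOn 𝓘(ℝ, ℂ) 𝓘(ℝ, ℂ) ∞ (chartAt ℂ p).symm (chartAt ℂ p).target :=
    contMDiffOn_chart_symm
  have h2 := hf.comp_contMDiffOn h1
  exact (contMDiffOn_iff_contDiffOn.1 h2).contDiffAt ((chartAt ℂ p).open_target.mem_nhds hz)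

theorem two_le_infty : ((2 : ℕ) : ℕ∞ω) ≤ ∞ :=
  WithTop.coe_le_coe.2 le_top

/-- Changing the section of a reduction adds 2 log |χ| to the logarithm of the metric. This lemma
discards that term. -/
theorem laplacian_eq_of_harmonicAt {f g F : ℂ → ℝ} {z : ℂ} (hf : ContDiffAt ℝ ∞ f z)
    (hg : InnerProductSpace.HarmonicAt g z) (h : F =ᶠ[nhds z] fun w => f w + 2 * g w) :
    Laplacian.laplacian F z = Laplacian.laplacian f z := by
  have hharm := hg.const_smul (c := (2 : ℝ))
  have e : F =ᶠ[nhds z] f + (2 : ℝ) • g := h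
  rw [(InnerProductSpace.laplacian_congr_nhds e).self_of_nhds,
    (hf.of_le two_le_infty).laplacian_add hharm.1, hharm.2.self_of_nhds]
  simp

variable {P : PrincipalBundle.{u, v} G X} {H : Subgroup G}

/-- The line bundle associated to a reduction and to a character has a Hermitian metric. -/
theorem Reduction.exists_metric [IsManifold 𝓘(ℂ) ω X] [T2Space X] [CompactSpace X] (R : Reduction P H) {χ : H →* ℂˣ}
    (hχ : IsLogHarmonic χ) : Nonempty (R.Metric χ) := by
  have _ : IsManifold 𝓘(ℝ, ℂ) ∞ X := isManifold_real
  choose U σ hxU hσ using R.exists_isSection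
  obtain ⟨t, ht⟩ := isCompact_univ.elim_finite_subcover U (fun x => (hσ x).1)
    fun x _ => Set.mem_iUnion.2 ⟨x, hxU x⟩
  obtain ⟨ρ, hρ⟩ := SmoothPartitionOfUnity.exists_isSubordinate 𝓘(ℝ, ℂ) (s := Set.univ)
    isClosed_univ (fun i : t => U i) (fun i => (hσ i).1) fun x hx => by
      obtain ⟨i, hi, hx⟩ := Set.mem_iUnion₂.1 (ht hx)
      exact Set.mem_iUnion.2 ⟨⟨i, hi⟩, hx⟩
  have hρ0 : ∀ (i : t) x, x ∉ U i → ρ i x = 0 := fun i x hx =>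
    image_eq_zero_of_notMem_tsupport fun h => hx (hρ i h)
  have hsum : ∀ x, ∑ i, ρ i x = 1 := fun x => by
    rw [← finsum_eq_sum_of_fintype]
    exact ρ.sum_eq_one (Set.mem_univ x)
  -- On each `U i` there is the metric for which `σ i` has length one. The logarithms of these
  -- metrics are averaged with the weights `ρ i`; where a point is outside `U i`, the weight is zero
  -- and the value of `logChar` is irrelevant.
  refine ⟨⟨fun {x} a => Real.exp (∑ i, ρ i x * (2 * logChar χ (P.diff (σ i x) a))),
    fun a _ => Real.exp_pos _, fun {x} a ha g => ?_, fun τ V hτ p z hz => ?_⟩⟩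
  · rw [← exp_two_logChar, ← Real.exp_add]
    congr 1
    -- Moving the point by g adds 2 log |χ(g)| to each averaged term, so the weights, having sum
    -- one, add it exactly once.
    rw [← one_mul (2 * logChar χ (g : G)), ← hsum x, Finset.sum_mul, ← Finset.sum_add_distrib]
    refine Finset.sum_congr rfl fun i _ => ?_
    by_cases hx : x ∈ U i
    · rw [P.diff_act_right, logChar_mul χ ((R.mem_iff_of_mem ((hσ i).2.2 x hx) a).1 ha) g.2]
      ring
    · simp [hρ0 i x hx]
  · refine ContDiffAt.contDiffWithinAt (ContDiffAt.exp (ContDiffAt.sum fun i _ => ?_))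
    by_cases hx : (chartAt ℂ p).symm z ∈ tsupport (ρ i)
    · refine (contDiffAt_comp_chart_symm (ρ i).contMDiff p hz.1).mul (contDiffAt_const.mul ?_)
      have hW := (hσ i).1.inter hτ.1
      refine hχ.contDiffAt hW ((hσ i).2.1.isHolMap_diff hτ.2.1) (fun y hy => ?_) p
        ⟨hz.1, hρ i hx, hz.2⟩
      exact (R.mem_iff_of_mem ((hσ i).2.2 y hy.1) _).1 (hτ.2.2 y hy.2)
    -- Off the support of `ρ i` the summand is zero in a whole neighbourhood, even where `logChar`
    -- is not smooth.
    · refine (contDiffAt_const (c := (0 : ℝ))).congr_of_eventuallyEq ?_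
      filter_upwards [eventually_chart_symm_mem (isClosed_tsupport (ρ i)).isOpen_compl p
        ⟨hz.1, hx⟩] with w hw
      rw [image_eq_zero_of_notMem_tsupport hw.2, zero_mul]

namespace Reduction.Metric

variable {R : Reduction P H} {χ : H →* ℂˣ} (μ : R.Metric χ)

/-- The first Chern form of the metric `μ` is `κ p dx dy` in the chart at `p`. -/
def IsCurvature (κ : X → ℂ → ℝ) : Prop :=
  ∀ p σ U, R.IsSection σ U → ∀ z ∈ (chartAt ℂ p).target ∩ (chartAt ℂ p).symm ⁻¹' U,
    κ p z = -(1 / (4 * Real.pi)) *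
      Laplacian.laplacian (fun w => Real.log (μ.h (σ ((chartAt ℂ p).symm w)))) z

theorem contDiffAt_log {σ : ∀ x, P.fiber x} {U : Set X} (hσ : R.IsSection σ U) (p : X) {z : ℂ}
    (hz : z ∈ (chartAt ℂ p).target ∩ (chartAt ℂ p).symm ⁻¹' U) :
    ContDiffAt ℝ ∞ (fun w => Real.log (μ.h (σ ((chartAt ℂ p).symm w)))) z :=
  ((μ.smooth σ U hσ p).contDiffAt ((isOpen_chart_preimage hσ.1 p).mem_nhds hz)).log
    (μ.h_pos _ (hσ.2.2 _ hz.2)).ne'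

theorem log_h_eq {x : X} {a b : P.fiber x} (ha : a ∈ R.carrier x) (hb : b ∈ R.carrier x) :
    Real.log (μ.h b) = Real.log (μ.h a) + 2 * logChar χ (P.diff a b) := by
  have hg := (R.mem_iff_of_mem ha b).1 hb
  have h := μ.h_act a ha ⟨_, hg⟩
  rw [P.act_diff, ← exp_two_logChar] at h
  rw [h, Real.log_mul (Real.exp_pos _).ne' (μ.h_pos a ha).ne', Real.log_exp, add_comm]

/-- The Chern form does not depend on the section: two sections differ by a holomorphic map to H,
along which log |χ| is harmonic. -/
theorem laplacian_log_eq [IsManifold 𝓘(ℂ) ω X] (hχ : IsLogHarmonic χ) {σ τ : ∀ x, P.fiber x}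
    {U V : Set X} (hσ : R.IsSection σ U) (hτ : R.IsSection τ V) (p : X) {z : ℂ}
    (hz : z ∈ (chartAt ℂ p).target) (hU : (chartAt ℂ p).symm z ∈ U)
    (hV : (chartAt ℂ p).symm z ∈ V) :
    Laplacian.laplacian (fun w => Real.log (μ.h (τ ((chartAt ℂ p).symm w)))) z =
      Laplacian.laplacian (fun w => Real.log (μ.h (σ ((chartAt ℂ p).symm w)))) z := by
  refine laplacian_eq_of_harmonicAt (μ.contDiffAt_log hσ p ⟨hz, hU⟩)
    (hχ.harmonicAt (hσ.1.inter hτ.1) (hσ.2.1.isHolMap_diff hτ.2.1)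
      (fun y hy => (R.mem_iff_of_mem (hσ.2.2 y hy.1) _).1 (hτ.2.2 y hy.2)) p ⟨hz, hU, hV⟩) ?_
  filter_upwards [eventually_chart_symm_mem (hσ.1.inter hτ.1) p ⟨hz, hU, hV⟩] with w hw
  exact μ.log_h_eq (hσ.2.2 _ hw.2.1) (hτ.2.2 _ hw.2.2)

/-- At each point the density is computed with an arbitrary section defined there, which is
legitimate by `laplacian_log_eq`. -/
theorem exists_isCurvature [IsManifold 𝓘(ℂ) ω X] (hχ : IsLogHarmonic χ) :
    ∃ κ, μ.IsCurvature κ := by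
  choose U σ hxU hσ using R.exists_isSection
  refine ⟨fun p z => -(1 / (4 * Real.pi)) * Laplacian.laplacian
    (fun w => Real.log (μ.h (σ ((chartAt ℂ p).symm z) ((chartAt ℂ p).symm w)))) z, ?_⟩
  intro p τ V hτ z hz
  rw [μ.laplacian_log_eq hχ (hσ ((chartAt ℂ p).symm z)) hτ p hz.1 (hxU _) hz.2]

variable {μ} in
-- Near each point one section computes κ as the Laplacian of a smooth function. The continuity
-- serves to make the integrals in the degree additive.
theorem IsCurvature.continuousOn {κ : X → ℂ → ℝ} (hκ : μ.IsCurvature κ) (p : X) :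
    ContinuousOn (κ p) (chartAt ℂ p).target := by
  intro z hz
  obtain ⟨U, σ, hxU, hσ⟩ := R.exists_isSection ((chartAt ℂ p).symm z)
  have hz1 : z ∈ (chartAt ℂ p).target ∩ (chartAt ℂ p).symm ⁻¹' U := ⟨hz, hxU⟩
  refine ContinuousAt.continuousWithinAt ?_
  have hF := μ.contDiffAt_log hσ p hz1
  have hc : ContinuousAt (Laplacian.laplacian
      (fun w => Real.log (μ.h (σ ((chartAt ℂ p).symm w))))) z := by
    rw [InnerProductSpace.laplacian_eq_iteratedFDeriv_complexPlane]
    have h2 := (hF.iteratedFDeriv_right (m := 0) (i := 2) two_le_infty).continuousAt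
    exact (ContinuousAt.eval_const h2 _).add (ContinuousAt.eval_const h2 _)
  refine (hc.const_mul (-(1 / (4 * Real.pi)))).congr ?_
  filter_upwards [eventually_chart_symm_mem hσ.1 p hz1] with w hw
  exact (hκ p σ U hσ w hw).symm

end Reduction.Metric

/-- A function that is continuous on the target of a chart, cut off to a compact set, is
integrable. -/
theorem integrableOn_chart_target [CompactSpace X] {ρ : X → ℝ} (hρ : Continuous ρ) (p : X)
    (hs : tsupport ρ ⊆ (chartAt ℂ p).source) {κ : ℂ → ℝ}
    (hκ : ContinuousOn κ (chartAt ℂ p).target) :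
    MeasureTheory.IntegrableOn (fun z => ρ ((chartAt ℂ p).symm z) * κ z) (chartAt ℂ p).target := by
  have hK : IsCompact (chartAt ℂ p '' tsupport ρ) :=
    (isClosed_tsupport ρ).isCompact.image_of_continuousOn ((chartAt ℂ p).continuousOn.mono hs)
  have hKt : chartAt ℂ p '' tsupport ρ ⊆ (chartAt ℂ p).target := by
    rintro _ ⟨x, hx, rfl⟩
    exact (chartAt ℂ p).map_source (hs hx)
  have hc : ContinuousOn (fun z => ρ ((chartAt ℂ p).symm z) * κ z) (chartAt ℂ p).target :=
    (hρ.comp_continuousOn (chartAt ℂ p).continuousOn_symm).mul hκ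
  refine ((hc.mono hKt).integrableOn_compact hK).of_forall_sdiff_eq_zero
    (chartAt ℂ p).open_target.measurableSet fun z hz => ?_
  have h : (chartAt ℂ p).symm z ∉ tsupport ρ := fun h =>
    hz.2 ⟨_, h, (chartAt ℂ p).right_inv hz.1⟩
  rw [image_eq_zero_of_notMem_tsupport h, zero_mul]

end Metrics

/-! ### Characters of parabolic subgroups of `SL(2, ℂ)` -/

section ParabolicCharacters

open HiggsBundles.MatrixGroup (mat)

theorem exp_of_mul_self_eq_zero {n : Type} [Fintype n] [DecidableEq n] {N : Matrix n n ℂ}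
    (hN : N * N = 0) : NormedSpace.exp N = 1 + N := by
  have h := exp_of_hasDerivAt (γ := fun t : ℂ => 1 + t • N) (B := N) (by simp) (fun s t => ?_)
    (fun i j => ?_) 1
  · simpa using h
  · simp only [mul_add, add_mul, smul_mul_smul_comm, hN, smul_zero, mul_one, one_mul, add_zero,
      add_smul]
    abel
  · have := ((hasDerivAt_id (0 : ℂ)).mul_const (N i j)).const_add ((1 : Matrix n n ℂ) i j)
    simpa using this

/-- The right-hand side, with tα in place of α, is a one-parameter subgroup in t. This is the
exponential of a diagonal matrix without a choice of basis. -/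
theorem exp_of_projections {n : Type} [Fintype n] [DecidableEq n] {p q : Matrix n n ℂ}
    (hp : p * p = p) (hq : q * q = q) (hpq : p * q = 0) (hqp : q * p = 0) (h1 : p + q = 1) (α : ℂ) :
    NormedSpace.exp (α • (p - q)) = Complex.exp α • p + Complex.exp (-α) • q := by
  have h := exp_of_hasDerivAt (γ := fun t : ℂ => Complex.exp (t * α) • p + Complex.exp (-(t * α)) • q)
    (B := α • (p - q)) (by simp [h1]) (fun s t => ?_) (fun i j => ?_) 1
  · simpa using h
  · simp only [mul_add, add_mul, smul_mul_smul_comm, hp, hq, hpq, hqp, smul_zero, zero_add,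
      add_zero, ← Complex.exp_add, neg_add]
  · have ha : HasDerivAt (fun t : ℂ => t * α) α 0 := by
      simpa using (hasDerivAt_id (0 : ℂ)).mul_const α
    have := (ha.cexp.mul_const (p i j)).add (ha.neg.cexp.mul_const (q i j))
    refine HasDerivAt.congr_deriv this ?_
    simp
    ring

/-- A singular two by two matrix has the form u vᵀ, so p g p = (vᵀ g u) p, and the scalar is the
trace of p g. -/
theorem mul_mul_eq_trace_smul {p : Matrix (Fin 2) (Fin 2) ℂ} (hp : p.det = 0)
    (g : Matrix (Fin 2) (Fin 2) ℂ) : p * g * p = (p * g).trace • p := by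
  rw [Matrix.det_fin_two] at hp
  ext i j
  fin_cases i <;> fin_cases j <;>
    simp only [Fin.zero_eta, Fin.mk_one, Matrix.mul_apply, Fin.sum_univ_two, Matrix.trace,
      Matrix.diag_apply, Matrix.smul_apply, smul_eq_mul]
  · linear_combination -(g 1 1) * hp
  · linear_combination (g 0 1) * hp
  · linear_combination (g 1 0) * hp
  · linear_combination -(g 0 0) * hp

/-- The Cayley–Hamilton identity for determinant one. -/
theorem SL₂_inv_eq (g : SLGroup 2) : mat g⁻¹ = (mat g).trace • (1 : Matrix (Fin 2) (Fin 2) ℂ) - mat g := by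
  have h : mat g⁻¹ = (mat g).adjugate := rfl
  rw [h, Matrix.adjugate_fin_two, Matrix.trace_fin_two]
  ext i j
  fin_cases i <;> fin_cases j <;> simp

/-- For Z the matrix unit E_ji, the (i, j) entry of N Z N is the square of N_ij. -/
theorem eq_zero_of_forall_mul_mul {n : Type} [Fintype n] [DecidableEq n] {N : Matrix n n ℂ}
    (h : ∀ Z, N * Z * N = 0) : N = 0 := by
  ext i j
  have := congrFun (congrFun (h (Matrix.single j i 1)) i) j
  rw [mul_assoc, Matrix.mul_apply] at this
  simpa [Matrix.single, Matrix.mul_apply, ite_and] using this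

theorem mul_self_of_trace_eq_zero {s : Matrix (Fin 2) (Fin 2) ℂ} (hs : s.trace = 0) :
    s * s = (-s.det) • (1 : Matrix (Fin 2) (Fin 2) ℂ) := by
  rw [Matrix.trace_fin_two] at hs
  have h : s 1 1 = -s 0 0 := by linear_combination hs
  ext i j
  fin_cases i <;> fin_cases j <;>
    simp [Matrix.mul_apply, Fin.sum_univ_two, Matrix.det_fin_two, h] <;> ring

/-- A nonzero semisimple element of the Lie algebra of `SL(2, ℂ)` with real eigenvalues has the
eigenvalues `r` and `-r` for some `r > 0`. -/
theorem exists_mul_self_eq_of_isRealSemisimple {s : Matrix (Fin 2) (Fin 2) ℂ}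
    (hs : IsRealSemisimple (SLGroup 2) s) (h0 : s ≠ 0) :
    ∃ r : ℝ, 0 < r ∧ s * s = ((r : ℂ) ^ 2) • (1 : Matrix (Fin 2) (Fin 2) ℂ) := by
  have hss := mul_self_of_trace_eq_zero (mem_lieAlg_SL.1 hs.1)
  by_cases h : ∃ Y, Y ≠ 0 ∧ ∃ r : ℝ, r ≠ 0 ∧ s * Y - Y * s = (r : ℂ) • Y
  · obtain ⟨Y, hY, r, hr, e⟩ := h
    have hr' : (r : ℂ) ≠ 0 := by exact_mod_cast hr
    -- Since s² is scalar, s anticommutes with each commutator [s, Y]. For an eigenvector with r ≠ 0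
    -- this gives s Y = -Y s, hence 2 s Y = r Y and 4 s² Y = r² Y.
    have e1 : s * (s * Y - Y * s) + (s * Y - Y * s) * s = 0 := by
      rw [mul_sub, sub_mul, ← mul_assoc, hss, mul_assoc Y, hss, ← mul_assoc]
      simp only [smul_mul_assoc, mul_smul_comm, one_mul, mul_one]
      abel
    rw [e, mul_smul_comm, smul_mul_assoc, ← smul_add] at e1
    have e2 := (smul_eq_zero.1 e1).resolve_left hr'
    have e3 : (2 : ℂ) • (s * Y) = (r : ℂ) • Y := by
      rw [← e, two_smul, eq_neg_of_add_eq_zero_right e2]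
      abel
    refine ⟨|r| / 2, by positivity, ?_⟩
    rw [hss]
    congr 1
    have e4 : (2 : ℂ) • (s * ((2 : ℂ) • (s * Y))) = ((r : ℂ) * r) • Y := by
      rw [e3, mul_smul_comm, smul_smul, mul_comm, ← smul_smul, e3, smul_smul]
    rw [mul_smul_comm, ← mul_assoc, hss, smul_mul_assoc, one_mul, smul_smul, smul_smul] at e4
    have e5 := smul_left_injective ℂ hY e4
    have e6 : ((|r| : ℝ) : ℂ) ^ 2 = (r : ℂ) * r := by
      rw [← Complex.ofReal_pow, sq_abs]
      push_cast
      ring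
    push_cast
    linear_combination (1 / 4 : ℂ) * e5 - (1 / 4 : ℂ) * e6
  · exfalso
    push Not at h
    apply h0
    -- Without a nonzero eigenvalue, ad s vanishes on a spanning set, so s is central; commuting
    -- with the two elementary nilpotent matrices, and being traceless, it is zero.
    have hc : ∀ Y ∈ lieAlg (SLGroup 2), s * Y - Y * s = 0 := by
      intro Y hY
      refine Submodule.span_induction (p := fun Y _ => s * Y - Y * s = 0) (fun Z hZ => ?_)
        (by simp) (fun A B _ _ hA hB => ?_) (fun c A _ hA => ?_) (hs.2 hY)
      · obtain ⟨-, r, hr⟩ := hZ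
        by_cases hZ0 : Z = 0
        · simp [hZ0]
        · by_cases hr0 : r = 0
          · simpa [hr0] using hr
          · exact absurd hr (h Z hZ0 r hr0)
      · rw [mul_add, add_mul, add_sub_add_comm, hA, hB, add_zero]
      · rw [mul_smul_comm, smul_mul_assoc, ← smul_sub, hA, smul_zero]
    have h1 := hc !![0, 1; 0, 0] (mem_lieAlg_SL.2 (by simp [Matrix.trace_fin_two]))
    have h2 := hc !![0, 0; 1, 0] (mem_lieAlg_SL.2 (by simp [Matrix.trace_fin_two]))
    have h3 := mem_lieAlg_SL.1 hs.1
    rw [Matrix.trace_fin_two] at h3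
    have a1 := congrFun (congrFun h1 0) 1
    have a2 := congrFun (congrFun h1 0) 0
    have a3 := congrFun (congrFun h2 0) 0
    simp only [Matrix.sub_apply, Matrix.mul_apply, Fin.sum_univ_two] at a1 a2 a3
    simp at a1 a2 a3
    ext i j
    fin_cases i <;> fin_cases j <;> simp
    · linear_combination (1 / 2 : ℂ) * (a1 + h3)
    · exact a3
    · exact a2
    · linear_combination (1 / 2 : ℂ) * (h3 - a1)

theorem mem_parabolicAlg_zero {Y : Matrix (Fin 2) (Fin 2) ℂ} (hY : Y.trace = 0) :
    Y ∈ parabolicAlg (SLGroup 2) 0 :=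
  Submodule.subset_span ⟨mem_lieAlg_SL.2 hY, 0, le_rfl, by simp⟩

/-- The duality condition determines χ on exponentials only. This lemma evaluates it on the
unipotent elements 1 + N = exp N. -/
theorem IsDualCharacter.eq_one_of_nilpotent {s N : Matrix (Fin 2) (Fin 2) ℂ}
    {χ : parabolicGroup (SLGroup 2) s →* ℂˣ} (hχ : IsDualCharacter s χ)
    (hN : N ∈ parabolicAlg (SLGroup 2) s) (hNN : N * N = 0) (htr : (s * N).trace = 0)
    (g : parabolicGroup (SLGroup 2) s) (hg : mat (g : SLGroup 2) = 1 + N) : χ g = 1 := by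
  ext
  rw [hχ g N hN (hg.trans (exp_of_mul_self_eq_zero hNN).symm), htr, Complex.exp_zero, Units.val_one]

/-- For s = 0 the parabolic subgroup is all of SL(2, ℂ). It is generated by elementary unipotent
matrices, on which χ is trivial because the trace pairing with s is zero. -/
theorem IsDualCharacter.zero_eq_one {χ : parabolicGroup (SLGroup 2) 0 →* ℂˣ}
    (hχ : IsDualCharacter 0 χ) (g : parabolicGroup (SLGroup 2) 0) : χ g = 1 := by
  have hmem : ∀ g : SLGroup 2, g ∈ parabolicGroup (SLGroup 2) 0 := fun g =>
    leviGroup_le_parabolicGroup 0 (show mat g * 0 = 0 * mat g by simp)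
  let U : ℂ → SLGroup 2 := fun x => ⟨!![1, x; 0, 1], by simp⟩
  let L : ℂ → SLGroup 2 := fun x => ⟨!![1, 0; x, 1], by simp⟩
  have hU : ∀ x, χ ⟨U x, hmem _⟩ = 1 := fun x =>
    hχ.eq_one_of_nilpotent (N := !![0, x; 0, 0])
      (mem_parabolicAlg_zero (by simp [Matrix.trace_fin_two]))
      (by simp [← Matrix.ext_iff, Fin.forall_fin_two])
      (by simp) _ (by
        change (!![1, x; 0, 1] : Matrix (Fin 2) (Fin 2) ℂ) = _
        ext i j
        fin_cases i <;> fin_cases j <;> simp)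
  have hL : ∀ x, χ ⟨L x, hmem _⟩ = 1 := fun x =>
    hχ.eq_one_of_nilpotent (N := !![0, 0; x, 0])
      (mem_parabolicAlg_zero (by simp [Matrix.trace_fin_two]))
      (by simp [← Matrix.ext_iff, Fin.forall_fin_two])
      (by simp) _ (by
        change (!![1, 0; x, 1] : Matrix (Fin 2) (Fin 2) ℂ) = _
        ext i j
        fin_cases i <;> fin_cases j <;> simp)
  have key : ∀ g : SLGroup 2, g.1 1 0 ≠ 0 → χ ⟨g, hmem g⟩ = 1 := by
    intro g hc
    have hd := g.2
    rw [Matrix.det_fin_two] at hd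
    -- Row and column operations: with a nonzero lower left entry, an element of SL(2, ℂ) is a
    -- product upper · lower · upper of unipotent matrices.
    have e : g = U ((g.1 0 0 - 1) / g.1 1 0) * L (g.1 1 0) * U ((g.1 1 1 - 1) / g.1 1 0) := by
      apply Subtype.ext
      change g.1 = !![1, _; 0, 1] * !![1, 0; _, 1] * !![1, _; 0, 1]
      ext i j
      fin_cases i <;> fin_cases j <;>
        simp [Matrix.mul_apply, Fin.sum_univ_two] <;> field_simp <;> ring_nf
      linear_combination -hd
    have e' : (⟨g, hmem g⟩ : parabolicGroup (SLGroup 2) 0) =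
        ⟨U ((g.1 0 0 - 1) / g.1 1 0), hmem _⟩ * ⟨L (g.1 1 0), hmem _⟩ *
          ⟨U ((g.1 1 1 - 1) / g.1 1 0), hmem _⟩ := Subtype.ext e
    rw [e', map_mul, map_mul, hU, hL, hU, one_mul, one_mul]
  by_cases hc : g.1.1 1 0 = 0
  -- If the lower left entry is zero, multiplication by `L 1` makes it nonzero.
  · have h1 : χ (g * ⟨L 1, hmem _⟩) = 1 := by
      refine key (g.1 * L 1) ?_
      change (g.1.1 * (!![1, 0; 1, 1] : Matrix (Fin 2) (Fin 2) ℂ)) 1 0 ≠ 0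
      have hd := g.1.2
      rw [Matrix.det_fin_two, hc, mul_zero, sub_zero] at hd
      simpa [Matrix.mul_apply, Fin.sum_univ_two, hc] using right_ne_zero_of_mul_eq_one hd
    rwa [map_mul, hL, mul_one] at h1
  · exact key g.1 hc

/-- χ is an abstract homomorphism, so its regularity must be derived. If s ≠ 0, then s = r (p - q)
with complementary projections of rank one, and elements g of P_s are triangular, with eigenvalues a
= tr(p g) and a⁻¹. Up to a unipotent factor, on which χ is trivial, g is exp((log a / r) s), so χ(g)
= exp(2r log a) and |χ(g)| = |a|^(2r). -/
theorem IsDualCharacter.isLogHarmonic {s : Matrix (Fin 2) (Fin 2) ℂ}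
    (hs : IsRealSemisimple (SLGroup 2) s) {χ : parabolicGroup (SLGroup 2) s →* ℂˣ}
    (hχ : IsDualCharacter s χ) : IsLogHarmonic χ := by
  by_cases h0 : s = 0
  · subst h0
    exact ⟨0, fun _ => 1, differentiable_const _, fun g => by simp [hχ.zero_eq_one g]⟩
  obtain ⟨r, hr, hss⟩ := exists_mul_self_eq_of_isRealSemisimple hs h0
  have hrc : (r : ℂ) ≠ 0 := by exact_mod_cast hr.ne'
  -- p and q are the projections onto the eigenlines of s with eigenvalues r and -r. They are
  -- introduced as opaque variables, known only through their relations.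
  obtain ⟨p, hp⟩ : ∃ p, p = (1 / (2 * r) : ℂ) • (s + (r : ℂ) • (1 : Matrix (Fin 2) (Fin 2) ℂ)) :=
    ⟨_, rfl⟩
  obtain ⟨q, hq⟩ : ∃ q, q = 1 - p := ⟨_, rfl⟩
  have htr := mem_lieAlg_SL.1 hs.1
  have hpp : p * p = p := by
    rw [hp]
    simp only [mul_add, add_mul, hss, mul_one, one_mul, smul_add, smul_smul,
      mul_smul_comm, smul_mul_assoc]
    match_scalars <;> field_simp <;> ring
  have hqq : q * q = q := by rw [hq]; simp [mul_sub, sub_mul, hpp]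
  have hpq : p * q = 0 := by rw [hq, mul_sub, mul_one, hpp, sub_self]
  have hqp : q * p = 0 := by rw [hq, sub_mul, one_mul, hpp, sub_self]
  have hadd : p + q = 1 := by rw [hq]; abel
  have hspq : s = (r : ℂ) • (p - q) := by
    rw [hq, hp]
    match_scalars <;> field_simp <;> ring
  have hsp : s * p = (r : ℂ) • p := by
    rw [hspq, smul_mul_assoc, sub_mul, hpp, hqp, sub_zero]
  have hqs : q * s = -(r : ℂ) • q := by
    rw [hspq, mul_smul_comm, mul_sub, hqp, hqq, zero_sub, smul_neg, neg_smul]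
  have hqs' : s * q = -(r : ℂ) • q := by
    rw [hspq, smul_mul_assoc, sub_mul, hpq, hqq, zero_sub, smul_neg, neg_smul]
  -- An invertible projection is 1, and then s would be a nonzero scalar matrix, against its
  -- vanishing trace. The same applies to q.
  have hdetp : p.det = 0 := by
    have h1 : p.det * q.det = 0 := by rw [← Matrix.det_mul, hpq]; simp
    by_contra hne
    have h2 : p = 1 := by
      have hu : IsUnit p := (Matrix.isUnit_iff_isUnit_det p).2 (isUnit_iff_ne_zero.2 hne)
      exact hu.mul_left_cancel (by rw [hpp, mul_one])
    rw [hq, h2, sub_self, sub_zero] at hspq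
    rw [hspq, Matrix.trace_smul, Matrix.trace_one] at htr
    simp [hrc] at htr
  have hdetq : q.det = 0 := by
    by_contra hne
    have h2 : q = 1 := by
      have hu : IsUnit q := (Matrix.isUnit_iff_isUnit_det q).2 (isUnit_iff_ne_zero.2 hne)
      exact hu.mul_left_cancel (by rw [hqq, mul_one])
    have h3 : p = 0 := by rw [h2] at hpq; simpa using hpq
    rw [h2, h3, zero_sub] at hspq
    rw [hspq, Matrix.trace_smul, Matrix.trace_neg, Matrix.trace_one] at htr
    simp [hrc] at htr
  have hp0 : p ≠ 0 := by
    intro h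
    rw [h, zero_add] at hadd
    rw [hadd, Matrix.det_one] at hdetq
    exact one_ne_zero hdetq
  have hpar : ∀ Z, p * Z * q ∈ parabolicAlg (SLGroup 2) s := by
    intro Z
    refine Submodule.subset_span ⟨mem_lieAlg_SL.2 ?_, 2 * r, by positivity, ?_⟩
    · rw [Matrix.trace_mul_comm, ← mul_assoc, hqp, zero_mul, Matrix.trace_zero]
    · have hqs2 : q * s = -(r : ℂ) • q := hqs
      rw [← mul_assoc, ← mul_assoc, hsp, mul_assoc _ q s, hqs2]
      simp only [smul_mul_assoc, mul_smul_comm]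
      rw [← sub_smul]
      congr 1
      push_cast
      ring
  -- q Y p is the component of Y with ad s-eigenvalue -2r, which is negative and so does not occur
  -- in 𝔭_s.
  have hzero : ∀ Y ∈ parabolicAlg (SLGroup 2) s, q * Y * p = 0 := by
    intro Y hY
    refine Submodule.span_induction (p := fun Y _ => q * Y * p = 0) (fun Y h => ?_) (by simp)
      (fun A B _ _ hA hB => by rw [mul_add, add_mul, hA, hB, add_zero])
      (fun c A _ hA => by rw [mul_smul_comm, smul_mul_assoc, hA, smul_zero]) hY
    obtain ⟨-, a, ha, e⟩ := h
    have e1 : q * (s * Y - Y * s) * p = q * ((a : ℂ) • Y) * p := by rw [e]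
    rw [mul_sub, sub_mul, ← mul_assoc, hqs, mul_assoc q (Y * s), mul_assoc Y, hsp] at e1
    simp only [smul_mul_assoc, mul_smul_comm, ← mul_assoc] at e1
    have e2 : ((a : ℂ) + 2 * r) • (q * Y * p) = 0 := by
      rw [add_smul, ← e1, ← sub_smul, ← add_smul]
      refine (congrArg (· • (q * Y * p)) ?_).trans (zero_smul ℂ _)
      ring
    refine (smul_eq_zero.1 e2).resolve_left ?_
    have : a + 2 * r ≠ 0 := by positivity
    exact_mod_cast this
  have hborel : ∀ g ∈ parabolicGroup (SLGroup 2) s, q * mat g * p = 0 := by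
    intro g hg
    -- g conjugates the nilpotent element pZq into 𝔭_s, so q g (pZq) g⁻¹ p = 0. As q g⁻¹ p = -q g p,
    -- this reads N Z N = 0 for N = q g p.
    refine eq_zero_of_forall_mul_mul fun Z => ?_
    have h1 := hzero _ ((mem_parabolicGroup_iff.1 hg).1 _ (hpar (p * Z * q)))
    have h2 : q * mat g⁻¹ * p = -(q * mat g * p) := by
      rw [SL₂_inv_eq, mul_sub, sub_mul, mul_smul_comm, smul_mul_assoc, mul_one, hqp, smul_zero,
        zero_sub]
    have h3 : q * (mat g * (p * (p * Z * q) * q) * mat g⁻¹) * p =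
        (q * mat g * p) * Z * (q * mat g⁻¹ * p) := by
      have hp2 : p * (p * Z * q) * q = p * Z * q := by
        rw [mul_assoc, mul_assoc (p * Z), hqq, mul_assoc p Z, ← mul_assoc p p, hpp]
      rw [hp2]
      simp only [mul_assoc]
    rw [h3, h2, mul_neg, neg_eq_zero] at h1
    exact h1
  -- The exponent is 2r because tr(s · (log a / r) s) = 2r log a; the holomorphic function is the
  -- eigenvalue tr(p g).
  refine ⟨2 * r, fun M => (p * Matrix.of M).trace, ?_, fun g => ?_⟩
  · simp only [Matrix.trace, Matrix.diag_apply, Matrix.mul_apply, Matrix.of_apply]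
    fun_prop
  have hb := hborel g.1 g.2
  set M : Matrix (Fin 2) (Fin 2) ℂ := mat (g : SLGroup 2) with hM
  change (p * M).trace ≠ 0 ∧ _ = _ * Real.log ‖(p * M).trace‖
  set a := (p * M).trace with ha
  have hMp : M * p = a • p := by
    rw [← mul_mul_eq_trace_smul hdetp M]
    calc M * p = (p + q) * M * p := by rw [hadd, one_mul]
      _ = p * M * p := by rw [add_mul, add_mul, hb, add_zero]
  have hqM : q * M = (q * M).trace • q := by
    rw [← mul_mul_eq_trace_smul hdetq M]
    calc q * M = q * M * (p + q) := by rw [hadd, mul_one]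
      _ = q * M * q := by rw [mul_add, hb, zero_add]
  have htrM : M.trace = a + (q * M).trace := by
    rw [ha, ← Matrix.trace_add, ← add_mul, hadd, one_mul]
  -- These are the two eigenvalues of M. That their product is one is obtained by applying M and its
  -- inverse to the range of p.
  have hprod : a * (q * M).trace = 1 := by
    have h1 : mat (g : SLGroup 2)⁻¹ * p = (q * M).trace • p := by
      rw [SL₂_inv_eq, sub_mul, smul_mul_assoc, one_mul, ← hM, hMp, htrM, ← sub_smul]
      congr 1
      ring
    have h2 : M * (mat (g : SLGroup 2)⁻¹ * p) = p := by
      rw [← mul_assoc, hM, mat_mul_mat_inv, one_mul]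
    rw [h1, mul_smul_comm, hMp, smul_smul] at h2
    have h3 : ((q * M).trace * a) • p = (1 : ℂ) • p := by rw [h2, one_smul]
    rw [mul_comm]
    exact smul_left_injective ℂ hp0 h3
  have ha0 : a ≠ 0 := left_ne_zero_of_mul_eq_one hprod
  have hinv : (q * M).trace = a⁻¹ := eq_inv_of_mul_eq_one_right hprod
  refine ⟨ha0, ?_⟩
  have hsmem : (Complex.log a / r) • s ∈ parabolicAlg (SLGroup 2) s :=
    Submodule.smul_mem _ _ (Submodule.subset_span ⟨hs.1, 0, le_rfl, by simp⟩)
  have hD : NormedSpace.exp ((Complex.log a / r) • s) = a • p + a⁻¹ • q := by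
    conv_lhs => rw [hspq]
    rw [smul_smul, div_mul_cancel₀ _ hrc, exp_of_projections hpp hqq hpq hqp hadd,
      Complex.exp_log ha0, Complex.exp_neg, Complex.exp_log ha0]
  let D : SLGroup 2 := expG (SLGroup 2) ((Complex.log a / r) • s) 1
  have hDmat : mat D = a • p + a⁻¹ • q := by
    rw [mat_expG (smul_mem_lieAlg hs.1 _), one_smul, hD]
  have hDP : D ∈ parabolicGroup (SLGroup 2) s := by
    refine leviGroup_le_parabolicGroup s (show mat D * s = s * mat D from ?_)
    have hps : p * s = (r : ℂ) • p := by
      rw [hspq, mul_smul_comm, mul_sub, hpp, hpq, sub_zero]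
    rw [hDmat, add_mul, mul_add, smul_mul_assoc, smul_mul_assoc, mul_smul_comm, mul_smul_comm,
      hps, hsp, hqs, hqs']
  -- D is the diagonal part of g. The quotient D⁻¹ g is 1 + N with N = p (a⁻¹ M) q, which has square
  -- zero and is orthogonal to s for the trace form.
  have hgD : χ g = χ ⟨D, hDP⟩ := by
    have hN : mat ((⟨D, hDP⟩⁻¹ * g : parabolicGroup (SLGroup 2) s) : SLGroup 2) =
        1 + p * (a⁻¹ • M) * q := by
      have hDi : mat D⁻¹ = a⁻¹ • p + a • q := by
        rw [mat_inv]
        refine Matrix.inv_eq_right_inv ?_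
        rw [hDmat]
        simp only [mul_add, add_mul, smul_mul_smul_comm, hpp, hqq, hpq, hqp, smul_zero, zero_add,
          add_zero, mul_inv_cancel₀ ha0, inv_mul_cancel₀ ha0, one_smul, hadd]
      change mat (D⁻¹ * (g : SLGroup 2)) = _
      have hMdec : M = a • p + p * M * q + a⁻¹ • q := by
        calc M = M * p + (p + q) * M * q := by rw [hadd, one_mul, ← mul_add, hadd, mul_one]
          _ = _ := by rw [hMp, add_mul, add_mul, hqM, smul_mul_assoc, hqq, hinv, add_assoc]
      rw [map_mul, hDi, ← hM]
      conv_lhs => rw [hMdec]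
      simp only [mul_add, add_mul, smul_mul_assoc, mul_smul_comm, ← mul_assoc, hpp, hqq, hpq, hqp,
        smul_zero, zero_add, add_zero]
      rw [smul_inv_smul₀ ha0, inv_smul_smul₀ ha0, ← hadd]
      abel
    have h1 := hχ.eq_one_of_nilpotent (hpar (a⁻¹ • M)) ?_ ?_ _ hN
    · rw [map_mul, map_inv, inv_mul_eq_one] at h1
      exact h1.symm
    · rw [mul_assoc _ q, ← mul_assoc q, ← mul_assoc q, hqp, zero_mul, zero_mul, mul_zero]
    · rw [← mul_assoc, ← mul_assoc, hsp, Matrix.trace_mul_comm, smul_mul_assoc, mul_smul_comm,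
        ← mul_assoc, hqp, zero_mul, smul_zero, Matrix.trace_zero]
  have htr2 : (s * ((Complex.log a / r) • s)).trace = 2 * r * Complex.log a := by
    rw [mul_smul_comm, hss, smul_smul, Matrix.trace_smul, Matrix.trace_one]
    simp only [Fintype.card_fin, smul_eq_mul, Nat.cast_ofNat]
    field_simp
  rw [hgD, hχ ⟨D, hDP⟩ _ hsmem (hDmat.trans hD.symm), htr2, Complex.norm_exp, Real.log_exp]
  have : (2 * (r : ℂ) * Complex.log a) = ((2 * r : ℝ) : ℂ) * Complex.log a := by push_cast; ring
  rw [this, Complex.re_ofReal_mul, Complex.log_re]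

end ParabolicCharacters

/-! ### Parabolic subgroups of a product -/

section ProductParabolic

open HiggsBundles.MatrixGroup (mat)

section Transfer

variable {n m : Type} [Fintype n] [DecidableEq n] [Fintype m] [DecidableEq m]
variable {G : Type} [Group G] [MatrixGroup G n] {G' : Type} [Group G'] [MatrixGroup G' m]

/-- A linear map that intertwines ad s and ad s' takes eigenvectors to eigenvectors with the same
eigenvalue. It is applied to the block projections and inclusions of the product. -/
theorem map_mem_parabolicAlg {f : Matrix n n ℂ →ₗ[ℂ] Matrix m m ℂ} {s : Matrix n n ℂ}
    {s' : Matrix m m ℂ} (hf : ∀ Y ∈ lieAlg G, f Y ∈ lieAlg G')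
    (hs : ∀ Y ∈ lieAlg G, s' * f Y - f Y * s' = f (s * Y - Y * s)) {Y : Matrix n n ℂ}
    (hY : Y ∈ parabolicAlg G s) : f Y ∈ parabolicAlg G' s' := by
  have h : parabolicAlg G s ≤ (parabolicAlg G' s').comap f := by
    refine Submodule.span_le.2 ?_
    rintro Z ⟨hZ, r, hr, e⟩
    exact Submodule.subset_span ⟨hf Z hZ, r, hr, by rw [hs Z hZ, e, map_smul]⟩
  exact h hY

theorem isRealSemisimple_of_retract {f : Matrix n n ℂ →ₗ[ℂ] Matrix m m ℂ} {s : Matrix n n ℂ}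
    {s' : Matrix m m ℂ} (hf : ∀ Y ∈ lieAlg G, f Y ∈ lieAlg G')
    (hs : ∀ Y ∈ lieAlg G, s' * f Y - f Y * s' = f (s * Y - Y * s)) (hs' : s' ∈ lieAlg G')
    (hsurj : ∀ Z ∈ lieAlg G', ∃ Y ∈ lieAlg G, f Y = Z) (h : IsRealSemisimple G s) :
    IsRealSemisimple G' s' := by
  refine ⟨hs', fun Z hZ => ?_⟩
  obtain ⟨Y, hY, rfl⟩ := hsurj Z hZ
  have key : Submodule.span ℂ {Y | Y ∈ lieAlg G ∧ ∃ r : ℝ, s * Y - Y * s = (r : ℂ) • Y} ≤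
      (Submodule.span ℂ {Y | Y ∈ lieAlg G' ∧ ∃ r : ℝ, s' * Y - Y * s' = (r : ℂ) • Y}).comap f := by
    refine Submodule.span_le.2 ?_
    rintro Z ⟨hZ, r, e⟩
    exact Submodule.subset_span ⟨hf Z hZ, r, by rw [hs Z hZ, e, map_smul]⟩
  exact key (h.2 hY)

end Transfer

/-- The upper left block of a matrix. -/
def blockFst : Matrix (Fin 2 ⊕ Fin 2) (Fin 2 ⊕ Fin 2) ℂ →ₗ[ℂ] Matrix (Fin 2) (Fin 2) ℂ where
  toFun := Matrix.toBlocks₁₁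
  map_add' _ _ := rfl
  map_smul' _ _ := rfl

/-- The lower right block of a matrix. -/
def blockSnd : Matrix (Fin 2 ⊕ Fin 2) (Fin 2 ⊕ Fin 2) ℂ →ₗ[ℂ] Matrix (Fin 2) (Fin 2) ℂ where
  toFun := Matrix.toBlocks₂₂
  map_add' _ _ := rfl
  map_smul' _ _ := rfl

/-- The block diagonal matrix with blocks `A` and zero. -/
def blockInl : Matrix (Fin 2) (Fin 2) ℂ →ₗ[ℂ] Matrix (Fin 2 ⊕ Fin 2) (Fin 2 ⊕ Fin 2) ℂ where
  toFun A := Matrix.fromBlocks A 0 0 0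
  map_add' _ _ := by simp [Matrix.fromBlocks_add]
  map_smul' _ _ := by simp [Matrix.fromBlocks_smul]

/-- The block diagonal matrix with blocks zero and `A`. -/
def blockInr : Matrix (Fin 2) (Fin 2) ℂ →ₗ[ℂ] Matrix (Fin 2 ⊕ Fin 2) (Fin 2 ⊕ Fin 2) ℂ where
  toFun A := Matrix.fromBlocks 0 0 0 A
  map_add' _ _ := by simp [Matrix.fromBlocks_add]
  map_smul' _ _ := by simp [Matrix.fromBlocks_smul]

theorem blockFst_mem {Y : Matrix (Fin 2 ⊕ Fin 2) (Fin 2 ⊕ Fin 2) ℂ}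
    (hY : Y ∈ lieAlg (SLGroup 2 × SLGroup 2)) : blockFst Y ∈ lieAlg (SLGroup 2) := by
  obtain ⟨A, B, hA, -, rfl⟩ := mem_lieAlg_prod.1 hY
  exact mem_lieAlg_SL.2 hA

theorem blockSnd_mem {Y : Matrix (Fin 2 ⊕ Fin 2) (Fin 2 ⊕ Fin 2) ℂ}
    (hY : Y ∈ lieAlg (SLGroup 2 × SLGroup 2)) : blockSnd Y ∈ lieAlg (SLGroup 2) := by
  obtain ⟨A, B, -, hB, rfl⟩ := mem_lieAlg_prod.1 hY
  exact mem_lieAlg_SL.2 hB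

theorem blockInl_mem {Y : Matrix (Fin 2) (Fin 2) ℂ} (hY : Y ∈ lieAlg (SLGroup 2)) :
    blockInl Y ∈ lieAlg (SLGroup 2 × SLGroup 2) :=
  mem_lieAlg_prod.2 ⟨Y, 0, mem_lieAlg_SL.1 hY, Matrix.trace_zero _ _, rfl⟩

theorem blockInr_mem {Y : Matrix (Fin 2) (Fin 2) ℂ} (hY : Y ∈ lieAlg (SLGroup 2)) :
    blockInr Y ∈ lieAlg (SLGroup 2 × SLGroup 2) :=
  mem_lieAlg_prod.2 ⟨0, Y, Matrix.trace_zero _ _, mem_lieAlg_SL.1 hY, rfl⟩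

variable {s₁ s₂ : Matrix (Fin 2) (Fin 2) ℂ}

theorem blockFst_ad {Y : Matrix (Fin 2 ⊕ Fin 2) (Fin 2 ⊕ Fin 2) ℂ}
    (hY : Y ∈ lieAlg (SLGroup 2 × SLGroup 2)) : s₁ * blockFst Y - blockFst Y * s₁ =
      blockFst (Matrix.fromBlocks s₁ 0 0 s₂ * Y - Y * Matrix.fromBlocks s₁ 0 0 s₂) := by
  obtain ⟨A, B, -, -, rfl⟩ := mem_lieAlg_prod.1 hY
  have e : ∀ A B, blockFst (Matrix.fromBlocks A 0 0 B) = A := fun A B => rfl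
  rw [map_sub]
  simp [e, Matrix.fromBlocks_multiply]

theorem blockSnd_ad {Y : Matrix (Fin 2 ⊕ Fin 2) (Fin 2 ⊕ Fin 2) ℂ}
    (hY : Y ∈ lieAlg (SLGroup 2 × SLGroup 2)) : s₂ * blockSnd Y - blockSnd Y * s₂ =
      blockSnd (Matrix.fromBlocks s₁ 0 0 s₂ * Y - Y * Matrix.fromBlocks s₁ 0 0 s₂) := by
  obtain ⟨A, B, -, -, rfl⟩ := mem_lieAlg_prod.1 hY
  have e : ∀ A B, blockSnd (Matrix.fromBlocks A 0 0 B) = B := fun A B => rfl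
  rw [map_sub]
  simp [e, Matrix.fromBlocks_multiply]

theorem blockInl_ad (Y : Matrix (Fin 2) (Fin 2) ℂ) : Matrix.fromBlocks s₁ 0 0 s₂ * blockInl Y -
    blockInl Y * Matrix.fromBlocks s₁ 0 0 s₂ = blockInl (s₁ * Y - Y * s₁) := by
  rw [map_sub]
  simp [blockInl, Matrix.fromBlocks_multiply]

theorem blockInr_ad (Y : Matrix (Fin 2) (Fin 2) ℂ) : Matrix.fromBlocks s₁ 0 0 s₂ * blockInr Y -
    blockInr Y * Matrix.fromBlocks s₁ 0 0 s₂ = blockInr (s₂ * Y - Y * s₂) := by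
  rw [map_sub]
  simp [blockInr, Matrix.fromBlocks_multiply]

theorem IsRealSemisimple.fst
    (h : IsRealSemisimple (SLGroup 2 × SLGroup 2) (Matrix.fromBlocks s₁ 0 0 s₂)) :
    IsRealSemisimple (SLGroup 2) s₁ :=
  isRealSemisimple_of_retract (f := blockFst) (fun _ => blockFst_mem) (fun _ => blockFst_ad)
    (blockFst_mem h.1) (fun Z hZ => ⟨blockInl Z, blockInl_mem hZ, rfl⟩) h

theorem IsRealSemisimple.snd
    (h : IsRealSemisimple (SLGroup 2 × SLGroup 2) (Matrix.fromBlocks s₁ 0 0 s₂)) :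
    IsRealSemisimple (SLGroup 2) s₂ :=
  isRealSemisimple_of_retract (f := blockSnd) (fun _ => blockSnd_mem) (fun _ => blockSnd_ad)
    (blockSnd_mem h.1) (fun Z hZ => ⟨blockInr Z, blockInr_mem hZ, rfl⟩) h

theorem lieAlg_prod_add_mem (A : Matrix (Fin 2 ⊕ Fin 2) (Fin 2 ⊕ Fin 2) ℂ)
    (hA : A ∈ lieAlg (SLGroup 2 × SLGroup 2)) (B : Matrix (Fin 2 ⊕ Fin 2) (Fin 2 ⊕ Fin 2) ℂ)
    (hB : B ∈ lieAlg (SLGroup 2 × SLGroup 2)) : A + B ∈ lieAlg (SLGroup 2 × SLGroup 2) := by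
  rw [mem_lieAlg_prod] at *
  obtain ⟨A₁, A₂, h1, h2, rfl⟩ := hA
  obtain ⟨B₁, B₂, h3, h4, rfl⟩ := hB
  exact ⟨A₁ + B₁, A₂ + B₂, by rw [Matrix.trace_add, h1, h3, add_zero],
    by rw [Matrix.trace_add, h2, h4, add_zero], by simp [Matrix.fromBlocks_add]⟩

theorem mem_parabolicAlg_prod {Y₁ Y₂ : Matrix (Fin 2) (Fin 2) ℂ} :
    Matrix.fromBlocks Y₁ 0 0 Y₂ ∈
        parabolicAlg (SLGroup 2 × SLGroup 2) (Matrix.fromBlocks s₁ 0 0 s₂) ↔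
      Y₁ ∈ parabolicAlg (SLGroup 2) s₁ ∧ Y₂ ∈ parabolicAlg (SLGroup 2) s₂ := by
  constructor
  · intro h
    exact ⟨map_mem_parabolicAlg (f := blockFst) (fun _ => blockFst_mem) (fun _ => blockFst_ad) h,
      map_mem_parabolicAlg (f := blockSnd) (fun _ => blockSnd_mem) (fun _ => blockSnd_ad) h⟩
  · rintro ⟨h1, h2⟩
    have e : Matrix.fromBlocks Y₁ 0 0 Y₂ = blockInl Y₁ + blockInr Y₂ := by
      simp [blockInl, blockInr, Matrix.fromBlocks_add]
    rw [e]
    exact Submodule.add_mem _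
      (map_mem_parabolicAlg (f := blockInl) (fun _ => blockInl_mem) (fun Y _ => blockInl_ad Y) h1)
      (map_mem_parabolicAlg (f := blockInr) (fun _ => blockInr_mem) (fun Y _ => blockInr_ad Y) h2)

theorem exists_of_mem_parabolicAlg_prod {Y : Matrix (Fin 2 ⊕ Fin 2) (Fin 2 ⊕ Fin 2) ℂ}
    (hY : Y ∈ parabolicAlg (SLGroup 2 × SLGroup 2) (Matrix.fromBlocks s₁ 0 0 s₂)) :
    ∃ Y₁ ∈ parabolicAlg (SLGroup 2) s₁, ∃ Y₂ ∈ parabolicAlg (SLGroup 2) s₂,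
      Y = Matrix.fromBlocks Y₁ 0 0 Y₂ := by
  obtain ⟨A, B, -, -, rfl⟩ := mem_lieAlg_prod.1 (parabolicAlg_subset lieAlg_prod_add_mem hY)
  obtain ⟨h1, h2⟩ := mem_parabolicAlg_prod.1 hY
  exact ⟨A, h1, B, h2, rfl⟩

theorem mat_prod_conj (g h : SLGroup 2 × SLGroup 2) (A B : Matrix (Fin 2) (Fin 2) ℂ) :
    mat g * Matrix.fromBlocks A 0 0 B * mat h =
      Matrix.fromBlocks (mat g.1 * A * mat h.1) 0 0 (mat g.2 * B * mat h.2) := by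
  change Matrix.fromBlocks (mat g.1) 0 0 (mat g.2) * _ *
    Matrix.fromBlocks (mat h.1) 0 0 (mat h.2) = _
  simp [Matrix.fromBlocks_multiply]

/-- Testing the normalizer condition on matrices with one zero block separates the two factors. -/
theorem mem_parabolicGroup_prod {g : SLGroup 2 × SLGroup 2} :
    g ∈ parabolicGroup (SLGroup 2 × SLGroup 2) (Matrix.fromBlocks s₁ 0 0 s₂) ↔
      g.1 ∈ parabolicGroup (SLGroup 2) s₁ ∧ g.2 ∈ parabolicGroup (SLGroup 2) s₂ := by
  constructor
  · intro h
    constructor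
    · intro Y
      have := h (Matrix.fromBlocks Y 0 0 0)
      rw [mat_prod_conj, mem_parabolicAlg_prod, mem_parabolicAlg_prod] at this
      simpa using this
    · intro Y
      have := h (Matrix.fromBlocks 0 0 0 Y)
      rw [mat_prod_conj, mem_parabolicAlg_prod, mem_parabolicAlg_prod] at this
      simpa using this
  · rintro ⟨h1, h2⟩
    rw [mem_parabolicGroup_iff] at h1 h2 ⊢
    constructor
    · intro Y hY
      obtain ⟨A, hA, B, hB, rfl⟩ := exists_of_mem_parabolicAlg_prod hY
      rw [mat_prod_conj, mem_parabolicAlg_prod]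
      exact ⟨h1.1 A hA, h2.1 B hB⟩
    · intro Y hY
      obtain ⟨A, hA, B, hB, rfl⟩ := exists_of_mem_parabolicAlg_prod hY
      rw [mat_prod_conj, mem_parabolicAlg_prod]
      exact ⟨h1.2 A hA, h2.2 B hB⟩

theorem mem_leviGroup_prod {g : SLGroup 2 × SLGroup 2} :
    g ∈ leviGroup (SLGroup 2 × SLGroup 2) (Matrix.fromBlocks s₁ 0 0 s₂) ↔
      g.1 ∈ leviGroup (SLGroup 2) s₁ ∧ g.2 ∈ leviGroup (SLGroup 2) s₂ := by
  change Matrix.fromBlocks (mat g.1) 0 0 (mat g.2) * _ =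
    _ * Matrix.fromBlocks (mat g.1) 0 0 (mat g.2) ↔
      mat g.1 * s₁ = s₁ * mat g.1 ∧ mat g.2 * s₂ = s₂ * mat g.2
  simp [Matrix.fromBlocks_multiply, Matrix.fromBlocks_inj]

/-- The inclusion of the first factor of the parabolic subgroup of a product. -/
def parabolicInl (s₁ s₂ : Matrix (Fin 2) (Fin 2) ℂ) : parabolicGroup (SLGroup 2) s₁ →*
    parabolicGroup (SLGroup 2 × SLGroup 2) (Matrix.fromBlocks s₁ 0 0 s₂) :=
  ((MonoidHom.inl (SLGroup 2) (SLGroup 2)).comp (Subgroup.subtype _)).codRestrict _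
    fun g => mem_parabolicGroup_prod.2 ⟨g.2, Subgroup.one_mem _⟩

/-- The inclusion of the second factor of the parabolic subgroup of a product. -/
def parabolicInr (s₁ s₂ : Matrix (Fin 2) (Fin 2) ℂ) : parabolicGroup (SLGroup 2) s₂ →*
    parabolicGroup (SLGroup 2 × SLGroup 2) (Matrix.fromBlocks s₁ 0 0 s₂) :=
  ((MonoidHom.inr (SLGroup 2) (SLGroup 2)).comp (Subgroup.subtype _)).codRestrict _
    fun g => mem_parabolicGroup_prod.2 ⟨Subgroup.one_mem _, g.2⟩

variable {χ : parabolicGroup (SLGroup 2 × SLGroup 2) (Matrix.fromBlocks s₁ 0 0 s₂) →* ℂˣ}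

/-- The restriction of χ to the first factor sees only s₁, since block diagonal traces add. -/
theorem IsDualCharacter.inl (hχ : IsDualCharacter (Matrix.fromBlocks s₁ 0 0 s₂) χ) :
    IsDualCharacter s₁ (χ.comp (parabolicInl s₁ s₂)) := by
  intro g Y hY e
  have h := hχ (parabolicInl s₁ s₂ g) (Matrix.fromBlocks Y 0 0 0)
    (mem_parabolicAlg_prod.2 ⟨hY, Submodule.zero_mem _⟩) ?_
  · refine h.trans ?_
    simp [Matrix.fromBlocks_multiply, Matrix.trace, Fintype.sum_sum_type]
  · rw [exp_fromBlocks, ← e, NormedSpace.exp_zero]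
    rfl

theorem IsDualCharacter.inr (hχ : IsDualCharacter (Matrix.fromBlocks s₁ 0 0 s₂) χ) :
    IsDualCharacter s₂ (χ.comp (parabolicInr s₁ s₂)) := by
  intro g Y hY e
  have h := hχ (parabolicInr s₁ s₂ g) (Matrix.fromBlocks 0 0 0 Y)
    (mem_parabolicAlg_prod.2 ⟨Submodule.zero_mem _, hY⟩) ?_
  · refine h.trans ?_
    simp [Matrix.fromBlocks_multiply, Matrix.trace, Fintype.sum_sum_type]
  · rw [exp_fromBlocks, ← e, NormedSpace.exp_zero]
    rfl

end ProductParabolic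

/-! ### Polystability of products -/

section ProductStability

open HiggsBundles.MatrixGroup (mat)

theorem Reduction.exists_mem {X : Type u} [TopologicalSpace X] [ChartedSpace ℂ X]
    {n : Type} [Fintype n] [DecidableEq n] {G : Type} [Group G] [MatrixGroup G n]
    {P : PrincipalBundle.{u, v} G X} {H : Subgroup G} (R : Reduction P H) (x : X) :
    ∃ a, a ∈ R.carrier x := by
  obtain ⟨U, σ, hx, hσ⟩ := R.exists_isSection x
  exact ⟨σ x, hσ.2.2 x hx⟩

variable {X : Type u} [TopologicalSpace X] [ChartedSpace ℂ X] [IsManifold 𝓘(ℂ) ω X]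
variable {P₁ P₂ : PrincipalHiggs.{u, v} (SLGroup 2) X} {s₁ s₂ : Matrix (Fin 2) (Fin 2) ℂ}

namespace Reduction

/-- The first component of a reduction of a product. -/
def fst (R : Reduction (P₁.prod P₂).toPrincipalBundle
      (parabolicGroup (SLGroup 2 × SLGroup 2) (Matrix.fromBlocks s₁ 0 0 s₂))) :
    Reduction P₁.toPrincipalBundle (parabolicGroup (SLGroup 2) s₁) :=
  R.map (HiggsHom.fst P₁ P₂) fun _ hg => (mem_parabolicGroup_prod.1 hg).1

/-- The second component of a reduction of a product. -/
def snd (R : Reduction (P₁.prod P₂).toPrincipalBundle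
      (parabolicGroup (SLGroup 2 × SLGroup 2) (Matrix.fromBlocks s₁ 0 0 s₂))) :
    Reduction P₂.toPrincipalBundle (parabolicGroup (SLGroup 2) s₂) :=
  R.map (HiggsHom.snd P₁ P₂) fun _ hg => (mem_parabolicGroup_prod.1 hg).2

variable (R : Reduction (P₁.prod P₂).toPrincipalBundle
      (parabolicGroup (SLGroup 2 × SLGroup 2) (Matrix.fromBlocks s₁ 0 0 s₂)))

/-- Both sides are orbits through the same point, under P_s and under the product of the two
parabolic subgroups, which coincide. -/
theorem mem_prod_iff {x : X} {a₁ : P₁.fiber x} {a₂ : P₂.fiber x} :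
    (show (P₁.prod P₂).fiber x from (a₁, a₂)) ∈ R.carrier x ↔
      a₁ ∈ R.fst.carrier x ∧ a₂ ∈ R.snd.carrier x := by
  obtain ⟨⟨b₁, b₂⟩, hb⟩ := R.exists_mem x
  have h1 : b₁ ∈ R.fst.carrier x := R.map_mem_map (HiggsHom.fst P₁ P₂) _ hb
  have h2 : b₂ ∈ R.snd.carrier x := R.map_mem_map (HiggsHom.snd P₁ P₂) _ hb
  rw [R.mem_iff_of_mem hb, R.fst.mem_iff_of_mem h1, R.snd.mem_iff_of_mem h2]
  exact mem_parabolicGroup_prod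

theorem isHiggsReduction_fst (hR : (P₁.prod P₂).IsHiggsReduction R) :
    P₁.IsHiggsReduction R.fst := by
  intro x a ha t
  obtain ⟨b, hb⟩ := R.snd.exists_mem x
  exact (mem_parabolicAlg_prod.1 (hR x _ (R.mem_prod_iff.2 ⟨ha, hb⟩) t)).1

theorem isHiggsReduction_snd (hR : (P₁.prod P₂).IsHiggsReduction R) :
    P₂.IsHiggsReduction R.snd := by
  intro x a ha t
  obtain ⟨b, hb⟩ := R.fst.exists_mem x
  exact (mem_parabolicAlg_prod.1 (hR x _ (R.mem_prod_iff.2 ⟨hb, ha⟩) t)).2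

variable {R} in
theorem IsSection.prod {σ₁ : ∀ x, P₁.fiber x} {σ₂ : ∀ x, P₂.fiber x} {U₁ U₂ : Set X}
    (h₁ : R.fst.IsSection σ₁ U₁) (h₂ : R.snd.IsSection σ₂ U₂) :
    R.IsSection (fun x => (σ₁ x, σ₂ x)) (U₁ ∩ U₂) :=
  ⟨h₁.1.inter h₂.1, fun p => isHolMap_prod
    (IsHolMap.mono (h₁.2.1 p) fun _ hx => ⟨hx.1.1, hx.2.1⟩)
    (IsHolMap.mono (h₂.2.1 p) fun _ hx => ⟨hx.1.2, hx.2.2⟩),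
    fun x hx => R.mem_prod_iff.2 ⟨h₁.2.2 x hx.1, h₂.2.2 x hx.2⟩⟩

variable {χ : parabolicGroup (SLGroup 2 × SLGroup 2) (Matrix.fromBlocks s₁ 0 0 s₂) →* ℂˣ}
variable {R}

theorem Metric.h_act_fst (μ : R.Metric χ) {x : X} {a₁ : P₁.fiber x} {a₂ : P₂.fiber x}
    (h₁ : a₁ ∈ R.fst.carrier x) (h₂ : a₂ ∈ R.snd.carrier x) (g : parabolicGroup (SLGroup 2) s₁) :
    μ.h (P₁.act a₁ g, a₂) = ‖(χ.comp (parabolicInl s₁ s₂) g : ℂ)‖ ^ 2 * μ.h (a₁, a₂) := by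
  have h := μ.h_act (a₁, a₂) (R.mem_prod_iff.2 ⟨h₁, h₂⟩) (parabolicInl s₁ s₂ g)
  refine Eq.trans ?_ h
  change _ = μ.h (P₁.act a₁ g, P₂.act a₂ 1)
  rw [P₂.act_one]

theorem Metric.h_act_snd (μ : R.Metric χ) {x : X} {a₁ : P₁.fiber x} {a₂ : P₂.fiber x}
    (h₁ : a₁ ∈ R.fst.carrier x) (h₂ : a₂ ∈ R.snd.carrier x) (g : parabolicGroup (SLGroup 2) s₂) :
    μ.h (a₁, P₂.act a₂ g) = ‖(χ.comp (parabolicInr s₁ s₂) g : ℂ)‖ ^ 2 * μ.h (a₁, a₂) := by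
  have h := μ.h_act (a₁, a₂) (R.mem_prod_iff.2 ⟨h₁, h₂⟩) (parabolicInr s₁ s₂ g)
  refine Eq.trans ?_ h
  change _ = μ.h (P₁.act a₁ 1, P₂.act a₂ g)
  rw [P₁.act_one]

/-- Moving the first component multiplies numerator and denominator by the same factor, so the
quotient depends only on the second component. -/
theorem Metric.div_eq (μ : R.Metric χ) (μ₁ : R.fst.Metric (χ.comp (parabolicInl s₁ s₂))) {x : X}
    {a b : P₁.fiber x} {c : P₂.fiber x} (ha : a ∈ R.fst.carrier x) (hb : b ∈ R.fst.carrier x)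
    (hc : c ∈ R.snd.carrier x) : μ.h (a, c) / μ₁.h a = μ.h (b, c) / μ₁.h b := by
  have hg := (R.fst.mem_iff_of_mem ha b).1 hb
  have h1 := μ.h_act_fst ha hc ⟨_, hg⟩
  have h2 := μ₁.h_act a ha ⟨_, hg⟩
  rw [P₁.act_diff] at h1 h2
  rw [h1, h2]
  refine (mul_div_mul_left _ _ ?_).symm
  exact pow_ne_zero _ (norm_ne_zero_iff.2 (Units.ne_zero _))

/-- The metric on the second component determined by metrics on the product and on the first
component. -/
def Metric.quotient (μ : R.Metric χ) (μ₁ : R.fst.Metric (χ.comp (parabolicInl s₁ s₂))) :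
    R.snd.Metric (χ.comp (parabolicInr s₁ s₂)) where
  -- The point of the first component is chosen without any regularity in x, which is harmless by
  -- `Metric.div_eq`.
  h {x} c := μ.h ((R.fst.exists_mem x).choose, c) / μ₁.h (R.fst.exists_mem x).choose
  h_pos {x} c hc := div_pos
    (μ.h_pos _ (R.mem_prod_iff.2 ⟨(R.fst.exists_mem x).choose_spec, hc⟩))
    (μ₁.h_pos _ (R.fst.exists_mem x).choose_spec)
  h_act {x} c hc g := by rw [μ.h_act_snd (R.fst.exists_mem x).choose_spec hc, mul_div_assoc]
  smooth σ₂ U hσ₂ p z hz := by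
    -- For smoothness, the arbitrary choice is replaced near z by a holomorphic section.
    obtain ⟨V, σ₁, hV, hσ₁⟩ := R.fst.exists_isSection ((chartAt ℂ p).symm z)
    have hz1 : z ∈ (chartAt ℂ p).target ∩ (chartAt ℂ p).symm ⁻¹' V := ⟨hz.1, hV⟩
    have hz2 : z ∈ (chartAt ℂ p).target ∩ (chartAt ℂ p).symm ⁻¹' (V ∩ U) := ⟨hz.1, hV, hz.2⟩
    have h1 := (μ.smooth _ _ (hσ₁.prod hσ₂) p).contDiffAt
      ((isOpen_chart_preimage (hσ₁.1.inter hσ₂.1) p).mem_nhds hz2)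
    have h2 := (μ₁.smooth _ _ hσ₁ p).contDiffAt
      ((isOpen_chart_preimage hσ₁.1 p).mem_nhds hz1)
    refine ContDiffAt.contDiffWithinAt ?_
    refine (h1.div h2 (μ₁.h_pos _ (hσ₁.2.2 _ hV)).ne').congr_of_eventuallyEq ?_
    filter_upwards [eventually_chart_symm_mem (hσ₁.1.inter hσ₂.1) p hz2] with w hw
    exact μ.div_eq μ₁ (R.fst.exists_mem _).choose_spec (hσ₁.2.2 _ hw.2.1) (hσ₂.2.2 _ hw.2.2)

/-- The logarithm of the quotient metric is a difference of smooth functions, and the Laplacian is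
linear on these. -/
theorem Metric.isCurvature_quotient {μ : R.Metric χ}
    {μ₁ : R.fst.Metric (χ.comp (parabolicInl s₁ s₂))} {κ κ₁ : X → ℂ → ℝ} (hκ : μ.IsCurvature κ)
    (hκ₁ : μ₁.IsCurvature κ₁) : (μ.quotient μ₁).IsCurvature fun p z => κ p z - κ₁ p z := by
  intro p σ₂ U hσ₂ z hz
  obtain ⟨V, σ₁, hV, hσ₁⟩ := R.fst.exists_isSection ((chartAt ℂ p).symm z)
  have hz1 : z ∈ (chartAt ℂ p).target ∩ (chartAt ℂ p).symm ⁻¹' V := ⟨hz.1, hV⟩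
  have hz2 : z ∈ (chartAt ℂ p).target ∩ (chartAt ℂ p).symm ⁻¹' (V ∩ U) := ⟨hz.1, hV, hz.2⟩
  have e : (fun w => Real.log ((μ.quotient μ₁).h (σ₂ ((chartAt ℂ p).symm w)))) =ᶠ[nhds z]
      (fun w => Real.log (μ.h (σ₁ ((chartAt ℂ p).symm w), σ₂ ((chartAt ℂ p).symm w)))) -
        fun w => Real.log (μ₁.h (σ₁ ((chartAt ℂ p).symm w))) := by
    filter_upwards [eventually_chart_symm_mem (hσ₁.1.inter hσ₂.1) p hz2] with w hw
    have h1 := hσ₁.2.2 _ hw.2.1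
    have h2 := hσ₂.2.2 _ hw.2.2
    refine (congrArg Real.log (μ.div_eq μ₁ (R.fst.exists_mem _).choose_spec h1 h2)).trans ?_
    exact Real.log_div (μ.h_pos _ (R.mem_prod_iff.2 ⟨h1, h2⟩)).ne' (μ₁.h_pos _ h1).ne'
  change κ p z - κ₁ p z = _
  rw [hκ p _ _ (hσ₁.prod hσ₂) z hz2, hκ₁ p σ₁ V hσ₁ z hz1,
    (InnerProductSpace.laplacian_congr_nhds e).self_of_nhds,
    ((μ.contDiffAt_log (hσ₁.prod hσ₂) p hz2).of_le two_le_infty).laplacian_sub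
      ((μ₁.contDiffAt_log hσ₁ p hz1).of_le two_le_infty), mul_sub]

/-- The degree of a line bundle associated to a reduction of a product is the sum of the degrees of
its components. -/
theorem HasDegree.prod [T2Space X] [CompactSpace X]
    (hs : IsRealSemisimple (SLGroup 2 × SLGroup 2) (Matrix.fromBlocks s₁ 0 0 s₂))
    (hχ : IsDualCharacter (Matrix.fromBlocks s₁ 0 0 s₂) χ) {d : ℝ} (hd : R.HasDegree χ d) :
    ∃ d₁ d₂, R.fst.HasDegree (χ.comp (parabolicInl s₁ s₂)) d₁ ∧
      R.snd.HasDegree (χ.comp (parabolicInr s₁ s₂)) d₂ ∧ d = d₁ + d₂ := by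
  obtain ⟨μ, κ, A, ρ, hκ, hρ, hsum, rfl⟩ := hd
  have hχ₁ := hχ.inl.isLogHarmonic hs.fst
  -- `HasDegree` asks for some metric, so any metric may be taken for the first component; the
  -- quotient then serves for the second, with the same partition of unity.
  obtain ⟨μ₁⟩ := R.fst.exists_metric hχ₁
  obtain ⟨κ₁, hκ₁⟩ := μ₁.exists_isCurvature hχ₁
  have hκ₂ := Metric.isCurvature_quotient (μ := μ) hκ hκ₁
  refine ⟨_, _, ⟨μ₁, κ₁, A, ρ, hκ₁, hρ, hsum, rfl⟩,
    ⟨μ.quotient μ₁, fun p z => κ p z - κ₁ p z, A, ρ, hκ₂, hρ, hsum, rfl⟩, ?_⟩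
  rw [← Finset.sum_add_distrib]
  refine Finset.sum_congr rfl fun p hp => ?_
  -- Additivity of the integral needs integrability: each ρ is supported in a compact part of the
  -- chart, and the curvature densities are continuous there.
  rw [← MeasureTheory.integral_add
    (integrableOn_chart_target (hρ p hp).1 p (hρ p hp).2 (hκ₁.continuousOn p))
    (integrableOn_chart_target (hρ p hp).1 p (hρ p hp).2 (hκ₂.continuousOn p))]
  refine MeasureTheory.integral_congr_ae (Filter.Eventually.of_forall fun z => ?_)
  change _ * κ p z = _ * κ₁ p z + _ * (κ p z - κ₁ p z)
  ring

/-- The product of two reductions to Levi subgroups. -/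
def leviProd (R₁ : Reduction P₁.toPrincipalBundle (leviGroup (SLGroup 2) s₁))
    (R₂ : Reduction P₂.toPrincipalBundle (leviGroup (SLGroup 2) s₂)) :
    Reduction (P₁.prod P₂).toPrincipalBundle
      (leviGroup (SLGroup 2 × SLGroup 2) (Matrix.fromBlocks s₁ 0 0 s₂)) where
  carrier x := {a | a.1 ∈ R₁.carrier x ∧ a.2 ∈ R₂.carrier x}
  exists_section x := by
    obtain ⟨U₁, σ₁, hU₁, hx₁, hσ₁, h₁⟩ := R₁.exists_section x
    obtain ⟨U₂, σ₂, hU₂, hx₂, hσ₂, h₂⟩ := R₂.exists_section x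
    refine ⟨U₁ ∩ U₂, fun y => (σ₁ y, σ₂ y), hU₁.inter hU₂, ⟨hx₁, hx₂⟩, fun p => isHolMap_prod
      (IsHolMap.mono (hσ₁ p) fun x hx => ⟨hx.1.1, hx.2.1⟩)
      (IsHolMap.mono (hσ₂ p) fun x hx => ⟨hx.1.2, hx.2.2⟩), fun y hy a => ?_⟩
    rw [mem_leviGroup_prod]
    exact and_congr (h₁ y hy.1 a.1) (h₂ y hy.2 a.2)

end Reduction

/-- The degree of a reduction of the product is a sum of two degrees that are nonpositive by
semistability. If the sum is zero, both are, and the product of the two Levi reductions does what is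
required. -/
theorem PrincipalHiggs.Polystable.prod [T2Space X] [CompactSpace X] (h₁ : P₁.Polystable)
    (h₂ : P₂.Polystable) : (P₁.prod P₂).Polystable := by
  have key : ∀ s, IsRealSemisimple (SLGroup 2 × SLGroup 2) s →
      ∃ s₁ s₂, s = Matrix.fromBlocks s₁ 0 0 s₂ := by
    intro s hs
    obtain ⟨s₁, s₂, -, -, e⟩ := mem_lieAlg_prod.1 hs.1
    exact ⟨s₁, s₂, e⟩
  constructor
  · intro s χ R d hs hχ hR hd
    obtain ⟨s₁, s₂, rfl⟩ := key s hs
    obtain ⟨d₁, d₂, hd₁, hd₂, rfl⟩ := hd.prod hs hχ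
    have e₁ := h₁.1 s₁ _ R.fst d₁ hs.fst hχ.inl (R.isHiggsReduction_fst hR) hd₁
    have e₂ := h₂.1 s₂ _ R.snd d₂ hs.snd hχ.inr (R.isHiggsReduction_snd hR) hd₂
    exact add_nonpos e₁ e₂
  · intro s χ R hs hχ hR hd
    obtain ⟨s₁, s₂, rfl⟩ := key s hs
    obtain ⟨d₁, d₂, hd₁, hd₂, e⟩ := hd.prod hs hχ
    have e₁ := h₁.1 s₁ _ R.fst d₁ hs.fst hχ.inl (R.isHiggsReduction_fst hR) hd₁
    have e₂ := h₂.1 s₂ _ R.snd d₂ hs.snd hχ.inr (R.isHiggsReduction_snd hR) hd₂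
    obtain rfl : d₁ = 0 := by linarith
    obtain rfl : d₂ = 0 := by linarith
    obtain ⟨R₁, hR₁, hc₁⟩ := h₁.2 s₁ _ R.fst hs.fst hχ.inl (R.isHiggsReduction_fst hR) hd₁
    obtain ⟨R₂, hR₂, hc₂⟩ := h₂.2 s₂ _ R.snd hs.snd hχ.inr (R.isHiggsReduction_snd hR) hd₂
    refine ⟨Reduction.leviProd R₁ R₂, fun x a ha => R.mem_prod_iff.2 ⟨hR₁ x ha.1, hR₂ x ha.2⟩,
      fun x a ha t => ?_⟩
    change Matrix.fromBlocks (P₁.higgs a.1 t) 0 0 (P₂.higgs a.2 t) * _ =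
      _ * Matrix.fromBlocks (P₁.higgs a.1 t) 0 0 (P₂.higgs a.2 t)
    simp [Matrix.fromBlocks_multiply, hc₁ x a.1 ha.1 t, hc₂ x a.2 ha.2 t]

/-- If both components of a principal `SL(2, ℂ) × SL(2, ℂ)`-Higgs bundle are polystable, then so is
its extension along the isogeny to `SO(4, ℂ)`. -/
theorem PrincipalHiggs.polystable_extend_isogeny₂ [T2Space X] [CompactSpace X]
    (Q : PrincipalHiggs.{u, v} (SLGroup 2 × SLGroup 2) X) (h₁ : (Q.extend proj₁).Polystable)
    (h₂ : (Q.extend proj₂).Polystable) : (Q.extend isogeny₂).Polystable :=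
  isogeny₂_isLocalIso.polystable
    -- Q is isomorphic to the product of its extensions along the projections, so the product maps
    -- to the extension of Q.
    (HiggsHom.isoComp (HiggsHom.isoProd (HiggsHom.toExtend proj₁ Q)
      (HiggsHom.toExtend proj₂ Q)).symm (HiggsHom.toExtend isogeny₂ Q)) (h₁.prod h₂)

end ProductStability

/-! ### Framings of Higgs bundles by principal Higgs bundles -/

section Framings

open HiggsBundles.MatrixGroup (mat)

variable {k : ℕ} {n : Type} [Fintype n] [DecidableEq n]
variable {G : Type} [Group G] [MatrixGroup G n] {G' : Type} [Group G'] [MatrixGroup G' (Fin k)]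
variable {X : Type u} [TopologicalSpace X] [ChartedSpace ℂ X] [IsManifold 𝓘(ℂ) ω X]

/-- A framing of the Higgs bundle `H` by the principal `G`-Higgs bundle `P`: the points of `P` are
linear coordinates on the fibres of `H`, and `G` acts by coordinate changes via `Ψ`. -/
structure Framing (Ψ : HolHom G G') (P : PrincipalHiggs.{u, v} G X) (H : HiggsBundle.{u, v} X k)
    where
  coord : ∀ {x}, P.fiber x → H.fiber x ≃ₗ[ℂ] (Fin k → ℂ)
  coord_act : ∀ {x} (a : P.fiber x) (g : G) (w : H.fiber x),
    coord (P.act a g) w = mat (Ψ.hom g)⁻¹ *ᵥ coord a w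
  hol : ∀ p q i j, IsHolOn (fun x => coord (P.sec p x) (H.frame q x j) i) (P.dom p ∩ H.dom q)
  coord_higgs : ∀ {x} (a : P.fiber x) (t : Tan x) (w : H.fiber x),
    coord a (H.higgs x t w) = Ψ.d (P.higgs a t) *ᵥ coord a w

/-- The matrix of the vectors `w` in the coordinates `c`. -/
def coordMatrix {V : Type v} [AddCommGroup V] [Module ℂ V] (c : V ≃ₗ[ℂ] (Fin k → ℂ))
    (w : Fin k → V) : Matrix (Fin k) (Fin k) ℂ := Matrix.of fun i j => c (w j) i

theorem coordMatrix_basis {V : Type v} [AddCommGroup V] [Module ℂ V] (c : V ≃ₗ[ℂ] (Fin k → ℂ))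
    (b : Module.Basis (Fin k) ℂ V) : coordMatrix c b = (Module.Basis.ofEquivFun c).toMatrix b := by
  ext i j
  simp [coordMatrix, Module.Basis.toMatrix_apply]

theorem det_coordMatrix {V : Type v} [AddCommGroup V] [Module ℂ V] (c : V ≃ₗ[ℂ] (Fin k → ℂ))
    (w : Fin k → V) : (coordMatrix c w).det = (Module.Basis.ofEquivFun c).det w := by
  rw [Module.Basis.det_apply]
  congr 1

theorem det_coordMatrix_basis_ne_zero {V : Type v} [AddCommGroup V] [Module ℂ V]
    (c : V ≃ₗ[ℂ] (Fin k → ℂ)) (b : Module.Basis (Fin k) ℂ V) : (coordMatrix c b).det ≠ 0 := by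
  rw [det_coordMatrix]
  exact ((Module.Basis.ofEquivFun c).isUnit_det b).ne_zero

/-- The inverse of the coordinate matrix of a basis. -/
theorem coordMatrix_inv {V : Type v} [AddCommGroup V] [Module ℂ V] (c : V ≃ₗ[ℂ] (Fin k → ℂ))
    (b : Module.Basis (Fin k) ℂ V) (i j : Fin k) :
    (coordMatrix c b)⁻¹ i j = b.repr (c.symm (Pi.single j 1)) i := by
  have h : (coordMatrix c b)⁻¹ = b.toMatrix (Module.Basis.ofEquivFun c) := by
    rw [coordMatrix_basis]
    exact Matrix.inv_eq_right_inv (Module.Basis.toMatrix_mul_toMatrix_flip _ _)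
  rw [h, Module.Basis.toMatrix_apply, Module.Basis.coe_ofEquivFun]

theorem PrincipalBundle.assoc_frame_apply {X : Type u} [TopologicalSpace X] [ChartedSpace ℂ X]
    (P' : PrincipalBundle.{u, v} G' X) (p x : X) (j : Fin k) (b : P'.fiber x) :
    (show P'.assocFiber x from P'.assoc.frame p x j).1 b =
      mat (P'.diff b (P'.sec p x)) *ᵥ Pi.single j 1 := by
  have e : Module.Basis.ofEquivFun (P'.assocEquiv (P'.sec p x)) j =
      (P'.assocEquiv (P'.sec p x)).symm (Pi.single j 1) := by
    rw [Module.Basis.coe_ofEquivFun]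
  exact congrArg (fun w : P'.assocFiber x => w.1 b) e

namespace Framing

variable {Ψ : HolHom G G'} {P : PrincipalHiggs.{u, v} G X} {H : HiggsBundle.{u, v} X k}

theorem coord_eq (f : Framing Ψ P H) {x : X} (a b : P.fiber x) (w : H.fiber x) :
    f.coord a w = mat (Ψ.hom (P.diff a b)) *ᵥ f.coord b w := by
  have h := f.coord_act a (P.diff a b) w
  rw [P.act_diff] at h
  rw [h, Matrix.mulVec_mulVec, mat_mul_mat_inv, Matrix.one_mulVec]

variable {P' : PrincipalHiggs.{u, v} G' X}

/-- The isomorphism of fibres given by a framing. -/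
def isoEquiv (f : Framing Ψ P H) (F : HiggsHom Ψ P P') (x : X) :
    P'.assocFiber x ≃ₗ[ℂ] H.fiber x :=
  P'.assocEquiv (F.map (P.sec x x)) ≪≫ₗ (f.coord (P.sec x x)).symm

/-- The isomorphism was defined with one point of the fibre; in the coordinates given by any other
point `a` it is evaluation at `F.map a`, so it is independent of that choice. -/
theorem coord_isoEquiv (f : Framing Ψ P H) (F : HiggsHom Ψ P P') {x : X} (a : P.fiber x)
    (w : P'.assocFiber x) : f.coord a (f.isoEquiv F x w) = w.1 (F.map a) := by
  rw [f.coord_eq a (P.sec x x), P'.assocFiber_eq w (F.map a) (F.map (P.sec x x)), F.diff_map]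
  congr 1
  exact (f.coord (P.sec x x)).apply_symm_apply _

/-- A Higgs bundle framed by a principal Higgs bundle is associated to it. -/
def iso (f : Framing Ψ P H) (F : HiggsHom Ψ P P') : P'.assoc.Iso H where
  equiv := f.isoEquiv F
  hol p q i j := by
    refine isHolOn_of_locally fun x₀ hx₀ => ⟨P.dom x₀, P.isOpen_dom x₀, P.mem_dom x₀, ?_⟩
    -- In the given frames, the matrix of the isomorphism is the inverse of the coordinate matrix of
    -- the frame of H times a transition matrix of P'; both factors are holomorphic.
    have h1 : ∀ i j, IsHolOn
        (fun x => (coordMatrix (f.coord (P.sec x₀ x)) (H.frame q x))⁻¹ i j)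
        (P'.assoc.dom p ∩ H.dom q ∩ P.dom x₀) :=
      isHolOn_matrix_inv (fun i j => (f.hol x₀ q i j).mono fun y hy => ⟨hy.2, hy.1.2⟩)
        fun x _ => det_coordMatrix_basis_ne_zero _ _
    have h2 : ∀ i j, IsHolOn (fun x => mat (P'.diff (F.map (P.sec x₀ x)) (P'.sec p x)) i j)
        (P'.assoc.dom p ∩ H.dom q ∩ P.dom x₀) :=
      ((F.hol x₀).isHolMap_diff (P'.isHolSection_sec p)).mono fun y hy => ⟨hy.2, hy.1.1⟩
    refine (isHolOn_matrix_mul h1 h2 i j).congr fun x _ => ?_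
    rw [LinearMap.toMatrix_apply]
    change (H.frame q x).repr (f.isoEquiv F x (P'.assoc.frame p x j)) i = _
    have e : f.isoEquiv F x (P'.assoc.frame p x j) = (f.coord (P.sec x₀ x)).symm
        (∑ l, mat (P'.diff (F.map (P.sec x₀ x)) (P'.sec p x)) l j • Pi.single l 1) := by
      refine (LinearEquiv.eq_symm_apply _).2 ((f.coord_isoEquiv F _ _).trans ?_)
      refine (P'.assoc_frame_apply p x j _).trans ?_
      ext i
      simp [Finset.sum_apply, Pi.single_apply]
    rw [e, map_sum, map_sum, Finsupp.finsetSum_apply, Matrix.mul_apply]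
    refine Finset.sum_congr rfl fun l _ => ?_
    rw [map_smul, map_smul, Finsupp.smul_apply, smul_eq_mul, coordMatrix_inv, mul_comm]
  map_higgs x t := fun (w : P'.assocFiber x) => by
    refine (f.coord (P.sec x x)).injective ?_
    change f.coord _ (f.isoEquiv F x (P'.assocHiggs x t w)) =
      f.coord _ (H.higgs x t (f.isoEquiv F x w))
    rw [f.coord_higgs, f.coord_isoEquiv, f.coord_isoEquiv, ← F.map_higgs]
    rfl

theorem det_coord_isoEquiv (f : Framing Ψ P H) (F : HiggsHom Ψ P P')
    (hG : ∀ g : G', (mat g).det = 1) (x : X) (w : Fin k → P'.assocFiber x) :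
    (coordMatrix (f.coord (P.sec x x)) fun i => f.isoEquiv F x (w i)).det =
      (P'.assoc.frame x x).det w := by
  have e : (P'.assoc.frame x x).det w = (coordMatrix (P'.assocEquiv (P'.sec x x)) w).det := by
    rw [det_coordMatrix]
    rfl
  have e' : (coordMatrix (f.coord (P.sec x x)) fun i => f.isoEquiv F x (w i)) =
      mat (P'.diff (F.map (P.sec x x)) (P'.sec x x)) *
        coordMatrix (P'.assocEquiv (P'.sec x x)) w := by
    ext i j
    change f.coord (P.sec x x) (f.isoEquiv F x (w j)) i = _
    rw [f.coord_isoEquiv, P'.assocFiber_eq (w j) _ (P'.sec x x)]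
    rfl
  rw [e, e', Matrix.det_mul, hG, one_mul]

/-- An isomorphism with an associated Higgs bundle is a framing. -/
def ofIso (F : HiggsHom Ψ P P') (φ : P'.assoc.Iso H) : Framing Ψ P H where
  coord {x} a := (φ.equiv x).symm ≪≫ₗ P'.assocEquiv (F.map a)
  coord_act {x} a g w := by
    change ((φ.equiv x).symm w).1 (F.map (P.act a g)) = _ *ᵥ ((φ.equiv x).symm w).1 (F.map a)
    rw [F.map_act]
    exact ((φ.equiv x).symm w).2 (F.map a) (Ψ.hom g)
  hol p q i j := by
    refine isHolOn_of_locally fun x₀ hx₀ => ⟨P'.dom x₀, P'.isOpen_dom x₀, P'.mem_dom x₀, ?_⟩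
    have h1 : ∀ i j, IsHolOn (fun x => (LinearMap.toMatrix (P'.assoc.frame x₀ x) (H.frame q x)
        (φ.equiv x).toLinearMap)⁻¹ i j) (P.dom p ∩ H.dom q ∩ P'.dom x₀) := by
      refine isHolOn_matrix_inv (fun i j => (φ.hol x₀ q i j).mono fun y hy => ⟨hy.2, hy.1.2⟩)
        fun x _ => ?_
      exact ((φ.equiv x).isUnit_det _ _).ne_zero
    have h2 : ∀ i j, IsHolOn (fun x => mat (P'.diff (F.map (P.sec p x)) (P'.sec x₀ x)) i j)
        (P.dom p ∩ H.dom q ∩ P'.dom x₀) :=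
      ((F.hol p).isHolMap_diff (P'.isHolSection_sec x₀)).mono fun y hy => ⟨hy.1.1, hy.2⟩
    refine (isHolOn_matrix_mul h2 h1 i j).congr fun x _ => ?_
    have e : (LinearMap.toMatrix (P'.assoc.frame x₀ x) (H.frame q x)
        (φ.equiv x).toLinearMap)⁻¹ = LinearMap.toMatrix (H.frame q x) (P'.assoc.frame x₀ x)
        (φ.equiv x).symm.toLinearMap := by
      refine Matrix.inv_eq_left_inv ?_
      rw [← LinearMap.toMatrix_comp, LinearEquiv.comp_coe, LinearEquiv.self_trans_symm]
      exact LinearMap.toMatrix_id _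
    rw [e]
    change ((φ.equiv x).symm (H.frame q x j)).1 (F.map (P.sec p x)) i = _
    refine (congrFun (P'.assocFiber_eq ((φ.equiv x).symm (H.frame q x j)) _
      (P'.sec x₀ x)) i).trans ?_
    exact congrArg (fun v : Fin k → ℂ =>
        (mat (P'.diff (F.map (P.sec p x)) (P'.sec x₀ x)) *ᵥ v) i)
      (a₂ := fun l => LinearMap.toMatrix (H.frame q x) (P'.assoc.frame x₀ x)
        (φ.equiv x).symm.toLinearMap l j)
      (funext fun l => (LinearMap.toMatrix_apply (H.frame q x) (P'.assoc.frame x₀ x)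
        (φ.equiv x).symm.toLinearMap l j).symm)
  coord_higgs {x} a t w := by
    have h := φ.map_higgs x t ((φ.equiv x).symm w)
    rw [LinearEquiv.apply_symm_apply, ← LinearEquiv.eq_symm_apply] at h
    change ((φ.equiv x).symm (H.higgs x t w)).1 (F.map a) = _
    rw [← h, ← F.map_higgs]
    rfl

end Framing

/-! #### Framings by special linear groups -/

namespace Framing

variable {P' : PrincipalHiggs.{u, v} (SLGroup k) X} {Ψ : HolHom G (SLGroup k)}
  {P : PrincipalHiggs.{u, v} G X} {H : HiggsBundle.{u, v} X k}

theorem isomorphicSL (f : Framing Ψ P H) (F : HiggsHom Ψ P P') (S : SLStructure H)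
    (hS : ∀ {x} (a : P.fiber x) w, S.vol x w = (coordMatrix (f.coord a) w).det) :
    P'.assocSL.Isomorphic S :=
  ⟨f.iso F, fun x w => (hS (P.sec x x) _).trans (f.det_coord_isoEquiv F (fun g => g.2) x w)⟩

/-- The coordinates that come from an isomorphism of SL-structures are unimodular, that is, points
of `SLStructure.FrameFiber`. This links arbitrary principal bundles with the frame bundle. -/
theorem vol_ofIso (F : HiggsHom Ψ P P') {S : SLStructure H} (φ : P'.assoc.Iso H)
    (hφ : ∀ x w, S.vol x (fun i => φ.equiv x (w i)) = P'.assocSL.vol x w) {x : X} (a : P.fiber x)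
    (w : Fin k → H.fiber x) :
    S.vol x w = (coordMatrix ((Framing.ofIso F φ).coord a) w).det := by
  have h := hφ x fun i => (φ.equiv x).symm (w i)
  simp only [LinearEquiv.apply_symm_apply] at h
  rw [h]
  refine (det_coordMatrix (P'.assocEquiv (P'.sec x x))
    (fun i => (φ.equiv x).symm (w i))).symm.trans ?_
  have e : coordMatrix (P'.assocEquiv (P'.sec x x)) (fun i => (φ.equiv x).symm (w i)) =
      mat (P'.diff (P'.sec x x) (F.map a)) * coordMatrix ((Framing.ofIso F φ).coord a) w := by
    ext i j
    exact congrFun (P'.assocFiber_eq ((φ.equiv x).symm (w j)) _ (F.map a)) i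
  rw [e, Matrix.det_mul]
  exact (congrArg (· * _) (P'.diff (P'.sec x x) (F.map a)).2).trans (one_mul _)

end Framing

/-! #### Framings by special orthogonal groups -/

namespace Framing

variable {P' : PrincipalHiggs.{u, v} (SOGroup k) X} {Ψ : HolHom G (SOGroup k)}
  {P : PrincipalHiggs.{u, v} G X} {H : HiggsBundle.{u, v} X k}

/-- Coordinates change by orthogonal matrices, so the transported form is independent of the point
of P. -/
theorem dotProduct_coord (f : Framing Ψ P H) {x : X} (a b : P.fiber x) (w w' : H.fiber x) :
    f.coord a w ⬝ᵥ f.coord a w' = f.coord b w ⬝ᵥ f.coord b w' := by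
  rw [f.coord_eq a b, f.coord_eq a b, Matrix.dotProduct_mulVec, Matrix.vecMul_mulVec]
  have h : (mat (Ψ.hom (P.diff a b)))ᵀ * mat (Ψ.hom (P.diff a b)) = 1 :=
    (mem_SO_iff.1 (Ψ.hom (P.diff a b)).2).1
  rw [h, Matrix.vecMul_one]

theorem det_coord (f : Framing Ψ P H) {x : X} (a b : P.fiber x) (w : Fin k → H.fiber x) :
    (coordMatrix (f.coord a) w).det = (coordMatrix (f.coord b) w).det := by
  have e : coordMatrix (f.coord a) w =
      mat (Ψ.hom (P.diff a b)) * coordMatrix (f.coord b) w := by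
    ext i j
    change f.coord a (w j) i = _
    rw [f.coord_eq a b]
    rfl
  rw [e, Matrix.det_mul]
  exact (congrArg (· * _) (mem_SO_iff.1 (Ψ.hom (P.diff a b)).2).2).trans (one_mul _)

/-- The orthogonal structure on a Higgs bundle given by a framing by a principal Higgs bundle. -/
def soStructure (f : Framing Ψ P H) : SOStructure H where
  form x := (dotProductBilin ℂ ℂ).compl₁₂ (f.coord (P.sec x x)).toLinearMap
    (f.coord (P.sec x x)).toLinearMap
  form_symm x := ⟨fun w w' => dotProduct_comm (f.coord (P.sec x x) w) (f.coord (P.sec x x) w')⟩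
  form_nondegenerate x := by
    refine ⟨fun w hw => (f.coord (P.sec x x)).injective ?_,
      fun w hw => (f.coord (P.sec x x)).injective ?_⟩
    · rw [map_zero]
      refine dotProduct_eq_zero _ fun v => ?_
      have h := hw ((f.coord (P.sec x x)).symm v)
      exact (congrArg _ ((f.coord (P.sec x x)).apply_symm_apply v)).symm.trans h
    · rw [map_zero]
      refine dotProduct_eq_zero _ fun v => ?_
      have h := hw ((f.coord (P.sec x x)).symm v)
      rw [dotProduct_comm]
      exact (congrArg (· ⬝ᵥ _) ((f.coord (P.sec x x)).apply_symm_apply v)).symm.trans h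
  hol_form p a b := by
    -- The section x ↦ `P.sec x x` used in the definition is not holomorphic. Locally it is
    -- exchanged for `P.sec x₀`, which does not change the form.
    refine isHolOn_of_locally fun x₀ hx₀ => ⟨P.dom x₀, P.isOpen_dom x₀, P.mem_dom x₀, ?_⟩
    have h := IsHolOn.sum Finset.univ fun i _ =>
      ((f.hol x₀ p i a).mul (f.hol x₀ p i b)).mono (V := H.dom p ∩ P.dom x₀)
        fun y hy => ⟨hy.2, hy.1⟩
    exact h.congr fun x _ => f.dotProduct_coord (P.sec x x) (P.sec x₀ x) _ _
  vol x := (Module.Basis.ofEquivFun (f.coord (P.sec x x))).det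
  hol_vol p := by
    refine isHolOn_of_locally fun x₀ hx₀ => ⟨P.dom x₀, P.isOpen_dom x₀, P.mem_dom x₀, ?_⟩
    have h : IsHolOn (fun x => (coordMatrix (f.coord (P.sec x₀ x)) (H.frame p x)).det)
        (H.dom p ∩ P.dom x₀) :=
      IsHolOn.comp_matrix (F := fun M => Matrix.det (Matrix.of M))
        (fun i j => (f.hol x₀ p i j).mono fun y hy => ⟨hy.2, hy.1⟩) fun x _ => differentiable_det _
    refine h.congr fun x _ => ?_
    rw [← det_coordMatrix]
    exact f.det_coord _ _ _
  vol_sq x w := by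
    rw [← det_coordMatrix, sq]
    nth_rewrite 1 [← Matrix.det_transpose]
    rw [← Matrix.det_mul]
    rfl
  form_higgs x t w w' := by
    change f.coord (P.sec x x) w ⬝ᵥ f.coord (P.sec x x) (H.higgs x t w') =
      -(f.coord (P.sec x x) (H.higgs x t w) ⬝ᵥ f.coord (P.sec x x) w')
    rw [f.coord_higgs, f.coord_higgs, Matrix.dotProduct_mulVec, ← Matrix.mulVec_transpose,
      transpose_of_mem_lieAlg (Ψ.d_mem (P.higgs_mem _ _)), Matrix.neg_mulVec, neg_dotProduct]

theorem soStructure_form (f : Framing Ψ P H) {x : X} (a : P.fiber x) (w w' : H.fiber x) :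
    f.soStructure.form x w w' = f.coord a w ⬝ᵥ f.coord a w' :=
  f.dotProduct_coord (P.sec x x) a w w'

theorem soStructure_vol (f : Framing Ψ P H) {x : X} (a : P.fiber x) (w : Fin k → H.fiber x) :
    f.soStructure.vol x w = (coordMatrix (f.coord a) w).det :=
  (det_coordMatrix _ _).symm.trans (f.det_coord (P.sec x x) a w)

theorem isomorphicSO (f : Framing Ψ P H) (F : HiggsHom Ψ P P') (T : SOStructure H)
    (hform : ∀ {x} (a : P.fiber x) w w', T.form x w w' = f.coord a w ⬝ᵥ f.coord a w')
    (hvol : ∀ {x} (a : P.fiber x) w, T.vol x w = (coordMatrix (f.coord a) w).det) :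
    P'.assocSO.Isomorphic T := by
  refine ⟨f.iso F, fun x => fun (w w' : P'.assocFiber x) => ?_, fun x w => ?_⟩
  · refine (hform (P.sec x x) _ _).trans ?_
    change f.coord _ (f.isoEquiv F x w) ⬝ᵥ f.coord _ (f.isoEquiv F x w') =
      P'.assocForm (P'.sec x x) w w'
    rw [f.coord_isoEquiv, f.coord_isoEquiv, P'.assocForm_eq _ (F.map (P.sec x x))]
    rfl
  · exact (hvol (P.sec x x) _).trans
      (f.det_coord_isoEquiv F (fun g => (mem_SO_iff.1 g.2).2) x w)

end Framing

end Framings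

/-! ### The frame bundle of an `SL(k, ℂ)`-Higgs bundle -/

section FrameBundle

open HiggsBundles.MatrixGroup (mat)

variable {k : ℕ} {X : Type u} [TopologicalSpace X] [ChartedSpace ℂ X] [IsManifold 𝓘(ℂ) ω X]
variable {E : HiggsBundle.{u, v} X k}

theorem coordMatrix_comp {V : Type v} [AddCommGroup V] [Module ℂ V] (c : V ≃ₗ[ℂ] (Fin k → ℂ))
    (g : (Fin k → ℂ) ≃ₗ[ℂ] (Fin k → ℂ)) (w : Fin k → V) :
    coordMatrix (c ≪≫ₗ g) w = LinearMap.toMatrix' g.toLinearMap * coordMatrix c w := by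
  ext i j
  change g (c (w j)) i = (LinearMap.toMatrix' g.toLinearMap *ᵥ c (w j)) i
  rw [LinearMap.toMatrix'_mulVec]
  rfl

theorem coordMatrix_symm_single {V : Type v} [AddCommGroup V] [Module ℂ V]
    (c c' : V ≃ₗ[ℂ] (Fin k → ℂ)) : coordMatrix c (fun j => c'.symm (Pi.single j 1)) =
      LinearMap.toMatrix' (c'.symm ≪≫ₗ c).toLinearMap := by
  ext i j
  rw [LinearMap.toMatrix'_apply]
  rfl

/-- The unimodular linear coordinates on the fibre of an `SL(k, ℂ)`-Higgs bundle. -/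
def SLStructure.FrameFiber (S : SLStructure E) (x : X) : Type v :=
  {c : E.fiber x ≃ₗ[ℂ] (Fin k → ℂ) // ∀ w, S.vol x w = (coordMatrix c w).det}

namespace SLStructure

variable (S : SLStructure E)

/-- The coordinate change between two unimodular coordinates. -/
def frameDiff {x : X} (c c' : S.FrameFiber x) : SLGroup k :=
  -- g acts on coordinates by c ↦ g⁻¹ c, so c' = c g means g = c ∘ c'⁻¹. A unimodular basis for c'
  -- is one for c, whence determinant one.
  ⟨LinearMap.toMatrix' (c'.1.symm ≪≫ₗ c.1).toLinearMap, by
    rw [← coordMatrix_symm_single, ← c.2, c'.2, coordMatrix_symm_single,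
      LinearEquiv.symm_trans_self]
    exact (congrArg Matrix.det LinearMap.toMatrix'_id).trans Matrix.det_one⟩

theorem frameDiff_mulVec {x : X} (c c' : S.FrameFiber x) (v : Fin k → ℂ) :
    mat (S.frameDiff c c') *ᵥ v = c.1 (c'.1.symm v) :=
  LinearMap.toMatrix'_mulVec _ _

/-- The action of the special linear group on unimodular coordinates. -/
def frameAct {x : X} (c : S.FrameFiber x) (g : SLGroup k) : S.FrameFiber x :=
  ⟨c.1 ≪≫ₗ Matrix.SpecialLinearGroup.toLin' g⁻¹, fun w => by
    have h : (LinearMap.toMatrix' (Matrix.SpecialLinearGroup.toLin' g⁻¹).toLinearMap).det = 1 := by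
      rw [Matrix.SpecialLinearGroup.toLin'_to_linearMap, LinearMap.toMatrix'_toLin']
      exact g⁻¹.2
    rw [coordMatrix_comp, Matrix.det_mul, h, one_mul, c.2]⟩

theorem frameAct_apply {x : X} (c : S.FrameFiber x) (g : SLGroup k) (w : E.fiber x) :
    (S.frameAct c g).1 w = mat g⁻¹ *ᵥ c.1 w := rfl

theorem frameFiber_ext {x : X} {c c' : S.FrameFiber x} (h : ∀ w, c.1 w = c'.1 w) : c = c' :=
  Subtype.ext (LinearEquiv.ext h)

theorem vol_frame_ne_zero (p x : X) : S.vol x (E.frame p x) ≠ 0 := by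
  intro h
  apply S.vol_ne_zero x
  rw [(S.vol x).eq_smul_basis_det (E.frame p x), h, zero_smul]

/-- The matrix of the Higgs field in linear coordinates. -/
def frameHiggs {x : X} (c : S.FrameFiber x) : Tan x →ₗ[ℂ] Matrix (Fin k) (Fin k) ℂ :=
  LinearMap.toMatrix'.toLinearMap ∘ₗ c.1.conj.toLinearMap ∘ₗ E.higgs x

theorem frameHiggs_mulVec {x : X} (c : S.FrameFiber x) (t : Tan x) (w : E.fiber x) :
    S.frameHiggs c t *ᵥ c.1 w = c.1 (E.higgs x t w) := by
  refine (LinearMap.toMatrix'_mulVec _ _).trans ?_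
  change c.1 (E.higgs x t (c.1.symm (c.1 w))) = _
  rw [LinearEquiv.symm_apply_apply]

-- A frame is normalized by rescaling the single coordinate with index 0 by the volume of the frame.
-- This avoids a choice of k-th roots but requires k ≠ 0.
variable [NeZero k]

/-- The factors by which the coordinates of a frame are rescaled to make it unimodular. -/
def frameScale (p x : X) (i : Fin k) : ℂ := if i = 0 then S.vol x (E.frame p x) else 1

theorem frameScale_ne_zero (p x : X) (i : Fin k) : S.frameScale p x i ≠ 0 := by
  unfold frameScale
  split_ifs
  · exact S.vol_frame_ne_zero p x
  · exact one_ne_zero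

theorem isHolOn_frameScale (p : X) (i : Fin k) :
    IsHolOn (fun x => S.frameScale p x i) (E.dom p) := by
  unfold frameScale
  split_ifs
  · exact S.hol_vol p
  · exact isHolOn_const 1 _

/-- The unimodular coordinates given by a rescaled frame. -/
def frameSec (p x : X) : S.FrameFiber x :=
  ⟨(E.frame p x).equivFun ≪≫ₗ LinearEquiv.piCongrRight fun i =>
    LinearEquiv.smulOfNeZero ℂ ℂ (S.frameScale p x i) (S.frameScale_ne_zero p x i), fun w => by
    have h1 : S.vol x w = S.vol x (E.frame p x) * (E.frame p x).det w := by
      conv_lhs => rw [(S.vol x).eq_smul_basis_det (E.frame p x)]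
      rfl
    have h2 := Matrix.det_mul_column (S.frameScale p x) ((E.frame p x).toMatrix w)
    have h3 : ∏ i, S.frameScale p x i = S.vol x (E.frame p x) := by
      simp [frameScale]
    rw [h3, ← Module.Basis.det_apply] at h2
    rw [h1, ← h2]
    rfl⟩

theorem frameSec_apply (p x : X) (w : E.fiber x) (i : Fin k) :
    (S.frameSec p x).1 w i = S.frameScale p x i * (E.frame p x).repr w i := rfl

theorem frameSec_symm_single (p x : X) (j : Fin k) :
    (S.frameSec p x).1.symm (Pi.single j 1) = (S.frameScale p x j)⁻¹ • E.frame p x j := by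
  rw [LinearEquiv.symm_apply_eq]
  ext i
  rw [frameSec_apply, map_smul, Module.Basis.repr_self]
  by_cases h : i = j
  · subst h
    simp [S.frameScale_ne_zero p x i]
  · simp [h]

/-- The principal bundle of unimodular linear coordinates of an `SL(k, ℂ)`-Higgs bundle. -/
def frameBundle : PrincipalHiggs.{u, v} (SLGroup k) X where
  fiber := S.FrameFiber
  act := S.frameAct
  act_one c := S.frameFiber_ext fun w => by simp [frameAct_apply]
  act_mul c g h := S.frameFiber_ext fun w => by
    rw [frameAct_apply, frameAct_apply, frameAct_apply, Matrix.mulVec_mulVec, mul_inv_rev, map_mul]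
  diff := S.frameDiff
  act_diff c c' := S.frameFiber_ext fun w => by
    have h := S.frameDiff_mulVec c c' (c'.1 w)
    rw [LinearEquiv.symm_apply_apply] at h
    rw [frameAct_apply, ← h, Matrix.mulVec_mulVec, mat_inv_mul_mat, Matrix.one_mulVec]
  diff_act c g := by
    apply MatrixGroup.mat_injective
    refine Matrix.mulVec_injective (funext fun v => ?_)
    rw [frameDiff_mulVec]
    obtain ⟨w, rfl⟩ := (S.frameAct c g).1.surjective v
    rw [LinearEquiv.symm_apply_apply, frameAct_apply, Matrix.mulVec_mulVec, mat_mul_mat_inv,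
      Matrix.one_mulVec]
  dom := E.dom
  isOpen_dom := E.isOpen_dom
  mem_dom := E.mem_dom
  sec := S.frameSec
  hol_sec p q i j := by
    have h := (((S.isHolOn_frameScale p i).mono Set.inter_subset_left).mul
      (E.hol_frame p q i j)).mul (((S.isHolOn_frameScale q j).inv
        fun x _ => S.frameScale_ne_zero q x j).mono (V := E.dom p ∩ E.dom q) Set.inter_subset_right)
    refine h.congr fun x _ => ?_
    change LinearMap.toMatrix' _ i j = _
    rw [← coordMatrix_symm_single]
    change (S.frameSec p x).1 ((S.frameSec q x).1.symm (Pi.single j 1)) i = _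
    rw [frameSec_symm_single, map_smul, Pi.smul_apply, frameSec_apply, smul_eq_mul, mul_comm]
    rfl
  higgs := S.frameHiggs
  higgs_mem {x} c t := by
    rw [mem_lieAlg_SL]
    have h := LinearMap.trace_conj' (E.higgs x t) c.1
    rw [S.trace_higgs, LinearMap.trace_eq_matrix_trace ℂ (Pi.basisFun ℂ (Fin k)),
      LinearMap.toMatrix_eq_toMatrix'] at h
    exact h
  higgs_act {x} c g t := by
    refine Matrix.mulVec_injective (funext fun v => ?_)
    obtain ⟨w, rfl⟩ := (S.frameAct c g).1.surjective v
    rw [frameHiggs_mulVec, frameAct_apply, frameAct_apply, ← frameHiggs_mulVec,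
      Matrix.mulVec_mulVec, Matrix.mulVec_mulVec, mul_assoc, mul_assoc, mat_mul_mat_inv, mul_one]
  hol_higgs p i j := by
    have h := IsHolFormOn.smul (((S.isHolOn_frameScale p i)).mul ((S.isHolOn_frameScale p j).inv
        fun x _ => S.frameScale_ne_zero p x j)) (E.hol_higgs p i j)
    refine h.congr fun x _ => LinearMap.ext fun t => ?_
    change LinearMap.toMatrix' ((S.frameSec p x).1.conj (E.higgs x t)) i j =
      (S.frameScale p x i * (S.frameScale p x j)⁻¹) *
        LinearMap.toMatrix (E.frame p x) (E.frame p x) (E.higgs x t) i j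
    rw [LinearMap.toMatrix'_apply, LinearMap.toMatrix_apply]
    have e := S.frameSec_symm_single p x j
    change (S.frameSec p x).1 (E.higgs x t ((S.frameSec p x).1.symm _)) i = _
    rw [e, map_smul, map_smul, Pi.smul_apply, frameSec_apply, smul_eq_mul]
    ring

end SLStructure

/-- A homomorphism to the frame bundle is a framing. -/
def HiggsHom.toFraming {n : Type} [Fintype n] [DecidableEq n] {G : Type} [Group G]
    [MatrixGroup G n] [NeZero k] {Ψ : HolHom G (SLGroup k)} {P : PrincipalHiggs.{u, v} G X}
    {S : SLStructure E} (F : HiggsHom Ψ P S.frameBundle) : Framing Ψ P E where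
  coord a := (F.map a).1
  coord_act a g w := by
    rw [F.map_act]
    rfl
  hol p q i j := by
    have h1 : IsHolMap (fun x => S.frameDiff (F.map (P.sec p x)) (S.frameSec q x))
        (P.dom p ∩ E.dom q) := (F.hol p).isHolMap_diff (S.frameBundle.isHolSection_sec q)
    refine ((h1 i j).mul ((S.isHolOn_frameScale q j).mono Set.inter_subset_right)).congr
      fun x _ => ?_
    have h2 := S.frameDiff_mulVec (F.map (P.sec p x)) (S.frameSec q x)
      ((S.frameSec q x).1 (E.frame q x j))
    rw [LinearEquiv.symm_apply_apply] at h2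
    rw [← h2]
    have h3 : (S.frameSec q x).1 (E.frame q x j) = Pi.single j (S.frameScale q x j) := by
      ext l
      rw [S.frameSec_apply, Module.Basis.repr_self]
      by_cases h : l = j
      · subst h
        simp
      · simp [h]
    rw [h3]
    simp
  coord_higgs {x} a t w := by
    rw [← F.map_higgs]
    exact (S.frameHiggs_mulVec (F.map a) t w).symm

end FrameBundle

/-! ### Framings of tensor products and of exterior squares -/

section TensorFraming

open HiggsBundles.MatrixGroup (mat)

/-- Coordinates with respect to an orthonormal basis: the columns of `C` are an orthogonal basis,
with common square length two, for the form with Gram matrix `J`. -/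
def orthoCoord {k : ℕ} {C J : Matrix (Fin k) (Fin k) ℂ}
    (hC : ((1 / 2 : ℂ) • (Cᵀ * J)) * C = 1) : (Fin k → ℂ) ≃ₗ[ℂ] (Fin k → ℂ) :=
  Matrix.toLin'OfInv (M := C) (M' := ((1 / 2 : ℂ) • (Cᵀ * J))) (mul_eq_one_comm.1 hC) hC ≪≫ₗ
    -- The columns of C have square length two, so C⁻¹ alone halves the form; the factor √2 makes
    -- the coordinates orthonormal and commutes with all matrices.
    LinearEquiv.smulOfNeZero ℂ (Fin k → ℂ) ((Real.sqrt 2 : ℝ) : ℂ)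
      (Complex.ofReal_ne_zero.2 (by positivity))

theorem orthoCoord_apply {k : ℕ} {C J : Matrix (Fin k) (Fin k) ℂ}
    (hC : ((1 / 2 : ℂ) • (Cᵀ * J)) * C = 1) (u : Fin k → ℂ) :
    orthoCoord hC u = ((Real.sqrt 2 : ℝ) : ℂ) • (((1 / 2 : ℂ) • (Cᵀ * J)) *ᵥ u) := rfl

theorem orthoCoord_mulVec {k : ℕ} {C J : Matrix (Fin k) (Fin k) ℂ}
    (hC : ((1 / 2 : ℂ) • (Cᵀ * J)) * C = 1) (K : Matrix (Fin k) (Fin k) ℂ) (u : Fin k → ℂ) :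
    orthoCoord hC (K *ᵥ u) = (((1 / 2 : ℂ) • (Cᵀ * J)) * K * C) *ᵥ orthoCoord hC u := by
  have hC' := mul_eq_one_comm.1 hC
  rw [orthoCoord_apply, orthoCoord_apply, Matrix.mulVec_smul, Matrix.mulVec_mulVec,
    Matrix.mulVec_mulVec, mul_assoc _ C, hC', mul_one]

theorem orthoCoord_dotProduct {k : ℕ} {C J : Matrix (Fin k) (Fin k) ℂ}
    (hC : ((1 / 2 : ℂ) • (Cᵀ * J)) * C = 1) (hJ : Jᵀ = J) (u u' : Fin k → ℂ) :
    orthoCoord hC u ⬝ᵥ orthoCoord hC u' = u ⬝ᵥ (J *ᵥ u') := by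
  have hC' := mul_eq_one_comm.1 hC
  have h2 : ((Real.sqrt 2 : ℝ) : ℂ) * ((Real.sqrt 2 : ℝ) : ℂ) = 2 := by
    rw [← Complex.ofReal_mul, Real.mul_self_sqrt (by norm_num)]
    norm_num
  have hD : ((1 / 2 : ℂ) • (Cᵀ * J))ᵀ * ((1 / 2 : ℂ) • (Cᵀ * J)) = (1 / 2 : ℂ) • J := by
    rw [Matrix.transpose_smul, Matrix.transpose_mul, Matrix.transpose_transpose, hJ,
      smul_mul_assoc, mul_assoc, hC', mul_one]
  rw [orthoCoord_apply, orthoCoord_apply, smul_dotProduct, dotProduct_smul, smul_smul, h2,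
    Matrix.dotProduct_mulVec, Matrix.vecMul_mulVec, hD, ← Matrix.dotProduct_mulVec,
    Matrix.smul_mulVec, dotProduct_smul, smul_smul]
  norm_num

section Tensor

variable {V W : Type v} [AddCommGroup V] [Module ℂ V] [AddCommGroup W] [Module ℂ W]

/-- The coordinates of the tensor product of two vectors. -/
def tensorVec (u w : Fin 2 → ℂ) : Fin 4 → ℂ := ![u 0 * w 0, u 0 * w 1, u 1 * w 0, u 1 * w 1]

theorem tensorMatrix_mulVec (A B : Matrix (Fin 2) (Fin 2) ℂ) (u w : Fin 2 → ℂ) :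
    tensorMatrix A B *ᵥ tensorVec u w = tensorVec (A *ᵥ u) (B *ᵥ w) := by
  rw [tensorMatrix_apply]
  ext i
  fin_cases i <;>
    simp [tensorVec, Matrix.mulVec, dotProduct, Fin.sum_univ_four, Fin.sum_univ_two] <;> ring

theorem tensorVec_gram (u w u' w' : Fin 2 → ℂ) :
    tensorVec u w ⬝ᵥ (tensorGram *ᵥ tensorVec u' w') =
      (u 0 * u' 1 - u' 0 * u 1) * (w 0 * w' 1 - w' 0 * w 1) := by
  simp [tensorVec, tensorGram, Matrix.mulVec, dotProduct, Fin.sum_univ_four]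
  ring

/-- The product coordinates on a tensor product. -/
def tensorProdCoord (c₁ : V ≃ₗ[ℂ] (Fin 2 → ℂ)) (c₂ : W ≃ₗ[ℂ] (Fin 2 → ℂ)) :
    V ⊗[ℂ] W ≃ₗ[ℂ] (Fin 4 → ℂ) :=
  (((Module.Basis.ofEquivFun c₁).tensorProduct (Module.Basis.ofEquivFun c₂)).reindex
    (finProdFinEquiv (m := 2) (n := 2))).equivFun

theorem tensorProdCoord_tmul (c₁ : V ≃ₗ[ℂ] (Fin 2 → ℂ)) (c₂ : W ≃ₗ[ℂ] (Fin 2 → ℂ)) (a : V) (b : W) :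
    tensorProdCoord c₁ c₂ (a ⊗ₜ b) = tensorVec (c₁ a) (c₂ b) := by
  have h : ∀ i : Fin 2 × Fin 2, tensorProdCoord c₁ c₂ (a ⊗ₜ b) (finProdFinEquiv i) =
      c₁ a i.1 * c₂ b i.2 := by
    intro i
    change (((Module.Basis.ofEquivFun c₁).tensorProduct (Module.Basis.ofEquivFun c₂)).reindex
      (finProdFinEquiv (m := 2) (n := 2))).repr (a ⊗ₜ b) (finProdFinEquiv i) = _
    rw [Module.Basis.repr_reindex_apply, Equiv.symm_apply_apply,
      Module.Basis.tensorProduct_repr_tmul_apply, smul_eq_mul, mul_comm]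
    rfl
  ext i
  fin_cases i
  · exact h (0, 0)
  · exact h (0, 1)
  · exact h (1, 0)
  · exact h (1, 1)

/-- Orthonormal coordinates on a tensor product. -/
def tensorCoord (c₁ : V ≃ₗ[ℂ] (Fin 2 → ℂ)) (c₂ : W ≃ₗ[ℂ] (Fin 2 → ℂ)) :
    V ⊗[ℂ] W ≃ₗ[ℂ] (Fin 4 → ℂ) :=
  tensorProdCoord c₁ c₂ ≪≫ₗ orthoCoord tensorBasis_spec

theorem tensorCoord_tmul (c₁ : V ≃ₗ[ℂ] (Fin 2 → ℂ)) (c₂ : W ≃ₗ[ℂ] (Fin 2 → ℂ)) (a : V) (b : W) :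
    tensorCoord c₁ c₂ (a ⊗ₜ b) = orthoCoord tensorBasis_spec (tensorVec (c₁ a) (c₂ b)) := by
  rw [← tensorProdCoord_tmul]
  rfl

theorem det_coordMatrix_two (c : V ≃ₗ[ℂ] (Fin 2 → ℂ)) (a b : V) :
    (coordMatrix c ![a, b]).det = c a 0 * c b 1 - c b 0 * c a 1 := by
  rw [Matrix.det_fin_two]
  rfl

/-- The change of the coordinates on a tensor product. -/
theorem tensorCoord_mulVec {c₁ c₁' : V ≃ₗ[ℂ] (Fin 2 → ℂ)} {c₂ c₂' : W ≃ₗ[ℂ] (Fin 2 → ℂ)}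
    {A B : Matrix (Fin 2) (Fin 2) ℂ} (h₁ : ∀ a, c₁' a = A *ᵥ c₁ a) (h₂ : ∀ b, c₂' b = B *ᵥ c₂ b)
    (w : V ⊗[ℂ] W) : tensorCoord c₁' c₂' w =
      (((1 / 2 : ℂ) • (tensorBasisᵀ * tensorGram)) * tensorMatrix A B * tensorBasis) *ᵥ
        tensorCoord c₁ c₂ w := by
  refine TensorProduct.induction_on w ?_ (fun b c => ?_) fun w w' hw hw' => ?_
  · rw [map_zero, map_zero, Matrix.mulVec_zero]
  · rw [tensorCoord_tmul, tensorCoord_tmul, h₁, h₂, ← tensorMatrix_mulVec, orthoCoord_mulVec]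
  · rw [map_add, map_add, hw, hw', Matrix.mulVec_add]

/-- The derivation of a tensor product in coordinates. -/
theorem tensorCoord_der {c₁ : V ≃ₗ[ℂ] (Fin 2 → ℂ)} {c₂ : W ≃ₗ[ℂ] (Fin 2 → ℂ)}
    {A B : Matrix (Fin 2) (Fin 2) ℂ} {φ : Module.End ℂ V} {ψ : Module.End ℂ W}
    (h₁ : ∀ a, c₁ (φ a) = A *ᵥ c₁ a) (h₂ : ∀ b, c₂ (ψ b) = B *ᵥ c₂ b)
    (w : V ⊗[ℂ] W) : tensorCoord c₁ c₂ ((φ.rTensor W + ψ.lTensor V) w) =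
      (((1 / 2 : ℂ) • (tensorBasisᵀ * tensorGram)) * tensorDer A B * tensorBasis) *ᵥ
        tensorCoord c₁ c₂ w := by
  refine TensorProduct.induction_on w ?_ (fun b c => ?_) fun w w' hw hw' => ?_
  · rw [map_zero, map_zero, Matrix.mulVec_zero]
  · rw [LinearMap.add_apply, LinearMap.rTensor_tmul, LinearMap.lTensor_tmul, map_add,
      tensorCoord_tmul, tensorCoord_tmul, tensorCoord_tmul, h₁, h₂, ← orthoCoord_mulVec,
      ← map_add, tensorDer, Matrix.add_mulVec, tensorMatrix_mulVec, tensorMatrix_mulVec,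
      Matrix.one_mulVec, Matrix.one_mulVec]
  · rw [map_add, map_add, map_add, hw, hw', Matrix.mulVec_add]

theorem tensorCoord_basis (c₁ : V ≃ₗ[ℂ] (Fin 2 → ℂ)) (c₂ : W ≃ₗ[ℂ] (Fin 2 → ℂ))
    (e : Module.Basis (Fin 2) ℂ V) (f : Module.Basis (Fin 2) ℂ W) (i j : Fin 2) :
    tensorCoord c₁ c₂ (((e.tensorProduct f).reindex finProdFinEquiv) (finProdFinEquiv (i, j))) =
      orthoCoord tensorBasis_spec (tensorVec (c₁ (e i)) (c₂ (f j))) := by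
  rw [Module.Basis.reindex_apply, Equiv.symm_apply_apply, Module.Basis.tensorProduct_apply,
    tensorCoord_tmul]

theorem tensorCoord_dotProduct (c₁ : V ≃ₗ[ℂ] (Fin 2 → ℂ)) (c₂ : W ≃ₗ[ℂ] (Fin 2 → ℂ)) (a c : V)
    (b d : W) : tensorCoord c₁ c₂ (a ⊗ₜ b) ⬝ᵥ tensorCoord c₁ c₂ (c ⊗ₜ d) =
      (coordMatrix c₁ ![a, c]).det * (coordMatrix c₂ ![b, d]).det := by
  rw [tensorCoord_tmul, tensorCoord_tmul, orthoCoord_dotProduct _ tensorGram_transpose,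
    tensorVec_gram, det_coordMatrix_two, det_coordMatrix_two]

end Tensor

section Wedge

variable {V : Type v} [AddCommGroup V] [Module ℂ V]

/-- The coordinates of the wedge product of two vectors. -/
def wedgeVec (u w : Fin 4 → ℂ) : Fin 6 → ℂ := fun l =>
  u (wedgeIndex l).1 * w (wedgeIndex l).2 - u (wedgeIndex l).2 * w (wedgeIndex l).1

theorem wedgeMatrix_mulVec (A : Matrix (Fin 4) (Fin 4) ℂ) (u w : Fin 4 → ℂ) :
    wedgeMatrix A *ᵥ wedgeVec u w = wedgeVec (A *ᵥ u) (A *ᵥ w) := by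
  ext a
  generalize hp : wedgeIndex a = p
  simp only [wedgeMatrix, wedgeVec, Matrix.mulVec, dotProduct, Matrix.of_apply, hp]
  simp only [Fin.sum_univ_succ, wedgeIndex, Fin.sum_univ_zero]
  simp
  ring

theorem wedgeVec_add_left (u u' w : Fin 4 → ℂ) :
    wedgeVec (u + u') w = wedgeVec u w + wedgeVec u' w := by
  ext l
  simp only [wedgeVec, Pi.add_apply]
  ring

theorem wedgeVec_add_right (u w w' : Fin 4 → ℂ) :
    wedgeVec u (w + w') = wedgeVec u w + wedgeVec u w' := by
  ext l
  simp only [wedgeVec, Pi.add_apply]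
  ring

theorem wedgeVec_smul_left (t : ℂ) (u w : Fin 4 → ℂ) :
    wedgeVec (t • u) w = t • wedgeVec u w := by
  ext l
  simp only [wedgeVec, Pi.smul_apply, smul_eq_mul]
  ring

theorem wedgeVec_smul_right (t : ℂ) (u w : Fin 4 → ℂ) :
    wedgeVec u (t • w) = t • wedgeVec u w := by
  ext l
  simp only [wedgeVec, Pi.smul_apply, smul_eq_mul]
  ring

theorem wedgeVec_self (u : Fin 4 → ℂ) : wedgeVec u u = 0 := by
  ext l
  simp only [wedgeVec, Pi.zero_apply]
  ring

theorem wedgeDer_mulVec (A : Matrix (Fin 4) (Fin 4) ℂ) (u w : Fin 4 → ℂ) :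
    wedgeDer A *ᵥ wedgeVec u w = wedgeVec (A *ᵥ u) w + wedgeVec u (A *ᵥ w) := by
  rw [wedgeDer_apply]
  ext a
  fin_cases a <;>
    simp [wedgeVec, wedgeIndex, Matrix.mulVec, dotProduct, Fin.sum_univ_six,
      Fin.sum_univ_four] <;> ring

/-- The Laplace expansion of a four by four determinant along its first two columns. -/
theorem wedgeVec_gram (c : V ≃ₗ[ℂ] (Fin 4 → ℂ)) (a b a' b' : V) :
    wedgeVec (c a) (c b) ⬝ᵥ (wedgeGram *ᵥ wedgeVec (c a') (c b')) =
      (coordMatrix c ![a, b, a', b']).det := by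
  simp [coordMatrix, wedgeVec, wedgeGram, wedgeIndex, Matrix.mulVec, dotProduct,
    Matrix.det_succ_row_zero, Fin.sum_univ_succ, Fin.succAbove]
  ring

/-- The wedge product of two vectors in coordinates, as an alternating map. -/
def wedgeVecAlternating (c : V ≃ₗ[ℂ] (Fin 4 → ℂ)) : V [⋀^Fin 2]→ₗ[ℂ] (Fin 6 → ℂ) where
  toFun w := wedgeVec (c (w 0)) (c (w 1))
  map_update_add' {inst} w i a b := by
    rw [Subsingleton.elim inst (instDecidableEqFin 2)]
    fin_cases i <;> simp [wedgeVec_add_left, wedgeVec_add_right]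
  map_update_smul' {inst} w i t a := by
    rw [Subsingleton.elim inst (instDecidableEqFin 2)]
    fin_cases i <;> simp [wedgeVec_smul_left, wedgeVec_smul_right]
  map_eq_zero_of_eq' w i j h hij := by
    have h01 : w 0 = w 1 := by
      fin_cases i <;> fin_cases j <;> simp_all
    rw [h01, wedgeVec_self]

/-- The linear map of the exterior square given by coordinates. -/
def wedgeProdMap (c : V ≃ₗ[ℂ] (Fin 4 → ℂ)) : ⋀[ℂ]^2 V →ₗ[ℂ] (Fin 6 → ℂ) :=
  exteriorPower.alternatingMapLinearEquiv (wedgeVecAlternating c)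

theorem wedgeProdMap_wedge₂ (c : V ≃ₗ[ℂ] (Fin 4 → ℂ)) (a b : V) :
    wedgeProdMap c (wedge₂ a b) = wedgeVec (c a) (c b) := by
  simp [wedgeProdMap, wedge₂, wedgeVecAlternating]

theorem wedgeProdMap_surjective (c : V ≃ₗ[ℂ] (Fin 4 → ℂ)) :
    Function.Surjective (wedgeProdMap c) := by
  rw [← LinearMap.range_eq_top, eq_top_iff, ← (Pi.basisFun ℂ (Fin 6)).span_eq, Submodule.span_le]
  rintro _ ⟨l, rfl⟩
  refine ⟨wedge₂ (c.symm (Pi.single (wedgeIndex l).1 1)) (c.symm (Pi.single (wedgeIndex l).2 1)), ?_⟩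
  rw [wedgeProdMap_wedge₂, c.apply_symm_apply, c.apply_symm_apply, Pi.basisFun_apply]
  ext m
  fin_cases l <;> fin_cases m <;> simp [wedgeVec, wedgeIndex]

/-- Surjectivity suffices, as both sides have dimension six. -/
theorem wedgeProdMap_bijective (c : V ≃ₗ[ℂ] (Fin 4 → ℂ)) :
    Function.Bijective (wedgeProdMap c) := by
  have : Module.Finite ℂ V := Module.Finite.equiv c.symm
  refine ⟨(LinearMap.injective_iff_surjective_of_finrank_eq_finrank ?_).2
    (wedgeProdMap_surjective c), wedgeProdMap_surjective c⟩
  rw [exteriorPower.finrank_eq, c.finrank_eq, Module.finrank_fin_fun, Module.finrank_fin_fun]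
  rfl

/-- Orthonormal coordinates on an exterior square. -/
def wedgeCoord (c : V ≃ₗ[ℂ] (Fin 4 → ℂ)) : ⋀[ℂ]^2 V ≃ₗ[ℂ] (Fin 6 → ℂ) :=
  LinearEquiv.ofBijective (wedgeProdMap c) (wedgeProdMap_bijective c) ≪≫ₗ
    orthoCoord wedgeBasis_spec

theorem wedgeCoord_wedge₂ (c : V ≃ₗ[ℂ] (Fin 4 → ℂ)) (a b : V) :
    wedgeCoord c (wedge₂ a b) = orthoCoord wedgeBasis_spec (wedgeVec (c a) (c b)) := by
  rw [← wedgeProdMap_wedge₂]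
  rfl

theorem wedge₂_linearMap_ext {W : Type*} [AddCommGroup W] [Module ℂ W] {f g : ⋀[ℂ]^2 V →ₗ[ℂ] W}
    (h : ∀ a b, f (wedge₂ a b) = g (wedge₂ a b)) : f = g := by
  refine exteriorPower.linearMap_ext (AlternatingMap.ext fun w => ?_)
  have e : w = ![w 0, w 1] := by
    ext i
    fin_cases i <;> rfl
  rw [e]
  exact h _ _

/-- The change of the coordinates on an exterior square. -/
theorem wedgeCoord_mulVec {c c' : V ≃ₗ[ℂ] (Fin 4 → ℂ)} {A : Matrix (Fin 4) (Fin 4) ℂ}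
    (h : ∀ a, c' a = A *ᵥ c a) (w : ⋀[ℂ]^2 V) : wedgeCoord c' w =
      (((1 / 2 : ℂ) • (wedgeBasisᵀ * wedgeGram)) * wedgeMatrix A * wedgeBasis) *ᵥ
        wedgeCoord c w := by
  refine LinearMap.congr_fun (f := (wedgeCoord c').toLinearMap)
    (g := Matrix.mulVecLin _ ∘ₗ (wedgeCoord c).toLinearMap) (wedge₂_linearMap_ext fun a b => ?_) w
  change wedgeCoord c' (wedge₂ a b) = _ *ᵥ wedgeCoord c (wedge₂ a b)
  rw [wedgeCoord_wedge₂, wedgeCoord_wedge₂, h, h, ← wedgeMatrix_mulVec, orthoCoord_mulVec]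

/-- The derivation of an exterior square in coordinates. -/
theorem wedgeCoord_der {c : V ≃ₗ[ℂ] (Fin 4 → ℂ)} {A : Matrix (Fin 4) (Fin 4) ℂ}
    {φ : Module.End ℂ V} (h : ∀ a, c (φ a) = A *ᵥ c a) (w : ⋀[ℂ]^2 V) :
    wedgeCoord c (wedgeEnd V φ w) =
      (((1 / 2 : ℂ) • (wedgeBasisᵀ * wedgeGram)) * wedgeDer A * wedgeBasis) *ᵥ
        wedgeCoord c w := by
  refine LinearMap.congr_fun (f := (wedgeCoord c).toLinearMap ∘ₗ wedgeEnd V φ)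
    (g := Matrix.mulVecLin _ ∘ₗ (wedgeCoord c).toLinearMap) (wedge₂_linearMap_ext fun a b => ?_) w
  change wedgeCoord c (wedgeEnd V φ (wedge₂ a b)) = _ *ᵥ wedgeCoord c (wedge₂ a b)
  rw [wedgeEnd_wedge₂, map_add, wedgeCoord_wedge₂, wedgeCoord_wedge₂, wedgeCoord_wedge₂, h, h,
    ← orthoCoord_mulVec, wedgeDer_mulVec, map_add]

theorem wedgeCoord_basis (c : V ≃ₗ[ℂ] (Fin 4 → ℂ)) (e : Module.Basis (Fin 4) ℂ V)
    (l : Fin (Nat.choose 4 2)) :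
    wedgeCoord c (((e.exteriorPower 2).reindex (pairsEquiv 4)) l) =
      orthoCoord wedgeBasis_spec (wedgeVec (c (e (pairEmb l 0))) (c (e (pairEmb l 1)))) := by
  rw [← wedgeCoord_wedge₂]
  refine congrArg _ ?_
  rw [Module.Basis.reindex_apply, exteriorPower.basis_apply,
    exteriorPower.ιMulti_family, wedge₂]
  refine congrArg _ ?_
  ext i
  fin_cases i <;> rfl

theorem wedgeCoord_dotProduct (c : V ≃ₗ[ℂ] (Fin 4 → ℂ)) (a b a' b' : V) :
    wedgeCoord c (wedge₂ a b) ⬝ᵥ wedgeCoord c (wedge₂ a' b') =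
      (coordMatrix c ![a, b, a', b']).det := by
  rw [wedgeCoord_wedge₂, wedgeCoord_wedge₂, orthoCoord_dotProduct _ wedgeGram_transpose,
    wedgeVec_gram]

end Wedge

end TensorFraming

/-! ### Framings and orthogonal structures on tensor products and exterior squares. -/

section InducedFramings

open HiggsBundles.MatrixGroup (mat)

variable {X : Type u} [TopologicalSpace X] [ChartedSpace ℂ X]

theorem isHolOn_orthoCoord {k : ℕ} {C J : Matrix (Fin k) (Fin k) ℂ}
    (hC : ((1 / 2 : ℂ) • (Cᵀ * J)) * C = 1) {U : Set X} {u : X → Fin k → ℂ}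
    (hu : ∀ l, IsHolOn (fun x => u x l) U) (i : Fin k) :
    IsHolOn (fun x => orthoCoord hC (u x) i) U :=
  (isHolOn_const ((Real.sqrt 2 : ℝ) : ℂ) U).mul
    (IsHolOn.sum Finset.univ fun l _ => (isHolOn_const (((1 / 2 : ℂ) • (Cᵀ * J)) i l) U).mul (hu l))

theorem isHolOn_tensorVec {U : Set X} {u w : X → Fin 2 → ℂ} (hu : ∀ l, IsHolOn (fun x => u x l) U)
    (hw : ∀ l, IsHolOn (fun x => w x l) U) (l : Fin 4) :
    IsHolOn (fun x => tensorVec (u x) (w x) l) U := by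
  fin_cases l
  · exact (hu 0).mul (hw 0)
  · exact (hu 0).mul (hw 1)
  · exact (hu 1).mul (hw 0)
  · exact (hu 1).mul (hw 1)

theorem isHolOn_wedgeVec {U : Set X} {u w : X → Fin 4 → ℂ} (hu : ∀ l, IsHolOn (fun x => u x l) U)
    (hw : ∀ l, IsHolOn (fun x => w x l) U) (l : Fin 6) :
    IsHolOn (fun x => wedgeVec (u x) (w x) l) U :=
  ((hu _).mul (hw _)).sub ((hu _).mul (hw _))

variable [IsManifold 𝓘(ℂ) ω X]

section Tensor

variable {Q : PrincipalHiggs.{u, v} (SLGroup 2 × SLGroup 2) X} {E₁ E₂ : HiggsBundle.{u, v} X 2}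

theorem Framing.isHolOn_tensorCoord (f₁ : Framing proj₁ Q E₁) (f₂ : Framing proj₂ Q E₂) (p q : X)
    (i j : Fin 4) : IsHolOn (fun x => tensorCoord (f₁.coord (Q.sec p x)) (f₂.coord (Q.sec p x))
      ((((E₁.frame q x).tensorProduct (E₂.frame q x)).reindex
        (finProdFinEquiv (m := 2) (n := 2))) j) i) (Q.dom p ∩ (E₁.dom q ∩ E₂.dom q)) := by
  obtain ⟨⟨j₁, j₂⟩, rfl⟩ := (finProdFinEquiv (m := 2) (n := 2)).surjective j
  refine (isHolOn_orthoCoord tensorBasis_spec (isHolOn_tensorVec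
    (fun l => (f₁.hol p q l j₁).mono fun y hy => ⟨hy.1, hy.2.1⟩)
    fun l => (f₂.hol p q l j₂).mono fun y hy => ⟨hy.1, hy.2.2⟩) i).congr fun x _ => ?_
  rw [tensorCoord_basis]

theorem Framing.tensorCoord_higgs (f₁ : Framing proj₁ Q E₁) (f₂ : Framing proj₂ Q E₂) {x : X}
    (a : Q.fiber x) (t : Tan x) (w : E₁.fiber x ⊗[ℂ] E₂.fiber x) :
    tensorCoord (f₁.coord a) (f₂.coord a)
      (((E₁.higgs x t).rTensor (E₂.fiber x) + (E₂.higgs x t).lTensor (E₁.fiber x)) w) =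
      isogeny₂.d (Q.higgs a t) *ᵥ tensorCoord (f₁.coord a) (f₂.coord a) w := by
  obtain ⟨A, B, hA, hB, e⟩ := mem_lieAlg_prod.1 (Q.higgs_mem a t)
  have d₁ : proj₁.d (Q.higgs a t) = A := by
    rw [proj₁_d (Q.higgs_mem a t), e, Matrix.toBlocks_fromBlocks₁₁]
  have d₂ : proj₂.d (Q.higgs a t) = B := by
    rw [proj₂_d (Q.higgs_mem a t), e, Matrix.toBlocks_fromBlocks₂₂]
  have d : isogeny₂.d (Q.higgs a t) =
      ((1 / 2 : ℂ) • (tensorBasisᵀ * tensorGram)) * tensorDer A B * tensorBasis := by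
    rw [e, isogeny₂_d hA hB]
  rw [d]
  exact tensorCoord_der (fun b => (f₁.coord_higgs a t b).trans (by rw [d₁]))
    (fun b => (f₂.coord_higgs a t b).trans (by rw [d₂])) w

/-- The framing of a tensor product. -/
def Framing.tensor (f₁ : Framing proj₁ Q E₁) (f₂ : Framing proj₂ Q E₂) :
    Framing isogeny₂ Q (E₁.tensor E₂) where
  coord a := tensorCoord (f₁.coord a) (f₂.coord a)
  coord_act a g w := (tensorCoord_mulVec (f₁.coord_act a g) (f₂.coord_act a g) w).trans
    (congrArg (fun h : SOGroup 4 => mat h *ᵥ tensorCoord (f₁.coord a) (f₂.coord a) w)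
      (map_inv isogeny₂.hom g))
  hol p q i j := f₁.isHolOn_tensorCoord f₂ p q i j
  coord_higgs a t w := f₁.tensorCoord_higgs f₂ a t w

end Tensor

/-- The identity of a principal Higgs bundle. -/
def HiggsHom.refl {n : Type} [Fintype n] [DecidableEq n] {G : Type} [Group G] [MatrixGroup G n]
    (P : PrincipalHiggs.{u, v} G X) : HiggsHom (HolHom.refl G) P P where
  map a := a
  map_act _ _ := rfl
  hol p := P.isHolSection_sec p
  map_higgs a t := (HolHom.refl_d (P.higgs_mem a t)).symm

section Wedge

variable {P : PrincipalHiggs.{u, v} (SLGroup 4) X} {E : HiggsBundle.{u, v} X 4}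

theorem Framing.isHolOn_wedgeCoord (f : Framing (HolHom.refl (SLGroup 4)) P E) (p q : X)
    (i : Fin 6) (j : Fin (Nat.choose 4 2)) : IsHolOn (fun x => wedgeCoord (f.coord (P.sec p x))
      ((((E.frame q x).exteriorPower 2).reindex (pairsEquiv 4)) j) i) (P.dom p ∩ E.dom q) := by
  refine (isHolOn_orthoCoord wedgeBasis_spec (isHolOn_wedgeVec
    (fun l => f.hol p q l (pairEmb j 0)) fun l => f.hol p q l (pairEmb j 1)) i).congr
    fun x _ => ?_
  rw [wedgeCoord_basis]

theorem Framing.wedgeCoord_higgs (f : Framing (HolHom.refl (SLGroup 4)) P E) {x : X}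
    (a : P.fiber x) (t : Tan x) (w : ⋀[ℂ]^2 (E.fiber x)) :
    wedgeCoord (f.coord a) (wedgeEnd _ (E.higgs x t) w) =
      isogeny₃.d (P.higgs a t) *ᵥ wedgeCoord (f.coord a) w := by
  rw [isogeny₃_d (mem_lieAlg_SL.1 (P.higgs_mem a t))]
  exact wedgeCoord_der (fun b => (f.coord_higgs a t b).trans
    (by rw [HolHom.refl_d (P.higgs_mem a t)])) w

/-- The framing of an exterior square. -/
def Framing.wedge (f : Framing (HolHom.refl (SLGroup 4)) P E) : Framing isogeny₃ P E.wedge where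
  coord a := wedgeCoord (f.coord a)
  coord_act a g w := (wedgeCoord_mulVec (f.coord_act a g) w).trans
    (congrArg (fun h : SOGroup 6 => mat h *ᵥ wedgeCoord (f.coord a) w) (map_inv isogeny₃.hom g))
  hol p q i j := f.isHolOn_wedgeCoord p q i j
  coord_higgs a t w := f.wedgeCoord_higgs a t w

end Wedge

section StructureGroups

variable {E₁ E₂ : HiggsBundle.{u, v} X 2}

/-- The structure of an `SO(4, ℂ)`-Higgs bundle on a tensor product. -/
def SLStructure.tensorSO (S₁ : SLStructure E₁) (S₂ : SLStructure E₂) :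
    SOStructure (E₁.tensor E₂) :=
  ((HiggsHom.fst S₁.frameBundle S₂.frameBundle).toFraming.tensor
    (HiggsHom.snd S₁.frameBundle S₂.frameBundle).toFraming).soStructure

theorem SLStructure.tensorSO_form (S₁ : SLStructure E₁) (S₂ : SLStructure E₂) (x : X)
    (c₁ : S₁.FrameFiber x) (c₂ : S₂.FrameFiber x) (w w' : E₁.fiber x ⊗[ℂ] E₂.fiber x) :
    (S₁.tensorSO S₂).form x w w' = tensorCoord c₁.1 c₂.1 w ⬝ᵥ tensorCoord c₁.1 c₂.1 w' :=
  Framing.soStructure_form ((HiggsHom.fst S₁.frameBundle S₂.frameBundle).toFraming.tensor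
    (HiggsHom.snd S₁.frameBundle S₂.frameBundle).toFraming) (x := x) (c₁, c₂) w w'

theorem SLStructure.tensorSO_vol (S₁ : SLStructure E₁) (S₂ : SLStructure E₂) (x : X)
    (c₁ : S₁.FrameFiber x) (c₂ : S₂.FrameFiber x) (w : Fin 4 → E₁.fiber x ⊗[ℂ] E₂.fiber x) :
    (S₁.tensorSO S₂).vol x w = (coordMatrix (tensorCoord c₁.1 c₂.1) w).det :=
  Framing.soStructure_vol ((HiggsHom.fst S₁.frameBundle S₂.frameBundle).toFraming.tensor
    (HiggsHom.snd S₁.frameBundle S₂.frameBundle).toFraming) (x := x) (c₁, c₂) w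

theorem SLStructure.tensorSO_form_tmul (S₁ : SLStructure E₁) (S₂ : SLStructure E₂) (x : X)
    (a c : E₁.fiber x) (b d : E₂.fiber x) :
    (S₁.tensorSO S₂).form x (a ⊗ₜ[ℂ] b) (c ⊗ₜ[ℂ] d) = S₁.vol x ![a, c] * S₂.vol x ![b, d] := by
  have h₁ := (S₁.frameBundle.sec x x).2
  have h₂ := (S₂.frameBundle.sec x x).2
  rw [h₁, h₂]
  exact (S₁.tensorSO_form S₂ x (S₁.frameBundle.sec x x) (S₂.frameBundle.sec x x) _ _).trans
    (tensorCoord_dotProduct _ _ a c b d)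

/-- The Higgs bundle associated to the extension along `isogeny₂` is the tensor product. -/
theorem SLStructure.isomorphic_tensorSO (S₁ : SLStructure E₁) (S₂ : SLStructure E₂)
    (Q : PrincipalHiggs.{u, v} (SLGroup 2 × SLGroup 2) X)
    (h₁ : (Q.extend proj₁).assocSL.Isomorphic S₁) (h₂ : (Q.extend proj₂).assocSL.Isomorphic S₂) :
    (Q.extend isogeny₂).assocSO.Isomorphic (S₁.tensorSO S₂) := by
  obtain ⟨φ₁, hφ₁⟩ := h₁
  obtain ⟨φ₂, hφ₂⟩ := h₂
  -- The isomorphisms turn points of Q into unimodular coordinates on both factors, and the form and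
  -- volume of the tensor product can be computed in any such coordinates, not only those of the
  -- frame bundles' sections.
  have hv₁ := fun {x : X} (a : Q.fiber x) =>
    Framing.vol_ofIso (S := S₁) (HiggsHom.toExtend proj₁ Q) φ₁ hφ₁ a
  have hv₂ := fun {x : X} (a : Q.fiber x) =>
    Framing.vol_ofIso (S := S₂) (HiggsHom.toExtend proj₂ Q) φ₂ hφ₂ a
  exact ((Framing.ofIso (HiggsHom.toExtend proj₁ Q) φ₁).tensor
    (Framing.ofIso (HiggsHom.toExtend proj₂ Q) φ₂)).isomorphicSO (HiggsHom.toExtend isogeny₂ Q) _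
    (fun {x} a w w' => S₁.tensorSO_form S₂ x ⟨_, hv₁ a⟩ ⟨_, hv₂ a⟩ w w')
    (fun {x} a w => S₁.tensorSO_vol S₂ x ⟨_, hv₁ a⟩ ⟨_, hv₂ a⟩ w)

variable {E : HiggsBundle.{u, v} X 4}

/-- The structure of an `SO(6, ℂ)`-Higgs bundle on an exterior square. -/
def SLStructure.wedgeSO (S : SLStructure E) : SOStructure E.wedge :=
  (HiggsHom.refl S.frameBundle).toFraming.wedge.soStructure

theorem SLStructure.wedgeSO_form (S : SLStructure E) (x : X) (c : S.FrameFiber x)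
    (w w' : ⋀[ℂ]^2 (E.fiber x)) :
    S.wedgeSO.form x w w' = wedgeCoord c.1 w ⬝ᵥ wedgeCoord c.1 w' :=
  Framing.soStructure_form (HiggsHom.refl S.frameBundle).toFraming.wedge (x := x) c w w'

theorem SLStructure.wedgeSO_vol (S : SLStructure E) (x : X) (c : S.FrameFiber x)
    (w : Fin 6 → ⋀[ℂ]^2 (E.fiber x)) :
    S.wedgeSO.vol x w = (coordMatrix (wedgeCoord c.1) w).det :=
  Framing.soStructure_vol (HiggsHom.refl S.frameBundle).toFraming.wedge (x := x) c w

theorem SLStructure.wedgeSO_form_wedge₂ (S : SLStructure E) (x : X) (a b c d : E.fiber x) :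
    S.wedgeSO.form x (wedge₂ a b) (wedge₂ c d) = S.vol x ![a, b, c, d] := by
  have h := (S.frameBundle.sec x x).2
  rw [h]
  exact (S.wedgeSO_form x (S.frameBundle.sec x x) _ _).trans (wedgeCoord_dotProduct _ a b c d)

/-- The Higgs bundle associated to the extension along `isogeny₃` is the exterior square. -/
theorem SLStructure.isomorphic_wedgeSO (S : SLStructure E) (P : PrincipalHiggs.{u, v} (SLGroup 4) X)
    (h : P.assocSL.Isomorphic S) : (P.extend isogeny₃).assocSO.Isomorphic S.wedgeSO := by
  obtain ⟨φ, hφ⟩ := h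
  have hv := fun {x : X} (a : P.fiber x) =>
    Framing.vol_ofIso (S := S) (HiggsHom.refl P) φ hφ a
  exact (Framing.ofIso (HiggsHom.refl P) φ).wedge.isomorphicSO (HiggsHom.toExtend isogeny₃ P) _
    (fun {x} a w w' => S.wedgeSO_form x ⟨_, hv a⟩ w w')
    (fun {x} a w => S.wedgeSO_vol x ⟨_, hv a⟩ w)

end StructureGroups

end InducedFramings

end

end HiggsBundles

theorem mainTheorem1 (X : Type u) [TopologicalSpace X] [T2Space X] [CompactSpace X]
    [ConnectedSpace X] [ChartedSpace ℂ X] [IsManifold 𝓘(ℂ) ω X] :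
    -- the two homomorphisms are isogenies
    isogeny₂.IsIsogeny ∧ isogeny₃.IsIsogeny ∧
    -- the effect of the first one on pairs of `SL(2, ℂ)`-Higgs bundles
    (∀ (E₁ E₂ : HiggsBundle.{u, v} X 2) (S₁ : SLStructure E₁) (S₂ : SLStructure E₂),
      ∃ T : SOStructure (E₁.tensor E₂),
        (∀ x a b c d, T.form x (a ⊗ₜ[ℂ] b) (c ⊗ₜ[ℂ] d) = S₁.vol x ![a, c] * S₂.vol x ![b, d]) ∧
        (∃ Q : PrincipalHiggs.{u, v} (SLGroup 2 × SLGroup 2) X,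
          (Q.extend proj₁).assocSL.Isomorphic S₁ ∧ (Q.extend proj₂).assocSL.Isomorphic S₂) ∧
        ∀ Q : PrincipalHiggs.{u, v} (SLGroup 2 × SLGroup 2) X,
          (Q.extend proj₁).assocSL.Isomorphic S₁ → (Q.extend proj₂).assocSL.Isomorphic S₂ →
            (Q.extend isogeny₂).assocSO.Isomorphic T) ∧
    -- the effect of the second one on `SL(4, ℂ)`-Higgs bundles
    (∀ (E : HiggsBundle.{u, v} X 4) (S : SLStructure E), ∃ T : SOStructure E.wedge,
        (∀ x a b c d, T.form x (wedge₂ a b) (wedge₂ c d) = S.vol x ![a, b, c, d]) ∧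
        (∃ P : PrincipalHiggs.{u, v} (SLGroup 4) X, P.assocSL.Isomorphic S) ∧
        ∀ P : PrincipalHiggs.{u, v} (SLGroup 4) X, P.assocSL.Isomorphic S →
          (P.extend isogeny₃).assocSO.Isomorphic T) ∧
    -- the induced maps of moduli spaces
    (∃ f : Moduli.{u, v} (SLGroup 2) X × Moduli.{u, v} (SLGroup 2) X → Moduli.{u, v} (SOGroup 4) X,
      ∀ (Q : PrincipalHiggs.{u, v} (SLGroup 2 × SLGroup 2) X)
        (h₁ : (Q.extend proj₁).Polystable) (h₂ : (Q.extend proj₂).Polystable),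
        ∃ h : (Q.extend isogeny₂).Polystable,
          f (Moduli.mk _ h₁, Moduli.mk _ h₂) = Moduli.mk _ h) ∧
    ∃ f : Moduli.{u, v} (SLGroup 4) X → Moduli.{u, v} (SOGroup 6) X,
      ∀ (P : PrincipalHiggs.{u, v} (SLGroup 4) X) (h₀ : P.Polystable),
        ∃ h : (P.extend isogeny₃).Polystable, f (Moduli.mk P h₀) = Moduli.mk _ h := by
  refine ⟨isogeny₂_isIsogeny, isogeny₃_isIsogeny, fun E₁ E₂ S₁ S₂ => ⟨S₁.tensorSO S₂,
    fun x a b c d => S₁.tensorSO_form_tmul S₂ x a c b d, ⟨S₁.frameBundle.prod S₂.frameBundle, ?_, ?_⟩,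
    S₁.isomorphic_tensorSO S₂⟩, fun E S => ⟨S.wedgeSO, S.wedgeSO_form_wedge₂,
    ⟨S.frameBundle, ?_⟩, S.isomorphic_wedgeSO⟩, ⟨fun q => Quot.map₂
      -- A pair of classes goes to the class of the extension of the product. `Moduli` is the
      -- quotient by a bare relation, so it suffices to check invariance under isomorphisms in each
      -- variable.
      (fun P₁ P₂ => ⟨(P₁.1.prod P₂.1).extend isogeny₂, isogeny₂_isLocalIso.polystable
        (HiggsHom.toExtend isogeny₂ _) (P₁.2.prod P₂.2)⟩) ?_ ?_ q.1 q.2, fun Q h₁ h₂ =>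
      -- The class is the expected one because Q is isomorphic to the product of its two extensions.
      ⟨Q.polystable_extend_isogeny₂ h₁ h₂, (Quot.sound ?_).symm⟩⟩,
    ⟨Quot.map (fun P => ⟨P.1.extend isogeny₃, isogeny₃_isLocalIso.polystable
      (HiggsHom.toExtend isogeny₃ _) P.2⟩) ?_, fun P h₀ => ⟨_, rfl⟩⟩⟩
  · exact (HiggsHom.fst S₁.frameBundle S₂.frameBundle).toFraming.isomorphicSL
      (HiggsHom.toExtend proj₁ _) S₁ fun a => ((HiggsHom.fst _ _).map a).2
  · exact (HiggsHom.snd S₁.frameBundle S₂.frameBundle).toFraming.isomorphicSL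
      (HiggsHom.toExtend proj₂ _) S₂ fun a => ((HiggsHom.snd _ _).map a).2
  · exact (HiggsHom.refl S.frameBundle).toFraming.isomorphicSL (HiggsHom.refl _) S fun a => a.2
  · rintro P₁ P₂ P₂' ⟨φ⟩
    exact ⟨(HiggsHom.isoProd (HiggsHom.fst P₁.1 P₂.1)
      ((HiggsHom.snd P₁.1 P₂.1).compIso φ)).extend isogeny₂⟩
  · rintro P₁ P₁' P₂ ⟨φ⟩
    exact ⟨(HiggsHom.isoProd ((HiggsHom.fst P₁.1 P₂.1).compIso φ)
      (HiggsHom.snd P₁.1 P₂.1)).extend isogeny₂⟩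
  · exact ⟨(HiggsHom.isoProd (HiggsHom.toExtend proj₁ Q) (HiggsHom.toExtend proj₂ Q)).extend
      isogeny₂⟩
  · rintro P P' ⟨φ⟩
    exact ⟨φ.extend isogeny₃⟩
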